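/- Setting. Let $\widetilde M$ be a Riemann surface (Hausdorff, second countable) with a smooth Riemannian metric $g$ compatible with its complex structure, and let $M\subset\widetilde M$ be open with compact closure; $L^p(M)$ is taken with respect to the area measure of $g$. Let $\Phi$ be holomorphic on $\widetilde M$, $\psi=\operatorname{Im}\Phi$, and let $z_0\in M$ be a nondegenerate (Morse) critical point of $\Phi$. The operator $\overline\partial^{-1}\omega(w)=\frac1{2\pi i}\int_{\widetilde M}\kappa(w,z)\,dz\wedge\omega(z)$ is the right inverse of $\overline\partial$ given by a Cauchy kernel: $\kappa(w,z)dz$ is smooth off the diagonal, equals $\frac{dz}{z-w}$ plus a smooth kernel in each chart, is holomorphic in $w\ne z$, and is holomorphic in $z\neq w$ for $z$ in an open neighbourhood $U$ of $z_0$. Put $\partial^{-1}\omega=\overline{\overline\partial^{-1}\overline\omega}$ and, for compactly supported $\omega$ and $h>0$, $\overline\partial_\psi^{-1}\omega=\overline\partial^{-1}(e^{-2i\psi/h}\omega)$, $\partial_\psi^{-1}\omega=\partial^{-1}(e^{-2i\psi/h}\omega)$. A section $f$ of $T^*_{0,1}\widetilde M$ or $T^*_{1,0}\widetilde M$, smooth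 off $z_0$, has degree $N\in\mathbb Z$ at $z_0$, $\deg(f)=N$, if in a holomorphic coordinate $z$ centred at $z_0$ its coefficient is a finite sum of terms $Cz^k\overline z^{\,l}$ with $k,l\in\mathbb Z$, $k+l=N$, $C\in\mathbb C$, plus a remainder $R$ all of whose derivatives of order $m$ are $O(|z|^{N+1-m})$, for every $m\ge0$. For $h$-independent $f$ and an interval $I$, we write $\deg_h(f)=I$ if $\int_M e^{4i\psi/h}f\wedge\chi$ converges absolutely and is $O(h^r)$ as $h\to0^+$ for every $r\in I$ and every smooth form $\chi$ of the complementary type with compact support in $M$. Lemma 3.4. Let $f$ be a section of $T^*_{0,1}\widetilde M$, smooth on $\widetilde M\setminus\{z_0\}$, with (compact) support contained in $M\cap U$ and containing no critical point of $\psi$ other than possibly $z_0$. Define $$F^1=\frac i2\frac f{\overline\partial\psi},\qquad F^{j+1}=\frac i2\frac{\overline\partial F^j}{\overline\partial\psi}\quad(j\ge1).$$ These functions are smooth on $\widetilde M\setminus\{z_0\}$, and the following holds. a) Let $\deg(f)=K$ with $K\ge-1$ an integer. Then $\deg_h(f)=(-\infty,\lfloor K/2\rfloor+1]$ if $K$ is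 odd, and $\deg_h(f)=(-\infty,K/2+1)$ if $K$ is even. Moreover, for every smooth section $\chi$ of $T^*_{1,0}\widetilde M$ with compact support in $M$, every function $\rho$ that is smooth on a neighbourhood of $\overline M\times\overline M$, and every $p\in[1,\infty)$, $$\Big\|\int_M e^{4i\psi(z)/h}\rho(z,\cdot)\,f(z)\wedge\chi(z)\Big\|_{L^p(M)}=\begin{cases}O(h^{\lfloor K/2\rfloor+1}),&K\text{ odd},\\ O(h^{K/2+1-\epsilon})\ \text{for all }\epsilon>0,&K\text{ even},\end{cases}\qquad h\to0^+.$$ b) Let $\deg(f)=2K+1$, $K\in\{0,1,2,\dots\}$. Then for all $h>0$, on $M\setminus\{z_0\}$, $$\overline\partial_\psi^{-1}f=e^{-2i\psi/h}\sum_{j=1}^{K+1}(-1)^{j-1}h^jF^j+(-1)^{K+1}h^{K+1}\,\overline\partial_\psi^{-1}(\overline\partial F^{K+1}),$$ and $\overline\partial_\psi^{-1}(\overline\partial F^{K+1})=o_{L^p(M)}(1)$ as $h\to0^+$ for all $p\in[1,\infty)$. c) Let $\deg(f)=2K$, $K\in\{1,2,\dots\}$. Then for all $h>0$, on $M\setminus\{z_0\}$,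 $$\overline\partial_\psi^{-1}f=e^{-2i\psi/h}\sum_{j=1}^{K}(-1)^{j-1}h^jF^j+(-1)^{K}h^{K}\,\overline\partial_\psi^{-1}(\overline\partial F^{K}),$$ and $\overline\partial_\psi^{-1}(\overline\partial F^{K})=o_{L^2(M)}(h^{1/2})$ as $h\to0^+$. The same statements hold for sections $f$ of $T^*_{1,0}\widetilde M$, with $\overline\partial$, $\overline\partial_\psi^{-1}$ replaced by $\partial$, $\partial_\psi^{-1}$ and $\chi$ a section of $T^*_{0,1}\widetilde M$. -/

import Mathlib

open Set Filter Topology MeasureTheory Asymptotics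
open scoped Manifold ContDiff ENNReal ComplexConjugate

noncomputable section

namespace RiemannSurface

/-! ### Forms of type (1,0) and (0,1) on a Riemann surface, and the operators `∂`, `∂̄` -/

section Forms

variable (X : Type*) [TopologicalSpace X] [ChartedSpace ℂ X]

/-- Sections (no regularity required) of `T*_{1,0} X`: complex-linear functionals on the tangent
spaces. -/
abbrev Form10 := ∀ x : X, TangentSpace 𝓘(ℂ, ℂ) x →L[ℂ] ℂ

/-- Sections (no regularity required) of `T*_{0,1} X`: conjugate-linear functionals on the tangent
spaces. -/
abbrev Form01 := ∀ x : X, TangentSpace 𝓘(ℂ, ℂ) x →L⋆[ℂ] ℂ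

end Forms

variable {X : Type*} [TopologicalSpace X] [ChartedSpace ℂ X]

/-- The coordinate vector `∂/∂z` of the chart `e`, at the point with coordinate `z`. Mathlib
identifies the tangent space at `x` with `ℂ` by the preferred chart at `x`. -/
def coordVec (e : OpenPartialHomeomorph X ℂ) (z : ℂ) : ℂ :=
  mfderiv 𝓘(ℂ, ℂ) 𝓘(ℂ, ℂ) e.symm z (1 : ℂ)

/-- The function `a` such that `α = a dz` in the coordinate `z` given by the chart `e`. -/
def Form10.coeff (α : Form10 X) (e : OpenPartialHomeomorph X ℂ) (z : ℂ) : ℂ :=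
  α (e.symm z) (coordVec e z)

/-- The function `a` such that `α = a dz̄` in the coordinate `z` given by the chart `e`. -/
def Form01.coeff (α : Form01 X) (e : OpenPartialHomeomorph X ℂ) (z : ℂ) : ℂ :=
  α (e.symm z) (coordVec e z)

/-- `α` is smooth (in the real sense) on the open set `S`. -/
def Form10.SmoothOn (α : Form10 X) (S : Set X) : Prop :=
  ∀ e ∈ atlas ℂ X, ContDiffOn ℝ ∞ (α.coeff e) (e.target ∩ e.symm ⁻¹' S)

/-- `α` is smooth (in the real sense) on the open set `S`. -/
def Form01.SmoothOn (α : Form01 X) (S : Set X) : Prop :=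
  ∀ e ∈ atlas ℂ X, ContDiffOn ℝ ∞ (α.coeff e) (e.target ∩ e.symm ⁻¹' S)

/-- The (closed) support of a section. -/
def Form10.supp (α : Form10 X) : Set X := closure {x | α x ≠ 0}

/-- The (closed) support of a section. -/
def Form01.supp (α : Form01 X) : Set X := closure {x | α x ≠ 0}

/-- Complex conjugation `T*_{1,0} → T*_{0,1}`. -/
def Form10.conj (α : Form10 X) : Form01 X := fun x =>
  (starL ℂ : ℂ ≃L⋆[ℂ] ℂ).toContinuousLinearMap.comp (α x)

/-- The real differential `du` of a complex-valued function at `x`, applied to a tangent vector. -/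
def realDeriv (u : X → ℂ) (x : X) (v : ℂ) : ℂ := mfderiv 𝓘(ℝ, ℂ) 𝓘(ℝ, ℂ) u x v

/-- `∂̄ u = π_{0,1} du`. In the coordinate `z = x + iy` this is `½ (u_x + i u_y) dz̄`. -/
def dbar (u : X → ℂ) : Form01 X := fun x =>
  ((realDeriv u x 1 + Complex.I * realDeriv u x Complex.I) / 2) • (starL ℂ : ℂ ≃L⋆[ℂ] ℂ).toContinuousLinearMap

/-- `∂ u = π_{1,0} du`. In the coordinate `z = x + iy` this is `½ (u_x - i u_y) dz`. -/
def del (u : X → ℂ) : Form10 X := fun x =>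
  ((realDeriv u x 1 - Complex.I * realDeriv u x Complex.I) / 2) • ContinuousLinearMap.id ℂ ℂ

/-- The scalar function `f / β` with `β (f / β) = f`, where `β ≠ 0`. -/
def Form10.quot (f β : Form10 X) : X → ℂ := fun x => f x (1 : ℂ) / β x (1 : ℂ)

/-- The scalar function `f / β` with `β (f / β) = f`, where `β ≠ 0`. -/
def Form01.quot (f β : Form01 X) : X → ℂ := fun x => f x (1 : ℂ) / β x (1 : ℂ)

/-! ### Degree at a point -/

/-- Near `a` and off `a`, the function `c` of a complex variable is a finite sum of terms
`C (z - a)^k conj(z - a)^l`, `k + l = N` with `k, l` integers, up to a remainder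
`O(|z - a|^(N+1))`; as always for such classes, each derivative of the remainder gains
one negative power of `|z - a|`. -/
def HasDegreeAt (c : ℂ → ℂ) (a : ℂ) (N : ℤ) : Prop :=
  ∃ (S : Finset ℤ) (C : ℤ → ℂ), ∀ m : ℕ,
    (fun z => iteratedFDeriv ℝ m
      (fun z => c z - ∑ k ∈ S, C k * (z - a) ^ k * (conj (z - a)) ^ (N - k)) z)
      =O[𝓝[≠] a] fun z => ‖z - a‖ ^ (N + 1 - (m : ℤ))

/-- `deg α = N` at `x₀`. -/
def Form10.HasDegree (α : Form10 X) (x₀ : X) (N : ℤ) : Prop :=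
  HasDegreeAt (α.coeff (chartAt ℂ x₀)) (chartAt ℂ x₀ x₀) N

/-- `deg α = N` at `x₀`. -/
def Form01.HasDegree (α : Form01 X) (x₀ : X) (N : ℤ) : Prop :=
  HasDegreeAt (α.coeff (chartAt ℂ x₀)) (chartAt ℂ x₀ x₀) N

/-! ### Critical points -/

/-- `x` is a critical point of the holomorphic function `Φ` (equivalently, of `Im Φ`). -/
def IsCritical (Φ : X → ℂ) (x : X) : Prop :=
  mfderiv 𝓘(ℂ, ℂ) 𝓘(ℂ, ℂ) Φ x = 0

/-- `x` is a nondegenerate (Morse) critical point of the holomorphic function `Φ`. -/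
def IsMorseCritical (Φ : X → ℂ) (x : X) : Prop :=
  IsCritical Φ x ∧ deriv (deriv (Φ ∘ (chartAt ℂ x).symm)) (chartAt ℂ x x) ≠ 0

/-! ### Conformal metrics, area, integration of two-forms -/

/-- A smooth Riemannian metric on `X` which is compatible with the complex structure:
`g = factor x |dz|²` at `x`, where `z` is the preferred chart at `x`; in
another chart the factor gets multiplied by the square of the length of the coordinate vector. -/
structure ConformalMetric (X : Type*) [TopologicalSpace X] [ChartedSpace ℂ X] where
  factor : X → ℝ
  factor_pos : ∀ x, 0 < factor x
  smooth : ∀ e ∈ atlas ℂ X,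
    ContDiffOn ℝ ∞ (fun z => factor (e.symm z) * ‖coordVec e z‖ ^ 2) e.target

/-- The conformal factor `λ` such that `g = λ |dz|²` in the coordinate `z` of the chart `e`. -/
def ConformalMetric.coeff (g : ConformalMetric X) (e : OpenPartialHomeomorph X ℂ) (z : ℂ) : ℝ :=
  g.factor (e.symm z) * ‖coordVec e z‖ ^ 2

theorem exists_chart_cover (X : Type*) [TopologicalSpace X] [ChartedSpace ℂ X]
    [SecondCountableTopology X] [Nonempty X] :
    ∃ c : ℕ → X, ⋃ n, (chartAt ℂ (c n)).source = univ := by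
  obtain ⟨s, hs, hcov⟩ := TopologicalSpace.countable_cover_nhds
    (fun x : X => (chartAt ℂ x).open_source.mem_nhds (mem_chart_source ℂ x))
  have hne : s.Nonempty := by
    obtain ⟨x⟩ := ‹Nonempty X›
    have hx : x ∈ ⋃ y ∈ s, (chartAt ℂ y).source := hcov ▸ mem_univ x
    simp only [mem_iUnion] at hx
    obtain ⟨y, hy, _⟩ := hx
    exact ⟨y, hy⟩
  obtain ⟨c, rfl⟩ := hs.exists_eq_range hne
  exact ⟨c, by simpa using hcov⟩

/-- Centres of a countable family of charts whose domains cover `X`. -/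
def chartCenter (X : Type*) [TopologicalSpace X] [ChartedSpace ℂ X]
    [SecondCountableTopology X] [Nonempty X] : ℕ → X :=
  (exists_chart_cover X).choose

/-- The area measure of `g`, which is `λ dx dy` in a chart where `g = λ |dz|²`. It is put together
from the pieces `source e_n \ (source e_0 ∪ … ∪ source e_{n-1})` of a countable cover by charts. -/
def ConformalMetric.area [SecondCountableTopology X] [Nonempty X] [MeasurableSpace X]
    (g : ConformalMetric X) : Measure X :=
  Measure.sum fun n =>
    ((volume.withDensity
        fun z => ENNReal.ofReal (g.coeff (chartAt ℂ (chartCenter X n)) z)).restrict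
      ((chartAt ℂ (chartCenter X n)).target ∩ (chartAt ℂ (chartCenter X n)).symm ⁻¹'
        disjointed (fun m => (chartAt ℂ (chartCenter X m)).source) n)).map
      (chartAt ℂ (chartCenter X n)).symm

/-- `⋆ (α ∧ β)`, the function with `α ∧ β = ⋆ (α ∧ β) dA`. For `α = a dz`, `β = b dz̄`,
`g = λ |dz|²` one has `α ∧ β = -2i a b dx ∧ dy` and `dA = λ dx ∧ dy`. -/
def starWedge (g : ConformalMetric X) (α : Form10 X) (β : Form01 X) (x : X) : ℂ :=
  -2 * Complex.I * (α x (1 : ℂ) * β x (1 : ℂ)) / (g.factor x : ℂ)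

section Integration

variable [SecondCountableTopology X] [Nonempty X] [MeasurableSpace X]

/-- `∫_X α ∧ β` (which does not depend on `g`). -/
def intWedge (g : ConformalMetric X) (α : Form10 X) (β : Form01 X) : ℂ :=
  ∫ x, starWedge g α β x ∂g.area

end Integration

/-! ### The operators `∂̄⁻¹`, `∂⁻¹`, `∂̄_ψ⁻¹`, `∂_ψ⁻¹` -/

/-- The family `κ w = κ(w, z) dz` of (1,0)-forms is a Cauchy kernel on `X`: it is smooth off the
diagonal, it is `dz / (z - w)` plus a smooth kernel near the diagonal, and it is holomorphic in `w`
off the diagonal. The operator `dbarInv` below is then a right inverse of `∂̄` which differs from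
the Cauchy transform in charts by operators with smooth kernels. -/
structure IsCauchyKernel (κ : X → Form10 X) : Prop where
  smooth_off_diag : ∀ e ∈ atlas ℂ X, ∀ e' ∈ atlas ℂ X,
    ContDiffOn ℝ ∞ (fun q : ℂ × ℂ => (κ (e.symm q.1)).coeff e' q.2)
      {q | q.1 ∈ e.target ∧ q.2 ∈ e'.target ∧ e.symm q.1 ≠ e'.symm q.2}
  diag : ∀ e ∈ atlas ℂ X, ∃ H : ℂ × ℂ → ℂ, ContDiffOn ℝ ∞ H (e.target ×ˢ e.target) ∧
    ∀ w ∈ e.target, ∀ z ∈ e.target, w ≠ z → (κ (e.symm w)).coeff e z = 1 / (z - w) + H (w, z)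
  holomorphic : ∀ e ∈ atlas ℂ X, ∀ e' ∈ atlas ℂ X, ∀ z ∈ e'.target,
    DifferentiableOn ℂ (fun w => (κ (e.symm w)).coeff e' z) {w ∈ e.target | e.symm w ≠ e'.symm z}

/-- The kernel `κ(w, z) dz` is holomorphic also in `z`, off the diagonal, for `z` in the open set
`U`. -/
def IsHolomorphicInSecond (κ : X → Form10 X) (U : Set X) : Prop :=
  ∀ w : X, ∀ e ∈ atlas ℂ X,
    DifferentiableOn ℂ ((κ w).coeff e) {z ∈ e.target | e.symm z ∈ U ∧ e.symm z ≠ w}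

section Operators

variable [SecondCountableTopology X] [Nonempty X] [MeasurableSpace X]

/-- The right inverse `∂̄⁻¹ α (w) = (1 / 2πi) ∫ κ(w, z) dz ∧ α(z)` of `∂̄`. -/
def dbarInv (g : ConformalMetric X) (κ : X → Form10 X) (α : Form01 X) (w : X) : ℂ :=
  (2 * Real.pi * Complex.I)⁻¹ * intWedge g (κ w) α

/-- `∂⁻¹`, the complex conjugate of `∂̄⁻¹`. -/
def delInv (g : ConformalMetric X) (κ : X → Form10 X) (α : Form10 X) (w : X) : ℂ :=
  conj (dbarInv g κ α.conj w)

/-- The oscillating factor `e^{i t ψ / h}`. -/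
def osc (t : ℝ) (ψ : X → ℝ) (h : ℝ) (x : X) : ℂ :=
  Complex.exp (Complex.I * (t * ψ x / h : ℝ))

/-- `∂̄_ψ⁻¹ α = ∂̄⁻¹ (e^{-2iψ/h} α)`, for `α` compactly supported and extended by zero. -/
def dbarInvPsi (g : ConformalMetric X) (κ : X → Form10 X) (ψ : X → ℝ) (h : ℝ) (α : Form01 X) :
    X → ℂ :=
  dbarInv g κ fun x => osc (-2) ψ h x • α x

/-- `∂_ψ⁻¹ α = ∂⁻¹ (e^{-2iψ/h} α)`, for `α` compactly supported and extended by zero. -/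
def delInvPsi (g : ConformalMetric X) (κ : X → Form10 X) (ψ : X → ℝ) (h : ℝ) (α : Form10 X) :
    X → ℂ :=
  delInv g κ fun x => osc (-2) ψ h x • α x

/-! ### Coefficients of the expansions -/

/-- The functions `F^1 = (i/2) f / ∂̄ψ`, `F^{j+1} = (i/2) ∂̄F^j / ∂̄ψ` (there is no `F^0`; its
slot is filled with `0`). -/
def expDbar (ψ : X → ℝ) (f : Form01 X) : ℕ → X → ℂ
  | 0 => 0
  | 1 => fun x => Complex.I / 2 * f.quot (dbar fun y => (ψ y : ℂ)) x
  | j + 2 => fun x =>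
      Complex.I / 2 * (dbar (expDbar ψ f (j + 1))).quot (dbar fun y => (ψ y : ℂ)) x

/-- The functions `F^1 = (i/2) f / ∂ψ`, `F^{j+1} = (i/2) ∂F^j / ∂ψ` (there is no `F^0`; its
slot is filled with `0`). -/
def expDel (ψ : X → ℝ) (f : Form10 X) : ℕ → X → ℂ
  | 0 => 0
  | 1 => fun x => Complex.I / 2 * f.quot (del fun y => (ψ y : ℂ)) x
  | j + 2 => fun x =>
      Complex.I / 2 * (del (expDel ψ f (j + 1))).quot (del fun y => (ψ y : ℂ)) x

/-! ### Asymptotics as `h → 0+` -/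

/-- `deg_h f = I` for an `h`-independent (0,1)-form `f`: for all `χ ∈ C_c^∞(M; T*_{1,0})`,
`∫ e^{4iψ/h} f ∧ χ` converges absolutely and is `O(h^r)` for every `r ∈ I`. -/
def Form01.HasHDegree (g : ConformalMetric X) (M : Set X) (ψ : X → ℝ) (f : Form01 X)
    (I : Set ℝ) : Prop :=
  ∀ χ : Form10 X, χ.SmoothOn univ → IsCompact χ.supp → χ.supp ⊆ M →
    Integrable (starWedge g χ f) g.area ∧
    ∀ r ∈ I, (fun h : ℝ => -intWedge g χ (fun x => osc 4 ψ h x • f x))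
      =O[𝓝[>] 0] fun h => h ^ r

/-- `deg_h f = I` for an `h`-independent (1,0)-form `f`: for all `χ ∈ C_c^∞(M; T*_{0,1})`,
`∫ e^{4iψ/h} f ∧ χ` converges absolutely and is `O(h^r)` for every `r ∈ I`. -/
def Form10.HasHDegree (g : ConformalMetric X) (M : Set X) (ψ : X → ℝ) (f : Form10 X)
    (I : Set ℝ) : Prop :=
  ∀ χ : Form01 X, χ.SmoothOn univ → IsCompact χ.supp → χ.supp ⊆ M →
    Integrable (starWedge g f χ) g.area ∧
    ∀ r ∈ I, (fun h : ℝ => intWedge g (fun x => osc 4 ψ h x • f x) χ)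
      =O[𝓝[>] 0] fun h => h ^ r

/-- `‖u_h‖_{L^p(M)} ≤ C h^s` for small `h > 0`. -/
def IsBigOLp (g : ConformalMetric X) (M : Set X) (p : ℝ≥0∞) (s : ℝ) (u : ℝ → X → ℂ) : Prop :=
  ∃ C : ℝ, ∀ᶠ h in 𝓝[>] (0 : ℝ), MemLp (u h) p (g.area.restrict M) ∧
    eLpNorm (u h) p (g.area.restrict M) ≤ ENNReal.ofReal (C * h ^ s)

/-- `u_h = o_{L^p(M)}(h^s)`. -/
def IsLittleOLp (g : ConformalMetric X) (M : Set X) (p : ℝ≥0∞) (s : ℝ) (u : ℝ → X → ℂ) : Prop :=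
  ∀ c : ℝ, 0 < c → ∀ᶠ h in 𝓝[>] (0 : ℝ), MemLp (u h) p (g.area.restrict M) ∧
    eLpNorm (u h) p (g.area.restrict M) ≤ ENNReal.ofReal (c * h ^ s)

end Operators

end RiemannSurface

end

/-!
# Oscillatory Cauchy transforms at a Morse point

Let `ψ = Im Φ` with `Φ` holomorphic. Since `∂̄ e^{-2iψ/h} = -(2i/h) e^{-2iψ/h} ∂̄ψ`, the function
`F = (i/2) f / ∂̄ψ` satisfies

  `e^{-2iψ/h} f = h (∂̄ (e^{-2iψ/h} F) - e^{-2iψ/h} ∂̄F)`.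

Applying `∂̄⁻¹` and the Cauchy–Pompeiu formula (`IsPhaseSetting.dbarInv_dbar`) gives one step of the
expansion, `IsPhaseSetting.dbarInvPsi_step`, in which a factor `h` is gained and `f` is replaced by
`∂̄F`. At the Morse point `z₀`, division by `∂̄ψ` lowers the degree by one, and so does `∂̄`. Hence a
form of degree `2K + 1` allows `K + 1` steps, with a remainder of degree `-1`, and one of degree `2K`
allows `K` steps, with a remainder of degree `0`
(`IsPhaseSetting.isSingularForm_formSeq`, `IsPhaseSetting.dbarInvPsi_expansion`).

Of the degree only the bounds `|∂̄^j u| = O(|z|^(N - j))` matter (`IsSymbol`). They are stable under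
products and `∂̄`, they hold for `1 / ∂̄ψ` with `N = -1`, and they make sense uniformly for families of
functions.

All estimates are made in the plane.

* The integrals `∫ e^{4iψ/h} ρ(z, w) f ∧ χ` are integrated by parts `n` times until the amplitude has
  order `-1`, where it is integrable, or order `0`, where one more integration by parts off a small
  disc costs a logarithm (`IsMorsePhase.exists_norm_integral_le_odd` and
  `IsMorsePhase.exists_norm_integral_le_even`). The bounds are uniform in the parameter `w`, and `M`
  has finite area, so that they hold in every `L^p(M)`.
* For the remainder `∂̄_ψ⁻¹ f` with `f` of order `-1` or `0`, the kernel has a pole at `w`. As it is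
  holomorphic in `z`, it is not differentiated in an integration by parts off small discs about `z₀`
  and `w`. This gives decay at each fixed `w ≠ z₀`
  (`IsMorsePhase.exists_norm_integral_kernel_le_decay` for order `-1`, `…_rpow` for order `0`). There
  is a slower bound with a majorant in `L^p(M)` (`…_dist`, by absolute values, and `…_sqrt`). By dominated convergence (`isLittleOLp_of_dominated`) the norms
  are `o(1)` and `o(√h)`.

The passage to the surface is by a partition of unity in whose members `z₀` is seen by a single chart
(`exists_partition`), and whose supports have coordinate neighbourhoods in which `Φ` has no critical
point but `z₀` (`IsPatch`, `exists_isPatch`). Forms of type (1,0) are reduced to forms of type (0,1)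
by complex conjugation, which replaces `Φ` by `-Φ` (`IsPhaseSetting.neg`, `expDbar_conj`,
`delInvPsi_eq`).
-/

noncomputable section

namespace RiemannSurface

/-! ### Integrals of powers of the distance in the plane -/

theorem integral_radial (f : ℝ → ℝ) :
    ∫ z : ℂ, f ‖z‖ = 2 * Real.pi * ∫ y in Ioi (0 : ℝ), y * f y := by
  rw [integral_fun_norm_addHaar]
  have h1 : (volume : Measure ℂ).real (Metric.ball 0 1) = Real.pi := by
    simp [measureReal_def, Complex.volume_ball]
  simp [h1, Complex.finrank_real_complex, mul_assoc]

theorem integrable_radial_iff (f : ℝ → ℝ) :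
    Integrable (fun z : ℂ => f ‖z‖) ↔ IntegrableOn (fun y => y * f y) (Ioi 0) := by
  rw [integrable_fun_norm_addHaar]
  simp [Complex.finrank_real_complex]

theorem mul_indicator_rpow (A : Set ℝ) (s : ℝ) :
    EqOn (fun y => y * A.indicator (fun y : ℝ => y ^ (-s)) y)
      (A.indicator fun y : ℝ => y ^ (1 - s)) (Ioi 0) := by
  intro y hy
  by_cases h : y ∈ A
  · simp only [h, indicator_of_mem]
    rw [sub_eq_add_neg, Real.rpow_add hy, Real.rpow_one]
  · simp [h]

theorem integrableOn_ball_rpow {s : ℝ} (hs : s < 2) (q : ℂ) {r : ℝ} (hr : 0 < r) :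
    IntegrableOn (fun z => ‖z - q‖ ^ (-s)) (Metric.ball q r) := by
  rw [← integrable_indicator_iff measurableSet_ball]
  have h : Integrable (fun z : ℂ => (Iio r).indicator (fun y : ℝ => y ^ (-s)) ‖z‖) := by
    rw [integrable_radial_iff, integrableOn_congr_fun (mul_indicator_rpow _ _) measurableSet_Ioi,
      IntegrableOn, integrable_indicator_iff measurableSet_Iio, IntegrableOn,
      Measure.restrict_restrict measurableSet_Iio, Iio_inter_Ioi]
    exact (intervalIntegral.integrableOn_Ioo_rpow_iff hr).2 (by linarith)
  have h3 := h.comp_sub_right q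
  refine h3.congr (ae_of_all _ fun z => ?_)
  by_cases hz : ‖z - q‖ < r <;> simp [indicator, hz, Complex.dist_eq]

theorem setIntegral_ball_rpow {s : ℝ} (hs : s < 2) (q : ℂ) {r : ℝ} (hr : 0 < r) :
    ∫ z in Metric.ball q r, ‖z - q‖ ^ (-s) = 2 * Real.pi / (2 - s) * r ^ (2 - s) := by
  rw [← integral_indicator measurableSet_ball]
  have h := integral_radial ((Iio r).indicator (fun y : ℝ => y ^ (-s)))
  rw [← integral_sub_right_eq_self _ q, setIntegral_congr_fun measurableSet_Ioi
    (mul_indicator_rpow _ _), setIntegral_indicator measurableSet_Iio, Ioi_inter_Iio,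
    ← integral_Ioc_eq_integral_Ioo, ← intervalIntegral.integral_of_le hr.le,
    integral_rpow (Or.inl (by linarith)), Real.zero_rpow (by linarith)] at h
  have e : (1 - s + 1) = 2 - s := by ring
  rw [e] at h
  have h2 : (∫ z, (Metric.ball q r).indicator (fun z => ‖z - q‖ ^ (-s)) z) =
      ∫ z, (Iio r).indicator (fun y : ℝ => y ^ (-s)) ‖z - q‖ := by
    congr 1
    ext z
    by_cases hz : ‖z - q‖ < r <;> simp [indicator, hz, Complex.dist_eq]
  rw [h2, h]
  ring

theorem rpow_neg_le_one_add_indicator {s : ℝ} (hs0 : 0 ≤ s) (q z : ℂ) :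
    ‖z - q‖ ^ (-s) ≤ 1 + (Metric.ball q 1).indicator (fun z => ‖z - q‖ ^ (-s)) z := by
  by_cases hz : ‖z - q‖ < 1
  · simp [indicator, hz, Complex.dist_eq]
  · simpa [indicator, hz, Complex.dist_eq] using
      Real.rpow_le_one_of_one_le_of_nonpos (not_lt.1 hz) (neg_nonpos.2 hs0)

theorem integrableOn_one_add_indicator_rpow {s : ℝ} (hs : s < 2) {S : Set ℂ}
    (hSf : volume S ≠ ⊤) (q : ℂ) :
    IntegrableOn (fun z => 1 + (Metric.ball q 1).indicator (fun z => ‖z - q‖ ^ (-s)) z) S :=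
  (integrableOn_const hSf).add
    ((integrable_indicator_iff measurableSet_ball).2
      (integrableOn_ball_rpow hs q one_pos)).integrableOn

theorem integrableOn_rpow {s : ℝ} (hs : s < 2) (hs0 : 0 ≤ s) {S : Set ℂ}
    (hSf : volume S ≠ ⊤) (q : ℂ) :
    IntegrableOn (fun z => ‖z - q‖ ^ (-s)) S := by
  refine (integrableOn_one_add_indicator_rpow hs hSf q).mono' ?_ (ae_of_all _ fun z => ?_)
  · exact (by fun_prop : Measurable fun z : ℂ => ‖z - q‖ ^ (-s)).aestronglyMeasurable
  · rw [Real.norm_of_nonneg (by positivity)]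
    exact rpow_neg_le_one_add_indicator hs0 q z

/-- The integral of `|z - q|^(-s)`, `s < 2`, over a set of finite area is bounded uniformly in the
position of the singularity. -/
theorem exists_setIntegral_rpow_le {s : ℝ} (hs : s < 2) (hs0 : 0 ≤ s) {S : Set ℂ}
    (hSf : volume S ≠ ⊤) :
    ∃ C : ℝ, 0 ≤ C ∧ ∀ q, ∫ z in S, ‖z - q‖ ^ (-s) ≤ C := by
  have h2s : 0 < 2 - s := by linarith
  refine ⟨volume.real S + 2 * Real.pi / (2 - s), by positivity, fun q => ?_⟩
  calc ∫ z in S, ‖z - q‖ ^ (-s)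
      ≤ ∫ z in S, (1 + (Metric.ball q 1).indicator (fun z => ‖z - q‖ ^ (-s)) z) :=
        integral_mono (integrableOn_rpow hs hs0 hSf q)
          (integrableOn_one_add_indicator_rpow hs hSf q)
          fun z => rpow_neg_le_one_add_indicator hs0 q z
    _ = volume.real S + ∫ z in S, (Metric.ball q 1).indicator (fun z => ‖z - q‖ ^ (-s)) z := by
        rw [integral_add (integrable_const_iff.2 (Or.inr ⟨by simpa using hSf.lt_top⟩))
          ((integrable_indicator_iff measurableSet_ball).2
            (integrableOn_ball_rpow hs q one_pos)).integrableOn]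
        simp
    _ ≤ volume.real S + ∫ z, (Metric.ball q 1).indicator (fun z => ‖z - q‖ ^ (-s)) z := by
        gcongr
        · exact ae_of_all _ fun z => indicator_nonneg (fun _ _ => by positivity) _
        · exact (integrable_indicator_iff measurableSet_ball).2
            (integrableOn_ball_rpow hs q one_pos)
        · exact Measure.restrict_le_self
    _ = _ := by
        rw [integral_indicator measurableSet_ball, setIntegral_ball_rpow hs q one_pos]
        simp

theorem integrableOn_compl_ball_rpow_three (q : ℂ) {δ : ℝ} (hδ : 0 < δ) :
    IntegrableOn (fun z => ‖z - q‖ ^ (-3 : ℝ)) (Metric.ball q δ)ᶜ := by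
  rw [← integrable_indicator_iff measurableSet_ball.compl]
  have h : Integrable (fun z : ℂ => (Ici δ).indicator (fun y : ℝ => y ^ (-3 : ℝ)) ‖z‖) := by
    rw [integrable_radial_iff, integrableOn_congr_fun (mul_indicator_rpow _ _) measurableSet_Ioi,
      IntegrableOn, integrable_indicator_iff measurableSet_Ici, IntegrableOn,
      Measure.restrict_restrict measurableSet_Ici,
      inter_eq_left.2 (Ici_subset_Ioi.2 hδ), ← IntegrableOn,
      integrableOn_Ici_iff_integrableOn_Ioi]
    exact integrableOn_Ioi_rpow_of_lt (by norm_num) hδ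
  have h3 := h.comp_sub_right q
  refine h3.congr (ae_of_all _ fun z => ?_)
  by_cases hz : ‖z - q‖ < δ <;> simp [indicator, hz, Complex.dist_eq, not_le.2, not_lt.1]

theorem setIntegral_compl_ball_rpow_three (q : ℂ) {δ : ℝ} (hδ : 0 < δ) :
    ∫ z in (Metric.ball q δ)ᶜ, ‖z - q‖ ^ (-3 : ℝ) = 2 * Real.pi / δ := by
  rw [← integral_indicator measurableSet_ball.compl]
  have h := integral_radial ((Ici δ).indicator (fun y : ℝ => y ^ (-3 : ℝ)))
  rw [← integral_sub_right_eq_self _ q, setIntegral_congr_fun measurableSet_Ioi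
    (mul_indicator_rpow _ _), setIntegral_indicator measurableSet_Ici,
    inter_eq_right.2 (Ici_subset_Ioi.2 hδ), integral_Ici_eq_integral_Ioi,
    integral_Ioi_rpow_of_lt (by norm_num) hδ] at h
  have h2 : (∫ z, (Metric.ball q δ)ᶜ.indicator (fun z => ‖z - q‖ ^ (-3 : ℝ)) z) =
      ∫ z, (Ici δ).indicator (fun y : ℝ => y ^ (-3 : ℝ)) ‖z - q‖ := by
    congr 1
    ext z
    by_cases hz : ‖z - q‖ < δ <;> simp [indicator, hz, Complex.dist_eq, not_le.2, not_lt.1]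
  rw [h2, h]
  norm_num [Real.rpow_neg_one]
  field_simp

/-! ### The operator `∂/∂z̄` in the plane -/

/-- `∂v/∂z̄ = ½ (v_x + i v_y)` for a function `v` on the plane. -/
def dbarC (v : ℂ → ℂ) (z : ℂ) : ℂ := (fderiv ℝ v z 1 + Complex.I * fderiv ℝ v z Complex.I) / 2

/-- The linear form on real differentials which gives their `∂/∂z̄` component. -/
def dbarForm : (ℂ →L[ℝ] ℂ) →L[ℝ] ℂ :=
  (1 / 2 : ℂ) • (ContinuousLinearMap.apply ℝ ℂ (1 : ℂ) +
    Complex.I • ContinuousLinearMap.apply ℝ ℂ Complex.I)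

theorem dbarC_eq (v : ℂ → ℂ) (z : ℂ) : dbarC v z = dbarForm (fderiv ℝ v z) := by
  simp [dbarC, dbarForm]; ring

theorem _root_.HasFDerivAt.dbarC {v : ℂ → ℂ} {z : ℂ} {v' : ℂ →L[ℝ] ℂ} (h : HasFDerivAt v v' z) :
    dbarC v z = (v' 1 + Complex.I * v' Complex.I) / 2 := by
  rw [RiemannSurface.dbarC, h.fderiv]

theorem dbarC_congr {u v : ℂ → ℂ} {z : ℂ} (h : u =ᶠ[𝓝 z] v) : dbarC u z = dbarC v z := by
  rw [dbarC, dbarC, h.fderiv_eq]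

theorem dbarC_congr_on {u v : ℂ → ℂ} {O : Set ℂ} (hO : IsOpen O) (h : EqOn u v O) :
    EqOn (dbarC u) (dbarC v) O := fun _ hz =>
  dbarC_congr (h.eventuallyEq_of_mem (hO.mem_nhds hz))

theorem dbarC_mul {u v : ℂ → ℂ} {z : ℂ} (hu : DifferentiableAt ℝ u z)
    (hv : DifferentiableAt ℝ v z) :
    dbarC (fun z => u z * v z) z = dbarC u z * v z + u z * dbarC v z := by
  have h : HasFDerivAt (fun z => u z * v z) _ z := hu.hasFDerivAt.mul hv.hasFDerivAt
  rw [h.dbarC]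
  simp [dbarC]; ring

theorem dbarC_add {u v : ℂ → ℂ} {z : ℂ} (hu : DifferentiableAt ℝ u z)
    (hv : DifferentiableAt ℝ v z) :
    dbarC (fun z => u z + v z) z = dbarC u z + dbarC v z := by
  have h : HasFDerivAt (fun z => u z + v z) _ z := hu.hasFDerivAt.add hv.hasFDerivAt
  rw [h.dbarC]
  simp [dbarC]; ring

theorem dbarC_sub {u v : ℂ → ℂ} {z : ℂ} (hu : DifferentiableAt ℝ u z)
    (hv : DifferentiableAt ℝ v z) :
    dbarC (fun z => u z - v z) z = dbarC u z - dbarC v z := by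
  have h : HasFDerivAt (fun z => u z - v z) _ z := hu.hasFDerivAt.sub hv.hasFDerivAt
  rw [h.dbarC]
  simp [dbarC]; ring

@[simp] theorem dbarC_const (c z : ℂ) : dbarC (fun _ => c) z = 0 := by
  simp [dbarC]

theorem dbarC_const_mul {u : ℂ → ℂ} {z : ℂ} (c : ℂ) (hu : DifferentiableAt ℝ u z) :
    dbarC (fun z => c * u z) z = c * dbarC u z := by
  rw [dbarC_mul (differentiableAt_const c) hu]; simp

theorem dbarC_of_differentiableAt {u : ℂ → ℂ} {z : ℂ} (hu : DifferentiableAt ℂ u z) :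
    dbarC u z = 0 := by
  rw [(hu.hasDerivAt.hasFDerivAt.restrictScalars ℝ).dbarC]
  simp
  rw [← mul_assoc, Complex.I_mul_I]; ring

theorem dbarC_conj {u : ℂ → ℂ} {z : ℂ} (hu : DifferentiableAt ℂ u z) :
    dbarC (fun z => conj (u z)) z = conj (deriv u z) := by
  have h := (hu.hasDerivAt.hasFDerivAt.restrictScalars ℝ)
  have h2 := (Complex.conjCLE.toContinuousLinearMap.hasFDerivAt (x := u z)).comp z h
  rw [show (fun z => conj (u z)) = (Complex.conjCLE.toContinuousLinearMap : ℂ → ℂ) ∘ u from rfl,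
    h2.dbarC]
  simp
  rw [← mul_assoc, Complex.I_mul_I]; ring

/-- `∂̄ (g ∘ v) = g' ∂̄v` for holomorphic `g`. -/
theorem dbarC_holomorphic_comp {g v : ℂ → ℂ} {z g' : ℂ} (hg : HasDerivAt g g' (v z))
    (hv : DifferentiableAt ℝ v z) : dbarC (fun z => g (v z)) z = g' * dbarC v z := by
  have h2 := (hg.hasFDerivAt.restrictScalars ℝ).comp z hv.hasFDerivAt
  rw [show (fun z => g (v z)) = g ∘ v from rfl, h2.dbarC]
  simp [dbarC]; ring

theorem dbarC_real_comp {g : ℝ → ℝ} {ρ : ℂ → ℝ} {z : ℂ} {g' : ℝ} (hg : HasDerivAt g g' (ρ z))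
    (hv : DifferentiableAt ℝ ρ z) :
    dbarC (fun z => (g (ρ z) : ℂ)) z = g' * dbarC (fun z => (ρ z : ℂ)) z := by
  have h1 := Complex.ofRealCLM.hasFDerivAt.comp z (hg.hasFDerivAt.comp z hv.hasFDerivAt)
  have h2 := Complex.ofRealCLM.hasFDerivAt.comp z hv.hasFDerivAt
  rw [show (fun z => (g (ρ z) : ℂ)) = Complex.ofRealCLM ∘ g ∘ ρ from rfl,
    show (fun z => (ρ z : ℂ)) = Complex.ofRealCLM ∘ ρ from rfl, h1.dbarC, h2.dbarC]
  simp; ring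

theorem _root_.ContDiffOn.dbarC {v : ℂ → ℂ} {O : Set ℂ} (hO : IsOpen O) (hv : ContDiffOn ℝ ∞ v O) :
    ContDiffOn ℝ ∞ (RiemannSurface.dbarC v) O := by
  have h : RiemannSurface.dbarC v = fun z => dbarForm (fderiv ℝ v z) := funext (dbarC_eq v)
  rw [h]
  exact dbarForm.contDiff.comp_contDiffOn (hv.fderiv_of_isOpen hO (by simp))

theorem continuous_dbarC {v : ℂ → ℂ} (hv : ContDiff ℝ 1 v) : Continuous (dbarC v) := by
  have h : dbarC v = fun z => dbarForm (fderiv ℝ v z) := funext (dbarC_eq v)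
  rw [h]
  exact dbarForm.continuous.comp (hv.continuous_fderiv one_ne_zero)

theorem integral_dbarC_eq_zero {v : ℂ → ℂ} (hv : ContDiff ℝ 1 v) (hc : HasCompactSupport v) :
    ∫ z, dbarC v z = 0 := by
  have hi : ∀ e : ℂ, Integrable fun z => fderiv ℝ v z e := fun e =>
    ((hv.continuous_fderiv one_ne_zero).clm_apply continuous_const).integrable_of_hasCompactSupport
      ((hc.fderiv (𝕜 := ℝ)).mono fun x hx => by
        contrapose! hx
        simp only [Function.mem_support, not_not] at hx ⊢
        simp [hx])
  have h0 : ∀ e : ℂ, ∫ z, fderiv ℝ v z e = 0 := fun e => by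
    have := integral_mul_fderiv_eq_neg_fderiv_mul_of_integrable (μ := volume)
      (f := fun _ : ℂ => (1 : ℂ)) (g := v) (v := e) (by simp) (by simpa using hi e)
      (by simpa using hv.continuous.integrable_of_hasCompactSupport hc)
      (fun _ _ => differentiableAt_const _) (fun x _ => (hv.differentiable one_ne_zero) x)
    simpa using this
  simp only [dbarC]
  rw [integral_div, integral_add (hi 1) ((hi _).const_mul _), integral_const_mul, h0, h0]
  simp

/-! ### Radial cutoffs -/

/-- A smooth function of the squared distance that is `0` up to `1` and `1` from `4` on. -/
def step (t : ℝ) : ℝ := Real.smoothTransition ((t - 1) / 3)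

theorem contDiff_step : ContDiff ℝ ∞ step :=
  Real.smoothTransition.contDiff.comp (by fun_prop)

theorem step_of_le {t : ℝ} (h : t ≤ 1) : step t = 0 :=
  Real.smoothTransition.zero_of_nonpos (by linarith)

theorem step_of_ge {t : ℝ} (h : 4 ≤ t) : step t = 1 :=
  Real.smoothTransition.one_of_one_le (by linarith)

theorem step_nonneg (t : ℝ) : 0 ≤ step t := Real.smoothTransition.nonneg _

theorem step_le_one (t : ℝ) : step t ≤ 1 := Real.smoothTransition.le_one _

theorem step_monotone : Monotone step := fun _ _ h =>
  Real.smoothTransition.monotone (by linarith)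

theorem hasDerivAt_step (t : ℝ) : HasDerivAt step (deriv step t) t :=
  (contDiff_step.differentiable (by simp) t).hasDerivAt

theorem deriv_step_of_lt {t : ℝ} (h : t < 1) : deriv step t = 0 := by
  have : step =ᶠ[𝓝 t] fun _ => 0 := by
    filter_upwards [Iio_mem_nhds h] with x hx using step_of_le (le_of_lt hx)
  rw [this.deriv_eq]; simp

theorem deriv_step_of_gt {t : ℝ} (h : 4 < t) : deriv step t = 0 := by
  have : step =ᶠ[𝓝 t] fun _ => 1 := by
    filter_upwards [Ioi_mem_nhds h] with x hx using step_of_ge (le_of_lt hx)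
  rw [this.deriv_eq]; simp

theorem exists_deriv_step_le : ∃ C : ℝ, 0 ≤ C ∧ ∀ t, |deriv step t| ≤ C := by
  obtain ⟨C, hC⟩ := isCompact_Icc (a := (1 : ℝ)) (b := 4) |>.exists_bound_of_continuousOn
    (f := deriv step) (contDiff_step.continuous_deriv (by simp)).continuousOn
  refine ⟨max C 0, le_max_right _ _, fun t => ?_⟩
  by_cases h1 : t < 1
  · simp [deriv_step_of_lt h1]
  by_cases h2 : 4 < t
  · simp [deriv_step_of_gt h2]
  · exact (hC t ⟨not_lt.1 h1, not_lt.1 h2⟩).trans (le_max_left _ _)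

/-- The radial cutoff that vanishes on the disc of radius `δ` about `p` and is `1` off the disc of
radius `2 δ`. -/
def cut (p : ℂ) (δ : ℝ) (z : ℂ) : ℂ := (step (Complex.normSq (z - p) / δ ^ 2) : ℝ)

theorem contDiff_normSq_sub (p : ℂ) : ContDiff ℝ ∞ fun z => Complex.normSq (z - p) := by
  simp only [Complex.normSq_apply]
  have h1 : ContDiff ℝ ∞ fun z : ℂ => (z - p).re :=
    Complex.reCLM.contDiff.comp (contDiff_id.sub contDiff_const)
  have h2 : ContDiff ℝ ∞ fun z : ℂ => (z - p).im :=
    Complex.imCLM.contDiff.comp (contDiff_id.sub contDiff_const)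
  exact (h1.mul h1).add (h2.mul h2)

theorem contDiff_cut (p : ℂ) (δ : ℝ) : ContDiff ℝ ∞ (cut p δ) :=
  Complex.ofRealCLM.contDiff.comp (contDiff_step.comp ((contDiff_normSq_sub p).div_const _))

theorem norm_cut_le (p : ℂ) (δ : ℝ) (z : ℂ) : ‖cut p δ z‖ ≤ 1 := by
  rw [cut, Complex.norm_real, Real.norm_of_nonneg (step_nonneg _)]
  exact step_le_one _

theorem norm_one_sub_cut_le (p : ℂ) (δ : ℝ) (z : ℂ) : ‖1 - cut p δ z‖ ≤ 1 := by
  rw [cut, ← Complex.ofReal_one, ← Complex.ofReal_sub, Complex.norm_real, Real.norm_eq_abs, abs_le]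
  constructor <;> linarith [step_nonneg (Complex.normSq (z - p) / δ ^ 2),
    step_le_one (Complex.normSq (z - p) / δ ^ 2)]

theorem cut_of_le {p z : ℂ} {δ : ℝ} (hδ : 0 < δ) (h : ‖z - p‖ ≤ δ) : cut p δ z = 0 := by
  rw [cut, step_of_le, Complex.ofReal_zero]
  rw [div_le_one (by positivity), Complex.normSq_eq_norm_sq]
  gcongr

theorem cut_of_ge {p z : ℂ} {δ : ℝ} (hδ : 0 < δ) (h : 2 * δ ≤ ‖z - p‖) : cut p δ z = 1 := by
  rw [cut, step_of_ge, Complex.ofReal_one]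
  rw [le_div_iff₀ (by positivity), Complex.normSq_eq_norm_sq]
  nlinarith

theorem dbarC_cut (p : ℂ) (δ : ℝ) (z : ℂ) :
    dbarC (cut p δ) z = deriv step (‖z - p‖ ^ 2 / δ ^ 2) * ((z - p) / δ ^ 2) := by
  have hd : DifferentiableAt ℝ (fun z => Complex.normSq (z - p) / δ ^ 2) z :=
    ((contDiff_normSq_sub p).div_const _).differentiable (by simp) z
  have h := dbarC_real_comp (ρ := fun z => Complex.normSq (z - p) / δ ^ 2)
    (hasDerivAt_step (Complex.normSq (z - p) / δ ^ 2)) hd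
  rw [show cut p δ = fun z => ((step (Complex.normSq (z - p) / δ ^ 2) : ℝ) : ℂ) from rfl, h,
    Complex.normSq_eq_norm_sq]
  congr 1
  have e : (fun z => ((Complex.normSq (z - p) / δ ^ 2 : ℝ) : ℂ)) =
      fun z => (((δ : ℂ) ^ 2)⁻¹ * (z - p)) * conj (z - p) := by
    ext z
    push_cast
    rw [← Complex.mul_conj]; ring
  have d1 : DifferentiableAt ℂ (fun z => ((δ : ℂ) ^ 2)⁻¹ * (z - p)) z := by fun_prop
  have d2 : DifferentiableAt ℂ (fun z => z - p) z := by fun_prop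
  have d3 : DifferentiableAt ℝ (fun z => conj (z - p)) z :=
    Complex.conjCLE.differentiableAt.comp z (d2.restrictScalars ℝ)
  rw [e, dbarC_mul (d1.restrictScalars ℝ) d3, dbarC_of_differentiableAt d1, dbarC_conj d2]
  simp; ring

theorem dbarC_cut_of_lt {p z : ℂ} {δ : ℝ} (hδ : 0 < δ) (h : ‖z - p‖ < δ) :
    dbarC (cut p δ) z = 0 := by
  rw [dbarC_cut, deriv_step_of_lt, Complex.ofReal_zero, zero_mul]
  rw [div_lt_one (by positivity)]
  gcongr

theorem dbarC_cut_of_gt {p z : ℂ} {δ : ℝ} (hδ : 0 < δ) (h : 2 * δ < ‖z - p‖) :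
    dbarC (cut p δ) z = 0 := by
  rw [dbarC_cut, deriv_step_of_gt, Complex.ofReal_zero, zero_mul]
  rw [lt_div_iff₀ (by positivity)]
  nlinarith

theorem exists_norm_dbarC_cut_le :
    ∃ C : ℝ, 0 ≤ C ∧ ∀ (p : ℂ) (δ : ℝ) (z : ℂ), 0 < δ → ‖dbarC (cut p δ) z‖ ≤ C / ‖z - p‖ ∧
      ‖dbarC (cut p δ) z‖ ≤ C / δ := by
  obtain ⟨C, hC0, hC⟩ := exists_deriv_step_le
  refine ⟨4 * C, by positivity, fun p δ z hδ => ?_⟩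
  by_cases h1 : ‖z - p‖ < δ
  · rw [dbarC_cut_of_lt hδ h1, norm_zero]
    constructor <;> positivity
  by_cases h2 : 2 * δ < ‖z - p‖
  · rw [dbarC_cut_of_gt hδ h2, norm_zero]
    constructor <;> positivity
  push Not at h1 h2
  have hp : 0 < ‖z - p‖ := hδ.trans_le h1
  have h3 : ‖dbarC (cut p δ) z‖ ≤ C * (‖z - p‖ / δ ^ 2) := by
    rw [dbarC_cut, norm_mul, norm_div, norm_pow, Complex.norm_real, Complex.norm_real,
      Real.norm_of_nonneg hδ.le]
    exact mul_le_mul_of_nonneg_right (hC _) (by positivity)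
  constructor
  · refine h3.trans ?_
    rw [le_div_iff₀ hp, mul_comm 4 C, mul_assoc]
    gcongr
    rw [div_mul_eq_mul_div, div_le_iff₀ (by positivity)]
    nlinarith
  · refine h3.trans ?_
    rw [le_div_iff₀ hδ, mul_comm 4 C, mul_assoc]
    gcongr
    rw [div_mul_eq_mul_div, div_le_iff₀ (by positivity)]
    nlinarith

/-- The normalization of the Cauchy kernel: `1 / (π (z - q))` is a fundamental solution of `∂̄`. -/
theorem integral_dbarC_cut_div (q : ℂ) {δ : ℝ} (hδ : 0 < δ) :
    ∫ z, dbarC (cut q δ) z / (z - q) = Real.pi := by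
  have h1 : (∫ z, dbarC (cut q δ) z / (z - q)) =
      ∫ z, ((deriv step (‖z - q‖ ^ 2 / δ ^ 2) / δ ^ 2 : ℝ) : ℂ) := by
    refine integral_congr_ae ?_
    filter_upwards [compl_mem_ae_iff.2 (measure_singleton q)] with z hz
    have : z - q ≠ 0 := sub_ne_zero.2 hz
    rw [dbarC_cut]
    push_cast
    field_simp
  have hrad := integral_radial fun y => deriv step (y ^ 2 / δ ^ 2) / δ ^ 2
  rw [← integral_sub_right_eq_self _ q] at hrad
  have hftc := integral_Ioi_of_hasDerivAt_of_nonneg' (a := 0) (l := 1)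
    (g := fun y : ℝ => step (y ^ 2 / δ ^ 2)) (g' := fun y => deriv step (y ^ 2 / δ ^ 2) *
      (2 * y / δ ^ 2)) (fun y _ => by
        have := (hasDerivAt_step (y ^ 2 / δ ^ 2)).comp y
          (((hasDerivAt_id y).pow 2).div_const (δ ^ 2))
        refine this.congr_deriv ?_
        simp)
      (fun y hy => mul_nonneg step_monotone.deriv_nonneg
        (div_nonneg (mul_nonneg zero_le_two (le_of_lt hy)) (by positivity)))
      (by
        refine tendsto_const_nhds.congr' ?_
        filter_upwards [eventually_ge_atTop (2 * δ)] with y hy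
        rw [step_of_ge]
        rw [le_div_iff₀ (by positivity)]
        nlinarith)
  have h2 : (∫ y in Ioi (0 : ℝ), y * (deriv step (y ^ 2 / δ ^ 2) / δ ^ 2)) = 1 / 2 := by
    have e : (fun y : ℝ => y * (deriv step (y ^ 2 / δ ^ 2) / δ ^ 2)) =
        fun y => (1 / 2) * (deriv step (y ^ 2 / δ ^ 2) * (2 * y / δ ^ 2)) := by
      ext y; ring
    rw [e, integral_const_mul, hftc]
    simp [step_of_le]
  rw [h1, integral_complex_ofReal, hrad, h2]
  push_cast
  ring

/-! ### Stokes' theorem and Cauchy's formula for functions with isolated singularities -/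

/-- A function that vanishes off a closed subset of the open set `O` is as smooth on the whole
plane as it is on `O`. -/
theorem contDiffOn_compl_of_eq_zero {n : WithTop ℕ∞} {u : ℂ → ℂ} {O S T : Set ℂ} (hO : IsOpen O)
    (hS : IsClosed S) (hT : IsClosed T) (hSO : S ⊆ O) (hu : ContDiffOn ℝ n u (O \ T))
    (h0 : ∀ z ∉ S, u z = 0) : ContDiffOn ℝ n u Tᶜ := by
  intro z hz
  by_cases hzO : z ∈ O
  · exact (hu.contDiffAt ((hO.sdiff hT).mem_nhds ⟨hzO, hz⟩)).contDiffWithinAt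
  · have : u =ᶠ[𝓝 z] fun _ => 0 :=
      Filter.mem_of_superset (hS.isOpen_compl.mem_nhds fun h => hzO (hSO h)) fun x hx => h0 x hx
    exact (contDiffAt_const.congr_of_eventuallyEq this).contDiffWithinAt

theorem dbarC_eq_zero_of_notMem {u : ℂ → ℂ} {S : Set ℂ} (hS : IsClosed S)
    (h0 : ∀ z ∉ S, u z = 0) {z : ℂ} (hz : z ∉ S) : dbarC u z = 0 := by
  have : u =ᶠ[𝓝 z] fun _ => 0 :=
    Filter.mem_of_superset (hS.isOpen_compl.mem_nhds hz) fun x hx => h0 x hx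
  rw [dbarC_congr this, dbarC_const]

theorem ae_ne (p : ℂ) : ∀ᵐ z : ℂ, z ≠ p := compl_mem_ae_iff.2 (measure_singleton p)

theorem isClosed_pair (p q : ℂ) : IsClosed ({p, q} : Set ℂ) := (Set.toFinite _).isClosed

theorem aestronglyMeasurable_of_contDiffOn {n : WithTop ℕ∞} {u : ℂ → ℂ} {p q : ℂ}
    (hu : ContDiffOn ℝ n u {p, q}ᶜ) : AEStronglyMeasurable u := by
  have h := (hu.continuousOn.aestronglyMeasurable (isClosed_pair p q).isOpen_compl.measurableSet
    (μ := volume))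
  rwa [Measure.restrict_eq_self_of_ae_mem] at h
  filter_upwards [ae_ne p, ae_ne q] with z h1 h2
  simp [h1, h2]

theorem continuousOn_dbarC {u : ℂ → ℂ} {O : Set ℂ} (hO : IsOpen O) (hu : ContDiffOn ℝ 1 u O) :
    ContinuousOn (dbarC u) O := by
  have h : dbarC u = fun z => dbarForm (fderiv ℝ u z) := funext (dbarC_eq u)
  rw [h]
  exact dbarForm.continuous.comp_continuousOn (hu.continuousOn_fderiv_of_isOpen hO le_rfl)

theorem aestronglyMeasurable_dbarC {u : ℂ → ℂ} {p q : ℂ}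
    (hu : ContDiffOn ℝ 1 u {p, q}ᶜ) : AEStronglyMeasurable (dbarC u) := by
  have hO := (isClosed_pair p q).isOpen_compl
  have h := (continuousOn_dbarC hO hu).aestronglyMeasurable hO.measurableSet (μ := volume)
  rwa [Measure.restrict_eq_self_of_ae_mem] at h
  filter_upwards [ae_ne p, ae_ne q] with z h1 h2
  simp [h1, h2]

/-- The product of the cutoffs at `p` and at `q`. -/
def cut₂ (p q : ℂ) (δ : ℝ) (z : ℂ) : ℂ := cut p δ z * cut q δ z

theorem contDiff_cut₂ (p q : ℂ) (δ : ℝ) : ContDiff ℝ ∞ (cut₂ p q δ) :=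
  (contDiff_cut p δ).mul (contDiff_cut q δ)

theorem norm_cut₂_le (p q : ℂ) (δ : ℝ) (z : ℂ) : ‖cut₂ p q δ z‖ ≤ 1 := by
  rw [cut₂, norm_mul]
  exact mul_le_one₀ (norm_cut_le _ _ _) (norm_nonneg _) (norm_cut_le _ _ _)

theorem norm_one_sub_cut₂_le (p q : ℂ) (δ : ℝ) (z : ℂ) : ‖1 - cut₂ p q δ z‖ ≤ 1 := by
  rw [cut₂, cut, cut, ← Complex.ofReal_mul, ← Complex.ofReal_one, ← Complex.ofReal_sub,
    Complex.norm_real, Real.norm_eq_abs, abs_le]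
  have h := step_nonneg (Complex.normSq (z - p) / δ ^ 2)
  have h' := step_nonneg (Complex.normSq (z - q) / δ ^ 2)
  have h1 := step_le_one (Complex.normSq (z - p) / δ ^ 2)
  have h1' := step_le_one (Complex.normSq (z - q) / δ ^ 2)
  constructor
  · nlinarith [mul_le_one₀ h1 h' h1']
  · nlinarith [mul_nonneg h h']

theorem cut₂_eq_zero {p q z : ℂ} {δ : ℝ} (hδ : 0 < δ)
    (h : z ∈ Metric.ball p δ ∪ Metric.ball q δ) : cut₂ p q δ z = 0 := by
  rcases h with h | h <;> rw [Metric.mem_ball, Complex.dist_eq] at h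
  · rw [cut₂, cut_of_le hδ h.le, zero_mul]
  · rw [cut₂, cut_of_le hδ h.le, mul_zero]

theorem cut₂_eq_one {p q z : ℂ} {δ : ℝ} (hδ : 0 < δ)
    (h : z ∉ Metric.ball p (2 * δ) ∪ Metric.ball q (2 * δ)) : cut₂ p q δ z = 1 := by
  simp only [mem_union, Metric.mem_ball, Complex.dist_eq, not_or, not_lt] at h
  rw [cut₂, cut_of_ge hδ h.1, cut_of_ge hδ h.2, mul_one]

theorem norm_dbarC_cut₂_le (p q z : ℂ) (δ : ℝ) :
    ‖dbarC (cut₂ p q δ) z‖ ≤ ‖dbarC (cut p δ) z‖ + ‖dbarC (cut q δ) z‖ := by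
  have h : dbarC (cut₂ p q δ) z = _ := dbarC_mul ((contDiff_cut p δ).differentiable (by simp) z)
    ((contDiff_cut q δ).differentiable (by simp) z)
  rw [h]
  refine (norm_add_le _ _).trans ?_
  rw [norm_mul, norm_mul]
  exact add_le_add (mul_le_of_le_one_right (norm_nonneg _) (norm_cut_le _ _ _))
    (mul_le_of_le_one_left (norm_nonneg _) (norm_cut_le _ _ _))

theorem contDiff_cut₂_mul {n : ℕ∞} {u : ℂ → ℂ} {p q : ℂ} {δ : ℝ} (hδ : 0 < δ)
    (hu : ContDiffOn ℝ n u {p, q}ᶜ) : ContDiff ℝ n fun z => cut₂ p q δ z * u z := by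
  rw [contDiff_iff_contDiffAt]
  intro z
  by_cases hz : z ∈ ({p, q} : Set ℂ)
  · have hz' : Metric.ball p δ ∪ Metric.ball q δ ∈ 𝓝 z := by
      refine (Metric.isOpen_ball.union Metric.isOpen_ball).mem_nhds ?_
      rcases hz with rfl | rfl
      · exact Or.inl (Metric.mem_ball_self hδ)
      · exact Or.inr (Metric.mem_ball_self hδ)
    refine contDiffAt_const (c := 0) |>.congr_of_eventuallyEq ?_
    filter_upwards [hz'] with x hx
    rw [cut₂_eq_zero hδ hx, zero_mul]
  · exact ((contDiff_cut₂ p q δ).contDiffAt.of_le (by exact_mod_cast le_top)).mul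
      (hu.contDiffAt ((isClosed_pair p q).isOpen_compl.mem_nhds hz))

theorem tendsto_cut₂ {p q z : ℂ} (hp : z ≠ p) (hq : z ≠ q) :
    Tendsto (fun δ => cut₂ p q δ z) (𝓝[>] 0) (𝓝 1) := by
  refine tendsto_const_nhds.congr' ?_
  have h1 : 0 < ‖z - p‖ / 2 := half_pos (norm_pos_iff.2 (sub_ne_zero.2 hp))
  have h2 : 0 < ‖z - q‖ / 2 := half_pos (norm_pos_iff.2 (sub_ne_zero.2 hq))
  filter_upwards [Ioo_mem_nhdsGT h1, Ioo_mem_nhdsGT h2] with δ hδ1 hδ2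
  rw [cut₂_eq_one hδ1.1]
  simp only [mem_union, Metric.mem_ball, Complex.dist_eq, not_or, not_lt]
  exact ⟨by linarith [hδ1.2], by linarith [hδ2.2]⟩

/-- Stokes' theorem for compactly supported functions with two removable singularities: the
boundary terms on small circles around bounded singularities vanish in the limit. -/
theorem integral_dbarC_eq_zero_of_bounded {v : ℂ → ℂ} {p q : ℂ} {S : Set ℂ} (hS : IsCompact S)
    (hv : ContDiffOn ℝ 1 v {p, q}ᶜ) (h0 : ∀ z ∉ S, v z = 0) {C : ℝ}
    (hC : ∀ z, z ≠ p → z ≠ q → ‖v z‖ ≤ C) (hi : Integrable (dbarC v)) :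
    ∫ z, dbarC v z = 0 := by
  obtain ⟨C₀, hC₀, hcut⟩ := exists_norm_dbarC_cut_le
  have hO := (isClosed_pair p q).isOpen_compl
  have hvd : ∀ z, z ≠ p → z ≠ q → DifferentiableAt ℝ v z := fun z h1 h2 =>
    (hv.contDiffAt (hO.mem_nhds (by simp [h1, h2]))).differentiableAt one_ne_zero
  have hC' : 0 ≤ C := by
    obtain ⟨z, hz⟩ := (Set.toFinite ({p, q} : Set ℂ)).infinite_compl.nonempty
    simp only [mem_compl_iff, mem_insert_iff, mem_singleton_iff, not_or] at hz
    exact (norm_nonneg _).trans (hC z hz.1 hz.2)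
  have hcd : ∀ δ z, DifferentiableAt ℝ (cut₂ p q δ) z := fun δ z =>
    (contDiff_cut₂ p q δ).differentiable (by simp) z
  have hlim : Tendsto (fun δ => ∫ z, cut₂ p q δ z * dbarC v z) (𝓝[>] 0) (𝓝 (∫ z, dbarC v z)) := by
    refine tendsto_integral_filter_of_dominated_convergence (fun z => ‖dbarC v z‖)
      (Eventually.of_forall fun δ => ?_) (Eventually.of_forall fun δ => ae_of_all _ fun z => ?_)
      hi.norm ?_
    · exact (contDiff_cut₂ p q δ).continuous.aestronglyMeasurable.mul hi.aestronglyMeasurable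
    · rw [norm_mul]
      exact mul_le_of_le_one_left (norm_nonneg _) (norm_cut₂_le _ _ _ _)
    · filter_upwards [ae_ne p, ae_ne q] with z h1 h2
      simpa using (tendsto_cut₂ h1 h2).mul_const (dbarC v z)
  have hbd : ∀ δ : ℝ, 0 < δ → ‖∫ z, cut₂ p q δ z * dbarC v z‖ ≤ 18 * Real.pi * C₀ * C * δ := by
    intro δ hδ
    have hw := contDiff_cut₂_mul (n := 1) hδ hv
    have hws : HasCompactSupport fun z => cut₂ p q δ z * v z :=
      HasCompactSupport.intro hS fun z hz => by simp [h0 z hz]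
    have hst := integral_dbarC_eq_zero hw hws
    have hi1 : Integrable fun z => cut₂ p q δ z * dbarC v z :=
      hi.bdd_mul (contDiff_cut₂ p q δ).continuous.aestronglyMeasurable
        (ae_of_all _ fun z => norm_cut₂_le _ _ _ _)
    have hi2 : Integrable (dbarC fun z => cut₂ p q δ z * v z) := by
      refine (continuous_dbarC hw).integrable_of_hasCompactSupport ?_
      refine HasCompactSupport.intro hS fun z hz => ?_
      exact dbarC_eq_zero_of_notMem hS.isClosed (fun z hz => by simp [h0 z hz]) hz
    have e : (∫ z, cut₂ p q δ z * dbarC v z) =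
        -∫ z, ((dbarC fun z => cut₂ p q δ z * v z) z - cut₂ p q δ z * dbarC v z) := by
      rw [integral_sub hi2 hi1, hst]; ring
    rw [e, norm_neg]
    -- `∂̄` of a cutoff is `O(1/δ)` and lives on a disc of area `O(δ²)`; the open disc of radius `3 δ`
    -- contains the closed one of radius `2 δ`.
    have hvol : ∀ x : ℂ, volume.real (Metric.ball x (3 * δ)) = 9 * Real.pi * δ ^ 2 := fun x => by
      rw [measureReal_def, Complex.volume_ball]
      simp [hδ.le]
      ring
    have hI : ∀ x : ℂ, Integrable ((Metric.ball x (3 * δ)).indicator fun _ => C₀ / δ * C) :=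
      fun x => (integrable_indicator_iff measurableSet_ball).2
        (integrableOn_const measure_ball_lt_top.ne)
    have hJ : ∀ x : ℂ, ∫ z, (Metric.ball x (3 * δ)).indicator (fun _ => C₀ / δ * C) z =
        9 * Real.pi * C₀ * C * δ := fun x => by
      rw [integral_indicator measurableSet_ball, setIntegral_const, hvol, smul_eq_mul]
      field_simp
    calc _ ≤ ∫ z, ((Metric.ball p (3 * δ)).indicator (fun _ => C₀ / δ * C) z +
          (Metric.ball q (3 * δ)).indicator (fun _ => C₀ / δ * C) z) := by
          refine norm_integral_le_of_norm_le ((hI p).add (hI q)) ?_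
          filter_upwards [ae_ne p, ae_ne q] with z h1 h2
          rw [dbarC_mul (hcd δ z) (hvd z h1 h2), add_sub_cancel_right, norm_mul]
          refine (mul_le_mul (norm_dbarC_cut₂_le p q z δ) (hC z h1 h2) (norm_nonneg _)
            (by positivity)).trans ?_
          have key : ∀ x : ℂ, ‖dbarC (cut x δ) z‖ * C ≤
              (Metric.ball x (3 * δ)).indicator (fun _ => C₀ / δ * C) z := fun x => by
            by_cases hx : z ∈ Metric.ball x (3 * δ)
            · rw [indicator_of_mem hx]
              exact mul_le_mul_of_nonneg_right (hcut x δ z hδ).2 hC'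
            · rw [indicator_of_notMem hx, dbarC_cut_of_gt hδ, norm_zero, zero_mul]
              rw [Metric.mem_ball, Complex.dist_eq, not_lt] at hx
              linarith
          rw [add_mul]
          exact add_le_add (key p) (key q)
      _ = _ := by
          rw [integral_add (hI p) (hI q), hJ, hJ]; ring
  have hlim0 : Tendsto (fun δ => ∫ z, cut₂ p q δ z * dbarC v z) (𝓝[>] 0) (𝓝 0) := by
    refine squeeze_zero_norm' (a := fun δ => 18 * Real.pi * C₀ * C * δ)
      (eventually_nhdsWithin_of_forall hbd) ?_
    have : Tendsto (fun δ : ℝ => 18 * Real.pi * C₀ * C * δ) (𝓝 0) (𝓝 (18 * Real.pi * C₀ * C * 0)) :=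
      (continuous_const.mul continuous_id).tendsto 0
    rw [mul_zero] at this
    exact this.mono_left nhdsWithin_le_nhds
  exact tendsto_nhds_unique hlim hlim0

theorem inv_mul_inv_le {x y d : ℝ} (hx : 0 < x) (hy : 0 < y) (hd : 0 < d) (h : d ≤ x + y) :
    x⁻¹ * y⁻¹ ≤ d⁻¹ * (x⁻¹ + y⁻¹) := by
  have e : x⁻¹ + y⁻¹ = (x + y) * (x⁻¹ * y⁻¹) := by field_simp; ring
  rw [e, ← mul_assoc]
  refine le_mul_of_one_le_left (by positivity) ?_
  rw [inv_mul_eq_div]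
  exact (one_le_div hd).2 h

theorem integrableOn_norm_sub_inv {S : Set ℂ} (hS : volume S ≠ ⊤) (q : ℂ) :
    IntegrableOn (fun z => ‖z - q‖⁻¹) S := by
  simpa [Real.rpow_neg_one] using integrableOn_rpow (s := 1) (by norm_num) zero_le_one hS q

theorem integrableOn_inv_mul_inv {S : Set ℂ} (hS : volume S ≠ ⊤) {p q : ℂ} (hpq : p ≠ q) :
    IntegrableOn (fun z => ‖z - p‖⁻¹ * ‖z - q‖⁻¹) S := by
  refine Integrable.mono' (((integrableOn_norm_sub_inv hS p).add
    (integrableOn_norm_sub_inv hS q)).const_mul ‖p - q‖⁻¹) ?_ ?_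
  · exact (by fun_prop : Measurable fun z : ℂ => ‖z - p‖⁻¹ * ‖z - q‖⁻¹).aestronglyMeasurable
  · filter_upwards [ae_restrict_of_ae (ae_ne p), ae_restrict_of_ae (ae_ne q)] with z h1 h2
    rw [Real.norm_of_nonneg (by positivity)]
    refine inv_mul_inv_le (norm_pos_iff.2 (sub_ne_zero.2 h1)) (norm_pos_iff.2 (sub_ne_zero.2 h2))
      (norm_pos_iff.2 (sub_ne_zero.2 hpq)) ?_
    rw [norm_sub_rev z p]
    exact norm_sub_le_norm_sub_add_norm_sub p z q

theorem integrable_of_norm_le {f : ℂ → ℂ} {g : ℂ → ℝ} {S : Set ℂ} (hS : MeasurableSet S)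
    (hf : AEStronglyMeasurable f) (hg : IntegrableOn g S) (h0 : ∀ z ∉ S, f z = 0) {p q : ℂ}
    (h : ∀ z ∈ S, z ≠ p → z ≠ q → ‖f z‖ ≤ g z) : Integrable f := by
  refine ((integrable_indicator_iff hS).2 hg).mono' hf ?_
  filter_upwards [ae_ne p, ae_ne q] with z h1 h2
  by_cases hz : z ∈ S
  · simpa [hz] using h z hz h1 h2
  · simp [hz, h0 z hz]

/-- Cauchy's formula `∫ ∂̄u / (z - q) = -π u(q)`, where `u` may have a bounded singularity at a
point `p ≠ q`. -/
theorem integral_dbarC_div_sub {u : ℂ → ℂ} {p q : ℂ} {S : Set ℂ} (hS : IsCompact S) (hpq : p ≠ q)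
    (hu : ContDiffOn ℝ 1 u {p}ᶜ) (h0 : ∀ z ∉ S, u z = 0) {C : ℝ}
    (hC : ∀ z, z ≠ p → ‖u z‖ ≤ C) (hC' : ∀ z, z ≠ p → ‖dbarC u z‖ ≤ C * ‖z - p‖⁻¹) :
    Integrable (fun z => dbarC u z / (z - q)) ∧
      ∫ z, dbarC u z / (z - q) = -(Real.pi * u q) := by
  have hu2 : ContDiffOn ℝ 1 u {p, q}ᶜ := hu.mono (by
    rw [compl_subset_compl]; simp)
  have hud : ∀ z, z ≠ p → DifferentiableAt ℝ u z := fun z hz =>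
    (hu.contDiffAt (isOpen_compl_singleton.mem_nhds hz)).differentiableAt one_ne_zero
  have hC0 : 0 ≤ C := (norm_nonneg _).trans (hC q hpq.symm)
  have hint : Integrable (fun z => dbarC u z / (z - q)) := by
    refine integrable_of_norm_le (p := p) (q := q) hS.measurableSet ?_
      ((integrableOn_inv_mul_inv hS.measure_lt_top.ne hpq).const_mul C) ?_ ?_
    · exact (aestronglyMeasurable_dbarC hu2).div₀
        (by fun_prop : Measurable fun z : ℂ => z - q).aestronglyMeasurable
    · intro z hz
      rw [dbarC_eq_zero_of_notMem hS.isClosed h0 hz, zero_div]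
    · intro z _ h1 h2
      rw [norm_div, div_eq_mul_inv, ← mul_assoc]
      exact mul_le_mul_of_nonneg_right (hC' z h1) (by positivity)
  refine ⟨hint, ?_⟩
  -- The integral is known to be `π ≠ 0`, which rules out the default value of a divergent integral.
  have hint2 : Integrable fun z => dbarC (cut q 1) z / (z - q) := by
    by_contra h
    have := integral_dbarC_cut_div q one_pos
    rw [integral_undef h] at this
    exact Real.pi_ne_zero (by exact_mod_cast this.symm)
  -- Subtracting a radial bump makes the quotient bounded at `q`.
  set v : ℂ → ℂ := fun z => (u z - u q * (1 - cut q 1 z)) / (z - q) with hv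
  have hd1 : ∀ z, DifferentiableAt ℝ (cut q 1) z := fun z =>
    (contDiff_cut q 1).differentiable (by simp) z
  have hvd : ∀ z, z ≠ p → z ≠ q →
      dbarC v z = dbarC u z / (z - q) + u q * (dbarC (cut q 1) z / (z - q)) := by
    intro z h1 h2
    have hne : z - q ≠ 0 := sub_ne_zero.2 h2
    have hinv : DifferentiableAt ℂ (fun z => (z - q)⁻¹) z := by fun_prop (disch := assumption)
    have e : v = fun z => (u z - u q * (1 - cut q 1 z)) * (z - q)⁻¹ := by
      ext z; simp only [hv, div_eq_mul_inv]
    have d3 : DifferentiableAt ℝ (fun z => 1 - cut q 1 z) z := (differentiableAt_const _).sub (hd1 z)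
    have d4 : DifferentiableAt ℝ (fun z => u z - u q * (1 - cut q 1 z)) z :=
      (hud z h1).sub (d3.const_mul _)
    rw [e, dbarC_mul d4 (hinv.restrictScalars ℝ),
      dbarC_of_differentiableAt hinv, dbarC_sub (hud z h1) (d3.const_mul _), dbarC_const_mul _ d3,
      dbarC_sub (differentiableAt_const _) (hd1 z), dbarC_const]
    ring
  have hvi : Integrable (dbarC v) := by
    refine (hint.add (hint2.const_mul (u q))).congr ?_
    filter_upwards [ae_ne p, ae_ne q] with z h1 h2
    simp [hvd z h1 h2]
  have hvz : ∀ z ∉ S ∪ Metric.closedBall q 2, v z = 0 := by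
    intro z hz
    simp only [mem_union, not_or, Metric.mem_closedBall, Complex.dist_eq, not_le] at hz
    simp [hv, h0 z hz.1, cut_of_ge (p := q) one_pos (by linarith [hz.2] : 2 * 1 ≤ ‖z - q‖)]
  have hvc : ContDiffOn ℝ 1 v {p, q}ᶜ := by
    simp only [hv, div_eq_mul_inv]
    refine (hu2.sub (contDiffOn_const.mul (contDiffOn_const.sub
      ((contDiff_cut q 1).contDiffOn.of_le (by exact_mod_cast le_top))))).mul
      ((contDiffOn_id.sub contDiffOn_const).inv fun z hz => ?_)
    simp only [mem_compl_iff, mem_insert_iff, mem_singleton_iff, not_or] at hz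
    exact sub_ne_zero.2 hz.2
  obtain ⟨B, hB⟩ : ∃ B, ∀ z, z ≠ p → z ≠ q → ‖v z‖ ≤ B := by
    have hO := ((hud q hpq.symm).isBigO_sub).bound
    obtain ⟨c, hc⟩ := hO
    obtain ⟨r, hr, hball⟩ := Metric.eventually_nhds_iff.1 hc
    set r' := min r 1 with hr'
    have hr'0 : 0 < r' := lt_min hr one_pos
    refine ⟨max c ((C + ‖u q‖) / r'), fun z h1 h2 => ?_⟩
    have hne : 0 < ‖z - q‖ := norm_pos_iff.2 (sub_ne_zero.2 h2)
    by_cases hz : ‖z - q‖ < r'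
    · refine le_trans ?_ (le_max_left _ _)
      have hcz : cut q 1 z = 0 := cut_of_le one_pos (hz.le.trans (min_le_right _ _))
      simp only [hv, hcz, sub_zero, mul_one]
      rw [norm_div, div_le_iff₀ hne]
      exact hball (by rw [Complex.dist_eq]; exact hz.trans_le (min_le_left _ _))
    · refine le_trans ?_ (le_max_right _ _)
      simp only [hv]
      rw [norm_div]
      refine div_le_div₀ (by positivity) ?_ hr'0 (not_lt.1 hz)
      refine (norm_sub_le _ _).trans (add_le_add (hC z h1) ?_)
      rw [norm_mul]
      exact mul_le_of_le_one_right (norm_nonneg _) (norm_one_sub_cut_le _ _ _)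
  have hst := integral_dbarC_eq_zero_of_bounded (hS.union (isCompact_closedBall q 2)) hvc hvz hB hvi
  have e : ∫ z, dbarC v z =
      ∫ z, (dbarC u z / (z - q) + u q * (dbarC (cut q 1) z / (z - q))) := by
    refine integral_congr_ae ?_
    filter_upwards [ae_ne p, ae_ne q] with z h1 h2
    rw [hvd z h1 h2]
  rw [e, integral_add hint (hint2.const_mul _), integral_const_mul,
    integral_dbarC_cut_div q one_pos] at hst
  linear_combination hst

/-- Cauchy's formula for a kernel that is holomorphic off `q` with principal part `c / (z - q)`. If
`c = 0`, the point `q` may coincide with the singularity `p` of `u`. -/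
theorem integral_mul_dbarC {u k : ℂ → ℂ} {p q c : ℂ} {O S : Set ℂ} (hO : IsOpen O)
    (hS : IsCompact S) (hSO : S ⊆ O) (hpq : c = 0 ∨ p ≠ q)
    (hu : ContDiffOn ℝ 1 u {p}ᶜ) (h0 : ∀ z ∉ S, u z = 0) {C : ℝ}
    (hC : ∀ z, z ≠ p → ‖u z‖ ≤ C) (hC' : ∀ z, z ≠ p → ‖dbarC u z‖ ≤ C * ‖z - p‖⁻¹)
    (hk : ∀ z ∈ O, z ≠ q → DifferentiableAt ℂ k z) {C₁ : ℝ}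
    (hkC : ∀ z ∈ O, z ≠ q → ‖k z - c / (z - q)‖ ≤ C₁) :
    ∫ z, k z * dbarC u z = -(Real.pi * (c * u q)) := by
  have hu2 : ContDiffOn ℝ 1 u {p, q}ᶜ := hu.mono (by
    rw [compl_subset_compl]; simp)
  have hud : ∀ z, z ≠ p → DifferentiableAt ℝ u z := fun z hz =>
    (hu.contDiffAt (isOpen_compl_singleton.mem_nhds hz)).differentiableAt one_ne_zero
  have hdu0 : ∀ z ∉ S, dbarC u z = 0 := fun z hz => dbarC_eq_zero_of_notMem hS.isClosed h0 hz
  have hOq : IsOpen (O \ {q}) := hO.sdiff isClosed_singleton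
  -- The bounded part `H` of the kernel contributes nothing, by Stokes' theorem for `H u`.
  set H : ℂ → ℂ := fun z => k z - c / (z - q) with hH
  have hHd : DifferentiableOn ℂ H (O \ {q}) := fun z hz => by
    have : z - q ≠ 0 := sub_ne_zero.2 hz.2
    exact ((hk z hz.1 hz.2).sub ((differentiableAt_const c).div
      (differentiableAt_id.sub (differentiableAt_const q)) this)).differentiableWithinAt
  have hHs : ContDiffOn ℝ 1 H (O \ {q}) := (hHd.contDiffOn hOq).restrict_scalars ℝ
  have hw : ContDiffOn ℝ 1 (fun z => H z * u z) {p, q}ᶜ := by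
    refine contDiffOn_compl_of_eq_zero hO hS.isClosed (isClosed_pair p q) hSO ?_
      fun z hz => by simp [h0 z hz]
    refine (hHs.mono fun z hz => ⟨hz.1, ?_⟩).mul (hu.mono fun z hz => ?_)
    · exact fun h => hz.2 (Or.inr h)
    · exact fun h => hz.2 (Or.inl h)
  have hwd : ∀ z, z ≠ p → z ≠ q → dbarC (fun z => H z * u z) z = H z * dbarC u z := by
    intro z h1 h2
    by_cases hz : z ∈ O
    · have hd := (hHd z ⟨hz, h2⟩).differentiableAt (hOq.mem_nhds ⟨hz, h2⟩)
      rw [dbarC_mul (hd.restrictScalars ℝ) (hud z h1), dbarC_of_differentiableAt hd]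
      ring
    · rw [hdu0 z fun h => hz (hSO h), dbarC_eq_zero_of_notMem hS.isClosed (fun z hz => by
        simp [h0 z hz]) fun h => hz (hSO h), mul_zero]
  have hC0 : 0 ≤ C := by
    obtain ⟨z, hz⟩ := (Set.finite_singleton p).infinite_compl.nonempty
    exact (norm_nonneg _).trans (hC z hz)
  have hC1 : ∀ z ∈ O, z ≠ q → 0 ≤ C₁ := fun z h1 h2 => (norm_nonneg _).trans (hkC z h1 h2)
  have hwi : Integrable (dbarC fun z => H z * u z) := by
    refine integrable_of_norm_le (p := p) (q := q) hS.measurableSet (aestronglyMeasurable_dbarC hw)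
      ((integrableOn_norm_sub_inv hS.measure_lt_top.ne p).const_mul (C₁ * C)) ?_ ?_
    · intro z hz
      exact dbarC_eq_zero_of_notMem hS.isClosed (fun z hz => by simp [h0 z hz]) hz
    · intro z hz h1 h2
      rw [hwd z h1 h2, norm_mul, mul_assoc]
      exact mul_le_mul (hkC z (hSO hz) h2) (hC' z h1) (norm_nonneg _) (hC1 z (hSO hz) h2)
  have hst : ∫ z, dbarC (fun z => H z * u z) z = 0 := by
    refine integral_dbarC_eq_zero_of_bounded hS hw (fun z hz => by simp [h0 z hz])
      (C := |C₁| * C) (fun z h1 h2 => ?_) hwi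
    rw [norm_mul]
    by_cases hz : z ∈ S
    · exact mul_le_mul ((hkC z (hSO hz) h2).trans (le_abs_self _)) (hC z h1) (norm_nonneg _)
        (abs_nonneg _)
    · rw [h0 z hz, norm_zero, mul_zero]
      positivity
  have e1 : ∀ᵐ z, dbarC (fun z => H z * u z) z = H z * dbarC u z := by
    filter_upwards [ae_ne p, ae_ne q] with z h1 h2 using hwd z h1 h2
  rw [integral_congr_ae e1] at hst
  have hHi : Integrable fun z => H z * dbarC u z := hwi.congr e1
  rcases hpq with rfl | hpq
  · simpa [hH] using hst
  · obtain ⟨hi, hcauchy⟩ := integral_dbarC_div_sub hS hpq hu h0 hC hC'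
    have e2 : ∀ z, k z * dbarC u z = H z * dbarC u z + c * (dbarC u z / (z - q)) := fun z => by
      rw [hH]; ring
    simp_rw [e2]
    rw [integral_add hHi (hi.const_mul c), hst, integral_const_mul, hcauchy]
    ring

/-! ### Integration by parts against an oscillating factor -/

/-- The oscillating factor `e^{i t Im φ / h}` in the plane. -/
def phase (t h : ℝ) (φ : ℂ → ℂ) (z : ℂ) : ℂ :=
  Complex.exp (Complex.I * (t * (φ z).im / h : ℝ))

/-- The function `1 / conj φ'`. Up to a factor `-2i` it is the reciprocal of `∂̄ (Im φ)`, and it is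
antiholomorphic. -/
def conjDerivInv (φ : ℂ → ℂ) (z : ℂ) : ℂ := (conj (deriv φ z))⁻¹

theorem norm_phase (t h : ℝ) (φ : ℂ → ℂ) (z : ℂ) : ‖phase t h φ z‖ = 1 := by
  rw [phase, mul_comm, Complex.norm_exp_ofReal_mul_I]

theorem contDiffOn_phase (t h : ℝ) {φ : ℂ → ℂ} {O : Set ℂ} (hO : IsOpen O)
    (hφ : DifferentiableOn ℂ φ O) : ContDiffOn ℝ ∞ (phase t h φ) O := by
  have h1 : ContDiffOn ℝ ∞ φ O := (hφ.contDiffOn hO).restrict_scalars ℝ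
  have h2 : ContDiffOn ℝ ∞ (fun z => (φ z).im) O := Complex.imCLM.contDiff.comp_contDiffOn h1
  have h3 : ContDiffOn ℝ ∞ (fun z => ((t * (φ z).im / h : ℝ) : ℂ)) O :=
    Complex.ofRealCLM.contDiff.comp_contDiffOn ((contDiffOn_const.mul h2).div_const h)
  exact (contDiffOn_const.mul h3).cexp

theorem dbarC_im {φ : ℂ → ℂ} {z : ℂ} (hφ : DifferentiableAt ℂ φ z) :
    dbarC (fun z => ((φ z).im : ℂ)) z = Complex.I / 2 * conj (deriv φ z) := by
  have e : (fun z => ((φ z).im : ℂ)) = fun z => (-Complex.I / 2) * (φ z - conj (φ z)) := by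
    ext z
    apply Complex.ext <;> simp
    ring
  have d2 : DifferentiableAt ℝ (fun z => conj (φ z)) z :=
    Complex.conjCLE.differentiableAt.comp z (hφ.restrictScalars ℝ)
  have d1 := hφ.restrictScalars ℝ
  have d3 : DifferentiableAt ℝ (fun z => φ z - conj (φ z)) z := d1.sub d2
  rw [e, dbarC_const_mul _ d3, dbarC_sub d1 d2, dbarC_of_differentiableAt hφ,
    dbarC_conj hφ]
  ring

theorem dbarC_phase (t h : ℝ) {φ : ℂ → ℂ} {z : ℂ} (hφ : DifferentiableAt ℂ φ z) :
    dbarC (phase t h φ) z = -(t / (2 * h)) * conj (deriv φ z) * phase t h φ z := by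
  have d1 : DifferentiableAt ℝ (fun z => ((φ z).im : ℂ)) z :=
    Complex.ofRealCLM.differentiableAt.comp z
      (Complex.imCLM.differentiableAt.comp z (hφ.restrictScalars ℝ))
  have d2 : DifferentiableAt ℝ (fun z => (Complex.I * t / h) * ((φ z).im : ℂ)) z := d1.const_mul _
  have e : phase t h φ = fun z => Complex.exp ((Complex.I * t / h) * ((φ z).im : ℂ)) := by
    ext z
    rw [phase]
    push_cast
    ring_nf
  have hexp := Complex.hasDerivAt_exp ((Complex.I * t / h) * ((φ z).im : ℂ))
  rw [e, dbarC_holomorphic_comp (v := fun z => (Complex.I * t / h) * ((φ z).im : ℂ)) hexp d2,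
    dbarC_const_mul _ d1, dbarC_im hφ]
  linear_combination (t / (2 * h) * conj (deriv φ z) *
    Complex.exp ((Complex.I * t / h) * ((φ z).im : ℂ))) * Complex.I_mul_I

theorem contDiffOn_conjDerivInv {φ : ℂ → ℂ} {O T : Set ℂ} (hO : IsOpen O)
    (hφ : DifferentiableOn ℂ φ O) (hT : T ⊆ O) (h : ∀ z ∈ T, deriv φ z ≠ 0) :
    ContDiffOn ℝ ∞ (conjDerivInv φ) T := by
  have h1 : ContDiffOn ℝ ∞ (deriv φ) O := ((hφ.deriv hO).contDiffOn hO).restrict_scalars ℝ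
  have h2 : ContDiffOn ℝ ∞ (fun z => conj (deriv φ z)) T :=
    Complex.conjCLE.contDiff.comp_contDiffOn (h1.mono hT)
  exact h2.inv fun z hz => by simpa using h z hz

/-- Integration by parts once, away from discs of radius `δ` about the critical point `p` of the
phase and about a singularity `q` of the amplitude `a`. The first integral on the right bounds what
remains on the discs, where only the majorant `α` of `|a|` is used; in the second one, `β` bounds
the derivative of `a / conj φ'` and the loss `1/δ` from the cutoffs, written in terms of the
distances to `p` and `q`. -/
theorem exists_norm_integral_phase_mul_le :
    ∃ C₀ : ℝ, 0 ≤ C₀ ∧ ∀ {O S : Set ℂ} {φ a : ℂ → ℂ} {p q : ℂ} {α β : ℂ → ℝ} {t h δ : ℝ},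
      IsOpen O → IsCompact S → S ⊆ O → DifferentiableOn ℂ φ O → t ≠ 0 → 0 < h → 0 < δ →
      (∀ z ∈ O, z ≠ p → z ≠ q → deriv φ z ≠ 0) → ContDiffOn ℝ 1 a {p, q}ᶜ →
      (∀ z ∉ S, a z = 0) → IntegrableOn α S →
      IntegrableOn β (S \ (Metric.ball p δ ∪ Metric.ball q δ)) →
      (∀ z ∈ S, z ≠ p → z ≠ q → ‖a z‖ ≤ α z) →
      (∀ z ∈ S \ (Metric.ball p δ ∪ Metric.ball q δ),
        ‖dbarC (fun z => a z * conjDerivInv φ z) z‖ ≤ β z) →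
      (∀ z ∈ S \ (Metric.ball p δ ∪ Metric.ball q δ),
        ‖a z * conjDerivInv φ z‖ * (‖z - p‖⁻¹ + ‖z - q‖⁻¹) ≤ β z) →
      ‖∫ z, phase t h φ z * a z‖ ≤
        (∫ z in S ∩ (Metric.ball p (2 * δ) ∪ Metric.ball q (2 * δ)), α z) +
        C₀ * (h / |t|) * ∫ z in S \ (Metric.ball p δ ∪ Metric.ball q δ), β z := by
  obtain ⟨C, hC0, hcut⟩ := exists_norm_dbarC_cut_le
  refine ⟨2 * (1 + C), by positivity, ?_⟩
  intro O S φ a p q α β t h δ hO hS hSO hφ ht hh hδ hφ' ha ha0 hα hβ haα haβ haβ'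
  set b := conjDerivInv φ with hb
  have hφd : ∀ z ∈ O, DifferentiableAt ℂ φ z := fun z hz => hφ.differentiableAt (hO.mem_nhds hz)
  have hEm : ContDiffOn ℝ 1 (phase t h φ) O :=
    (contDiffOn_phase t h hO hφ).of_le (by exact_mod_cast le_top)
  have hOpq : IsOpen (O \ {p, q}) := hO.sdiff (isClosed_pair p q)
  have hab : ContDiffOn ℝ 1 (fun z => a z * b z) {p, q}ᶜ := by
    refine contDiffOn_compl_of_eq_zero hO hS.isClosed (isClosed_pair p q) hSO ?_
      fun z hz => by simp [ha0 z hz]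
    refine (ha.mono fun z hz => hz.2).mul
      ((contDiffOn_conjDerivInv hO hφ sdiff_subset ?_).of_le (by exact_mod_cast le_top))
    intro z hz
    have := hz.2
    simp only [mem_insert_iff, mem_singleton_iff, not_or] at this
    exact hφ' z hz.1 this.1 this.2
  have hw : ContDiff ℝ 1 fun z => cut₂ p q δ z * (a z * b z) := contDiff_cut₂_mul (n := 1) hδ hab
  have hw0 : ∀ z ∉ S, cut₂ p q δ z * (a z * b z) = 0 := fun z hz => by simp [ha0 z hz]
  have hW : ContDiff ℝ 1 fun z => phase t h φ z * (cut₂ p q δ z * (a z * b z)) := by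
    rw [← contDiffOn_univ, ← compl_empty]
    refine contDiffOn_compl_of_eq_zero hO hS.isClosed isClosed_empty hSO ?_
      fun z hz => by simp [ha0 z hz]
    rw [sdiff_empty]
    exact hEm.mul hw.contDiffOn
  have hW0 : ∀ z ∉ S, phase t h φ z * (cut₂ p q δ z * (a z * b z)) = 0 := fun z hz => by
    simp [ha0 z hz]
  have hst := integral_dbarC_eq_zero hW (HasCompactSupport.intro hS hW0)
  have hWi : Integrable (dbarC fun z => phase t h φ z * (cut₂ p q δ z * (a z * b z))) :=
    (continuous_dbarC hW).integrable_of_hasCompactSupport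
      (HasCompactSupport.intro hS fun z hz => dbarC_eq_zero_of_notMem hS.isClosed hW0 hz)
  have hEa : AEStronglyMeasurable fun z => phase t h φ z * a z := by
    refine aestronglyMeasurable_of_contDiffOn (n := 1) (p := p) (q := q) ?_
    refine contDiffOn_compl_of_eq_zero hO hS.isClosed (isClosed_pair p q) hSO ?_
      fun z hz => by simp [ha0 z hz]
    exact (hEm.mono sdiff_subset).mul (ha.mono fun z hz => hz.2)
  have hEai : Integrable fun z => phase t h φ z * a z :=
    integrable_of_norm_le (p := p) (q := q) hS.measurableSet hEa hα (fun z hz => by simp [ha0 z hz])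
      fun z hz h1 h2 => by rw [norm_mul, norm_phase, one_mul]; exact haα z hz h1 h2
  have hEac : Integrable fun z => cut₂ p q δ z * (phase t h φ z * a z) :=
    hEai.bdd_mul (contDiff_cut₂ p q δ).continuous.aestronglyMeasurable
      (ae_of_all _ fun z => norm_cut₂_le _ _ _ _)
  -- the pointwise product rule behind the integration by parts
  have hprod : ∀ z, z ≠ p → z ≠ q →
      cut₂ p q δ z * (phase t h φ z * a z) + (2 * h / t : ℂ) *
        dbarC (fun z => phase t h φ z * (cut₂ p q δ z * (a z * b z))) z =
      (2 * h / t : ℂ) * (phase t h φ z * dbarC (fun z => cut₂ p q δ z * (a z * b z)) z) := by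
    intro z h1 h2
    by_cases hz : z ∈ O
    · have hne : conj (deriv φ z) ≠ 0 := by simpa using hφ' z hz h1 h2
      rw [dbarC_mul ((hEm.contDiffAt (hO.mem_nhds hz)).differentiableAt one_ne_zero)
        (hw.differentiable one_ne_zero z), dbarC_phase t h (hφd z hz), hb]
      simp only [conjDerivInv]
      have ht' : (t : ℂ) ≠ 0 := by exact_mod_cast ht
      have hh' : (h : ℂ) ≠ 0 := by exact_mod_cast hh.ne'
      field_simp
      ring
    · have hz' : z ∉ S := fun h => hz (hSO h)
      rw [dbarC_eq_zero_of_notMem hS.isClosed hW0 hz', dbarC_eq_zero_of_notMem hS.isClosed hw0 hz',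
        ha0 z hz']
      simp
  have hmain : ∫ z, cut₂ p q δ z * (phase t h φ z * a z) = ∫ z, (2 * h / t : ℂ) *
      (phase t h φ z * dbarC (fun z => cut₂ p q δ z * (a z * b z)) z) := by
    calc _ = ∫ z, (cut₂ p q δ z * (phase t h φ z * a z) + (2 * h / t : ℂ) *
        dbarC (fun z => phase t h φ z * (cut₂ p q δ z * (a z * b z))) z) := by
          rw [integral_add hEac (hWi.const_mul _), integral_const_mul, hst]; simp
      _ = _ := by
          refine integral_congr_ae ?_
          filter_upwards [ae_ne p, ae_ne q] with z h1 h2 using hprod z h1 h2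
  have hBm : MeasurableSet (Metric.ball p δ ∪ Metric.ball q δ) :=
    measurableSet_ball.union measurableSet_ball
  have hBm2 : MeasurableSet (Metric.ball p (2 * δ) ∪ Metric.ball q (2 * δ)) :=
    measurableSet_ball.union measurableSet_ball
  -- The part cut off from `p` and `q`, after the integration by parts.
  have hfar : ‖∫ z, cut₂ p q δ z * (phase t h φ z * a z)‖ ≤
      2 * (1 + C) * (h / |t|) * ∫ z in S \ (Metric.ball p δ ∪ Metric.ball q δ), β z := by
    rw [hmain, integral_const_mul, norm_mul]
    have hn : ‖(2 * h / t : ℂ)‖ = 2 * (h / |t|) := by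
      rw [norm_div, norm_mul, Complex.norm_real, Complex.norm_real, Complex.norm_ofNat,
        Real.norm_of_nonneg hh.le, Real.norm_eq_abs]
      ring
    have hle : ‖∫ z, phase t h φ z * dbarC (fun z => cut₂ p q δ z * (a z * b z)) z‖ ≤
        (1 + C) * ∫ z in S \ (Metric.ball p δ ∪ Metric.ball q δ), β z := by
      rw [← integral_const_mul, ← integral_indicator (hS.measurableSet.diff hBm)]
      refine norm_integral_le_of_norm_le ((integrable_indicator_iff
        (hS.measurableSet.diff hBm)).2 (hβ.const_mul _)) (ae_of_all _ fun z => ?_)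
      rw [norm_mul, norm_phase, one_mul]
      by_cases hz : z ∈ S \ (Metric.ball p δ ∪ Metric.ball q δ)
      · have hzp : z ≠ p := fun h => hz.2 (Or.inl (h ▸ Metric.mem_ball_self hδ))
        have hzq : z ≠ q := fun h => hz.2 (Or.inr (h ▸ Metric.mem_ball_self hδ))
        rw [indicator_of_mem hz, dbarC_mul ((contDiff_cut₂ p q δ).differentiable (by simp) z)
          ((hab.contDiffAt ((isClosed_pair p q).isOpen_compl.mem_nhds
            (by simp [hzp, hzq]))).differentiableAt one_ne_zero)]
        have h1 := haβ z hz
        have h2 := haβ' z hz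
        have h3 : ‖dbarC (cut₂ p q δ) z‖ ≤ C * (‖z - p‖⁻¹ + ‖z - q‖⁻¹) := by
          refine (norm_dbarC_cut₂_le p q z δ).trans ?_
          rw [mul_add, ← div_eq_mul_inv, ← div_eq_mul_inv]
          exact add_le_add (hcut p δ z hδ).1 (hcut q δ z hδ).1
        calc _ ≤ ‖dbarC (cut₂ p q δ) z‖ * ‖a z * b z‖ +
              1 * ‖dbarC (fun z => a z * b z) z‖ := by
              refine (norm_add_le _ _).trans ?_
              rw [norm_mul, norm_mul (cut₂ p q δ z)]
              gcongr
              exact norm_cut₂_le _ _ _ _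
          _ ≤ C * (‖z - p‖⁻¹ + ‖z - q‖⁻¹) * ‖a z * b z‖ + 1 * β z := by gcongr
          _ = C * (‖a z * b z‖ * (‖z - p‖⁻¹ + ‖z - q‖⁻¹)) + β z := by ring
          _ ≤ C * β z + β z := by gcongr
          _ = (1 + C) * β z := by ring
      · rw [indicator_of_notMem hz]
        by_cases hzS : z ∈ S
        · have hzB : z ∈ Metric.ball p δ ∪ Metric.ball q δ := by
            by_contra hcon
            exact hz ⟨hzS, hcon⟩
          have : (fun z => cut₂ p q δ z * (a z * b z)) =ᶠ[𝓝 z] fun _ => 0 := by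
            filter_upwards [(Metric.isOpen_ball.union Metric.isOpen_ball).mem_nhds hzB] with x hx
            rw [cut₂_eq_zero hδ hx, zero_mul]
          rw [dbarC_congr this, dbarC_const, norm_zero]
        · rw [dbarC_eq_zero_of_notMem hS.isClosed hw0 hzS, norm_zero]
    rw [hn]
    calc _ ≤ 2 * (h / |t|) * ((1 + C) * ∫ z in S \ (Metric.ball p δ ∪ Metric.ball q δ), β z) := by
          gcongr
      _ = _ := by ring
  -- The part near `p` and `q` is estimated by absolute values.
  have hnear : ‖∫ z, (phase t h φ z * a z - cut₂ p q δ z * (phase t h φ z * a z))‖ ≤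
      ∫ z in S ∩ (Metric.ball p (2 * δ) ∪ Metric.ball q (2 * δ)), α z := by
    rw [← integral_indicator (hS.measurableSet.inter hBm2)]
    refine norm_integral_le_of_norm_le ((integrable_indicator_iff
      (hS.measurableSet.inter hBm2)).2 (hα.mono_set inter_subset_left)) ?_
    filter_upwards [ae_ne p, ae_ne q] with z h1 h2
    by_cases hz : z ∈ S ∩ (Metric.ball p (2 * δ) ∪ Metric.ball q (2 * δ))
    · rw [indicator_of_mem hz, ← one_sub_mul, norm_mul, norm_mul, norm_phase, one_mul]
      exact (mul_le_of_le_one_left (norm_nonneg _) (norm_one_sub_cut₂_le _ _ _ _)).trans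
        (haα z hz.1 h1 h2)
    · rw [indicator_of_notMem hz]
      by_cases hzS : z ∈ S
      · rw [cut₂_eq_one hδ fun hcon => hz ⟨hzS, hcon⟩]
        simp
      · simp [ha0 z hzS]
  rw [integral_sub hEai hEac] at hnear
  calc ‖∫ z, phase t h φ z * a z‖ ≤ _ + _ := norm_le_norm_sub_add _
        (∫ z, cut₂ p q δ z * (phase t h φ z * a z))
    _ ≤ _ := add_le_add hnear hfar

/-! ### Symbol classes at a point of the plane -/

/-- The bounds `|u_i| ≤ C |z - p|^N` on `O \ {p}`, uniformly over a family `u_i`, `i ∈ T`. -/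
def PowerBound {ι : Type*} (T : Set ι) (O : Set ℂ) (p : ℂ) (N : ℤ) (u : ι → ℂ → ℂ) : Prop :=
  ∃ C : ℝ, 0 ≤ C ∧ ∀ i ∈ T, ∀ z ∈ O, z ≠ p → ‖u i z‖ ≤ C * ‖z - p‖ ^ N

/-- Symbol bounds of order `N` at `p` for the first `m` iterated `∂̄`-derivatives, uniform over a
family of functions: `|∂̄^j u_i| ≤ C |z - p|^(N - j)` on `O \ {p}` for `j ≤ m` and `i ∈ T`. Only
`∂̄`-derivatives are recorded since no others occur when one integrates by parts. -/
def SymbolBound {ι : Type*} (T : Set ι) (O : Set ℂ) (p : ℂ) : ℕ → ℤ → (ι → ℂ → ℂ) → Prop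
  | 0, N, u => PowerBound T O p N u
  | m + 1, N, u => PowerBound T O p N u ∧ SymbolBound T O p m (N - 1) fun i => dbarC (u i)

/-- A family of functions, smooth on `O \ {p}`, that satisfies all symbol bounds of order `N`
at `p`. -/
structure IsSymbol {ι : Type*} (T : Set ι) (O : Set ℂ) (p : ℂ) (N : ℤ) (u : ι → ℂ → ℂ) :
    Prop where
  smooth : ∀ i ∈ T, ContDiffOn ℝ ∞ (u i) (O \ {p})
  bound : ∀ m, SymbolBound T O p m N u

section Symbols

variable {ι : Type*} {T : Set ι} {O : Set ℂ} {p : ℂ} {N : ℤ} {u v : ι → ℂ → ℂ}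

theorem SymbolBound.zero_of {m : ℕ} (h : SymbolBound T O p m N u) : SymbolBound T O p 0 N u := by
  cases m with
  | zero => exact h
  | succ m => exact h.1

theorem SymbolBound.pred {m : ℕ} (h : SymbolBound T O p (m + 1) N u) :
    SymbolBound T O p m N u := by
  induction m generalizing N u with
  | zero => exact h.1
  | succ m ih => exact ⟨h.1, ih h.2⟩

theorem SymbolBound.congr (hO : IsOpen O) {m : ℕ} (h : SymbolBound T O p m N u)
    (huv : ∀ i ∈ T, EqOn (u i) (v i) (O \ {p})) : SymbolBound T O p m N v := by
  induction m generalizing N u v with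
  | zero =>
    obtain ⟨C, hC0, hC⟩ := h
    exact ⟨C, hC0, fun i hi z hz hzp => huv i hi ⟨hz, hzp⟩ ▸ hC i hi z hz hzp⟩
  | succ m ih =>
    refine ⟨?_, ih h.2 fun i hi => dbarC_congr_on (hO.sdiff isClosed_singleton) (huv i hi)⟩
    obtain ⟨C, hC0, hC⟩ := h.1
    exact ⟨C, hC0, fun i hi z hz hzp => huv i hi ⟨hz, hzp⟩ ▸ hC i hi z hz hzp⟩

theorem SymbolBound.mono {ι' : Type*} {T' : Set ι'} {O' : Set ℂ} {m : ℕ}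
    (h : SymbolBound T O p m N u) (g : ι' → ι) (hg : ∀ i ∈ T', g i ∈ T) (hO : O' ⊆ O) :
    SymbolBound T' O' p m N fun i => u (g i) := by
  induction m generalizing N u with
  | zero =>
    obtain ⟨C, hC0, hC⟩ := h
    exact ⟨C, hC0, fun i hi z hz hzp => hC _ (hg i hi) z (hO hz) hzp⟩
  | succ m ih =>
    obtain ⟨C, hC0, hC⟩ := h.1
    exact ⟨⟨C, hC0, fun i hi z hz hzp => hC _ (hg i hi) z (hO hz) hzp⟩, ih h.2⟩

theorem IsSymbol.mono {ι' : Type*} {T' : Set ι'} {O' : Set ℂ}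
    (h : IsSymbol T O p N u) (g : ι' → ι) (hg : ∀ i ∈ T', g i ∈ T) (hO : O' ⊆ O) :
    IsSymbol T' O' p N fun i => u (g i) :=
  ⟨fun i hi => (h.smooth _ (hg i hi)).mono (sdiff_subset_sdiff_left hO),
    fun m => (h.bound m).mono g hg hO⟩

theorem IsSymbol.congr (hO : IsOpen O) (h : IsSymbol T O p N u)
    (huv : ∀ i ∈ T, EqOn (u i) (v i) (O \ {p})) : IsSymbol T O p N v :=
  ⟨fun i hi => (h.smooth i hi).congr fun _ hz => (huv i hi hz).symm,
    fun m => (h.bound m).congr hO huv⟩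

theorem IsSymbol.differentiableAt (hO : IsOpen O) (h : IsSymbol T O p N u) {i : ι} (hi : i ∈ T)
    {z : ℂ} (hz : z ∈ O) (hzp : z ≠ p) : DifferentiableAt ℝ (u i) z :=
  ((h.smooth i hi).contDiffAt ((hO.sdiff isClosed_singleton).mem_nhds
    ⟨hz, hzp⟩)).differentiableAt (by simp)

theorem IsSymbol.dbarC (hO : IsOpen O) (h : IsSymbol T O p N u) :
    IsSymbol T O p (N - 1) fun i => RiemannSurface.dbarC (u i) :=
  ⟨fun i hi => (h.smooth i hi).dbarC (hO.sdiff isClosed_singleton), fun m => (h.bound (m + 1)).2⟩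

theorem SymbolBound.add (hO : IsOpen O) {m : ℕ} (hu : SymbolBound T O p m N u)
    (hv : SymbolBound T O p m N v) (hus : ∀ i ∈ T, ContDiffOn ℝ ∞ (u i) (O \ {p}))
    (hvs : ∀ i ∈ T, ContDiffOn ℝ ∞ (v i) (O \ {p})) :
    SymbolBound T O p m N fun i z => u i z + v i z := by
  have h0 : ∀ {N : ℤ} {u v : ι → ℂ → ℂ}, SymbolBound T O p 0 N u → SymbolBound T O p 0 N v →
      SymbolBound T O p 0 N fun i z => u i z + v i z := by
    rintro N u v ⟨C, hC0, hC⟩ ⟨D, hD0, hD⟩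
    refine ⟨C + D, by positivity, fun i hi z hz hzp => ?_⟩
    rw [add_mul]
    exact (norm_add_le _ _).trans (add_le_add (hC i hi z hz hzp) (hD i hi z hz hzp))
  have hO' : IsOpen (O \ {p}) := hO.sdiff isClosed_singleton
  induction m generalizing N u v with
  | zero => exact h0 hu hv
  | succ m ih =>
    refine ⟨h0 hu.1 hv.1, (ih hu.2 hv.2 (fun i hi => (hus i hi).dbarC hO')
      fun i hi => (hvs i hi).dbarC hO').congr hO fun i hi z hz => ?_⟩
    exact (dbarC_add (((hus i hi).contDiffAt (hO'.mem_nhds hz)).differentiableAt (by simp))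
      (((hvs i hi).contDiffAt (hO'.mem_nhds hz)).differentiableAt (by simp))).symm

theorem IsSymbol.add (hO : IsOpen O) (hu : IsSymbol T O p N u) (hv : IsSymbol T O p N v) :
    IsSymbol T O p N fun i z => u i z + v i z :=
  ⟨fun i hi => (hu.smooth i hi).add (hv.smooth i hi),
    fun m => (hu.bound m).add hO (hv.bound m) hu.smooth hv.smooth⟩

theorem SymbolBound.mul (hO : IsOpen O) {m : ℕ} {N' : ℤ} (hu : SymbolBound T O p m N u)
    (hv : SymbolBound T O p m N' v) (hus : ∀ i ∈ T, ContDiffOn ℝ ∞ (u i) (O \ {p}))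
    (hvs : ∀ i ∈ T, ContDiffOn ℝ ∞ (v i) (O \ {p})) :
    SymbolBound T O p m (N + N') fun i z => u i z * v i z := by
  have h0 : ∀ {N N' : ℤ} {u v : ι → ℂ → ℂ}, SymbolBound T O p 0 N u → SymbolBound T O p 0 N' v →
      SymbolBound T O p 0 (N + N') fun i z => u i z * v i z := by
    rintro N N' u v ⟨C, hC0, hC⟩ ⟨D, hD0, hD⟩
    refine ⟨C * D, by positivity, fun i hi z hz hzp => ?_⟩
    rw [zpow_add₀ (norm_ne_zero_iff.2 (sub_ne_zero.2 hzp)), norm_mul, mul_mul_mul_comm]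
    exact mul_le_mul (hC i hi z hz hzp) (hD i hi z hz hzp) (norm_nonneg _) (by positivity)
  have hO' : IsOpen (O \ {p}) := hO.sdiff isClosed_singleton
  induction m generalizing N N' u v with
  | zero => exact h0 hu hv
  | succ m ih =>
    refine ⟨h0 hu.1 hv.1, ?_⟩
    have h1 := ih hu.2 hv.pred (fun i hi => (hus i hi).dbarC hO') hvs
    have h2 := ih hu.pred hv.2 hus (fun i hi => (hvs i hi).dbarC hO')
    rw [show N - 1 + N' = N + N' - 1 by ring] at h1
    rw [show N + (N' - 1) = N + N' - 1 by ring] at h2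
    refine (h1.add hO h2 (fun i hi => ((hus i hi).dbarC hO').mul (hvs i hi))
      fun i hi => (hus i hi).mul ((hvs i hi).dbarC hO')).congr hO fun i hi z hz => ?_
    exact (dbarC_mul (((hus i hi).contDiffAt (hO'.mem_nhds hz)).differentiableAt (by simp))
      (((hvs i hi).contDiffAt (hO'.mem_nhds hz)).differentiableAt (by simp))).symm

theorem IsSymbol.mul (hO : IsOpen O) {N' : ℤ} (hu : IsSymbol T O p N u) (hv : IsSymbol T O p N' v) :
    IsSymbol T O p (N + N') fun i z => u i z * v i z :=
  ⟨fun i hi => (hu.smooth i hi).mul (hv.smooth i hi),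
    fun m => (hu.bound m).mul hO (hv.bound m) hu.smooth hv.smooth⟩

/-- A family whose `∂̄`-derivatives are all bounded is a symbol of every order `N ≤ 0` on a bounded
set: there `|z - p|^(N - j)` is bounded from below. -/
theorem symbolBound_of_iterate_bound {D : ℝ} (hD : ∀ z ∈ O, ‖z - p‖ ≤ D) (hN : N ≤ 0)
    (h : ∀ m : ℕ, ∃ C : ℝ, ∀ i ∈ T, ∀ z ∈ O, ‖dbarC^[m] (u i) z‖ ≤ C) (m : ℕ) :
    SymbolBound T O p m N u := by
  have h0 : ∀ {N : ℤ} {u : ι → ℂ → ℂ}, N ≤ 0 → (∃ C : ℝ, ∀ i ∈ T, ∀ z ∈ O, ‖u i z‖ ≤ C) →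
      SymbolBound T O p 0 N u := by
    rintro N u hN ⟨C, hC⟩
    refine ⟨|C| * |D| ^ (-N), by positivity, fun i hi z hz hzp => ?_⟩
    have hpos : 0 < ‖z - p‖ := norm_pos_iff.2 (sub_ne_zero.2 hzp)
    have h1 : (1 : ℝ) ≤ |D| ^ (-N) * ‖z - p‖ ^ N := by
      rw [← neg_neg N, zpow_neg ‖z - p‖, neg_neg, ← div_eq_mul_inv,
        one_le_div (zpow_pos hpos _)]
      exact zpow_le_zpow_left₀ (by lia) hpos.le ((hD z hz).trans (le_abs_self D))
    calc ‖u i z‖ ≤ |C| * 1 := by rw [mul_one]; exact (hC i hi z hz).trans (le_abs_self C)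
      _ ≤ |C| * (|D| ^ (-N) * ‖z - p‖ ^ N) := by gcongr
      _ = _ := by ring
  induction m generalizing N u with
  | zero => exact h0 hN (h 0)
  | succ m ih => exact ⟨h0 hN (h 0), ih (by lia) fun m => h (m + 1)⟩

end Symbols

section SingleSymbols

variable {O : Set ℂ} {p : ℂ} {N : ℤ} {u v : ℂ → ℂ}

theorem contDiffOn_iterate_dbarC {V : Set ℂ} (hV : IsOpen V) (hu : ContDiffOn ℝ ∞ u V) (m : ℕ) :
    ContDiffOn ℝ ∞ (dbarC^[m] u) V := by
  induction m generalizing u with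
  | zero => exact hu
  | succ m ih => exact ih (hu.dbarC hV)

/-- Smooth functions are symbols of order `0`, and hence of every negative order. -/
theorem isSymbol_of_contDiffOn {V K : Set ℂ} (hV : IsOpen V) (hK : IsCompact K) (hKV : K ⊆ V)
    (hOK : O ⊆ K) (hN : N ≤ 0) (hu : ContDiffOn ℝ ∞ u V) :
    IsSymbol (univ : Set Unit) O p N fun _ => u := by
  refine ⟨fun _ _ => hu.mono (sdiff_subset.trans (hOK.trans hKV)), ?_⟩
  obtain ⟨D, hD⟩ := (hK.isBounded.subset (hOK)).exists_norm_le
  refine symbolBound_of_iterate_bound (D := D + ‖p‖)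
    (fun z hz => (norm_sub_le _ _).trans (add_le_add_left (hD z hz) _)) hN fun m => ?_
  obtain ⟨C, hC⟩ := hK.exists_bound_of_continuousOn
    ((contDiffOn_iterate_dbarC hV hu m).continuousOn.mono hKV)
  exact ⟨C, fun _ _ z hz => hC z (hOK hz)⟩

/-- Symbol bounds near `p` extend to relatively compact sets. -/
theorem SymbolBound.extend {V K : Set ℂ} {m : ℕ} {r : ℝ} (hr : 0 < r) (hV : IsOpen V)
    (hK : IsCompact K) (hKV : K ⊆ V) (hOK : O ⊆ K)
    (h : SymbolBound (univ : Set Unit) (O ∩ Metric.ball p r) p m N fun _ => u)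
    (hu : ContDiffOn ℝ ∞ u (V \ {p})) : SymbolBound (univ : Set Unit) O p m N fun _ => u := by
  have h0 : ∀ {N : ℤ} {u : ℂ → ℂ}, ContDiffOn ℝ ∞ u (V \ {p}) →
      SymbolBound (univ : Set Unit) (O ∩ Metric.ball p r) p 0 N (fun _ => u) →
      SymbolBound (univ : Set Unit) O p 0 N (fun _ => u) := by
    rintro N u hu ⟨C, hC0, hC⟩
    have hcont : ContinuousOn (fun z => ‖u z‖ * ‖z - p‖ ^ (-N)) (K \ Metric.ball p r) := by
      have hsub : K \ Metric.ball p r ⊆ V \ {p} := fun z hz =>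
        ⟨hKV hz.1, fun h => hz.2 (h ▸ Metric.mem_ball_self hr)⟩
      refine (hu.continuousOn.mono hsub).norm.mul (ContinuousOn.zpow₀ (by fun_prop) _ ?_)
      exact fun z hz => Or.inl (norm_ne_zero_iff.2 (sub_ne_zero.2 (hsub hz).2))
    obtain ⟨D, hD⟩ := (hK.diff Metric.isOpen_ball).exists_bound_of_continuousOn hcont
    refine ⟨max C |D|, le_max_of_le_left hC0, fun i hi z hz hzp => ?_⟩
    have hpos : 0 < ‖z - p‖ := norm_pos_iff.2 (sub_ne_zero.2 hzp)
    by_cases hzr : z ∈ Metric.ball p r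
    · exact (hC i hi z ⟨hz, hzr⟩ hzp).trans
        (mul_le_mul_of_nonneg_right (le_max_left _ _) (by positivity))
    · have h1 := hD z ⟨hOK hz, hzr⟩
      rw [Real.norm_of_nonneg (by positivity), zpow_neg, ← div_eq_mul_inv,
        div_le_iff₀ (by positivity)] at h1
      exact h1.trans (mul_le_mul_of_nonneg_right ((le_abs_self D).trans (le_max_right _ _))
        (by positivity))
  induction m generalizing N u with
  | zero => exact h0 hu h
  | succ m ih => exact ⟨h0 hu h.1, ih h.2 (hu.dbarC (hV.sdiff isClosed_singleton))⟩

theorem IsSymbol.extend {V K : Set ℂ} {r : ℝ} (hr : 0 < r) (hV : IsOpen V)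
    (hK : IsCompact K) (hKV : K ⊆ V) (hOK : O ⊆ K)
    (h : IsSymbol (univ : Set Unit) (O ∩ Metric.ball p r) p N fun _ => u)
    (hu : ContDiffOn ℝ ∞ u (V \ {p})) : IsSymbol (univ : Set Unit) O p N fun _ => u :=
  ⟨fun _ _ => hu.mono (sdiff_subset_sdiff_left (hOK.trans hKV)),
    fun m => (h.bound m).extend hr hV hK hKV hOK hu⟩

theorem symbolBound_zero_fun (m : ℕ) : SymbolBound (univ : Set Unit) O p m N fun _ _ => 0 := by
  have h0 : ∀ {N : ℤ}, SymbolBound (univ : Set Unit) O p 0 N fun _ _ => 0 :=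
    ⟨0, le_rfl, fun _ _ _ _ _ => by simp⟩
  induction m generalizing N with
  | zero => exact h0
  | succ m ih =>
    refine ⟨h0, ?_⟩
    have e : (fun _ : Unit => dbarC fun _ => 0) = fun _ _ => 0 := by
      ext _ z; exact dbarC_const 0 z
    rw [e]
    exact ih

theorem SymbolBound.const_mul (hO : IsOpen O) (c : ℂ) {m : ℕ}
    (hb : SymbolBound (univ : Set Unit) O p m N fun _ => u) (hs : ContDiffOn ℝ ∞ u (O \ {p})) :
    SymbolBound (univ : Set Unit) O p m N fun _ z => c * u z := by
  have h0 : ∀ {N : ℤ} {u : ℂ → ℂ}, PowerBound (univ : Set Unit) O p N (fun _ => u) →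
      PowerBound (univ : Set Unit) O p N (fun _ z => c * u z) := by
    rintro N u ⟨C, hC0, hC⟩
    refine ⟨‖c‖ * C, by positivity, fun i hi z hz hzp => ?_⟩
    rw [norm_mul, mul_assoc]
    exact mul_le_mul_of_nonneg_left (hC i hi z hz hzp) (norm_nonneg _)
  have hO' := hO.sdiff (isClosed_singleton (x := p))
  induction m generalizing N u with
  | zero => exact h0 hb
  | succ m ih =>
    refine ⟨h0 hb.1, (ih hb.2 (hs.dbarC hO')).congr hO fun i _ z hz => ?_⟩
    exact (dbarC_const_mul c ((hs.contDiffAt (hO'.mem_nhds hz)).differentiableAt (by simp))).symm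

theorem IsSymbol.const_mul (hO : IsOpen O) (c : ℂ)
    (hu : IsSymbol (univ : Set Unit) O p N fun _ => u) :
    IsSymbol (univ : Set Unit) O p N fun _ z => c * u z :=
  ⟨fun i hi => contDiffOn_const.mul (hu.smooth i hi),
    fun m => (hu.bound m).const_mul hO c (hu.smooth () trivial)⟩

theorem isSymbol_zpow (hO : IsOpen O) (k : ℤ) :
    IsSymbol (univ : Set Unit) O p k fun _ z => (z - p) ^ k := by
  have hd : ∀ z ∈ O \ {p}, DifferentiableAt ℂ (fun z => (z - p) ^ k) z := fun z hz =>
    (differentiableAt_id.sub (differentiableAt_const p)).zpow (Or.inl (sub_ne_zero.2 hz.2))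
  have hO' := hO.sdiff (isClosed_singleton (x := p))
  refine ⟨fun _ _ => ((DifferentiableOn.contDiffOn (fun z hz =>
    (hd z hz).differentiableWithinAt) hO').restrict_scalars ℝ), fun m => ?_⟩
  have h0 : SymbolBound (univ : Set Unit) O p 0 k fun _ z => (z - p) ^ k :=
    ⟨1, zero_le_one, fun _ _ z _ _ => by rw [norm_zpow, one_mul]⟩
  cases m with
  | zero => exact h0
  | succ m =>
    exact ⟨h0, (symbolBound_zero_fun m).congr hO fun _ _ z hz =>
      (dbarC_of_differentiableAt (hd z hz)).symm⟩

theorem isSymbol_conj_zpow (hO : IsOpen O) (k : ℤ) :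
    IsSymbol (univ : Set Unit) O p k fun _ z => (conj (z - p)) ^ k := by
  have hO' := hO.sdiff (isClosed_singleton (x := p))
  have hd : ∀ k : ℤ, ∀ z ∈ O \ {p}, DifferentiableAt ℂ (fun z => (z - p) ^ k) z := fun k z hz =>
    (differentiableAt_id.sub (differentiableAt_const p)).zpow (Or.inl (sub_ne_zero.2 hz.2))
  have e : ∀ k : ℤ, (fun z => (conj (z - p)) ^ k) = fun z => conj ((z - p) ^ k) := fun k => by
    ext z; rw [map_zpow₀]
  have hs : ∀ k : ℤ, ContDiffOn ℝ ∞ (fun z => (conj (z - p)) ^ k) (O \ {p}) := fun k => by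
    rw [e]
    exact Complex.conjCLE.contDiff.comp_contDiffOn ((DifferentiableOn.contDiffOn (fun z hz =>
      (hd k z hz).differentiableWithinAt) hO').restrict_scalars ℝ)
  refine ⟨fun _ _ => hs k, fun m => ?_⟩
  have h0 : ∀ k : ℤ, SymbolBound (univ : Set Unit) O p 0 k fun _ z => (conj (z - p)) ^ k :=
    fun k => ⟨1, zero_le_one, fun _ _ z _ _ => by rw [norm_zpow, one_mul, RCLike.norm_conj]⟩
  induction m generalizing k with
  | zero => exact h0 k
  | succ m ih =>
    refine ⟨h0 k, ((ih (k - 1)).const_mul hO (k : ℂ) (hs _)).congr hO fun _ _ z hz => ?_⟩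
    rw [e k, dbarC_conj (hd k z hz)]
    have hderiv : deriv (fun z => (z - p) ^ k) z = k * (z - p) ^ (k - 1) := by
      have := (hasDerivAt_zpow k (z - p) (Or.inl (sub_ne_zero.2 hz.2))).comp z
        ((hasDerivAt_id z).sub_const p)
      simpa [Function.comp_def] using this.deriv
    rw [hderiv, map_mul, map_zpow₀, map_intCast]

/-- Bounds on all iterated Fréchet derivatives give symbol bounds, on a neighbourhood of `p` that
shrinks with the number of derivatives. -/
theorem exists_symbolBound_of_isBigO {V : Set ℂ} (hV : IsOpen V) (hpV : p ∈ V)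
    (hu : ContDiffOn ℝ ∞ u (V \ {p}))
    (h : ∀ m : ℕ, (fun z => iteratedFDeriv ℝ m u z) =O[𝓝[≠] p] fun z => ‖z - p‖ ^ (N - (m : ℤ)))
    (m : ℕ) : ∃ r > 0, SymbolBound (univ : Set Unit) (Metric.ball p r) p m N fun _ => u := by
  have hV' := hV.sdiff (isClosed_singleton (x := p))
  have h0 : ∀ {N : ℤ} {u : ℂ → ℂ},
      ((fun z => iteratedFDeriv ℝ 0 u z) =O[𝓝[≠] p] fun z => ‖z - p‖ ^ (N - ((0 : ℕ) : ℤ))) →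
      ∃ r > 0, PowerBound (univ : Set Unit) (Metric.ball p r) p N fun _ => u := by
    intro N u h
    obtain ⟨C, hC⟩ := h.bound
    rw [eventually_nhdsWithin_iff, Metric.eventually_nhds_iff] at hC
    obtain ⟨r, hr, hC⟩ := hC
    refine ⟨r, hr, |C|, abs_nonneg _, fun _ _ z hz hzp => ?_⟩
    have := hC hz hzp
    rw [norm_iteratedFDeriv_zero, Real.norm_of_nonneg (by positivity)] at this
    simp only [Nat.cast_zero, sub_zero] at this
    exact this.trans (mul_le_mul_of_nonneg_right (le_abs_self C) (by positivity))
  induction m generalizing N u with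
  | zero => exact h0 (h 0)
  | succ m ih =>
    obtain ⟨r, hr, h1⟩ := h0 (h 0)
    obtain ⟨r', hr', h2⟩ := ih (N := N - 1) (hu.dbarC hV') fun m => by
      refine IsBigO.trans (IsBigO.of_bound ‖dbarForm‖ ?_) ((h (m + 1)).congr_right fun z => by
        push_cast; congr 1; ring)
      filter_upwards [inter_mem (nhdsWithin_le_nhds (hV.mem_nhds hpV)) self_mem_nhdsWithin]
        with z hz
      have e : dbarC u = dbarForm ∘ fderiv ℝ u := funext (dbarC_eq u)
      have hf : ContDiffAt ℝ ∞ (fderiv ℝ u) z :=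
        (hu.fderiv_of_isOpen hV' (m := ∞) (by simp)).contDiffAt (hV'.mem_nhds hz)
      rw [e, dbarForm.iteratedFDeriv_comp_left hf (by exact_mod_cast le_top),
        ← norm_iteratedFDeriv_fderiv]
      exact ContinuousLinearMap.norm_compContinuousMultilinearMap_le _ _
    refine ⟨min r r', lt_min hr hr', ?_, h2.mono id (fun _ _ => trivial)
      (Metric.ball_subset_ball (min_le_right _ _))⟩
    exact SymbolBound.mono (m := 0) h1 id (fun _ _ => trivial)
      (Metric.ball_subset_ball (min_le_left _ _))

/-- A function of degree `N` at `p` is a symbol of order `N` at `p`. -/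
theorem isSymbol_of_hasDegreeAt {V : Set ℂ} {r : ℝ} (hV : IsOpen V)
    (hrV : Metric.closedBall p r ⊆ V) (hr : 0 < r) (hu : ContDiffOn ℝ ∞ u (V \ {p}))
    (h : HasDegreeAt u p N) :
    IsSymbol (univ : Set Unit) (Metric.ball p r) p N fun _ => u := by
  obtain ⟨S, C, hR⟩ := h
  have hpV : p ∈ V := hrV (Metric.mem_closedBall_self hr.le)
  have hterm : ∀ (O : Set ℂ), IsOpen O → ∀ k, IsSymbol (univ : Set Unit) O p N fun _ z =>
      C k * (z - p) ^ k * (conj (z - p)) ^ (N - k) := fun O hO k => by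
    have h1 := ((isSymbol_zpow (p := p) hO k).const_mul hO (C k)).mul hO
      (isSymbol_conj_zpow (p := p) hO (N - k))
    rwa [add_sub_cancel] at h1
  have hsum : ∀ (O : Set ℂ), IsOpen O → IsSymbol (univ : Set Unit) O p N fun _ z =>
      ∑ k ∈ S, C k * (z - p) ^ k * (conj (z - p)) ^ (N - k) := fun O hO => by
    clear hR
    induction S using Finset.cons_induction with
    | empty =>
      simp only [Finset.sum_empty]
      exact ⟨fun _ _ => contDiffOn_const, symbolBound_zero_fun⟩
    | cons k S hk ih =>
      simp only [Finset.sum_cons]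
      exact (hterm O hO k).add hO ih
  set R : ℂ → ℂ := fun z => u z - ∑ k ∈ S, C k * (z - p) ^ k * (conj (z - p)) ^ (N - k) with hRdef
  have hRs : ContDiffOn ℝ ∞ R (V \ {p}) := hu.sub ((hsum V hV).smooth () trivial)
  have hRsym : IsSymbol (univ : Set Unit) (Metric.ball p r) p N fun _ => R := by
    refine ⟨fun _ _ => hRs.mono (sdiff_subset_sdiff_left (Metric.ball_subset_closedBall.trans hrV)),
      fun m => ?_⟩
    obtain ⟨r', hr', hb⟩ := exists_symbolBound_of_isBigO (N := N) hV hpV hRs (fun m => by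
      refine (hR m).trans (IsBigO.of_bound 1 ?_)
      filter_upwards [inter_mem (nhdsWithin_le_nhds (Metric.ball_mem_nhds p one_pos))
        self_mem_nhdsWithin] with z hz
      have hpos : 0 < ‖z - p‖ := norm_pos_iff.2 (sub_ne_zero.2 hz.2)
      have hlt : ‖z - p‖ ≤ 1 := by
        have := hz.1
        rw [Metric.mem_ball, Complex.dist_eq] at this
        exact this.le
      rw [Real.norm_of_nonneg (by positivity), Real.norm_of_nonneg (by positivity), one_mul]
      exact zpow_le_zpow_right_of_le_one₀ hpos hlt (by lia)) m
    exact (hb.mono id (fun _ _ => trivial) inter_subset_right).extend hr' hV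
      (isCompact_closedBall p r) hrV Metric.ball_subset_closedBall hRs
  refine (hRsym.add Metric.isOpen_ball (hsum _ Metric.isOpen_ball)).congr Metric.isOpen_ball
    fun _ _ z _ => ?_
  simp [hRdef]

/-- For a phase whose derivative vanishes to first order at most, at `p`, the function
`1 / conj φ'` is a symbol of order `-1`. -/
theorem isSymbol_conjDerivInv {φ : ℂ → ℂ} {V K : Set ℂ} {c : ℝ} (hc : 0 < c) (hV : IsOpen V)
    (hO : IsOpen O) (hK : IsCompact K) (hKV : K ⊆ V) (hOK : O ⊆ K) (hφ : DifferentiableOn ℂ φ V)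
    (h : ∀ z ∈ O, c * ‖z - p‖ ≤ ‖deriv φ z‖) :
    IsSymbol (univ : Set Unit) O p (-1) fun _ => conjDerivInv φ := by
  have hne : ∀ z ∈ O \ {p}, deriv φ z ≠ 0 := fun z hz h0 => by
    have h1 := h z hz.1
    rw [h0, norm_zero] at h1
    have : 0 < ‖z - p‖ := norm_pos_iff.2 (sub_ne_zero.2 hz.2)
    nlinarith
  have hO' := hO.sdiff (isClosed_singleton (x := p))
  have hOV : O ⊆ V := hOK.trans hKV
  have hs : ContDiffOn ℝ ∞ (conjDerivInv φ) (O \ {p}) :=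
    contDiffOn_conjDerivInv hV hφ (sdiff_subset.trans hOV) hne
  have h2 : DifferentiableOn ℂ (deriv (deriv φ)) V := (hφ.deriv hV).deriv hV
  have hg : IsSymbol (univ : Set Unit) O p 0 fun _ z => -conj (deriv (deriv φ) z) := by
    refine isSymbol_of_contDiffOn hV hK hKV hOK le_rfl ?_
    exact (Complex.conjCLE.contDiff.comp_contDiffOn
      ((h2.contDiffOn hV).restrict_scalars ℝ)).neg
  refine ⟨fun _ _ => hs, fun m => ?_⟩
  have h0 : PowerBound (univ : Set Unit) O p (-1) fun _ => conjDerivInv φ := by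
    refine ⟨c⁻¹, by positivity, fun _ _ z hz hzp => ?_⟩
    have hpos : 0 < ‖z - p‖ := norm_pos_iff.2 (sub_ne_zero.2 hzp)
    change ‖(conj (deriv φ z))⁻¹‖ ≤ _
    rw [norm_inv, RCLike.norm_conj, zpow_neg_one, ← mul_inv]
    exact inv_anti₀ (by positivity) (h z hz)
  -- By `∂̄ (1 / conj φ') = -conj φ'' / (conj φ')²`, the bounds on `m + 1` derivatives follow from
  -- those on `m` derivatives.
  induction m with
  | zero => exact h0
  | succ m ih =>
    have hm := (hg.bound m).mul hO (ih.mul hO ih (fun _ _ => hs) (fun _ _ => hs)) hg.smooth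
      (fun _ _ => hs.mul hs)
    refine ⟨h0, SymbolBound.congr (u := fun _ z => -conj (deriv (deriv φ) z) *
      (conjDerivInv φ z * conjDerivInv φ z)) hO hm fun _ _ z hz => ?_⟩
    have hzV := hV.mem_nhds (hOV hz.1)
    have hd := (hφ.deriv hV).differentiableAt hzV
    have hinv : HasDerivAt (fun w : ℂ => w⁻¹) (-((conj (deriv φ z)) ^ 2)⁻¹) (conj (deriv φ z)) :=
      hasDerivAt_inv (by simpa using hne z hz)
    have hcd : DifferentiableAt ℝ (fun z => conj (deriv φ z)) z :=
      Complex.conjCLE.differentiableAt.comp z (hd.restrictScalars ℝ)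
    have hb : dbarC (conjDerivInv φ) z = _ :=
      dbarC_holomorphic_comp (v := fun z => conj (deriv φ z)) hinv hcd
    rw [hb, dbarC_conj hd]
    simp only [conjDerivInv]
    ring

end SingleSymbols

/-! ### Oscillatory integrals in the plane -/

/-- The standing assumptions on the phase in a chart: `φ` is holomorphic on the open set `O`, it has
no critical point in `O` except possibly a nondegenerate one at `p`, and the amplitudes live in the
compact set `S ⊆ O`. -/
structure IsMorsePhase (O S : Set ℂ) (p : ℂ) (φ : ℂ → ℂ) : Prop where
  isOpen : IsOpen O
  isCompact : IsCompact S
  subset : S ⊆ O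
  holomorphic : DifferentiableOn ℂ φ O
  deriv_ne : ∀ z ∈ O, z ≠ p → deriv φ z ≠ 0
  symbol : IsSymbol (univ : Set Unit) O p (-1) fun _ => conjDerivInv φ

/-- A kernel `k` that is holomorphic on `O` off `q` with a simple pole at `q` at worst. -/
structure IsKernel (O : Set ℂ) (q : ℂ) (B : ℝ) (k : ℂ → ℂ) : Prop where
  holomorphic : ∀ z ∈ O, z ≠ q → DifferentiableAt ℂ k z
  bound : ∀ z ∈ O, z ≠ q → ‖k z‖ ≤ B * ‖z - q‖⁻¹
  nonneg : 0 ≤ B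

section Oscillatory

variable {O S : Set ℂ} {p : ℂ} {φ : ℂ → ℂ}

theorem exists_zpow_le {S : Set ℂ} (hS : IsCompact S) (p : ℂ) {M N : ℤ} (hMN : M ≤ N) :
    ∃ D : ℝ, 0 ≤ D ∧ ∀ z ∈ S, z ≠ p → ‖z - p‖ ^ N ≤ D * ‖z - p‖ ^ M := by
  obtain ⟨R, hR⟩ := hS.isBounded.exists_norm_le
  refine ⟨|R + ‖p‖| ^ (N - M), by positivity, fun z hz hzp => ?_⟩
  have hpos : 0 < ‖z - p‖ := norm_pos_iff.2 (sub_ne_zero.2 hzp)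
  rw [← sub_add_cancel N M, zpow_add₀ hpos.ne']
  rw [sub_add_cancel]
  refine mul_le_mul_of_nonneg_right (zpow_le_zpow_left₀ (by lia) hpos.le ?_) (by positivity)
  exact ((norm_sub_le _ _).trans (add_le_add_left (hR z hz) _)).trans (le_abs_self _)

/-- On a compact set, a symbol of order `N ≥ M` is bounded by a multiple of `|z - p|^M`. -/
theorem SymbolBound.exists_norm_le {ι : Type*} {T : Set ι} {N M : ℤ} {u : ι → ℂ → ℂ} {m : ℕ}
    (hS : IsCompact S) (hSO : S ⊆ O) (h : SymbolBound T O p m N u) (hMN : M ≤ N) :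
    ∃ C : ℝ, 0 ≤ C ∧ ∀ i ∈ T, ∀ z ∈ S, z ≠ p → ‖u i z‖ ≤ C * ‖z - p‖ ^ M := by
  obtain ⟨C, hC0, hC⟩ := h.zero_of
  obtain ⟨D, hD0, hD⟩ := exists_zpow_le hS p hMN
  refine ⟨C * D, by positivity, fun i hi z hz hzp => ?_⟩
  rw [mul_assoc]
  exact (hC i hi z (hSO hz) hzp).trans (mul_le_mul_of_nonneg_left (hD z hz hzp) hC0)

theorem IsMorsePhase.contDiffOn (hφ : IsMorsePhase O S p φ) {n : WithTop ℕ∞} {u : ℂ → ℂ} (q : ℂ)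
    (hu : ContDiffOn ℝ n u (O \ {p, q})) (h0 : ∀ z ∉ S, u z = 0) : ContDiffOn ℝ n u {p, q}ᶜ :=
  contDiffOn_compl_of_eq_zero hφ.isOpen hφ.isCompact.isClosed (isClosed_pair p q) hφ.subset hu h0

theorem IsMorsePhase.integrable (hφ : IsMorsePhase O S p φ) {u : ℂ → ℂ} {C : ℝ}
    (hu : ContDiffOn ℝ ∞ u (O \ {p})) (h0 : ∀ z ∉ S, u z = 0)
    (hC : ∀ z ∈ S, z ≠ p → ‖u z‖ ≤ C * ‖z - p‖ ^ (-1 : ℤ)) : Integrable u := by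
  refine integrable_of_norm_le (p := p) (q := p) hφ.isCompact.measurableSet
    (aestronglyMeasurable_of_contDiffOn (n := ∞) (p := p) (q := p) (hφ.contDiffOn p ?_ h0))
    ((integrableOn_norm_sub_inv hφ.isCompact.measure_lt_top.ne p).const_mul C) h0 ?_
  · simpa using hu
  · intro z hz hzp _
    simpa [zpow_neg_one] using hC z hz hzp

theorem IsMorsePhase.integrable_phase_mul (hφ : IsMorsePhase O S p φ) (t h : ℝ) {u : ℂ → ℂ}
    {C : ℝ} (hu : ContDiffOn ℝ ∞ u (O \ {p})) (h0 : ∀ z ∉ S, u z = 0)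
    (hC : ∀ z ∈ S, z ≠ p → ‖u z‖ ≤ C * ‖z - p‖ ^ (-1 : ℤ)) :
    Integrable fun z => phase t h φ z * u z := by
  refine hφ.integrable (C := C) ?_ (fun z hz => by simp [h0 z hz]) fun z hz hzp => ?_
  · exact ((contDiffOn_phase t h hφ.isOpen hφ.holomorphic).mono sdiff_subset).mul hu
  · rw [norm_mul, norm_phase, one_mul]
    exact hC z hz hzp

/-- One integration by parts trades two orders of the amplitude for a factor `h`. -/
theorem IsMorsePhase.integral_phase_mul_eq (hφ : IsMorsePhase O S p φ) {t h : ℝ} (ht : t ≠ 0)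
    (hh : 0 < h) {u : ℂ → ℂ} {N : ℤ} (hN : 1 ≤ N)
    (hu : IsSymbol (univ : Set Unit) O p N fun _ => u) (h0 : ∀ z ∉ S, u z = 0) :
    ∫ z, phase t h φ z * u z =
      (2 * h / t : ℂ) * ∫ z, phase t h φ z * dbarC (fun z => u z * conjDerivInv φ z) z := by
  have hO := hφ.isOpen
  have hS := hφ.isCompact
  have hub := hu.mul hO hφ.symbol
  have hub' := hub.dbarC hO
  have hus := hu.smooth () trivial
  have hubs := hub.smooth () trivial
  obtain ⟨C₁, hC₁0, hC₁⟩ := (hu.bound 0).exists_norm_le hS hφ.subset (M := -1) (by lia)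
  obtain ⟨C₂, hC₂0, hC₂⟩ := (hub.bound 0).exists_norm_le hS hφ.subset (M := 0) (by lia)
  obtain ⟨C₃, hC₃0, hC₃⟩ := (hub'.bound 0).exists_norm_le hS hφ.subset (M := -1) (by lia)
  have hub0 : ∀ z ∉ S, u z * conjDerivInv φ z = 0 := fun z hz => by simp [h0 z hz]
  have i1 := hφ.integrable_phase_mul t h hus h0 (hC₁ () trivial)
  have i2 := hφ.integrable_phase_mul t h (hub'.smooth () trivial)
    (fun z hz => dbarC_eq_zero_of_notMem hS.isClosed hub0 hz) (hC₃ () trivial)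
  have hE := contDiffOn_phase t h hO hφ.holomorphic
  have ht' : (t : ℂ) ≠ 0 := by exact_mod_cast ht
  have hh' : (h : ℂ) ≠ 0 := by exact_mod_cast hh.ne'
  have hv0 : ∀ z ∉ S, phase t h φ z * (u z * conjDerivInv φ z) = 0 := fun z hz => by
    simp [h0 z hz]
  have hvd : ∀ z, z ≠ p → dbarC (fun z => phase t h φ z * (u z * conjDerivInv φ z)) z =
      phase t h φ z * dbarC (fun z => u z * conjDerivInv φ z) z -
        (t / (2 * h) : ℂ) * (phase t h φ z * u z) := by
    intro z hzp
    by_cases hz : z ∈ O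
    · have hne : conj (deriv φ z) ≠ 0 := by simpa using hφ.deriv_ne z hz hzp
      rw [dbarC_mul ((hE.contDiffAt (hO.mem_nhds hz)).differentiableAt (by simp))
        (hub.differentiableAt hO (mem_univ ()) hz hzp),
        dbarC_phase t h (hφ.holomorphic.differentiableAt (hO.mem_nhds hz))]
      simp only [conjDerivInv]
      field_simp
      ring
    · have hz' : z ∉ S := fun h => hz (hφ.subset h)
      rw [dbarC_eq_zero_of_notMem hS.isClosed hv0 hz', h0 z hz',
        dbarC_eq_zero_of_notMem hS.isClosed hub0 hz']
      simp
  have e : ∀ᵐ z, dbarC (fun z => phase t h φ z * (u z * conjDerivInv φ z)) z =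
      phase t h φ z * dbarC (fun z => u z * conjDerivInv φ z) z -
        (t / (2 * h) : ℂ) * (phase t h φ z * u z) := by
    filter_upwards [ae_ne p] with z hz using hvd z hz
  have hst : ∫ z, dbarC (fun z => phase t h φ z * (u z * conjDerivInv φ z)) z = 0 := by
    refine integral_dbarC_eq_zero_of_bounded (p := p) (q := p) (C := C₂) hS ?_ hv0 ?_
      ((i2.sub (i1.const_mul _)).congr (e.mono fun z hz => hz.symm))
    · refine hφ.contDiffOn p ?_ hv0
      have : ContDiffOn ℝ ∞ (fun z => phase t h φ z * (u z * conjDerivInv φ z)) (O \ {p}) :=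
        (hE.mono sdiff_subset).mul hubs
      simpa using this.of_le (by exact_mod_cast le_top)
    · intro z hzp _
      by_cases hz : z ∈ S
      · rw [norm_mul, norm_phase, one_mul]
        simpa using hC₂ () trivial z hz hzp
      · rw [hv0 z hz, norm_zero]
        exact hC₂0
  rw [integral_congr_ae e, integral_sub i2 (i1.const_mul _), integral_const_mul, sub_eq_zero] at hst
  rw [hst]
  field_simp

theorem volume_real_ball (q : ℂ) {r : ℝ} (hr : 0 ≤ r) :
    volume.real (Metric.ball q r) = Real.pi * r ^ 2 := by
  rw [measureReal_def, Complex.volume_ball]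
  simp [hr]
  ring

/-- The integral of `1 / |z - q|` over the two discs of radius `2 δ` is `O(δ)`, whatever the
position of `q`. -/
theorem setIntegral_inv_balls_le (S : Set ℂ) (hS : MeasurableSet S) (p q x : ℂ) {δ : ℝ}
    (hδ : 0 < δ) :
    ∫ z in S ∩ (Metric.ball p (2 * δ) ∪ Metric.ball q (2 * δ)), ‖z - x‖⁻¹ ≤
      10 * Real.pi * δ := by
  set R := S ∩ (Metric.ball p (2 * δ) ∪ Metric.ball q (2 * δ)) with hR
  have hRm : MeasurableSet R := hS.inter (measurableSet_ball.union measurableSet_ball)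
  have hle := measureReal_union_le (μ := volume) (Metric.ball p (2 * δ)) (Metric.ball q (2 * δ))
  have hfin : volume (Metric.ball p (2 * δ) ∪ Metric.ball q (2 * δ)) ≠ ⊤ :=
    ((measure_union_le _ _).trans_lt
      (ENNReal.add_lt_top.2 ⟨measure_ball_lt_top, measure_ball_lt_top⟩)).ne
  have hRf : volume R ≠ ⊤ := ((measure_mono inter_subset_right).trans_lt hfin.lt_top).ne
  have hRv : volume.real R ≤ 8 * Real.pi * δ ^ 2 := by
    refine (measureReal_mono inter_subset_right hfin).trans (hle.trans ?_)
    rw [volume_real_ball _ (by positivity), volume_real_ball _ (by positivity)]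
    apply le_of_eq; ring
  have hball : IntegrableOn (fun z => ‖z - x‖⁻¹) (Metric.ball x δ) :=
    integrableOn_norm_sub_inv measure_ball_lt_top.ne x
  have hind : Integrable ((Metric.ball x δ).indicator fun z => ‖z - x‖⁻¹) :=
    (integrable_indicator_iff measurableSet_ball).2 hball
  have hc : Integrable (fun _ : ℂ => δ⁻¹) (volume.restrict R) :=
    integrable_const_iff.2 (Or.inr ⟨by simpa using hRf.lt_top⟩)
  calc ∫ z in R, ‖z - x‖⁻¹
      ≤ ∫ z in R, ((Metric.ball x δ).indicator (fun z => ‖z - x‖⁻¹) z + δ⁻¹) := by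
        refine integral_mono (integrableOn_norm_sub_inv hRf x) (hind.integrableOn.add hc)
          fun z => ?_
        by_cases hz : z ∈ Metric.ball x δ
        · simp [hz, hδ.le]
        · simp only [hz, not_false_eq_true, indicator_of_notMem, zero_add]
          rw [Metric.mem_ball, Complex.dist_eq, not_lt] at hz
          exact inv_anti₀ hδ hz
    _ = (∫ z in R, (Metric.ball x δ).indicator (fun z => ‖z - x‖⁻¹) z) + volume.real R * δ⁻¹ := by
        rw [integral_add hind.integrableOn hc]
        simp
    _ ≤ 2 * Real.pi * δ + 8 * Real.pi * δ ^ 2 * δ⁻¹ := by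
        gcongr
        refine (integral_mono_measure Measure.restrict_le_self
          (ae_of_all _ fun z => indicator_nonneg (fun _ _ => by positivity) _) hind).trans ?_
        rw [integral_indicator measurableSet_ball]
        have := setIntegral_ball_rpow (s := 1) (by norm_num) x hδ
        simp only [Real.rpow_neg_one] at this
        rw [this]
        norm_num
    _ = 10 * Real.pi * δ := by field_simp; ring

/-- An amplitude of order `-1` is integrable in the plane, so no cancellation is needed. -/
theorem IsMorsePhase.exists_norm_integral_le_neg_one (hφ : IsMorsePhase O S p φ) (t : ℝ)
    {ι : Type*} {T : Set ι} {u : ι → ℂ → ℂ}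
    (hu : IsSymbol T O p (-1) u) (h0 : ∀ i ∈ T, ∀ z ∉ S, u i z = 0) :
    ∃ C : ℝ, ∀ h : ℝ, 0 < h → ∀ i ∈ T, ‖∫ z, phase t h φ z * u i z‖ ≤ C := by
  obtain ⟨C, hC0, hC⟩ := (hu.bound 0).exists_norm_le hφ.isCompact hφ.subset le_rfl
  refine ⟨∫ z in S, C * ‖z - p‖⁻¹, fun h _ i hi => ?_⟩
  rw [← integral_indicator hφ.isCompact.measurableSet]
  refine norm_integral_le_of_norm_le ((integrable_indicator_iff hφ.isCompact.measurableSet).2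
    ((integrableOn_norm_sub_inv hφ.isCompact.measure_lt_top.ne p).const_mul C)) ?_
  filter_upwards [ae_ne p] with z hzp
  by_cases hz : z ∈ S
  · rw [indicator_of_mem hz, norm_mul, norm_phase, one_mul]
    simpa using hC i hi z hz hzp
  · simp [hz, h0 i hi z hz]

/-- For an amplitude of order `0`, one integration by parts off a disc of radius `δ` leaves the
integral of `h |z - p|^(-2)`, which grows like `h log (1/δ)`: this is the loss of `h^(-ε)`. -/
theorem IsMorsePhase.exists_norm_integral_le_zero (hφ : IsMorsePhase O S p φ) {t : ℝ} (ht : t ≠ 0)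
    {ι : Type*} {T : Set ι} {u : ι → ℂ → ℂ}
    (hu : IsSymbol T O p 0 u) (h0 : ∀ i ∈ T, ∀ z ∉ S, u i z = 0) {ε : ℝ} (hε : 0 < ε)
    (hε1 : ε < 1) :
    ∃ C : ℝ, ∀ h : ℝ, 0 < h → h ≤ 1 → ∀ i ∈ T,
      ‖∫ z, phase t h φ z * u i z‖ ≤ C * h ^ (1 - ε) := by
  have hO := hφ.isOpen
  have hS := hφ.isCompact
  have hb : IsSymbol T O p (-1) fun _ => conjDerivInv φ :=
    hφ.symbol.mono (fun _ => ()) (fun _ _ => trivial) subset_rfl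
  have hub := hu.mul hO hb
  obtain ⟨C₀, hC₀0, hIBP⟩ := exists_norm_integral_phase_mul_le
  obtain ⟨C₁, hC₁0, hC₁⟩ := (hu.bound 0).exists_norm_le hS hφ.subset le_rfl
  obtain ⟨C₂, hC₂0, hC₂⟩ := (hub.bound 0).exists_norm_le hS hφ.subset le_rfl
  obtain ⟨C₃, hC₃0, hC₃⟩ := ((hub.dbarC hO).bound 0).exists_norm_le hS hφ.subset le_rfl
  have hSf : volume S ≠ ⊤ := hS.measure_lt_top.ne
  obtain ⟨J, hJ0, hJ⟩ := exists_setIntegral_rpow_le (s := 2 - 2 * ε) (by linarith) (by linarith) hSf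
  set B := 2 * C₂ + C₃ with hB
  refine ⟨C₁ * (8 * Real.pi) + C₀ * |t|⁻¹ * (B * J), fun h hh hh1 i hi => ?_⟩
  -- The disc of radius `√h` has area `O(h)`. Off the disc, `|z - p|^(-2 ε) ≤ h^(-ε)`, and
  -- `|z - p|^(-(2 - 2 ε))` is integrable.
  set δ := √h with hδdef
  have hδ : 0 < δ := Real.sqrt_pos.2 hh
  have hδ2 : δ ^ 2 = h := Real.sq_sqrt hh.le
  have hδε : δ ^ (-(2 * ε)) = h ^ (-ε) := by
    rw [hδdef, Real.sqrt_eq_rpow, ← Real.rpow_mul hh.le]; congr 1; ring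
  have hu1 : ContDiffOn ℝ 1 (u i) {p, p}ᶜ := by
    refine hφ.contDiffOn p ?_ (h0 i hi)
    simpa using (hu.smooth i hi).of_le (by exact_mod_cast le_top)
  have hx2 : ∀ z ∈ S \ (Metric.ball p δ ∪ Metric.ball p δ),
      z ≠ p ∧ ‖z - p‖ ^ (-2 : ℤ) ≤ h ^ (-ε) * ‖z - p‖ ^ (-(2 - 2 * ε)) := by
    intro z hz
    have hzδ : δ ≤ ‖z - p‖ := by
      have := hz.2
      simp only [union_self, Metric.mem_ball, Complex.dist_eq, not_lt] at this
      exact this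
    have hpos : 0 < ‖z - p‖ := hδ.trans_le hzδ
    refine ⟨fun h => by simp [h] at hpos, ?_⟩
    rw [← hδε, ← Real.rpow_intCast]
    calc ‖z - p‖ ^ (((-2 : ℤ)) : ℝ) = ‖z - p‖ ^ (-(2 * ε)) * ‖z - p‖ ^ (-(2 - 2 * ε)) := by
          rw [← Real.rpow_add hpos]; congr 1; push_cast; ring
      _ ≤ _ := by
          gcongr ?_ * _
          exact Real.rpow_le_rpow_of_nonpos hδ hzδ (by linarith)
  have hβi : IntegrableOn (fun z => B * (h ^ (-ε) * ‖z - p‖ ^ (-(2 - 2 * ε)))) S :=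
    ((integrableOn_rpow (by linarith) (by linarith) hSf p).const_mul _).const_mul _
  have key := hIBP (O := O) (S := S) (φ := φ) (a := u i) (p := p) (q := p) (α := fun _ => C₁)
    (β := fun z => B * (h ^ (-ε) * ‖z - p‖ ^ (-(2 - 2 * ε)))) (t := t) (h := h) (δ := δ)
    hO hS hφ.subset hφ.holomorphic ht hh hδ (fun z hz h1 _ => hφ.deriv_ne z hz h1) hu1 (h0 i hi)
    (integrableOn_const hSf)
    (hβi.mono_set sdiff_subset)
    (fun z hz h1 _ => by simpa using hC₁ i hi z hz h1)
    (fun z hz => by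
      obtain ⟨hzp, h2⟩ := hx2 z hz
      refine (hC₃ i hi z hz.1 hzp).trans ?_
      rw [show (0 + -1 - 1 : ℤ) = -2 by ring]
      exact mul_le_mul (by linarith) h2 (by positivity) (by positivity))
    (fun z hz => by
      obtain ⟨hzp, h2⟩ := hx2 z hz
      have hpos : 0 < ‖z - p‖ := norm_pos_iff.2 (sub_ne_zero.2 hzp)
      have h3 := hC₂ i hi z hz.1 hzp
      calc ‖u i z * conjDerivInv φ z‖ * (‖z - p‖⁻¹ + ‖z - p‖⁻¹)
          ≤ C₂ * ‖z - p‖ ^ (0 + -1 : ℤ) * (‖z - p‖⁻¹ + ‖z - p‖⁻¹) := by gcongr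
        _ = (2 * C₂) * ‖z - p‖ ^ (-2 : ℤ) := by
            rw [zero_add, zpow_neg_one, zpow_neg]
            norm_cast
            field_simp
            ring
        _ ≤ _ := mul_le_mul (by linarith) h2 (by positivity) (by positivity))
  refine key.trans ?_
  have hhε : h ≤ h ^ (1 - ε) := by
    conv_lhs => rw [← Real.rpow_one h]
    exact Real.rpow_le_rpow_of_exponent_ge hh hh1 (by linarith)
  have hI1 : ∫ _ in S ∩ (Metric.ball p (2 * δ) ∪ Metric.ball p (2 * δ)), C₁ ≤
      C₁ * (8 * Real.pi) * h ^ (1 - ε) := by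
    rw [setIntegral_const, smul_eq_mul, union_self]
    have : volume.real (S ∩ Metric.ball p (2 * δ)) ≤ 4 * Real.pi * h := by
      refine (measureReal_mono inter_subset_right measure_ball_lt_top.ne).trans (le_of_eq ?_)
      rw [volume_real_ball _ (by positivity), mul_pow, hδ2]; ring
    calc _ ≤ 4 * Real.pi * h * C₁ := by gcongr
      _ ≤ C₁ * (8 * Real.pi) * h := by
          have : 0 ≤ Real.pi * h * C₁ := by positivity
          nlinarith
      _ ≤ _ := by gcongr
  have hI2 : ∫ z in S \ (Metric.ball p δ ∪ Metric.ball p δ),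
      B * (h ^ (-ε) * ‖z - p‖ ^ (-(2 - 2 * ε))) ≤ B * (h ^ (-ε) * J) := by
    rw [integral_const_mul, integral_const_mul]
    gcongr
    refine (setIntegral_mono_set (integrableOn_rpow (by linarith) (by linarith) hSf p)
      (ae_of_all _ fun z => ?_) (sdiff_subset.eventuallyLE)).trans (hJ p)
    simp only [Pi.zero_apply]
    positivity
  calc _ ≤ C₁ * (8 * Real.pi) * h ^ (1 - ε) + C₀ * (h / |t|) * (B * (h ^ (-ε) * J)) := by gcongr
    _ = _ := by
        rw [sub_eq_add_neg, Real.rpow_add hh, Real.rpow_one]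
        ring

/-- Decay of oscillatory integrals with amplitudes of odd order `2n - 1`: after `n` integrations by
parts the order is `-1`. -/
theorem IsMorsePhase.exists_norm_integral_le_odd (hφ : IsMorsePhase O S p φ) {t : ℝ} (ht : t ≠ 0)
    {ι : Type*} {T : Set ι} (n : ℕ) {u : ι → ℂ → ℂ}
    (hu : IsSymbol T O p (2 * n - 1) u) (h0 : ∀ i ∈ T, ∀ z ∉ S, u i z = 0) :
    ∃ C : ℝ, ∀ h : ℝ, 0 < h → h ≤ 1 → ∀ i ∈ T,
      ‖∫ z, phase t h φ z * u i z‖ ≤ C * h ^ n := by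
  have hb : IsSymbol T O p (-1) fun _ => conjDerivInv φ :=
    hφ.symbol.mono (fun _ => ()) (fun _ _ => trivial) subset_rfl
  induction n generalizing u with
  | zero =>
    obtain ⟨C, hC⟩ := hφ.exists_norm_integral_le_neg_one t (by simpa using hu) h0
    exact ⟨C, fun h hh _ i hi => by simpa using hC h hh i hi⟩
  | succ n ih =>
    have hub := (hu.mul hφ.isOpen hb).dbarC hφ.isOpen
    rw [show (2 * ((n + 1 : ℕ) : ℤ) - 1 + -1 - 1 : ℤ) = 2 * n - 1 by push_cast; ring] at hub
    obtain ⟨C, hC⟩ := ih hub fun i hi z hz =>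
      dbarC_eq_zero_of_notMem hφ.isCompact.isClosed (fun z hz => by simp [h0 i hi z hz]) hz
    refine ⟨2 / |t| * C, fun h hh hh1 i hi => ?_⟩
    rw [hφ.integral_phase_mul_eq ht hh (N := 2 * ((n + 1 : ℕ) : ℤ) - 1) (by lia)
      (hu.mono (fun _ => i) (fun _ _ => hi) subset_rfl) (h0 i hi), norm_mul, norm_div, norm_mul,
      Complex.norm_real, Complex.norm_real, Complex.norm_ofNat, Real.norm_of_nonneg hh.le,
      Real.norm_eq_abs, pow_succ]
    calc _ ≤ 2 * h / |t| * (C * h ^ n) := by gcongr; exact hC h hh hh1 i hi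
      _ = _ := by ring

/-- Decay of oscillatory integrals with amplitudes of even order `2n`: after `n` integrations by
parts the order is `0`. -/
theorem IsMorsePhase.exists_norm_integral_le_even (hφ : IsMorsePhase O S p φ) {t : ℝ} (ht : t ≠ 0)
    {ι : Type*} {T : Set ι} (n : ℕ) {u : ι → ℂ → ℂ}
    (hu : IsSymbol T O p (2 * n) u) (h0 : ∀ i ∈ T, ∀ z ∉ S, u i z = 0) {ε : ℝ} (hε : 0 < ε)
    (hε1 : ε < 1) :
    ∃ C : ℝ, ∀ h : ℝ, 0 < h → h ≤ 1 → ∀ i ∈ T,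
      ‖∫ z, phase t h φ z * u i z‖ ≤ C * h ^ (n + 1 - ε : ℝ) := by
  have hb : IsSymbol T O p (-1) fun _ => conjDerivInv φ :=
    hφ.symbol.mono (fun _ => ()) (fun _ _ => trivial) subset_rfl
  induction n generalizing u with
  | zero =>
    obtain ⟨C, hC⟩ := hφ.exists_norm_integral_le_zero ht (by simpa using hu) h0 hε hε1
    exact ⟨C, fun h hh hh1 i hi => by simpa using hC h hh hh1 i hi⟩
  | succ n ih =>
    have hub := (hu.mul hφ.isOpen hb).dbarC hφ.isOpen
    rw [show (2 * ((n + 1 : ℕ) : ℤ) + -1 - 1 : ℤ) = 2 * n by push_cast; ring] at hub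
    obtain ⟨C, hC⟩ := ih hub fun i hi z hz =>
      dbarC_eq_zero_of_notMem hφ.isCompact.isClosed (fun z hz => by simp [h0 i hi z hz]) hz
    refine ⟨2 / |t| * C, fun h hh hh1 i hi => ?_⟩
    rw [hφ.integral_phase_mul_eq ht hh (N := 2 * ((n + 1 : ℕ) : ℤ)) (by lia)
      (hu.mono (fun _ => i) (fun _ _ => hi) subset_rfl) (h0 i hi), norm_mul, norm_div, norm_mul,
      Complex.norm_real, Complex.norm_real, Complex.norm_ofNat, Real.norm_of_nonneg hh.le,
      Real.norm_eq_abs, show (((n + 1 : ℕ) : ℝ) + 1 - ε) = (n + 1 - ε) + 1 by push_cast; ring,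
      Real.rpow_add hh, Real.rpow_one]
    calc _ ≤ 2 * h / |t| * (C * h ^ (n + 1 - ε : ℝ)) := by gcongr; exact hC h hh hh1 i hi
      _ = _ := by ring

end Oscillatory

/-! ### Oscillatory integrals against a Cauchy kernel -/

section KernelEstimates

variable {O S : Set ℂ} {p : ℂ} {φ : ℂ → ℂ}

theorem inv_pow_eq_zpow (x : ℝ) (n : ℕ) : x ^ (-(n : ℤ)) = x⁻¹ ^ n := by
  rw [zpow_neg, zpow_natCast, inv_pow]

theorem IsMorsePhase.contDiffOn_kernel_mul (hφ : IsMorsePhase O S p φ) {q : ℂ} {B : ℝ}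
    {k G : ℂ → ℂ} (hk : IsKernel O q B k) (hG : ContDiffOn ℝ ∞ G (O \ {p}))
    (h0 : ∀ z ∉ S, G z = 0) : ContDiffOn ℝ 1 (fun z => k z * G z) {p, q}ᶜ := by
  refine hφ.contDiffOn q ?_ fun z hz => by simp [h0 z hz]
  have hkd : DifferentiableOn ℂ k (O \ {q}) := fun z hz =>
    (hk.holomorphic z hz.1 hz.2).differentiableWithinAt
  have hks : ContDiffOn ℝ 1 k (O \ {q}) :=
    (hkd.contDiffOn (hφ.isOpen.sdiff isClosed_singleton)).restrict_scalars ℝ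
  refine (hks.mono fun z hz => ⟨hz.1, fun h => hz.2 (Or.inr h)⟩).mul
    ((hG.of_le (by exact_mod_cast le_top)).mono fun z hz => ⟨hz.1, fun h => hz.2 (Or.inl h)⟩)

theorem IsMorsePhase.integrable_kernel_mul (hφ : IsMorsePhase O S p φ) {q : ℂ} {B C : ℝ}
    {k G : ℂ → ℂ} (hk : IsKernel O q B k) (hpq : p ≠ q) (hG : ContDiffOn ℝ ∞ G (O \ {p}))
    (h0 : ∀ z ∉ S, G z = 0) (hC : ∀ z ∈ S, z ≠ p → ‖G z‖ ≤ C * ‖z - p‖⁻¹) :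
    Integrable fun z => k z * G z := by
  refine integrable_of_norm_le (p := p) (q := q) hφ.isCompact.measurableSet
    (aestronglyMeasurable_of_contDiffOn (hφ.contDiffOn_kernel_mul hk hG h0))
    ((integrableOn_inv_mul_inv hφ.isCompact.measure_lt_top.ne hpq).const_mul (B * C))
    (fun z hz => by simp [h0 z hz]) fun z hz h1 h2 => ?_
  rw [norm_mul]
  calc _ ≤ (B * ‖z - q‖⁻¹) * (C * ‖z - p‖⁻¹) :=
        mul_le_mul (hk.bound z (hφ.subset hz) h2) (hC z hz h1) (norm_nonneg _)
          (mul_nonneg hk.nonneg (by positivity))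
    _ = _ := by ring

/-- One integration by parts in an integral against a kernel with pole `q`, off the discs of radius
`δ` about `p` and `q`. Since the kernel is holomorphic, it is not differentiated. The constant `C`
does not depend on the kernel, nor on the position of its pole. -/
theorem IsMorsePhase.exists_norm_integral_kernel_le (hφ : IsMorsePhase O S p φ) {t : ℝ}
    (ht : t ≠ 0) (n : ℕ) {G : ℂ → ℂ}
    (hG : IsSymbol (univ : Set Unit) O p (-n) fun _ => G) (h0 : ∀ z ∉ S, G z = 0) :
    ∃ C : ℝ, 0 ≤ C ∧ (∀ z ∈ S, z ≠ p → ‖G z‖ ≤ C * ‖z - p‖⁻¹ ^ n) ∧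
      ∀ {k : ℂ → ℂ} {q : ℂ} {B : ℝ}, IsKernel O q B k → ∀ {α β : ℂ → ℝ} {h δ : ℝ}, 0 < h → 0 < δ →
      IntegrableOn α S → IntegrableOn β (S \ (Metric.ball p δ ∪ Metric.ball q δ)) →
      (∀ z ∈ S, z ≠ p → z ≠ q → ‖z - p‖⁻¹ ^ n * ‖z - q‖⁻¹ ≤ α z) →
      (∀ z ∈ S \ (Metric.ball p δ ∪ Metric.ball q δ),
        ‖z - p‖⁻¹ ^ (n + 1) * ‖z - q‖⁻¹ * (‖z - p‖⁻¹ + ‖z - q‖⁻¹) ≤ β z) →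
      ‖∫ z, phase t h φ z * (k z * G z)‖ ≤
        C * B * ((∫ z in S ∩ (Metric.ball p (2 * δ) ∪ Metric.ball q (2 * δ)), α z) +
          h * ∫ z in S \ (Metric.ball p δ ∪ Metric.ball q δ), β z) := by
  have hO := hφ.isOpen
  have hS := hφ.isCompact
  obtain ⟨C₀, hC₀0, hIBP⟩ := exists_norm_integral_phase_mul_le
  have hGb := hG.mul hO hφ.symbol
  obtain ⟨C₁, hC₁0, hC₁⟩ := (hG.bound 0).exists_norm_le hS hφ.subset le_rfl
  obtain ⟨C₂, hC₂0, hC₂⟩ := (hGb.bound 0).exists_norm_le hS hφ.subset le_rfl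
  obtain ⟨C₃, hC₃0, hC₃⟩ := ((hGb.dbarC hO).bound 0).exists_norm_le hS hφ.subset le_rfl
  set D := C₂ + C₃ with hD
  have hD0 : 0 ≤ D := add_nonneg hC₂0 hC₃0
  refine ⟨max C₁ (C₀ * |t|⁻¹ * D), le_max_of_le_left hC₁0, fun z hz hzp => ?_, ?_⟩
  · refine (hC₁ () trivial z hz hzp).trans ?_
    rw [inv_pow_eq_zpow]
    exact mul_le_mul_of_nonneg_right (le_max_left _ _) (by positivity)
  intro k q B hk α β h δ hh hδ hα hβ hαle hβle
  have hB := hk.nonneg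
  have hne : ∀ z ∈ S \ (Metric.ball p δ ∪ Metric.ball q δ), z ∈ O ∧ z ≠ p ∧ z ≠ q := fun z hz =>
    ⟨hφ.subset hz.1, fun h => hz.2 (Or.inl (h ▸ Metric.mem_ball_self hδ)),
      fun h => hz.2 (Or.inr (h ▸ Metric.mem_ball_self hδ))⟩
  have key := hIBP (O := O) (S := S) (φ := φ) (a := fun z => k z * G z) (p := p) (q := q)
    (α := fun z => C₁ * B * α z) (β := fun z => D * B * β z) (t := t) (h := h) (δ := δ)
    hO hS hφ.subset hφ.holomorphic ht hh hδ (fun z hz h1 _ => hφ.deriv_ne z hz h1)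
    (hφ.contDiffOn_kernel_mul hk (hG.smooth () trivial) h0) (fun z hz => by simp [h0 z hz])
    (hα.const_mul _) (hβ.const_mul _) ?_ ?_ ?_
  · refine key.trans ?_
    rw [integral_const_mul, integral_const_mul]
    have hI1 : 0 ≤ ∫ z in S ∩ (Metric.ball p (2 * δ) ∪ Metric.ball q (2 * δ)), α z := by
      refine integral_nonneg_of_ae ?_
      filter_upwards [ae_restrict_of_ae (ae_ne p), ae_restrict_of_ae (ae_ne q), ae_restrict_mem
        (hS.measurableSet.inter (measurableSet_ball.union measurableSet_ball))] with z h1 h2 hz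
      exact le_trans (by positivity) (hαle z hz.1 h1 h2)
    have hI2 : 0 ≤ ∫ z in S \ (Metric.ball p δ ∪ Metric.ball q δ), β z :=
      setIntegral_nonneg (hS.measurableSet.diff (measurableSet_ball.union measurableSet_ball))
        fun z hz => le_trans (by positivity) (hβle z hz)
    calc _ = C₁ * (B * ∫ z in S ∩ (Metric.ball p (2 * δ) ∪ Metric.ball q (2 * δ)), α z) +
          (C₀ * |t|⁻¹ * D) * (B * (h * ∫ z in S \ (Metric.ball p δ ∪ Metric.ball q δ), β z)) := by
          ring
      _ ≤ max C₁ (C₀ * |t|⁻¹ * D) *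
            (B * ∫ z in S ∩ (Metric.ball p (2 * δ) ∪ Metric.ball q (2 * δ)), α z) +
          max C₁ (C₀ * |t|⁻¹ * D) *
            (B * (h * ∫ z in S \ (Metric.ball p δ ∪ Metric.ball q δ), β z)) := by
          gcongr
          · exact le_max_left _ _
          · exact le_max_right _ _
      _ = _ := by ring
  · intro z hz h1 h2
    have e1 := hC₁ () trivial z hz h1
    rw [inv_pow_eq_zpow] at e1
    rw [norm_mul]
    calc _ ≤ (B * ‖z - q‖⁻¹) * (C₁ * ‖z - p‖⁻¹ ^ n) :=
          mul_le_mul (hk.bound z (hφ.subset hz) h2) e1 (norm_nonneg _) (by positivity)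
      _ = C₁ * B * (‖z - p‖⁻¹ ^ n * ‖z - q‖⁻¹) := by ring
      _ ≤ _ := mul_le_mul_of_nonneg_left (hαle z hz h1 h2) (by positivity)
  · intro z hz
    obtain ⟨hzO, hzp, hzq⟩ := hne z hz
    have e : (fun z => k z * G z * conjDerivInv φ z) = fun z => k z * (G z * conjDerivInv φ z) := by
      ext z; ring
    rw [e, dbarC_mul ((hk.holomorphic z hzO hzq).restrictScalars ℝ)
      (hGb.differentiableAt hO (mem_univ ()) hzO hzp),
      dbarC_of_differentiableAt (hk.holomorphic z hzO hzq), zero_mul, zero_add, norm_mul]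
    have e3 := hC₃ () trivial z hz.1 hzp
    rw [show (-(n : ℤ) + -1 - 1) = -((n + 2 : ℕ) : ℤ) by push_cast; ring, inv_pow_eq_zpow] at e3
    have hx : 0 ≤ ‖z - p‖⁻¹ := by positivity
    have hy : 0 ≤ ‖z - q‖⁻¹ := by positivity
    calc _ ≤ (B * ‖z - q‖⁻¹) * (C₃ * ‖z - p‖⁻¹ ^ (n + 2)) :=
          mul_le_mul (hk.bound z hzO hzq) e3 (norm_nonneg _) (by positivity)
      _ = C₃ * B * (‖z - p‖⁻¹ ^ (n + 1) * ‖z - q‖⁻¹ * ‖z - p‖⁻¹) := by ring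
      _ ≤ D * B * (‖z - p‖⁻¹ ^ (n + 1) * ‖z - q‖⁻¹ * (‖z - p‖⁻¹ + ‖z - q‖⁻¹)) := by
          gcongr
          · linarith
          · linarith
      _ ≤ _ := mul_le_mul_of_nonneg_left (hβle z hz) (by positivity)
  · intro z hz
    obtain ⟨hzO, hzp, hzq⟩ := hne z hz
    have e2 := hC₂ () trivial z hz.1 hzp
    rw [show (-(n : ℤ) + -1) = -((n + 1 : ℕ) : ℤ) by push_cast; ring, inv_pow_eq_zpow] at e2
    rw [mul_assoc (k z), norm_mul]
    calc _ ≤ (B * ‖z - q‖⁻¹) * (C₂ * ‖z - p‖⁻¹ ^ (n + 1)) * (‖z - p‖⁻¹ + ‖z - q‖⁻¹) := by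
          refine mul_le_mul_of_nonneg_right ?_ (by positivity)
          exact mul_le_mul (hk.bound z hzO hzq) e2 (norm_nonneg _) (by positivity)
      _ = C₂ * B * (‖z - p‖⁻¹ ^ (n + 1) * ‖z - q‖⁻¹ * (‖z - p‖⁻¹ + ‖z - q‖⁻¹)) := by ring
      _ ≤ D * B * (‖z - p‖⁻¹ ^ (n + 1) * ‖z - q‖⁻¹ * (‖z - p‖⁻¹ + ‖z - q‖⁻¹)) := by
          gcongr
          linarith
      _ ≤ _ := mul_le_mul_of_nonneg_left (hβle z hz) (by positivity)

theorem sub_inv_le_of_notMem_ball {p z : ℂ} {δ : ℝ} (hδ : 0 < δ) (hz : z ∉ Metric.ball p δ) :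
    ‖z - p‖⁻¹ ≤ δ⁻¹ := by
  rw [Metric.mem_ball, Complex.dist_eq, not_lt] at hz
  exact inv_anti₀ hδ hz

theorem integrableOn_inv_cube (x : ℂ) {δ : ℝ} (hδ : 0 < δ) :
    IntegrableOn (fun z => ‖z - x‖⁻¹ ^ 3) (Metric.ball x δ)ᶜ ∧
      ∫ z in (Metric.ball x δ)ᶜ, ‖z - x‖⁻¹ ^ 3 = 2 * Real.pi / δ := by
  have e : (fun z : ℂ => ‖z - x‖⁻¹ ^ 3) = fun z => ‖z - x‖ ^ (-3 : ℝ) := by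
    ext z
    rw [Real.rpow_neg (norm_nonneg _), inv_pow]
    norm_cast
  rw [e]
  exact ⟨integrableOn_compl_ball_rpow_three x hδ, setIntegral_compl_ball_rpow_three x hδ⟩

/-- For an amplitude of order `0` the oscillatory integral is `O(√h)`, uniformly in the position
of the pole of the kernel. -/
theorem IsMorsePhase.exists_norm_integral_kernel_le_sqrt (hφ : IsMorsePhase O S p φ) {t : ℝ}
    (ht : t ≠ 0) {G : ℂ → ℂ} (hG : IsSymbol (univ : Set Unit) O p 0 fun _ => G)
    (h0 : ∀ z ∉ S, G z = 0) :
    ∃ C : ℝ, ∀ {k : ℂ → ℂ} {q : ℂ} {B : ℝ}, IsKernel O q B k → ∀ h : ℝ, 0 < h →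
      ‖∫ z, phase t h φ z * (k z * G z)‖ ≤ C * B * √h := by
  obtain ⟨C, hC0, -, hC⟩ := hφ.exists_norm_integral_kernel_le ht 0 (by simpa using hG) h0
  refine ⟨C * (14 * Real.pi), fun {k q B} hk h hh => ?_⟩
  have hB := hk.nonneg
  -- The discs contribute `O(δ)` and their complement `O(h/δ)`, which agree for `δ = √h`.
  set δ := √h with hδdef
  have hδ : 0 < δ := Real.sqrt_pos.2 hh
  have hδ2 : δ ^ 2 = h := Real.sq_sqrt hh.le
  have hSf : volume S ≠ ⊤ := hφ.isCompact.measure_lt_top.ne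
  have hSm := hφ.isCompact.measurableSet
  obtain ⟨ip, Ip⟩ := integrableOn_inv_cube p hδ
  obtain ⟨iq, Iq⟩ := integrableOn_inv_cube q hδ
  have sp : S \ (Metric.ball p δ ∪ Metric.ball q δ) ⊆ (Metric.ball p δ)ᶜ := fun z hz h =>
    hz.2 (Or.inl h)
  have sq : S \ (Metric.ball p δ ∪ Metric.ball q δ) ⊆ (Metric.ball q δ)ᶜ := fun z hz h =>
    hz.2 (Or.inr h)
  have key := hC hk (α := fun z => ‖z - q‖⁻¹) (β := fun z => ‖z - p‖⁻¹ ^ 3 + ‖z - q‖⁻¹ ^ 3) hh hδ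
    (integrableOn_norm_sub_inv hSf q) ((ip.mono_set sp).add (iq.mono_set sq))
    (fun z _ _ _ => by simp)
    (fun z _ => by
      have hx : 0 ≤ ‖z - p‖⁻¹ := by positivity
      have hy : 0 ≤ ‖z - q‖⁻¹ := by positivity
      nlinarith [mul_nonneg (sq_nonneg (‖z - p‖⁻¹ - ‖z - q‖⁻¹)) (add_nonneg hx hy)])
  refine key.trans ?_
  have hI : ∫ z in S \ (Metric.ball p δ ∪ Metric.ball q δ), (‖z - p‖⁻¹ ^ 3 + ‖z - q‖⁻¹ ^ 3) ≤
      4 * Real.pi / δ := by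
    rw [integral_add (ip.mono_set sp) (iq.mono_set sq)]
    have h1 := setIntegral_mono_set ip (ae_of_all _ fun z => by positivity) sp.eventuallyLE
    have h2 := setIntegral_mono_set iq (ae_of_all _ fun z => by positivity) sq.eventuallyLE
    calc _ ≤ 2 * Real.pi / δ + 2 * Real.pi / δ := add_le_add (h1.trans_eq Ip) (h2.trans_eq Iq)
      _ = _ := by ring
  calc _ ≤ C * B * (10 * Real.pi * δ + h * (4 * Real.pi / δ)) := by
        gcongr
        exact setIntegral_inv_balls_le S hSm p q q hδ
    _ = _ := by
        rw [← hδ2]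
        field_simp
        ring

/-- For an amplitude of order `0` and a pole away from the critical point, the oscillatory integral
is `o(√h)`. -/
theorem IsMorsePhase.exists_norm_integral_kernel_le_rpow (hφ : IsMorsePhase O S p φ) {t : ℝ}
    (ht : t ≠ 0) {G : ℂ → ℂ} (hG : IsSymbol (univ : Set Unit) O p 0 fun _ => G)
    (h0 : ∀ z ∉ S, G z = 0) {k : ℂ → ℂ} {q : ℂ} {B : ℝ} (hk : IsKernel O q B k) (hpq : p ≠ q) :
    ∃ C : ℝ, ∀ h : ℝ, 0 < h → h ≤ 1 →
      ‖∫ z, phase t h φ z * (k z * G z)‖ ≤ C * h ^ (5 / 8 : ℝ) := by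
  obtain ⟨C, hC0, -, hC⟩ := hφ.exists_norm_integral_kernel_le ht 0 (by simpa using hG) h0
  have hB := hk.nonneg
  have hSf : volume S ≠ ⊤ := hφ.isCompact.measure_lt_top.ne
  have hSm := hφ.isCompact.measurableSet
  obtain ⟨J, hJ0, hJ⟩ := exists_setIntegral_rpow_le (s := 3 / 2) (by norm_num) (by norm_num) hSf
  set d := ‖p - q‖ with hd
  have hd0 : 0 < d := norm_pos_iff.2 (sub_ne_zero.2 hpq)
  refine ⟨C * B * (10 * Real.pi + 4 * d⁻¹ * J), fun h hh hh1 => ?_⟩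
  -- The discs contribute `O(δ)`. Since `p ≠ q`, the integrand on their complement is at most
  -- quadratically singular, which gives `O(h δ^(-1/2))` there. Every power `δ = h^a` with
  -- `1/2 < a < 1` makes both `o(√h)`.
  set δ := h ^ (3 / 4 : ℝ) with hδdef
  have hδ : 0 < δ := Real.rpow_pos_of_pos hh _
  have hδ' : δ ^ (-(1 / 2) : ℝ) = h ^ (-(3 / 8) : ℝ) := by
    rw [hδdef, ← Real.rpow_mul hh.le]; norm_num
  have hint : ∀ x, IntegrableOn (fun z => ‖z - x‖ ^ (-(3 / 2) : ℝ)) S := fun x =>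
    integrableOn_rpow (by norm_num) (by norm_num) hSf x
  have hsq : ∀ (x z : ℂ), z ∉ Metric.ball x δ →
      ‖z - x‖⁻¹ ^ 2 ≤ h ^ (-(3 / 8) : ℝ) * ‖z - x‖ ^ (-(3 / 2) : ℝ) := by
    intro x z hz
    rw [Metric.mem_ball, Complex.dist_eq, not_lt] at hz
    have hpos : 0 < ‖z - x‖ := hδ.trans_le hz
    rw [← hδ']
    calc ‖z - x‖⁻¹ ^ 2 = ‖z - x‖ ^ (-(1 / 2) : ℝ) * ‖z - x‖ ^ (-(3 / 2) : ℝ) := by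
          rw [← Real.rpow_add hpos, inv_pow]
          norm_num [Real.rpow_neg hpos.le]
      _ ≤ _ := by
          gcongr ?_ * _
          exact Real.rpow_le_rpow_of_nonpos hδ hz (by norm_num)
  have hβi : IntegrableOn (fun z => 2 * d⁻¹ * h ^ (-(3 / 8) : ℝ) *
      (‖z - p‖ ^ (-(3 / 2) : ℝ) + ‖z - q‖ ^ (-(3 / 2) : ℝ))) S :=
    ((hint p).add (hint q)).const_mul _
  have key := hC hk (α := fun z => ‖z - q‖⁻¹) (β := fun z => 2 * d⁻¹ * h ^ (-(3 / 8) : ℝ) *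
      (‖z - p‖ ^ (-(3 / 2) : ℝ) + ‖z - q‖ ^ (-(3 / 2) : ℝ))) hh hδ
    (integrableOn_norm_sub_inv hSf q) (hβi.mono_set sdiff_subset)
    (fun z _ _ _ => by simp)
    (fun z hz => by
      have hzp : z ∉ Metric.ball p δ := fun h => hz.2 (Or.inl h)
      have hzq : z ∉ Metric.ball q δ := fun h => hz.2 (Or.inr h)
      have hp0 : 0 < ‖z - p‖ := by
        rw [Metric.mem_ball, Complex.dist_eq, not_lt] at hzp; exact hδ.trans_le hzp
      have hq0 : 0 < ‖z - q‖ := by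
        rw [Metric.mem_ball, Complex.dist_eq, not_lt] at hzq; exact hδ.trans_le hzq
      have h1 := inv_mul_inv_le hp0 hq0 hd0 (by
        rw [hd, norm_sub_rev z p]; exact norm_sub_le_norm_sub_add_norm_sub p z q)
      have hx : 0 < ‖z - p‖⁻¹ := by positivity
      have hy : 0 < ‖z - q‖⁻¹ := by positivity
      calc ‖z - p‖⁻¹ ^ (0 + 1) * ‖z - q‖⁻¹ * (‖z - p‖⁻¹ + ‖z - q‖⁻¹)
          ≤ d⁻¹ * (‖z - p‖⁻¹ + ‖z - q‖⁻¹) * (‖z - p‖⁻¹ + ‖z - q‖⁻¹) := by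
            rw [zero_add, pow_one]; gcongr
        _ ≤ 2 * d⁻¹ * (‖z - p‖⁻¹ ^ 2 + ‖z - q‖⁻¹ ^ 2) := by
            have := mul_nonneg (inv_nonneg.2 hd0.le) (sq_nonneg (‖z - p‖⁻¹ - ‖z - q‖⁻¹))
            nlinarith
        _ ≤ 2 * d⁻¹ * (h ^ (-(3 / 8) : ℝ) * ‖z - p‖ ^ (-(3 / 2) : ℝ) +
              h ^ (-(3 / 8) : ℝ) * ‖z - q‖ ^ (-(3 / 2) : ℝ)) := by
            gcongr ?_ * (?_ + ?_)
            · exact hsq p z hzp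
            · exact hsq q z hzq
        _ = _ := by ring)
  refine key.trans ?_
  have hI : ∫ z in S \ (Metric.ball p δ ∪ Metric.ball q δ), 2 * d⁻¹ * h ^ (-(3 / 8) : ℝ) *
      (‖z - p‖ ^ (-(3 / 2) : ℝ) + ‖z - q‖ ^ (-(3 / 2) : ℝ)) ≤
      2 * d⁻¹ * h ^ (-(3 / 8) : ℝ) * (J + J) := by
    refine (setIntegral_mono_set hβi (ae_of_all _ fun z => by simp only [Pi.zero_apply]; positivity)
      sdiff_subset.eventuallyLE).trans ?_
    rw [integral_const_mul, integral_add (hint p) (hint q)]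
    gcongr
    · exact hJ p
    · exact hJ q
  have hh34 : δ ≤ h ^ (5 / 8 : ℝ) := Real.rpow_le_rpow_of_exponent_ge hh hh1 (by norm_num)
  have hhe : h * h ^ (-(3 / 8) : ℝ) = h ^ (5 / 8 : ℝ) := by
    conv_lhs => rw [← Real.rpow_one h, ← Real.rpow_mul hh.le, ← Real.rpow_add hh]
    norm_num
  calc _ ≤ C * B * (10 * Real.pi * δ + h * (2 * d⁻¹ * h ^ (-(3 / 8) : ℝ) * (J + J))) := by
        gcongr
        exact setIntegral_inv_balls_le S hSm p q q hδ
    _ = C * B * (10 * Real.pi * δ + 4 * d⁻¹ * J * (h * h ^ (-(3 / 8) : ℝ))) := by ring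
    _ ≤ C * B * (10 * Real.pi * h ^ (5 / 8 : ℝ) + 4 * d⁻¹ * J * h ^ (5 / 8 : ℝ)) := by
        rw [hhe]; gcongr
    _ = _ := by ring

/-- Of two distances whose sum is at least `d`, one is at least `d / 2`; thus `1 / (a b)` is nearly as
integrable as `1 / a²` and `1 / b²`, at the cost of a small negative power of `d`. -/
theorem inv_mul_inv_le_rpow {a b d s : ℝ} (ha : 0 < a) (hb : 0 < b) (hd : 0 < d) (hab : d ≤ a + b)
    (hs : 0 < s) (hs1 : s ≤ 1) :
    a⁻¹ * b⁻¹ ≤ 2 * d ^ (-s) * (a ^ (-(2 - s)) + b ^ (-(2 - s))) := by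
  have h1 : d ^ s ≤ a ^ s + b ^ s :=
    (Real.rpow_le_rpow hd.le hab hs.le).trans (Real.rpow_add_le_add_rpow ha.le hb.le hs.le hs1)
  have hds : 0 < d ^ s := Real.rpow_pos_of_pos hd s
  have hm : ∀ {x y : ℝ}, 0 < x → 0 < y →
      x ^ s * (x⁻¹ * y⁻¹) ≤ x ^ (-(2 - s)) + y ^ (-(2 - s)) := by
    intro x y hx hy
    have e : x ^ s * x⁻¹ = x ^ (s - 1) := by
      rw [Real.rpow_sub hx, Real.rpow_one, div_eq_mul_inv]
    rw [← mul_assoc, e]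
    have e2 : ∀ w : ℝ, 0 < w → w ^ (s - 1) * w⁻¹ = w ^ (-(2 - s)) := fun w hw => by
      rw [← Real.rpow_neg_one w, ← Real.rpow_add hw]; ring_nf
    rcases le_total x y with hxy | hxy
    · calc _ ≤ x ^ (s - 1) * x⁻¹ := by gcongr
        _ = x ^ (-(2 - s)) := e2 x hx
        _ ≤ _ := le_add_of_nonneg_right (by positivity)
    · calc _ ≤ y ^ (s - 1) * y⁻¹ :=
            mul_le_mul_of_nonneg_right
              (Real.rpow_le_rpow_of_nonpos hy hxy (by linarith)) (by positivity)
        _ = y ^ (-(2 - s)) := e2 y hy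
        _ ≤ _ := le_add_of_nonneg_left (by positivity)
  rw [Real.rpow_neg hd.le]
  have h2 := hm ha hb
  have h3 := hm hb ha
  rw [mul_comm b⁻¹] at h3
  have h4 : d ^ s * (a⁻¹ * b⁻¹) ≤ (a ^ s + b ^ s) * (a⁻¹ * b⁻¹) := by gcongr
  rw [mul_assoc 2, mul_left_comm, inv_mul_eq_div (d ^ s), le_div_iff₀ hds]
  linarith

/-- For an amplitude of order `-1` the oscillatory integral is bounded by an arbitrarily small
negative power of the distance from the pole of the kernel to the critical point. -/
theorem IsMorsePhase.exists_norm_integral_kernel_le_dist (hφ : IsMorsePhase O S p φ)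
    {G : ℂ → ℂ} (hG : IsSymbol (univ : Set Unit) O p (-1) fun _ => G)
    (h0 : ∀ z ∉ S, G z = 0) {s : ℝ} (hs : 0 < s) (hs1 : s ≤ 1) (t : ℝ) :
    ∃ C : ℝ, 0 ≤ C ∧ ∀ {k : ℂ → ℂ} {q : ℂ} {B : ℝ}, IsKernel O q B k → p ≠ q → ∀ h : ℝ, 0 < h →
      ‖∫ z, phase t h φ z * (k z * G z)‖ ≤ C * B * ‖p - q‖ ^ (-s) := by
  obtain ⟨C, hC0, hC⟩ := (hG.bound 0).exists_norm_le hφ.isCompact hφ.subset le_rfl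
  have hSf : volume S ≠ ⊤ := hφ.isCompact.measure_lt_top.ne
  have hSm := hφ.isCompact.measurableSet
  obtain ⟨J, hJ0, hJ⟩ := exists_setIntegral_rpow_le (s := 2 - s) (by linarith) (by linarith) hSf
  have hint : ∀ x, IntegrableOn (fun z => ‖z - x‖ ^ (-(2 - s))) S := fun x =>
    integrableOn_rpow (by linarith) (by linarith) hSf x
  refine ⟨4 * C * J, by positivity, fun {k q B} hk hpq h hh => ?_⟩
  have hB := hk.nonneg
  have hd0 : 0 < ‖p - q‖ := norm_pos_iff.2 (sub_ne_zero.2 hpq)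
  calc _ ≤ ∫ z in S, C * B * (2 * ‖p - q‖ ^ (-s)) *
        (‖z - p‖ ^ (-(2 - s)) + ‖z - q‖ ^ (-(2 - s))) := by
        rw [← integral_indicator hSm]
        refine norm_integral_le_of_norm_le ((integrable_indicator_iff hSm).2
          (((hint p).add (hint q)).const_mul _)) ?_
        filter_upwards [ae_ne p, ae_ne q] with z h1 h2
        by_cases hz : z ∈ S
        · have hGz := hC () trivial z hz h1
          rw [zpow_neg_one] at hGz
          have h3 := inv_mul_inv_le_rpow (norm_pos_iff.2 (sub_ne_zero.2 h1))
            (norm_pos_iff.2 (sub_ne_zero.2 h2)) hd0 (by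
              rw [norm_sub_rev z p]; exact norm_sub_le_norm_sub_add_norm_sub p z q) hs hs1
          rw [indicator_of_mem hz, norm_mul, norm_phase, one_mul, norm_mul]
          calc _ ≤ (B * ‖z - q‖⁻¹) * (C * ‖z - p‖⁻¹) :=
                mul_le_mul (hk.bound z (hφ.subset hz) h2) hGz (norm_nonneg _) (by positivity)
            _ = C * B * (‖z - p‖⁻¹ * ‖z - q‖⁻¹) := by ring
            _ ≤ _ := by
                rw [mul_assoc (C * B)]
                exact mul_le_mul_of_nonneg_left h3 (by positivity)
        · simp [hz, h0 z hz]
    _ = C * B * (2 * ‖p - q‖ ^ (-s)) *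
        ((∫ z in S, ‖z - p‖ ^ (-(2 - s))) + ∫ z in S, ‖z - q‖ ^ (-(2 - s))) := by
        rw [integral_const_mul, integral_add (hint p) (hint q)]
    _ ≤ C * B * (2 * ‖p - q‖ ^ (-s)) * (J + J) := by
        gcongr
        · exact hJ p
        · exact hJ q
    _ = _ := by ring

/-- For an amplitude of order `-1` and a pole away from the critical point, the oscillatory integral
tends to `0`. -/
theorem IsMorsePhase.exists_norm_integral_kernel_le_decay (hφ : IsMorsePhase O S p φ) {t : ℝ}
    (ht : t ≠ 0) {G : ℂ → ℂ} (hG : IsSymbol (univ : Set Unit) O p (-1) fun _ => G)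
    (h0 : ∀ z ∉ S, G z = 0) {k : ℂ → ℂ} {q : ℂ} {B : ℝ} (hk : IsKernel O q B k) (hpq : p ≠ q) :
    ∃ C : ℝ, ∀ h : ℝ, 0 < h → h ≤ 1 →
      ‖∫ z, phase t h φ z * (k z * G z)‖ ≤ C * h ^ (1 / 8 : ℝ) := by
  obtain ⟨C, hC0, -, hC⟩ := hφ.exists_norm_integral_kernel_le ht 1 (by simpa using hG) h0
  have hB := hk.nonneg
  have hSf : volume S ≠ ⊤ := hφ.isCompact.measure_lt_top.ne
  have hSm := hφ.isCompact.measurableSet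
  set d := ‖p - q‖ with hd
  have hd0 : 0 < d := norm_pos_iff.2 (sub_ne_zero.2 hpq)
  refine ⟨C * B * (d⁻¹ * (20 * Real.pi) + 2 * volume.real S), fun h hh hh1 => ?_⟩
  -- The discs contribute `O(δ)` and their complement `O(h δ^(-4))`, which is `O(δ^4)` for
  -- `δ = h^(1/8)`. Only some positive power of `h` is wanted.
  set δ := h ^ (1 / 8 : ℝ) with hδdef
  have hδ : 0 < δ := Real.rpow_pos_of_pos hh _
  have hδ8 : δ ^ 8 = h := by
    rw [hδdef, ← Real.rpow_natCast, ← Real.rpow_mul hh.le]; norm_num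
  have hδ1 : δ ≤ 1 := Real.rpow_le_one hh.le hh1 (by norm_num)
  have hint : ∀ x, IntegrableOn (fun z => ‖z - x‖⁻¹) S := integrableOn_norm_sub_inv hSf
  have key := hC hk (α := fun z => d⁻¹ * (‖z - p‖⁻¹ + ‖z - q‖⁻¹)) (β := fun _ => 2 * δ⁻¹ ^ 4) hh hδ
    (((hint p).add (hint q)).const_mul _) ((integrableOn_const hSf).mono_set sdiff_subset)
    (fun z _ h1 h2 => by
      rw [pow_one]
      exact inv_mul_inv_le (norm_pos_iff.2 (sub_ne_zero.2 h1))
        (norm_pos_iff.2 (sub_ne_zero.2 h2)) hd0 (by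
          rw [hd, norm_sub_rev z p]; exact norm_sub_le_norm_sub_add_norm_sub p z q))
    (fun z hz => by
      have h1 := sub_inv_le_of_notMem_ball hδ fun h => hz.2 (Or.inl h)
      have h2 := sub_inv_le_of_notMem_ball hδ fun h => hz.2 (Or.inr h)
      calc _ ≤ δ⁻¹ ^ (1 + 1) * δ⁻¹ * (δ⁻¹ + δ⁻¹) := by gcongr
        _ = _ := by ring)
  refine key.trans ?_
  have hI1 : ∫ z in S ∩ (Metric.ball p (2 * δ) ∪ Metric.ball q (2 * δ)),
      d⁻¹ * (‖z - p‖⁻¹ + ‖z - q‖⁻¹) ≤ d⁻¹ * (20 * Real.pi * δ) := by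
    rw [integral_const_mul, integral_add ((hint p).mono_set inter_subset_left)
      ((hint q).mono_set inter_subset_left)]
    gcongr
    linarith [setIntegral_inv_balls_le S hSm p q q hδ, setIntegral_inv_balls_le S hSm p q p hδ]
  have hI2 : ∫ _ in S \ (Metric.ball p δ ∪ Metric.ball q δ), 2 * δ⁻¹ ^ 4 ≤
      volume.real S * (2 * δ⁻¹ ^ 4) := by
    rw [setIntegral_const, smul_eq_mul]
    gcongr
    exact sdiff_subset
  calc _ ≤ C * B * (d⁻¹ * (20 * Real.pi * δ) + h * (volume.real S * (2 * δ⁻¹ ^ 4))) := by gcongr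
    _ = C * B * (d⁻¹ * (20 * Real.pi) * δ + 2 * volume.real S * δ ^ 4) := by
        rw [← hδ8]
        field_simp
    _ ≤ C * B * (d⁻¹ * (20 * Real.pi) * δ + 2 * volume.real S * δ) := by
        gcongr
        exact pow_le_of_le_one hδ.le hδ1 (by norm_num)
    _ = _ := by ring

end KernelEstimates

/-! ### Charts, coordinate vectors and `∂̄` in coordinates -/

section Charts

set_option linter.unusedSectionVars false

variable {X : Type*} [TopologicalSpace X] [ChartedSpace ℂ X] [IsManifold 𝓘(ℂ, ℂ) ω X]

theorem contDiffOn_transition {e e' : OpenPartialHomeomorph X ℂ} (he : e ∈ atlas ℂ X)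
    (he' : e' ∈ atlas ℂ X) :
    ContDiffOn ℂ ω (e' ∘ e.symm) (e.target ∩ e.symm ⁻¹' e'.source) := by
  have h := HasGroupoid.compatible (G := contDiffGroupoid ω 𝓘(ℂ, ℂ)) he he'
  rw [contDiffGroupoid, mem_groupoid_of_pregroupoid] at h
  simpa [contDiffPregroupoid] using h.1

/-- A Riemann surface is a smooth real manifold. -/
instance isManifold_real : IsManifold 𝓘(ℝ, ℂ) ∞ X := by
  refine isManifold_of_contDiffOn 𝓘(ℝ, ℂ) ∞ X fun e e' he he' => ?_
  have := ((contDiffOn_transition he he').restrict_scalars ℝ).of_le (m := ∞) le_top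
  simpa using this

theorem isOpen_transition_domain (e e' : OpenPartialHomeomorph X ℂ) :
    IsOpen (e.target ∩ e.symm ⁻¹' e'.source) :=
  e.isOpen_inter_preimage_symm e'.open_source

theorem differentiableAt_transition {e e' : OpenPartialHomeomorph X ℂ} (he : e ∈ atlas ℂ X)
    (he' : e' ∈ atlas ℂ X) {z : ℂ} (hz : z ∈ e.target) (hz' : e.symm z ∈ e'.source) :
    DifferentiableAt ℂ (e' ∘ e.symm) z :=
  ((contDiffOn_transition he he').contDiffAt
    ((isOpen_transition_domain e e').mem_nhds ⟨hz, hz'⟩)).differentiableAt (by simp)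

theorem coordVec_eq {e : OpenPartialHomeomorph X ℂ} (he : e ∈ atlas ℂ X) {z : ℂ}
    (hz : z ∈ e.target) : coordVec e z = deriv (chartAt ℂ (e.symm z) ∘ e.symm) z := by
  have h : MDifferentiableAt 𝓘(ℂ, ℂ) 𝓘(ℂ, ℂ) e.symm z := mdifferentiableAt_atlas_symm he hz
  rw [coordVec, h.mfderiv]
  simp only [writtenInExtChartAt, extChartAt, mfld_simps, fderivWithin_univ]
  rfl

theorem mfderiv_real_symm {e : OpenPartialHomeomorph X ℂ} (he : e ∈ atlas ℂ X) {z : ℂ}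
    (hz : z ∈ e.target) (v : ℂ) :
    (mfderiv 𝓘(ℝ, ℂ) 𝓘(ℝ, ℂ) e.symm z : ℂ → ℂ) v = coordVec e z * v := by
  have h : MDifferentiableAt 𝓘(ℝ, ℂ) 𝓘(ℝ, ℂ) e.symm z := mdifferentiableAt_atlas_symm he hz
  have hd := differentiableAt_transition he (chart_mem_atlas ℂ (e.symm z)) hz
    (mem_chart_source ℂ (e.symm z))
  rw [coordVec_eq he hz, h.mfderiv]
  simp only [writtenInExtChartAt, extChartAt, mfld_simps, fderivWithin_univ]
  change fderiv ℝ (chartAt ℂ (e.symm z) ∘ e.symm) z v = _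
  rw [(hd.hasDerivAt.hasFDerivAt.restrictScalars ℝ).fderiv]
  simp [mul_comm]

theorem coordVec_transition {e e' : OpenPartialHomeomorph X ℂ} (he : e ∈ atlas ℂ X)
    (he' : e' ∈ atlas ℂ X) {z : ℂ} (hz : z ∈ e.target) (hz' : e.symm z ∈ e'.source) :
    coordVec e z = coordVec e' (e' (e.symm z)) * deriv (e' ∘ e.symm) z := by
  have hs : e'.symm (e' (e.symm z)) = e.symm z := e'.left_inv hz'
  have ht : e' (e.symm z) ∈ e'.target := e'.map_source hz'
  have h1 := coordVec_eq he' ht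
  rw [hs] at h1
  have hd := differentiableAt_transition he' (chart_mem_atlas ℂ (e.symm z)) ht
    (by rw [hs]; exact mem_chart_source ℂ (e.symm z))
  have hc := deriv_comp (h := e' ∘ e.symm) (h₂ := chartAt ℂ (e.symm z) ∘ e'.symm) z hd
    (differentiableAt_transition he he' hz hz')
  rw [coordVec_eq he hz, h1]
  refine Eq.trans ?_ hc
  refine EventuallyEq.deriv_eq ?_
  filter_upwards [(isOpen_transition_domain e e').mem_nhds ⟨hz, hz'⟩] with y hy
  simp only [Function.comp_apply]
  rw [e'.left_inv hy.2]

theorem coordVec_chartAt (x : X) : coordVec (chartAt ℂ x) (chartAt ℂ x x) = 1 := by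
  rw [coordVec_eq (chart_mem_atlas ℂ x) (mem_chart_target ℂ x),
    (chartAt ℂ x).left_inv (mem_chart_source ℂ x)]
  have : (chartAt ℂ x ∘ (chartAt ℂ x).symm) =ᶠ[𝓝 (chartAt ℂ x x)] id := by
    filter_upwards [(chartAt ℂ x).open_target.mem_nhds (mem_chart_target ℂ x)] with y hy
    exact (chartAt ℂ x).right_inv hy
  rw [this.deriv_eq, deriv_id]

theorem coordVec_ne_zero {e : OpenPartialHomeomorph X ℂ} (he : e ∈ atlas ℂ X) {z : ℂ}
    (hz : z ∈ e.target) : coordVec e z ≠ 0 := by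
  intro h0
  set x := e.symm z with hx
  have hxs : x ∈ e.source := e.map_target hz
  have hs : (chartAt ℂ x).symm (chartAt ℂ x x) = x := (chartAt ℂ x).left_inv (mem_chart_source ℂ x)
  have h := coordVec_transition (chart_mem_atlas ℂ x) he (mem_chart_target ℂ x) (by rwa [hs])
  rw [hs, e.right_inv hz, coordVec_chartAt, h0, zero_mul] at h
  exact one_ne_zero h

theorem mdifferentiableAt_iff_chart {e : OpenPartialHomeomorph X ℂ} (he : e ∈ atlas ℂ X) {z : ℂ}
    (hz : z ∈ e.target) (u : X → ℂ) :
    MDifferentiableAt 𝓘(ℝ, ℂ) 𝓘(ℝ, ℂ) u (e.symm z) ↔ DifferentiableAt ℝ (u ∘ e.symm) z := by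
  have h : MDifferentiableAt 𝓘(ℝ, ℂ) 𝓘(ℝ, ℂ) e.symm z := mdifferentiableAt_atlas_symm he hz
  rw [← mdifferentiableAt_iff_differentiableAt]
  refine ⟨fun hu => hu.comp z h, fun hu => ?_⟩
  have h' : MDifferentiableAt 𝓘(ℝ, ℂ) 𝓘(ℝ, ℂ) e (e.symm z) :=
    mdifferentiableAt_atlas he (e.map_target hz)
  have hu' : MDifferentiableAt 𝓘(ℝ, ℂ) 𝓘(ℝ, ℂ) (u ∘ e.symm) (e (e.symm z)) := by
    rwa [e.right_inv hz]
  refine (hu'.comp _ h').congr_of_eventuallyEq ?_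
  filter_upwards [e.open_source.mem_nhds (e.map_target hz)] with y hy
  simp [e.left_inv hy]

theorem fderiv_comp_symm {e : OpenPartialHomeomorph X ℂ} (he : e ∈ atlas ℂ X) {z : ℂ}
    (hz : z ∈ e.target) (u : X → ℂ) (v : ℂ) :
    fderiv ℝ (u ∘ e.symm) z v = realDeriv u (e.symm z) (coordVec e z * v) := by
  by_cases hu : DifferentiableAt ℝ (u ∘ e.symm) z
  · have hu' := (mdifferentiableAt_iff_chart he hz u).2 hu
    have h : MDifferentiableAt 𝓘(ℝ, ℂ) 𝓘(ℝ, ℂ) e.symm z := mdifferentiableAt_atlas_symm he hz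
    rw [realDeriv, ← mfderiv_real_symm he hz, ← mfderiv_eq_fderiv, mfderiv_comp z hu' h]
    rfl
  · have hu' := mt (mdifferentiableAt_iff_chart he hz u).1 hu
    rw [fderiv_zero_of_not_differentiableAt hu, realDeriv, mfderiv_zero_of_not_mdifferentiableAt hu']
    rfl

theorem realDeriv_eq (u : X → ℂ) (x : X) (c : ℂ) :
    realDeriv u x c = c.re * realDeriv u x 1 + c.im * realDeriv u x Complex.I := by
  have h : c = c.re • (1 : ℂ) + c.im • Complex.I := by
    simp [Complex.real_smul, Complex.re_add_im]
  have h2 (L : ℂ →L[ℝ] ℂ) : L c = c.re * L 1 + c.im * L Complex.I := by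
    conv_lhs => rw [h]
    rw [map_add, map_smul, map_smul, Complex.real_smul, Complex.real_smul]
  exact h2 _

/-- In coordinates, `∂̄u` is the Cauchy–Riemann derivative. -/
theorem dbar_coeff {e : OpenPartialHomeomorph X ℂ} (he : e ∈ atlas ℂ X) {z : ℂ}
    (hz : z ∈ e.target) (u : X → ℂ) : (dbar u).coeff e z = dbarC (u ∘ e.symm) z := by
  rw [dbarC, fderiv_comp_symm he hz, fderiv_comp_symm he hz]
  simp only [Form01.coeff, dbar]
  change (realDeriv u (e.symm z) 1 + Complex.I * realDeriv u (e.symm z) Complex.I) / 2 *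
    conj (coordVec e z) = _
  generalize coordVec e z = c
  generalize e.symm z = x
  rw [realDeriv_eq u x (c * 1), realDeriv_eq u x (c * Complex.I)]
  conv_lhs => rw [← Complex.re_add_im c]
  simp only [map_add, map_mul, Complex.conj_ofReal, Complex.conj_I, mul_one, Complex.mul_I_re,
    Complex.mul_I_im, Complex.ofReal_neg]
  linear_combination (-1 / 2 * (c.im : ℂ) * realDeriv u x Complex.I) * Complex.I_mul_I

theorem apply_eq_apply_one_mul (α : ℂ →L[ℂ] ℂ) (c : ℂ) : α c = α 1 * c := by
  simpa [mul_comm] using α.map_smul c (1 : ℂ)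

theorem apply_eq_apply_one_mul_conj (α : ℂ →L⋆[ℂ] ℂ) (c : ℂ) : α c = α 1 * conj c := by
  simpa [mul_comm] using α.map_smulₛₗ c (1 : ℂ)

theorem conjLinear_ext {α β : ℂ →L⋆[ℂ] ℂ} (h : α 1 = β 1) : α = β :=
  ContinuousLinearMap.ext fun c => by
    rw [apply_eq_apply_one_mul_conj, apply_eq_apply_one_mul_conj β, h]

theorem Form10.coeff_eq (α : Form10 X) (e : OpenPartialHomeomorph X ℂ) (z : ℂ) :
    α.coeff e z = α (e.symm z) (1 : ℂ) * coordVec e z :=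
  apply_eq_apply_one_mul (α (e.symm z)) _

theorem Form01.coeff_eq (α : Form01 X) (e : OpenPartialHomeomorph X ℂ) (z : ℂ) :
    α.coeff e z = α (e.symm z) (1 : ℂ) * conj (coordVec e z) :=
  apply_eq_apply_one_mul_conj (α (e.symm z)) _

theorem Form01.quot_comp {e : OpenPartialHomeomorph X ℂ} (he : e ∈ atlas ℂ X) {z : ℂ}
    (hz : z ∈ e.target) (f β : Form01 X) : f.quot β (e.symm z) = f.coeff e z / β.coeff e z := by
  have : conj (coordVec e z) ≠ 0 := by simpa using coordVec_ne_zero he hz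
  rw [Form01.coeff_eq, Form01.coeff_eq, mul_div_mul_right _ _ this, Form01.quot]

theorem differentiableOn_comp_symm {Φ : X → ℂ} (hΦ : MDifferentiable 𝓘(ℂ, ℂ) 𝓘(ℂ, ℂ) Φ)
    {e : OpenPartialHomeomorph X ℂ} (he : e ∈ atlas ℂ X) :
    DifferentiableOn ℂ (Φ ∘ e.symm) e.target := fun z hz => by
  have h : MDifferentiableAt 𝓘(ℂ, ℂ) 𝓘(ℂ, ℂ) e.symm z := mdifferentiableAt_atlas_symm he hz
  exact ((hΦ (e.symm z)).comp z h).differentiableAt.differentiableWithinAt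

theorem isCritical_iff {Φ : X → ℂ} (hΦ : MDifferentiable 𝓘(ℂ, ℂ) 𝓘(ℂ, ℂ) Φ)
    {e : OpenPartialHomeomorph X ℂ} (he : e ∈ atlas ℂ X) {z : ℂ} (hz : z ∈ e.target) :
    IsCritical Φ (e.symm z) ↔ deriv (Φ ∘ e.symm) z = 0 := by
  have h : MDifferentiableAt 𝓘(ℂ, ℂ) 𝓘(ℂ, ℂ) e.symm z := mdifferentiableAt_atlas_symm he hz
  have h1 : deriv (Φ ∘ e.symm) z =
      (show ℂ →L[ℂ] ℂ from mfderiv 𝓘(ℂ, ℂ) 𝓘(ℂ, ℂ) Φ (e.symm z)) (coordVec e z) := by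
    rw [← fderiv_apply_one_eq_deriv, ← mfderiv_eq_fderiv, mfderiv_comp z (hΦ _) h]
    rfl
  rw [h1, apply_eq_apply_one_mul, mul_eq_zero, or_iff_left (coordVec_ne_zero he hz), IsCritical]
  refine ⟨fun h0 => by rw [h0]; rfl, fun h0 => ?_⟩
  exact ContinuousLinearMap.ext_ring (R₁ := ℂ) h0

end Charts

/-! ### The area measure in a chart -/

section Area

set_option linter.unusedSectionVars false

variable {X : Type*} [TopologicalSpace X] [ChartedSpace ℂ X] [IsManifold 𝓘(ℂ, ℂ) ω X]
  [MeasurableSpace X] [BorelSpace X]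

theorem measurableSet_target_inter (e : OpenPartialHomeomorph X ℂ) {A : Set X}
    (hA : MeasurableSet A) : MeasurableSet (e.target ∩ e.symm ⁻¹' A) := by
  have h : Measurable (e.target.domRestrict e.symm) :=
    (continuousOn_iff_continuous_domRestrict.1 e.continuousOn_symm).measurable
  have h2 := e.open_target.measurableSet.subtype_image (h hA)
  convert h2 using 1
  ext z
  simp only [mem_inter_iff, mem_preimage, mem_image, Subtype.exists, domRestrict_apply]
  exact ⟨fun h => ⟨z, h.1, h.2, rfl⟩, by rintro ⟨a, ha, h1, rfl⟩; exact ⟨ha, h1⟩⟩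

theorem ConformalMetric.coeff_transition (g : ConformalMetric X) {e e' : OpenPartialHomeomorph X ℂ}
    (he : e ∈ atlas ℂ X) (he' : e' ∈ atlas ℂ X) {z : ℂ} (hz : z ∈ e.target)
    (hz' : e.symm z ∈ e'.source) :
    g.coeff e z = ‖deriv (e' ∘ e.symm) z‖ ^ 2 * g.coeff e' (e' (e.symm z)) := by
  rw [ConformalMetric.coeff, ConformalMetric.coeff, coordVec_transition he he' hz hz',
    e'.left_inv hz', norm_mul]
  ring

theorem ConformalMetric.coeff_pos (g : ConformalMetric X) {e : OpenPartialHomeomorph X ℂ}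
    (he : e ∈ atlas ℂ X) {z : ℂ} (hz : z ∈ e.target) : 0 < g.coeff e z :=
  mul_pos (g.factor_pos _) (pow_pos (norm_pos_iff.2 (coordVec_ne_zero he hz)) 2)

theorem ConformalMetric.continuousOn_coeff (g : ConformalMetric X) {e : OpenPartialHomeomorph X ℂ}
    (he : e ∈ atlas ℂ X) : ContinuousOn (g.coeff e) e.target :=
  (g.smooth e he).continuousOn

theorem abs_det_restrictScalars_toSpanSingleton (a : ℂ) :
    |((ContinuousLinearMap.toSpanSingleton ℂ a).restrictScalars ℝ).det| = ‖a‖ ^ 2 := by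
  have h := LinearMap.det_restrictScalars (R := ℝ) (S := ℂ) (A := ℂ)
    (f := (ContinuousLinearMap.toSpanSingleton ℂ a : ℂ →ₗ[ℂ] ℂ))
  have h2 : LinearMap.det (ContinuousLinearMap.toSpanSingleton ℂ a : ℂ →ₗ[ℂ] ℂ) = a := by
    rw [LinearMap.det_ring]; simp
  rw [h2, Algebra.norm_complex_apply] at h
  change |LinearMap.det ((ContinuousLinearMap.toSpanSingleton ℂ a : ℂ →ₗ[ℂ] ℂ).restrictScalars ℝ)| = _
  rw [h, Complex.normSq_eq_norm_sq, abs_of_nonneg (by positivity)]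

/-- The area of a set in the domain of two charts may be computed in either of them. -/
theorem ConformalMetric.lintegral_coeff_transition (g : ConformalMetric X)
    {e e' : OpenPartialHomeomorph X ℂ} (he : e ∈ atlas ℂ X) (he' : e' ∈ atlas ℂ X) {A : Set X}
    (hA : MeasurableSet A) (hAe : A ⊆ e.source) (hAe' : A ⊆ e'.source) :
    ∫⁻ z in e'.target ∩ e'.symm ⁻¹' A, ENNReal.ofReal (g.coeff e' z) =
      ∫⁻ z in e.target ∩ e.symm ⁻¹' A, ENNReal.ofReal (g.coeff e z) := by
  have himg : (e' ∘ e.symm) '' (e.target ∩ e.symm ⁻¹' A) = e'.target ∩ e'.symm ⁻¹' A := by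
    ext z
    constructor
    · rintro ⟨y, ⟨hy, hyA⟩, rfl⟩
      refine ⟨e'.map_source (hAe' hyA), ?_⟩
      simpa [e'.left_inv (hAe' hyA)] using hyA
    · rintro ⟨hz, hzA⟩
      refine ⟨e (e'.symm z), ⟨e.map_source (hAe hzA), ?_⟩, ?_⟩
      · simpa [e.left_inv (hAe hzA)] using hzA
      · simp [e.left_inv (hAe hzA), e'.right_inv hz]
  rw [← himg, lintegral_image_eq_lintegral_abs_det_fderiv_mul volume
    (measurableSet_target_inter e hA)
    (f' := fun z => (ContinuousLinearMap.toSpanSingleton ℂ (deriv (e' ∘ e.symm) z)).restrictScalars ℝ)]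
  · refine setLIntegral_congr_fun (measurableSet_target_inter e hA) fun z hz => ?_
    simp only [Function.comp_apply]
    rw [abs_det_restrictScalars_toSpanSingleton, ← ENNReal.ofReal_mul (by positivity),
      ← g.coeff_transition he he' hz.1 (hAe' hz.2)]
  · intro z hz
    exact ((differentiableAt_transition he he' hz.1 (hAe' hz.2)).hasDerivAt.hasFDerivAt.restrictScalars
      ℝ).hasFDerivWithinAt
  · intro y hy z hz h
    have h1 := e'.injOn (hAe' hy.2) (hAe' hz.2) h
    exact e.symm.injOn hy.1 hz.1 h1

variable [SecondCountableTopology X] [Nonempty X]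

/-- In the domain of a chart, the area measure does not depend on the charts from which it is put
together. -/
theorem ConformalMetric.area_apply (g : ConformalMetric X) {e : OpenPartialHomeomorph X ℂ}
    (he : e ∈ atlas ℂ X) {A : Set X} (hA : MeasurableSet A) (hAe : A ⊆ e.source) :
    g.area A = ∫⁻ z in e.target ∩ e.symm ⁻¹' A, ENNReal.ofReal (g.coeff e z) := by
  set c := fun n => chartAt ℂ (chartCenter X n) with hc
  set D := fun n => disjointed (fun m => (c m).source) n with hD
  have hDs : ∀ n, D n ⊆ (c n).source := fun n => disjointed_subset _ _
  have hDm : ∀ n, MeasurableSet (D n) := fun n =>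
    MeasurableSet.disjointed (fun m => (c m).open_source.measurableSet) n
  have hDu : ⋃ n, D n = univ := by
    rw [hD, iUnion_disjointed]
    exact (exists_chart_cover X).choose_spec
  have h1 : ∀ n, ((volume.withDensity fun z => ENNReal.ofReal (g.coeff (c n) z)).restrict
      ((c n).target ∩ (c n).symm ⁻¹' D n)).map (c n).symm A =
      ∫⁻ z in e.target ∩ e.symm ⁻¹' (A ∩ D n), ENNReal.ofReal (g.coeff e z) := by
    intro n
    have hm := measurableSet_target_inter (c n) (hDm n)
    rw [Measure.map_apply_of_aemeasurable
      (((c n).continuousOn_symm.mono inter_subset_left).aemeasurable hm) hA,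
      Measure.restrict_apply' hm]
    have : (c n).symm ⁻¹' A ∩ ((c n).target ∩ (c n).symm ⁻¹' D n) =
        (c n).target ∩ (c n).symm ⁻¹' (A ∩ D n) := by
      ext z; simp; tauto
    rw [this, withDensity_apply _ (measurableSet_target_inter (c n) (hA.inter (hDm n)))]
    exact g.lintegral_coeff_transition he (chart_mem_atlas ℂ _) (hA.inter (hDm n))
      (inter_subset_left.trans hAe) (inter_subset_right.trans (hDs n))
  have h2 : e.target ∩ e.symm ⁻¹' A = ⋃ n, e.target ∩ e.symm ⁻¹' (A ∩ D n) := by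
    rw [← inter_iUnion, ← preimage_iUnion, ← inter_iUnion, hDu, inter_univ]
  rw [h2, lintegral_iUnion (fun n => measurableSet_target_inter e (hA.inter (hDm n))),
    ConformalMetric.area, Measure.sum_apply _ hA]
  · exact tsum_congr h1
  · intro m n hmn
    have := disjoint_disjointed (fun m => (c m).source) hmn
    refine Set.disjoint_left.2 fun z hz hz' => ?_
    exact Set.disjoint_left.1 this hz.2.2 hz'.2.2

theorem measurableEmbedding_symm (e : OpenPartialHomeomorph X ℂ) :
    MeasurableEmbedding (e.target.domRestrict e.symm) :=
  e.symm.isOpenEmbedding_restrict.measurableEmbedding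

/-- In the domain of a chart, the area measure is `λ dx dy`. -/
theorem ConformalMetric.area_restrict (g : ConformalMetric X) {e : OpenPartialHomeomorph X ℂ}
    (he : e ∈ atlas ℂ X) :
    g.area.restrict e.source = (Measure.comap ((↑) : e.target → ℂ)
      (volume.withDensity fun z => ENNReal.ofReal (g.coeff e z))).map
        (e.target.domRestrict e.symm) := by
  ext A hA
  have hsm := e.open_source.measurableSet
  have htm := e.open_target.measurableSet
  rw [Measure.restrict_apply hA, (measurableEmbedding_symm e).map_apply,
    (MeasurableEmbedding.subtype_coe htm).comap_apply, g.area_apply he (hA.inter hsm)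
    inter_subset_right]
  have h1 : ((↑) : e.target → ℂ) '' (e.target.domRestrict e.symm ⁻¹' A) =
      e.target ∩ e.symm ⁻¹' A := by
    ext z
    simp only [mem_inter_iff, mem_preimage, mem_image, Subtype.exists, domRestrict_apply]
    exact ⟨by rintro ⟨a, ha, h1, rfl⟩; exact ⟨ha, h1⟩, fun h => ⟨z, h.1, h.2, rfl⟩⟩
  have h2 : e.target ∩ e.symm ⁻¹' (A ∩ e.source) = e.target ∩ e.symm ⁻¹' A := by
    ext z
    simp only [mem_inter_iff, mem_preimage]
    exact ⟨fun h => ⟨h.1, h.2.1⟩, fun h => ⟨h.1, h.2, e.map_target h.1⟩⟩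
  rw [h1, h2, withDensity_apply _ (measurableSet_target_inter e hA)]

theorem ConformalMetric.setIntegral_source (g : ConformalMetric X)
    {e : OpenPartialHomeomorph X ℂ} (he : e ∈ atlas ℂ X) (f : X → ℂ) :
    ∫ x in e.source, f x ∂g.area = ∫ z in e.target, (g.coeff e z : ℂ) * f (e.symm z) := by
  have htm := e.open_target.measurableSet
  rw [g.area_restrict he, (measurableEmbedding_symm e).integral_map]
  simp only [domRestrict_apply]
  rw [integral_subtype_comap htm (fun z => f (e.symm z)), restrict_withDensity htm,
    integral_withDensity_eq_integral_toReal_smul₀]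
  · refine setIntegral_congr_fun htm fun z hz => ?_
    simp [ENNReal.toReal_ofReal (g.coeff_pos he hz).le]
  · exact ((g.continuousOn_coeff he).aemeasurable htm).ennreal_ofReal
  · exact ae_of_all _ fun _ => ENNReal.ofReal_lt_top

theorem ConformalMetric.integrableOn_source (g : ConformalMetric X)
    {e : OpenPartialHomeomorph X ℂ} (he : e ∈ atlas ℂ X) (f : X → ℂ) :
    IntegrableOn f e.source g.area ↔
      IntegrableOn (fun z => (g.coeff e z : ℂ) * f (e.symm z)) e.target := by
  have htm := e.open_target.measurableSet
  rw [IntegrableOn, g.area_restrict he, (measurableEmbedding_symm e).integrable_map_iff]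
  have h1 := integrableOn_iff_comap_subtypeVal (f := fun z => f (e.symm z))
    (μ := volume.withDensity fun z => ENNReal.ofReal (g.coeff e z)) htm
  refine h1.symm.trans ?_
  rw [IntegrableOn, restrict_withDensity htm, integrable_withDensity_iff_integrable_smul₀']
  · refine integrable_congr ((ae_restrict_iff' htm).2 (ae_of_all _ fun z hz => ?_))
    simp [ENNReal.toReal_ofReal (g.coeff_pos he hz).le]
  · exact ((g.continuousOn_coeff he).aemeasurable htm).ennreal_ofReal
  · exact ae_of_all _ fun _ => ENNReal.ofReal_lt_top

theorem starWedge_eq_zero (g : ConformalMetric X) (α : Form10 X) {β : Form01 X} {x : X}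
    (h : β x = 0) : starWedge g α β x = 0 := by
  have : β x (1 : ℂ) = 0 := by rw [h]; rfl
  rw [starWedge, this, mul_zero, mul_zero, zero_div]

theorem coeff_mul_starWedge (g : ConformalMetric X) (e : OpenPartialHomeomorph X ℂ)
    (z : ℂ) (α : Form10 X) (β : Form01 X) :
    (g.coeff e z : ℂ) * starWedge g α β (e.symm z) =
      -2 * Complex.I * (α.coeff e z * β.coeff e z) := by
  have h1 : (g.factor (e.symm z) : ℂ) ≠ 0 := by exact_mod_cast (g.factor_pos _).ne'
  rw [starWedge, ConformalMetric.coeff, Form10.coeff_eq, Form01.coeff_eq]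
  push_cast
  rw [← Complex.mul_conj']
  field_simp

/-- `∫ α ∧ β` in a chart whose domain carries `β`. -/
theorem intWedge_eq (g : ConformalMetric X) {e : OpenPartialHomeomorph X ℂ}
    (he : e ∈ atlas ℂ X) (α : Form10 X) (β : Form01 X) (hβ : ∀ x ∉ e.source, β x = 0) :
    intWedge g α β = -2 * Complex.I * ∫ z in e.target, α.coeff e z * β.coeff e z := by
  have hs : Function.support (starWedge g α β) ⊆ e.source := fun x hx => by
    by_contra h
    exact hx (starWedge_eq_zero g α (hβ x h))
  rw [intWedge, ← setIntegral_eq_integral_of_forall_compl_eq_zero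
    (fun x hx => Function.notMem_support.1 fun h => hx (hs h)), g.setIntegral_source he,
    ← integral_const_mul]
  exact setIntegral_congr_fun e.open_target.measurableSet fun z _ => coeff_mul_starWedge g e z α β

theorem integrable_starWedge_iff (g : ConformalMetric X) {e : OpenPartialHomeomorph X ℂ}
    (he : e ∈ atlas ℂ X) (α : Form10 X) (β : Form01 X) (hβ : ∀ x ∉ e.source, β x = 0) :
    Integrable (starWedge g α β) g.area ↔
      IntegrableOn (fun z => α.coeff e z * β.coeff e z) e.target := by
  have hs : Function.support (starWedge g α β) ⊆ e.source := fun x hx => by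
    by_contra h
    exact hx (starWedge_eq_zero g α (hβ x h))
  rw [← integrableOn_iff_integrable_of_support_subset hs, g.integrableOn_source he]
  refine Iff.trans ?_ (integrable_const_mul_iff (c := (-2 * Complex.I : ℂ)) (by simp) _)
  exact integrableOn_congr_fun (fun z _ => coeff_mul_starWedge g e z α β)
    e.open_target.measurableSet

theorem ConformalMetric.setLIntegral_image (g : ConformalMetric X)
    {e : OpenPartialHomeomorph X ℂ} (he : e ∈ atlas ℂ X) (f : X → ℝ≥0∞) :
    ∫⁻ x in e.source, f x ∂g.area =
      ∫⁻ z in e.target, ENNReal.ofReal (g.coeff e z) * f (e.symm z) := by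
  have htm := e.open_target.measurableSet
  rw [g.area_restrict he, (measurableEmbedding_symm e).lintegral_map]
  simp only [domRestrict_apply]
  rw [lintegral_subtype_comap htm (fun z => f (e.symm z)), restrict_withDensity htm,
    lintegral_withDensity_eq_lintegral_mul_non_measurable₀]
  · rfl
  · exact ((g.continuousOn_coeff he).aemeasurable htm).ennreal_ofReal
  · exact ae_of_all _ fun _ => ENNReal.ofReal_lt_top

theorem ConformalMetric.area_singleton (g : ConformalMetric X) [T1Space X] (x : X) :
    g.area {x} = 0 := by
  have he := chart_mem_atlas ℂ x
  rw [g.area_apply he (measurableSet_singleton x) (by simp)]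
  refine setLIntegral_measure_zero _ _ (measure_mono_null ?_ (measure_singleton (chartAt ℂ x x)))
  rintro z ⟨hz, hzx⟩
  have h : (chartAt ℂ x).symm z = x := hzx
  rw [mem_singleton_iff, ← (chartAt ℂ x).right_inv hz, h]

instance (g : ConformalMetric X) : IsLocallyFiniteMeasure g.area := by
  refine ⟨fun x => ?_⟩
  set e := chartAt ℂ x
  have he := chart_mem_atlas ℂ x
  have hx := mem_chart_source ℂ x
  obtain ⟨r, hr, hrt⟩ := Metric.nhds_basis_closedBall.mem_iff.1
    (e.open_target.mem_nhds (mem_chart_target ℂ x))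
  have hK : IsCompact (Metric.closedBall (e x) r) := isCompact_closedBall _ _
  obtain ⟨C, hC⟩ := hK.exists_bound_of_continuousOn ((g.continuousOn_coeff he).mono hrt)
  refine ⟨e.source ∩ e ⁻¹' Metric.ball (e x) r, ?_, ?_⟩
  · exact (e.isOpen_inter_preimage Metric.isOpen_ball).mem_nhds ⟨hx, by simpa using hr⟩
  · rw [g.area_apply he (e.isOpen_inter_preimage Metric.isOpen_ball).measurableSet
      inter_subset_left]
    have hsub : e.target ∩ e.symm ⁻¹' (e.source ∩ e ⁻¹' Metric.ball (e x) r) ⊆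
        Metric.closedBall (e x) r := by
      rintro z ⟨hz, -, hz'⟩
      rw [mem_preimage, e.right_inv hz] at hz'
      exact Metric.ball_subset_closedBall hz'
    calc _ ≤ ∫⁻ z in Metric.closedBall (e x) r, ENNReal.ofReal (g.coeff e z) :=
          lintegral_mono_set hsub
      _ ≤ ∫⁻ z in Metric.closedBall (e x) r, ENNReal.ofReal C :=
          setLIntegral_mono' hK.measurableSet fun z hz =>
            ENNReal.ofReal_le_ofReal ((le_abs_self _).trans (hC z hz))
      _ < ⊤ := by
          rw [setLIntegral_const]
          exact ENNReal.mul_lt_top ENNReal.ofReal_lt_top hK.measure_lt_top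

end Area

/-! ### Functions and forms with a singularity at one point -/

/-- Near `p`, the function `c` satisfies all symbol bounds of order `N` at `p`. -/
def HasOrderAt (c : ℂ → ℂ) (p : ℂ) (N : ℤ) : Prop :=
  ∃ r > 0, IsSymbol (univ : Set Unit) (Metric.ball p r) p N fun _ => c

section Order

variable {c d : ℂ → ℂ} {p : ℂ} {N N' : ℤ}

theorem HasOrderAt.exists_lt (h : HasOrderAt c p N) {ε : ℝ} (hε : 0 < ε) :
    ∃ r > 0, r ≤ ε ∧ IsSymbol (univ : Set Unit) (Metric.ball p r) p N fun _ => c := by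
  obtain ⟨r, hr, h⟩ := h
  exact ⟨min r ε, lt_min hr hε, min_le_right _ _,
    h.mono id (fun _ _ => trivial) (Metric.ball_subset_ball (min_le_left _ _))⟩

theorem HasOrderAt.mul (hc : HasOrderAt c p N) (hd : HasOrderAt d p N') :
    HasOrderAt (fun z => c z * d z) p (N + N') := by
  obtain ⟨r, hr, hd⟩ := hd
  obtain ⟨s, hs, hsr, hc⟩ := hc.exists_lt hr
  exact ⟨s, hs, hc.mul Metric.isOpen_ball
    (hd.mono id (fun _ _ => trivial) (Metric.ball_subset_ball hsr))⟩

theorem HasOrderAt.dbarC (hc : HasOrderAt c p N) : HasOrderAt (dbarC c) p (N - 1) := by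
  obtain ⟨r, hr, hc⟩ := hc
  exact ⟨r, hr, hc.dbarC Metric.isOpen_ball⟩

theorem HasOrderAt.congr (hc : HasOrderAt c p N) {V : Set ℂ} (hV : V ∈ 𝓝 p)
    (h : EqOn c d (V \ {p})) : HasOrderAt d p N := by
  obtain ⟨ε, hε, hV⟩ := Metric.mem_nhds_iff.1 hV
  obtain ⟨r, hr, hrε, hc⟩ := hc.exists_lt hε
  exact ⟨r, hr, hc.congr Metric.isOpen_ball fun _ _ => h.mono
    (sdiff_subset_sdiff_left ((Metric.ball_subset_ball hrε).trans hV))⟩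

theorem hasOrderAt_of_contDiffOn {V : Set ℂ} (hV : IsOpen V) (hp : p ∈ V) (hN : N ≤ 0)
    (hc : ContDiffOn ℝ ∞ c V) : HasOrderAt c p N := by
  obtain ⟨r, hr, hrV⟩ := Metric.nhds_basis_closedBall.mem_iff.1 (hV.mem_nhds hp)
  exact ⟨r, hr, isSymbol_of_contDiffOn hV (isCompact_closedBall p r) hrV Metric.ball_subset_closedBall
    hN hc⟩

theorem HasDegreeAt.hasOrderAt {V : Set ℂ} (hV : IsOpen V) (hp : p ∈ V)
    (hc : ContDiffOn ℝ ∞ c (V \ {p})) (h : HasDegreeAt c p N) : HasOrderAt c p N := by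
  obtain ⟨r, hr, hrV⟩ := Metric.nhds_basis_closedBall.mem_iff.1 (hV.mem_nhds hp)
  exact ⟨r, hr, isSymbol_of_hasDegreeAt hV hrV hr hc h⟩

end Order

section Singular

set_option linter.unusedSectionVars false

variable {X : Type*} [TopologicalSpace X] [ChartedSpace ℂ X] [IsManifold 𝓘(ℂ, ℂ) ω X]

/-- Smoothness of a complex function, expressed in charts. -/
def IsSmoothFun (θ : X → ℂ) : Prop := ∀ e ∈ atlas ℂ X, ContDiffOn ℝ ∞ (θ ∘ e.symm) e.target

/-- A function which is smooth off `z₀`, vanishes off `K` and satisfies the symbol bounds of order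
`N` at `z₀`. -/
structure IsSingularFun (z₀ : X) (K : Set X) (N : ℤ) (u : X → ℂ) : Prop where
  smooth : ∀ e ∈ atlas ℂ X, ContDiffOn ℝ ∞ (u ∘ e.symm) (e.target ∩ e.symm ⁻¹' {z₀}ᶜ)
  zero : ∀ x ∉ K, u x = 0
  order : HasOrderAt (u ∘ (chartAt ℂ z₀).symm) (chartAt ℂ z₀ z₀) N

/-- A (0,1)-form which is smooth off `z₀`, vanishes off `K` and satisfies the symbol bounds of order
`N` at `z₀`. -/
structure IsSingularForm (z₀ : X) (K : Set X) (N : ℤ) (f : Form01 X) : Prop where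
  smooth : f.SmoothOn {z₀}ᶜ
  zero : ∀ x ∉ K, f x = 0
  order : HasOrderAt (f.coeff (chartAt ℂ z₀)) (chartAt ℂ z₀ z₀) N

variable {z₀ : X} {K : Set X} {N : ℤ} {u θ : X → ℂ} {f : Form01 X}

theorem isOpen_target_inter_compl [T1Space X] (e : OpenPartialHomeomorph X ℂ) (z₀ : X) :
    IsOpen (e.target ∩ e.symm ⁻¹' {z₀}ᶜ) :=
  e.isOpen_inter_preimage_symm isClosed_singleton.isOpen_compl

theorem smul_coeff (θ : X → ℂ) (f : Form01 X) (e : OpenPartialHomeomorph X ℂ) (z : ℂ) :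
    Form01.coeff (fun x => θ x • f x) e z = θ (e.symm z) * f.coeff e z := rfl

theorem IsSmoothFun.hasOrderAt (hθ : IsSmoothFun θ) (z₀ : X) :
    HasOrderAt (θ ∘ (chartAt ℂ z₀).symm) (chartAt ℂ z₀ z₀) 0 :=
  hasOrderAt_of_contDiffOn (chartAt ℂ z₀).open_target (mem_chart_target ℂ z₀) le_rfl
    (hθ _ (chart_mem_atlas ℂ z₀))

theorem IsSingularFun.smul (hθ : IsSmoothFun θ) (hu : IsSingularFun z₀ K N u) :
    IsSingularFun z₀ (K ∩ tsupport θ) N fun x => θ x * u x := by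
  refine ⟨fun e he => ((hθ e he).mono inter_subset_left).mul (hu.smooth e he), fun x hx => ?_, ?_⟩
  · rw [mem_inter_iff, not_and_or] at hx
    rcases hx with hx | hx
    · rw [hu.zero x hx, mul_zero]
    · rw [image_eq_zero_of_notMem_tsupport hx, zero_mul]
  · have := (hθ.hasOrderAt z₀).mul hu.order
    rwa [zero_add] at this

theorem IsSingularForm.smul (hθ : IsSmoothFun θ) (hf : IsSingularForm z₀ K N f) :
    IsSingularForm z₀ (K ∩ tsupport θ) N fun x => θ x • f x := by
  refine ⟨fun e he => ((hθ e he).mono inter_subset_left).mul (hf.smooth e he), fun x hx => ?_, ?_⟩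
  · rw [mem_inter_iff, not_and_or] at hx
    rcases hx with hx | hx
    · rw [hf.zero x hx]
      exact smul_zero (A := ℂ →L⋆[ℂ] ℂ) (θ x)
    · rw [image_eq_zero_of_notMem_tsupport hx]
      exact zero_smul ℂ (show ℂ →L⋆[ℂ] ℂ from f x)
  · have := (hθ.hasOrderAt z₀).mul hf.order
    rwa [zero_add] at this

theorem Form01.coeff_chartAt_self (f : Form01 X) (x : X) :
    f.coeff (chartAt ℂ x) (chartAt ℂ x x) = f x (1 : ℂ) := by
  rw [Form01.coeff_eq, coordVec_chartAt, map_one, mul_one,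
    (chartAt ℂ x).left_inv (mem_chart_source ℂ x)]

theorem Form01.ext_coeff {f g : Form01 X} {x : X}
    (h : f.coeff (chartAt ℂ x) (chartAt ℂ x x) = g.coeff (chartAt ℂ x) (chartAt ℂ x x)) :
    f x = g x := by
  rw [Form01.coeff_chartAt_self, Form01.coeff_chartAt_self] at h
  exact conjLinear_ext h

theorem dbar_eq_zero (hK : IsClosed K) (h0 : ∀ x ∉ K, u x = 0) {x : X} (hx : x ∉ K) :
    dbar u x = 0 := by
  have hz := mem_chart_target ℂ x
  have hl := (chartAt ℂ x).left_inv (mem_chart_source ℂ x)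
  refine Form01.ext_coeff (g := fun _ => 0) ?_
  rw [dbar_coeff (chart_mem_atlas ℂ x) hz]
  have h1 : u ∘ (chartAt ℂ x).symm =ᶠ[𝓝 (chartAt ℂ x x)] fun _ => 0 := by
    have := ((chartAt ℂ x).isOpen_inter_preimage_symm hK.isOpen_compl).mem_nhds
      (x := chartAt ℂ x x) ⟨hz, by rw [mem_preimage, hl]; exact hx⟩
    filter_upwards [this] with y hy using h0 _ hy.2
  rw [dbarC_congr h1, dbarC_const]
  rfl

theorem dbar_smoothOn [T1Space X]
    (hu : ∀ e ∈ atlas ℂ X, ContDiffOn ℝ ∞ (u ∘ e.symm) (e.target ∩ e.symm ⁻¹' {z₀}ᶜ)) :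
    (dbar u).SmoothOn {z₀}ᶜ := fun e he =>
  ((hu e he).dbarC (isOpen_target_inter_compl e z₀)).congr fun _ hz => dbar_coeff he hz.1 u

theorem IsSingularFun.dbar [T1Space X] (hK : IsClosed K) (hu : IsSingularFun z₀ K N u) :
    IsSingularForm z₀ K (N - 1) (dbar u) := by
  refine ⟨dbar_smoothOn hu.smooth, fun x hx => dbar_eq_zero hK hu.zero hx, ?_⟩
  exact hu.order.dbarC.congr ((chartAt ℂ z₀).open_target.mem_nhds (mem_chart_target ℂ z₀))
    fun z hz => (dbar_coeff (chart_mem_atlas ℂ z₀) hz.1 u).symm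

theorem IsSingularFun.mono {K' : Set X} (hu : IsSingularFun z₀ K N u) (hK : K ⊆ K') :
    IsSingularFun z₀ K' N u :=
  ⟨hu.smooth, fun x hx => hu.zero x fun h => hx (hK h), hu.order⟩

theorem contMDiffOn_of_contDiffOn_charts [T1Space X]
    (hu : ∀ e ∈ atlas ℂ X, ContDiffOn ℝ ∞ (u ∘ e.symm) (e.target ∩ e.symm ⁻¹' {z₀}ᶜ)) :
    ContMDiffOn 𝓘(ℝ, ℂ) 𝓘(ℝ, ℂ) ∞ u {z₀}ᶜ := by
  intro x hx
  set e := chartAt ℂ x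
  have hl : e.symm (e x) = x := e.left_inv (mem_chart_source ℂ x)
  have h1 : ContMDiffAt 𝓘(ℝ, ℂ) 𝓘(ℝ, ℂ) ∞ (u ∘ e.symm) (e x) :=
    ((hu e (chart_mem_atlas ℂ x)).contDiffAt ((isOpen_target_inter_compl e z₀).mem_nhds
      ⟨mem_chart_target ℂ x, by rwa [mem_preimage, hl]⟩)).contMDiffAt
  have h2 : ContMDiffAt 𝓘(ℝ, ℂ) 𝓘(ℝ, ℂ) ∞ e x :=
    contMDiffAt_of_mem_maximalAtlas (IsManifold.chart_mem_maximalAtlas x) (mem_chart_source ℂ x)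
  refine ((h1.comp x h2).congr_of_eventuallyEq ?_).contMDiffWithinAt
  filter_upwards [e.open_source.mem_nhds (mem_chart_source ℂ x)] with y hy
  simp [e.left_inv hy]

theorem isSmoothFun_ofReal {θ : X → ℝ} (hθ : ContMDiff 𝓘(ℝ, ℂ) 𝓘(ℝ, ℝ) ∞ θ) :
    IsSmoothFun fun x => (θ x : ℂ) := fun _ he =>
  Complex.ofRealCLM.contDiff.comp_contDiffOn (hθ.comp_contMDiffOn
    (contMDiffOn_symm_of_mem_maximalAtlas (IsManifold.subset_maximalAtlas he))).contDiffOn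

/-- A partition of unity on a compact set, whose members live in charts; the point `z₀` is seen by
its own preferred chart only. -/
theorem exists_partition [T2Space X] [SecondCountableTopology X] (hK : IsCompact K) (z₀ : X) :
    ∃ (t : Finset X) (θ : X → X → ℂ), (∀ x, IsSmoothFun (θ x)) ∧
      (∀ x ∈ t, tsupport (θ x) ⊆ (chartAt ℂ x).source) ∧
      (∀ x ∈ t, x ≠ z₀ → z₀ ∉ tsupport (θ x)) ∧ ∀ y ∈ K, ∑ x ∈ t, θ x y = 1 := by
  classical
  have : LocallyCompactSpace X := ChartedSpace.locallyCompactSpace ℂ X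
  set W : X → Set X := fun x => if x = z₀ then (chartAt ℂ x).source else (chartAt ℂ x).source \ {z₀}
    with hW
  have hWo : ∀ x, IsOpen (W x) := fun x => by
    simp only [hW]
    split_ifs
    · exact (chartAt ℂ x).open_source
    · exact (chartAt ℂ x).open_source.sdiff isClosed_singleton
  have hxW : ∀ x, x ∈ W x := fun x => by
    simp only [hW]
    split_ifs with h
    · exact mem_chart_source ℂ x
    · exact ⟨mem_chart_source ℂ x, h⟩
  have hWs : ∀ x, W x ⊆ (chartAt ℂ x).source := fun x => by
    simp only [hW]
    split_ifs
    · exact le_rfl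
    · exact sdiff_subset
  obtain ⟨t, ht⟩ := hK.elim_finite_subcover W hWo fun x _ => mem_iUnion.2 ⟨x, hxW x⟩
  obtain ⟨ρ, hρ⟩ := SmoothPartitionOfUnity.exists_isSubordinate 𝓘(ℝ, ℂ) hK.isClosed
    (fun x : t => W x) (fun x => hWo x) (by
      intro y hy
      obtain ⟨x, hx, hyx⟩ := mem_iUnion₂.1 (ht hy)
      exact mem_iUnion.2 ⟨⟨x, hx⟩, hyx⟩)
  have hts : ∀ x : t, tsupport (fun y => (ρ x y : ℂ)) ⊆ W x := fun x => by
    refine Subset.trans (closure_mono fun y hy => ?_) (hρ x)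
    intro h0
    exact hy (by simp [h0])
  refine ⟨t, fun x y => if hx : x ∈ t then (ρ ⟨x, hx⟩ y : ℂ) else 0, fun x => ?_, fun x hx => ?_,
    fun x hx hxz => ?_, fun y hy => ?_⟩
  · by_cases hx : x ∈ t
    · simp only [hx, dite_true]
      exact isSmoothFun_ofReal (ρ ⟨x, hx⟩).contMDiff
    · simp only [hx, dite_false]
      exact fun _ _ => contDiffOn_const
  · simp only [hx, dite_true]
    exact (hts ⟨x, hx⟩).trans (hWs x)
  · simp only [hx, dite_true]
    intro h
    have := hts ⟨x, hx⟩ h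
    simp only [hW, hxz, if_false] at this
    exact this.2 rfl
  · have h1 := ρ.sum_eq_one hy
    rw [finsum_eq_sum_of_fintype] at h1
    rw [← Finset.sum_coe_sort t]
    simp only [Finset.coe_mem, dite_true, Subtype.coe_eta]
    exact_mod_cast h1

end Singular

/-! ### Coordinate patches adapted to the phase -/

section Patches

set_option linter.unusedSectionVars false

variable {X : Type*} [TopologicalSpace X] [ChartedSpace ℂ X] [IsManifold 𝓘(ℂ, ℂ) ω X]

/-- A coordinate patch for forms supported in `L`: in the chart `e` the set `L` is contained in the
open set `O`, which is relatively compact in the compact set `K`; the function `Φ` has no critical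
point in `O` except possibly `z₀`, with coordinate `p`. If the chart is not the preferred one at
`z₀`, then `z₀` has no coordinate in `K`, and `p` is any point off `K`. -/
structure IsPatch (Φ : X → ℂ) (z₀ : X) (V : Set X) (e : OpenPartialHomeomorph X ℂ) (L : Set X)
    (O K : Set ℂ) (p : ℂ) : Prop where
  mem_atlas : e ∈ atlas ℂ X
  subset_source : L ⊆ e.source
  morse : IsMorsePhase O (e '' L) p (Φ ∘ e.symm)
  isCompact : IsCompact K
  subset_target : K ⊆ e.target
  closure_subset : closure O ⊆ interior K
  symm_mem : ∀ z ∈ K, e.symm z ∈ V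
  center : (e = chartAt ℂ z₀ ∧ p = e z₀) ∨ (p ∉ K ∧ ∀ z ∈ K, e.symm z ≠ z₀)

variable {Φ : X → ℂ} {z₀ : X} {V L : Set X} {e : OpenPartialHomeomorph X ℂ} {O K : Set ℂ} {p : ℂ}

theorem IsPatch.isOpen (h : IsPatch Φ z₀ V e L O K p) : IsOpen O := h.morse.isOpen

theorem IsPatch.subset (h : IsPatch Φ z₀ V e L O K p) : O ⊆ K :=
  subset_closure.trans (h.closure_subset.trans interior_subset)

theorem IsPatch.eq_center (h : IsPatch Φ z₀ V e L O K p) {z : ℂ} (hz : z ∈ K) :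
    z = p ↔ e.symm z = z₀ := by
  rcases h.center with ⟨he, hp⟩ | ⟨hp, hne⟩
  · have hs : z₀ ∈ e.source := he ▸ mem_chart_source ℂ z₀
    rw [hp]
    constructor
    · rintro rfl
      exact e.left_inv hs
    · rintro rfl
      exact (e.right_inv (h.subset_target hz)).symm
  · exact iff_of_false (fun hzp => hp (hzp ▸ hz)) (hne z hz)

/-- A function that is smooth off `z₀` is a symbol at `p` in a patch: if `z₀` belongs to the patch, by
assumption, and otherwise because there is no singularity and `p` has a positive distance from `K`. -/
theorem IsPatch.isSymbol [T1Space X] (h : IsPatch Φ z₀ V e L O K p) {N : ℤ} {c : ℂ → ℂ}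
    (hc : ContDiffOn ℝ ∞ c (e.target ∩ e.symm ⁻¹' {z₀}ᶜ))
    (ho : e = chartAt ℂ z₀ → HasOrderAt c (chartAt ℂ z₀ z₀) N) :
    IsSymbol (univ : Set Unit) O p N fun _ => c := by
  rcases h.center with ⟨he, hp⟩ | ⟨hp, hne⟩
  · obtain ⟨r, hr, hs⟩ := ho he
    have hpe : p = chartAt ℂ z₀ z₀ := by rw [hp, he]
    rw [← hpe] at hs
    refine IsSymbol.extend hr e.open_target h.isCompact h.subset_target h.subset
      (hs.mono id (fun _ _ => trivial) inter_subset_right) (hc.mono fun z hz => ⟨hz.1, fun h0 => ?_⟩)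
    refine hz.2 ?_
    rw [mem_singleton_iff, hp, ← e.right_inv hz.1, h0]
  · obtain ⟨r, hr, hrK⟩ := Metric.isOpen_iff.1 h.isCompact.isClosed.isOpen_compl p hp
    have hem : O ∩ Metric.ball p r = ∅ := by
      refine eq_empty_of_forall_notMem fun z hz => hrK hz.2 (h.subset hz.1)
    refine IsSymbol.extend hr (isOpen_target_inter_compl e z₀) h.isCompact
      (fun z hz => ⟨h.subset_target hz, hne z hz⟩) h.subset ?_ (hc.mono sdiff_subset)
    rw [hem]
    have h0 : IsSymbol (univ : Set Unit) ∅ p N fun _ _ => (0 : ℂ) :=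
      ⟨fun _ _ => contDiffOn_const, fun m => symbolBound_zero_fun m⟩
    exact h0.congr isOpen_empty fun _ _ z hz => hz.1.elim

theorem IsPatch.isSymbol_form [T1Space X] (h : IsPatch Φ z₀ V e L O K p) {N : ℤ} {L' : Set X}
    {f : Form01 X} (hf : IsSingularForm z₀ L' N f) :
    IsSymbol (univ : Set Unit) O p N fun _ => f.coeff e :=
  h.isSymbol (hf.smooth e h.mem_atlas) fun he => he ▸ hf.order

theorem IsPatch.isSymbol_fun [T1Space X] (h : IsPatch Φ z₀ V e L O K p) {N : ℤ} {L' : Set X}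
    {u : X → ℂ} (hu : IsSingularFun z₀ L' N u) :
    IsSymbol (univ : Set Unit) O p N fun _ => u ∘ e.symm :=
  h.isSymbol (hu.smooth e h.mem_atlas) fun he => he ▸ hu.order

/-- Every compact set of a chart domain that contains no critical point of `Φ` but possibly the
Morse point `z₀` has an adapted patch, provided that `z₀` is seen by its preferred chart only. -/
theorem exists_isPatch [T2Space X] (hΦ : MDifferentiable 𝓘(ℂ, ℂ) 𝓘(ℂ, ℂ) Φ)
    (hz₀ : IsMorseCritical Φ z₀) (hV : IsOpen V) (he : e ∈ atlas ℂ X) (hL : IsCompact L)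
    (hLe : L ⊆ e.source) (hLV : L ⊆ V) (hcrit : ∀ x ∈ L, IsCritical Φ x → x = z₀)
    (hc : e = chartAt ℂ z₀ ∨ z₀ ∉ L) : ∃ O K p, IsPatch Φ z₀ V e L O K p := by
  have hφ := differentiableOn_comp_symm hΦ he
  have hφ' : DifferentiableOn ℂ (deriv (Φ ∘ e.symm)) e.target := hφ.deriv e.open_target
  have hS : IsCompact (e '' L) := hL.image_of_continuousOn (e.continuousOn.mono hLe)
  have hVo : IsOpen (e.target ∩ e.symm ⁻¹' V) := e.isOpen_inter_preimage_symm hV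
  have hSt : ∀ z ∈ e '' L, z ∈ e.target ∧ e.symm z ∈ L := by
    rintro _ ⟨x, hx, rfl⟩
    exact ⟨e.map_source (hLe hx), by rwa [e.left_inv (hLe hx)]⟩
  -- A continuous multiple of `|φ'|`, or of `|φ' / (z - p)|` at the critical point, which does not
  -- vanish on `L`.
  obtain ⟨W, hW, hWt, hSW, D⟩ : ∃ W : Set ℂ, IsOpen W ∧ W ⊆ e.target ∩ e.symm ⁻¹' V ∧ e '' L ⊆ W ∧
      ∀ K ⊆ W, IsCompact K → ∃ p, ((e = chartAt ℂ z₀ ∧ p = e z₀) ∨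
        (p ∉ K ∧ ∀ z ∈ K, e.symm z ≠ z₀)) ∧
        ∃ c > 0, ∀ z ∈ K, c * ‖z - p‖ ≤ ‖deriv (Φ ∘ e.symm) z‖ := by
    by_cases hez : e = chartAt ℂ z₀
    · have hz₀s : z₀ ∈ e.source := hez ▸ mem_chart_source ℂ z₀
      have hpt : e z₀ ∈ e.target := e.map_source hz₀s
      have hd0 : deriv (Φ ∘ e.symm) (e z₀) = 0 := by
        rw [← isCritical_iff hΦ he hpt, e.left_inv hz₀s]
        exact hz₀.1
      set ds := dslope (deriv (Φ ∘ e.symm)) (e z₀) with hds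
      have hcont : ContinuousOn ds e.target := (continuousOn_dslope
        (e.open_target.mem_nhds hpt)).2 ⟨hφ'.continuousOn, hφ'.differentiableAt
          (e.open_target.mem_nhds hpt)⟩
      have hmul : ∀ z, (z - e z₀) * ds z = deriv (Φ ∘ e.symm) z := fun z => by
        have := sub_smul_dslope (deriv (Φ ∘ e.symm)) (e z₀) z
        rwa [smul_eq_mul, hd0, sub_zero] at this
      refine ⟨(e.target ∩ e.symm ⁻¹' V) ∩ (e.target ∩ ds ⁻¹' {0}ᶜ), hVo.inter
        (hcont.isOpen_inter_preimage e.open_target isClosed_singleton.isOpen_compl),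
        inter_subset_left, fun z hz => ⟨⟨(hSt z hz).1, hLV (hSt z hz).2⟩, (hSt z hz).1, ?_⟩,
        fun K hKW hK => ⟨e z₀, Or.inl ⟨hez, rfl⟩, ?_⟩⟩
      · intro h0
        have h0' : ds z = 0 := h0
        by_cases hzp : z = e z₀
        · rw [hzp, hds, dslope_same] at h0'
          have := hz₀.2
          rw [← hez] at this
          exact this h0'
        · have h1 : deriv (Φ ∘ e.symm) z = 0 := by rw [← hmul, h0', mul_zero]
          have h2 := hcrit _ (hSt z hz).2 ((isCritical_iff hΦ he (hSt z hz).1).2 h1)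
          exact hzp (by rw [← h2, e.right_inv (hSt z hz).1])
      · obtain ⟨c, hc, hcK⟩ : ∃ c > 0, ∀ z ∈ K, c ≤ ‖ds z‖ :=
          hK.exists_forall_le' (hcont.mono fun z hz => (hKW hz).1.1).norm
            fun z hz => norm_pos_iff.2 (hKW hz).2.2
        refine ⟨c, hc, fun z hz => ?_⟩
        rw [← hmul, norm_mul, mul_comm]
        exact mul_le_mul_of_nonneg_left (hcK z hz) (norm_nonneg _)
    · have hzL : z₀ ∉ L := hc.resolve_left hez
      refine ⟨(e.target ∩ e.symm ⁻¹' (V ∩ {z₀}ᶜ)) ∩ (e.target ∩ deriv (Φ ∘ e.symm) ⁻¹' {0}ᶜ),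
        (e.isOpen_inter_preimage_symm (hV.inter isClosed_singleton.isOpen_compl)).inter
        (hφ'.continuousOn.isOpen_inter_preimage e.open_target isClosed_singleton.isOpen_compl),
        fun z hz => ⟨hz.1.1, hz.1.2.1⟩, fun z hz => ⟨⟨(hSt z hz).1, hLV (hSt z hz).2, fun h => ?_⟩,
          (hSt z hz).1, fun h0 => ?_⟩,
        fun K hKW hK => ?_⟩
      · have h' : e.symm z = z₀ := h
        exact hzL (h' ▸ (hSt z hz).2)
      · have h2 := hcrit _ (hSt z hz).2 ((isCritical_iff hΦ he (hSt z hz).1).2 h0)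
        exact hzL (h2 ▸ (hSt z hz).2)
      · obtain ⟨p, hp⟩ := (Set.ne_univ_iff_exists_notMem K).1 hK.ne_univ
        obtain ⟨c, hc, hcK⟩ : ∃ c > 0, ∀ z ∈ K, c ≤ ‖deriv (Φ ∘ e.symm) z‖ :=
          hK.exists_forall_le' (hφ'.continuousOn.mono fun z hz => (hKW hz).2.1).norm
            fun z hz => norm_pos_iff.2 (hKW hz).2.2
        obtain ⟨R, hR⟩ := hK.isBounded.exists_norm_le
        have hRp : 0 < |R| + ‖p‖ + 1 := by positivity
        refine ⟨p, Or.inr ⟨hp, fun z hz => (hKW hz).1.2.2⟩, c / (|R| + ‖p‖ + 1), by positivity,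
          fun z hz => ?_⟩
        have h1 : ‖z - p‖ ≤ |R| + ‖p‖ + 1 := by
          have := norm_sub_le z p
          have := hR z hz
          have := le_abs_self R
          linarith
        rw [div_mul_eq_mul_div, div_le_iff₀ hRp]
        exact mul_le_mul (hcK z hz) h1 (norm_nonneg _) (norm_nonneg _)
  obtain ⟨K, hK, hSK, hKW⟩ := exists_compact_between hS hW hSW
  obtain ⟨K', hK', hSK', hK'K⟩ := exists_compact_between hS isOpen_interior hSK
  obtain ⟨p, hp, c, hc0, hcK⟩ := D K hKW hK
  have hKt : K ⊆ e.target := fun z hz => (hWt (hKW hz)).1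
  have hOK : interior K' ⊆ K := interior_subset.trans (hK'K.trans interior_subset)
  refine ⟨interior K', K, p, he, hLe, ⟨isOpen_interior, hS, hSK', hφ.mono (hOK.trans hKt), ?_, ?_⟩,
    hK, hKt, (hK'.isClosed.closure_subset_iff.2 interior_subset).trans hK'K,
    fun z hz => (hWt (hKW hz)).2, hp⟩
  · intro z hz hzp h0
    have h1 := hcK z (hOK hz)
    rw [h0, norm_zero] at h1
    have : 0 < ‖z - p‖ := norm_pos_iff.2 (sub_ne_zero.2 hzp)
    nlinarith
  · exact isSymbol_conjDerivInv hc0 e.open_target isOpen_interior hK hKt hOK hφ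
      fun z hz => hcK z (hOK hz)

end Patches

/-! ### The Cauchy kernel in a patch -/

section Kernel

set_option linter.unusedSectionVars false

variable {X : Type*} [TopologicalSpace X] [ChartedSpace ℂ X] [IsManifold 𝓘(ℂ, ℂ) ω X]
  {Φ : X → ℂ} {z₀ : X} {V L : Set X} {e : OpenPartialHomeomorph X ℂ} {O K : Set ℂ} {p : ℂ}
  {κ : X → Form10 X}

theorem IsCauchyKernel.continuousOn (hκ : IsCauchyKernel κ) (he : e ∈ atlas ℂ X) :
    ContinuousOn (fun q : X × ℂ => (κ q.1).coeff e q.2) {q | q.2 ∈ e.target ∧ e.symm q.2 ≠ q.1} := by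
  rintro ⟨w, z⟩ ⟨hz, hzw⟩
  set e₀ := chartAt ℂ w
  have hnhds : e₀.source ×ˢ (univ : Set ℂ) ∈ 𝓝 (w, z) :=
    (e₀.open_source.prod isOpen_univ).mem_nhds ⟨mem_chart_source ℂ w, trivial⟩
  rw [← continuousWithinAt_inter hnhds]
  have h1 := (hκ.smooth_off_diag e₀ (chart_mem_atlas ℂ w) e he).continuousOn
  have h2 : ContinuousOn (fun q : X × ℂ => (e₀ q.1, q.2)) (e₀.source ×ˢ univ) :=
    (e₀.continuousOn.comp continuousOn_fst fun q hq => hq.1).prodMk continuousOn_snd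
  have h3 := h1.comp (h2.mono (inter_subset_right (s := {q : X × ℂ | q.2 ∈ e.target ∧
    e.symm q.2 ≠ q.1}))) fun q hq => by
      refine ⟨e₀.map_source hq.2.1, hq.1.1, ?_⟩
      change e₀.symm (e₀ q.1) ≠ e.symm q.2
      rw [e₀.left_inv hq.2.1]
      exact hq.1.2.symm
  refine (h3.congr fun q hq => ?_) _ ⟨⟨hz, hzw⟩, mem_chart_source ℂ w, trivial⟩
  change (κ q.1).coeff e q.2 = (κ (e₀.symm (e₀ q.1))).coeff e q.2
  rw [e₀.left_inv hq.2.1]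

open Classical in
/-- The position of the pole of `κ(w, ·)` in a patch. If there is none in `K`, the value is `p + 1`,
so that it differs from `p` whenever `w ≠ z₀`. -/
def pole (e : OpenPartialHomeomorph X ℂ) (K : Set ℂ) (p : ℂ) (w : X) : ℂ :=
  if w ∈ e.source ∧ e w ∈ K then e w else p + 1

open Classical in
/-- The residue of `κ(w, ·)` in a patch, at `pole e K p w`. -/
def residue (e : OpenPartialHomeomorph X ℂ) (K : Set ℂ) (w : X) : ℂ :=
  if w ∈ e.source ∧ e w ∈ K then 1 else 0

theorem IsPatch.ne_pole (h : IsPatch Φ z₀ V e L O K p) {w : X} (hw : w ≠ z₀) :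
    p ≠ pole e K p w := by
  unfold pole
  split_ifs with hc
  · intro hp
    have := (h.eq_center hc.2).1 hp.symm
    exact hw (by rw [← this, e.left_inv hc.1])
  · simp

theorem IsPatch.symm_ne (h : IsPatch Φ z₀ V e L O K p) {w : X} {z : ℂ} (hz : z ∈ O)
    (hzq : z ≠ pole e K p w) : e.symm z ≠ w := by
  rintro rfl
  refine hzq ?_
  have ht := h.subset_target (h.subset hz)
  rw [pole, if_pos ⟨e.map_target ht, by rw [e.right_inv ht]; exact h.subset hz⟩, e.right_inv ht]

theorem IsPatch.differentiableAt_kernel [T1Space X] (h : IsPatch Φ z₀ V e L O K p) {U : Set X}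
    (hU : IsOpen U) (hκU : IsHolomorphicInSecond κ U) (hVU : V ⊆ U) {w : X} {z : ℂ} (hz : z ∈ O)
    (hzq : z ≠ pole e K p w) : DifferentiableAt ℂ ((κ w).coeff e) z := by
  refine (hκU w e h.mem_atlas).differentiableAt (IsOpen.mem_nhds ?_
    ⟨h.subset_target (h.subset hz), hVU (h.symm_mem z (h.subset hz)), h.symm_ne hz hzq⟩)
  exact e.isOpen_inter_preimage_symm (hU.inter (isOpen_compl_singleton (x := w)))

/-- Uniformly for `w` in a compact set, the kernel is bounded in a patch after its principal part is
subtracted: if `w` has a coordinate in `K`, by the expansion on the diagonal, and otherwise because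
`w` stays away from the closure of `O`, which lies in the interior of `K`. -/
theorem IsPatch.exists_norm_kernel_sub_le (h : IsPatch Φ z₀ V e L O K p) (hκ : IsCauchyKernel κ)
    {Y : Set X} (hY : IsCompact Y) : ∃ C : ℝ, 0 ≤ C ∧ ∀ w ∈ Y, ∀ z ∈ O, z ≠ pole e K p w →
      ‖(κ w).coeff e z - residue e K w / (z - pole e K p w)‖ ≤ C := by
  obtain ⟨H, hH, hκH⟩ := hκ.diag e h.mem_atlas
  obtain ⟨C₁, hC₁⟩ := (h.isCompact.prod h.isCompact).exists_bound_of_continuousOn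
    (hH.continuousOn.mono (prod_mono h.subset_target h.subset_target))
  have hOc : IsCompact (closure O) :=
    h.isCompact.of_isClosed_subset isClosed_closure (h.closure_subset.trans interior_subset)
  have hAc : IsCompact (Y \ (e.source ∩ e ⁻¹' interior K)) :=
    hY.diff (e.isOpen_inter_preimage isOpen_interior)
  obtain ⟨C₂, hC₂⟩ := (hAc.prod hOc).exists_bound_of_continuousOn
    ((hκ.continuousOn h.mem_atlas).mono fun q hq => by
      have hz := h.closure_subset hq.2
      have ht := h.subset_target (interior_subset hz)
      refine ⟨ht, fun hzw => hq.1.2 ?_⟩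
      rw [← hzw]
      exact ⟨e.map_target ht, by rwa [mem_preimage, e.right_inv ht]⟩)
  refine ⟨max (max C₁ C₂) 0, le_max_right _ _, fun w hw z hz hzq => ?_⟩
  refine le_trans ?_ (le_max_left _ _)
  by_cases hc : w ∈ e.source ∧ e w ∈ K
  · refine le_trans ?_ (le_max_left _ _)
    rw [pole, if_pos hc] at hzq ⊢
    rw [residue, if_pos hc]
    have h1 := hκH (e w) (e.map_source hc.1) z (h.subset_target (h.subset hz)) hzq.symm
    rw [e.left_inv hc.1] at h1
    rw [h1, add_sub_cancel_left]
    exact hC₁ (e w, z) ⟨hc.2, h.subset hz⟩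
  · refine le_trans ?_ (le_max_right _ _)
    rw [residue, if_neg hc, zero_div, sub_zero]
    exact hC₂ (w, z) ⟨⟨hw, fun h' => hc ⟨h'.1, interior_subset h'.2⟩⟩, subset_closure hz⟩

theorem IsPatch.exists_isKernel [T1Space X] (h : IsPatch Φ z₀ V e L O K p)
    (hκ : IsCauchyKernel κ) {U : Set X} (hU : IsOpen U) (hκU : IsHolomorphicInSecond κ U)
    (hVU : V ⊆ U) {Y : Set X} (hY : IsCompact Y) :
    ∃ B : ℝ, ∀ w ∈ Y, IsKernel O (pole e K p w) B ((κ w).coeff e) := by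
  obtain ⟨C, hC0, hC⟩ := h.exists_norm_kernel_sub_le hκ hY
  obtain ⟨R, hR⟩ := h.isCompact.isBounded.exists_norm_le
  set D := 2 * |R| + ‖p‖ + 1 with hD
  refine ⟨1 + C * D, fun w hw => ⟨fun z hz hzq => h.differentiableAt_kernel hU hκU hVU hz hzq,
    fun z hz hzq => ?_, by positivity⟩⟩
  have hpos : 0 < ‖z - pole e K p w‖ := norm_pos_iff.2 (sub_ne_zero.2 hzq)
  have hzR := (hR z (h.subset hz)).trans (le_abs_self R)
  have hq : ‖z - pole e K p w‖ ≤ D := by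
    refine (norm_sub_le _ _).trans ?_
    have : ‖pole e K p w‖ ≤ |R| + ‖p‖ + 1 := by
      unfold pole
      split_ifs with hc
      · have := (hR _ hc.2).trans (le_abs_self R)
        have := norm_nonneg p
        linarith
      · refine (norm_add_le _ _).trans ?_
        rw [norm_one]
        have := abs_nonneg R
        linarith
    linarith
  have hr : ‖residue e K w / (z - pole e K p w)‖ ≤ ‖z - pole e K p w‖⁻¹ := by
    unfold residue
    split_ifs
    · rw [norm_div, norm_one, one_div]
    · rw [zero_div, norm_zero]
      positivity
  calc ‖(κ w).coeff e z‖ = ‖((κ w).coeff e z - residue e K w / (z - pole e K p w)) +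
        residue e K w / (z - pole e K p w)‖ := by rw [sub_add_cancel]
    _ ≤ C + ‖z - pole e K p w‖⁻¹ := (norm_add_le _ _).trans (add_le_add (hC w hw z hz hzq) hr)
    _ ≤ (1 + C * D) * ‖z - pole e K p w‖⁻¹ := by
        have : C ≤ C * D * ‖z - pole e K p w‖⁻¹ := by
          rw [mul_assoc]
          refine le_mul_of_one_le_right hC0 ?_
          rw [← div_eq_mul_inv, one_le_div hpos]
          exact hq
        linarith

end Kernel

/-! ### Forms supported in a patch -/

section PatchForms

set_option linter.unusedSectionVars false

variable {X : Type*} [TopologicalSpace X] [ChartedSpace ℂ X] [IsManifold 𝓘(ℂ, ℂ) ω X]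
  {Φ : X → ℂ} {z₀ : X} {V L : Set X} {e : OpenPartialHomeomorph X ℂ} {O K : Set ℂ} {p : ℂ}
  {κ : X → Form10 X} {f : Form01 X} {N : ℤ}

theorem IsPatch.indicator_coeff_eq_zero (h : IsPatch Φ z₀ V e L O K p) (hf : ∀ x ∉ L, f x = 0)
    {z : ℂ} (hz : z ∉ e '' L) : O.indicator (f.coeff e) z = 0 := by
  by_cases hzO : z ∈ O
  · rw [indicator_of_mem hzO, Form01.coeff, hf]
    · rfl
    · exact fun hL => hz ⟨_, hL, e.right_inv (h.subset_target (h.subset hzO))⟩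
  · exact indicator_of_notMem hzO _

theorem IsPatch.isSymbol_indicator [T1Space X] (h : IsPatch Φ z₀ V e L O K p) {L' : Set X}
    (hf : IsSingularForm z₀ L' N f) :
    IsSymbol (univ : Set Unit) O p N fun _ => O.indicator (f.coeff e) :=
  (h.isSymbol_form hf).congr h.isOpen fun _ _ _ hz => (indicator_of_mem hz.1 _).symm

theorem IsPatch.indicator_target_mul (h : IsPatch Φ z₀ V e L O K p) (hf : ∀ x ∉ L, f x = 0)
    (a : ℂ → ℂ) : e.target.indicator (fun z => a z * f.coeff e z) =
      fun z => a z * O.indicator (f.coeff e) z := by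
  ext z
  by_cases hzO : z ∈ O
  · rw [indicator_of_mem (h.subset_target (h.subset hzO)), indicator_of_mem hzO]
  · rw [indicator_of_notMem hzO, mul_zero]
    by_cases hzt : z ∈ e.target
    · rw [indicator_of_mem hzt, Form01.coeff, hf]
      · exact mul_zero _
      · intro hL
        exact hzO (h.morse.subset ⟨_, hL, e.right_inv hzt⟩)
    · exact indicator_of_notMem hzt _

theorem osc_comp_symm {ψ : X → ℝ} (hψ : ∀ x, ψ x = (Φ x).im) (t h : ℝ)
    (e : OpenPartialHomeomorph X ℂ) (z : ℂ) : osc t ψ h (e.symm z) = phase t h (Φ ∘ e.symm) z := by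
  rw [osc, phase, hψ]
  rfl

variable [SecondCountableTopology X] [Nonempty X] [MeasurableSpace X] [BorelSpace X]

theorem IsPatch.intWedge_eq (h : IsPatch Φ z₀ V e L O K p) (g : ConformalMetric X)
    (hf : ∀ x ∉ L, f x = 0) (α : Form10 X) :
    intWedge g α f = -2 * Complex.I * ∫ z, α.coeff e z * O.indicator (f.coeff e) z := by
  rw [RiemannSurface.intWedge_eq g h.mem_atlas α f fun x hx => hf x fun hL => hx (h.subset_source hL),
    ← integral_indicator e.open_target.measurableSet, h.indicator_target_mul hf]

theorem IsPatch.integrable_iff (h : IsPatch Φ z₀ V e L O K p) (g : ConformalMetric X)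
    (hf : ∀ x ∉ L, f x = 0) (α : Form10 X) : Integrable (starWedge g α f) g.area ↔
      Integrable fun z => α.coeff e z * O.indicator (f.coeff e) z := by
  rw [integrable_starWedge_iff g h.mem_atlas α f fun x hx => hf x fun hL => hx (h.subset_source hL),
    ← integrable_indicator_iff e.open_target.measurableSet, h.indicator_target_mul hf]

theorem smul_form_eq_zero {θ : X → ℂ} {x : X} (hf : f x = 0) : θ x • f x = 0 := by
  rw [hf]
  exact smul_zero (A := ℂ →L⋆[ℂ] ℂ) (θ x)

theorem indicator_smul_coeff (θ : X → ℂ) (z : ℂ) :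
    O.indicator (Form01.coeff (fun x => θ x • f x) e) z =
      θ (e.symm z) * O.indicator (f.coeff e) z := by
  by_cases hzO : z ∈ O
  · rw [indicator_of_mem hzO, indicator_of_mem hzO, smul_coeff]
  · rw [indicator_of_notMem hzO, indicator_of_notMem hzO, mul_zero]

theorem IsPatch.dbarInvPsi_eq (h : IsPatch Φ z₀ V e L O K p) (g : ConformalMetric X) {ψ : X → ℝ}
    (hψ : ∀ x, ψ x = (Φ x).im) (hf : ∀ x ∉ L, f x = 0) (ħ : ℝ) (w : X) :
    dbarInvPsi g κ ψ ħ f w = -(Real.pi : ℂ)⁻¹ * ∫ z, phase (-2) ħ (Φ ∘ e.symm) z *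
      ((κ w).coeff e z * O.indicator (f.coeff e) z) := by
  rw [dbarInvPsi, dbarInv, h.intWedge_eq g fun x hx => smul_form_eq_zero (hf x hx), ← mul_assoc]
  have hpi : (Real.pi : ℂ) ≠ 0 := by exact_mod_cast Real.pi_ne_zero
  congr 1
  · field_simp
  · congr 1
    ext z
    rw [indicator_smul_coeff, osc_comp_symm hψ]
    ring

theorem norm_neg_inv_pi_mul_le (c : ℂ) : ‖-(Real.pi : ℂ)⁻¹ * c‖ ≤ ‖c‖ := by
  rw [norm_mul, norm_neg, norm_inv, Complex.norm_real, Real.norm_of_nonneg Real.pi_pos.le]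
  refine mul_le_of_le_one_left (norm_nonneg _) (inv_le_one_of_one_le₀ ?_)
  linarith [Real.pi_gt_three]

variable [T1Space X]

theorem IsPatch.integrable_starWedge_kernel (h : IsPatch Φ z₀ V e L O K p) (g : ConformalMetric X)
    {ψ : X → ℝ} (hψ : ∀ x, ψ x = (Φ x).im) (hf : IsSingularForm z₀ L N f) (hN : -1 ≤ N) (t ħ : ℝ)
    {w : X} (hw : w ≠ z₀) {B : ℝ} (hk : IsKernel O (pole e K p w) B ((κ w).coeff e)) :
    Integrable (starWedge g (κ w) fun x => osc t ψ ħ x • f x) g.area := by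
  rw [h.integrable_iff g fun x hx => smul_form_eq_zero (hf.zero x hx)]
  have hs := h.isSymbol_indicator hf
  obtain ⟨C, -, hC⟩ := (hs.bound 0).exists_norm_le h.morse.isCompact h.morse.subset (M := -1) hN
  refine h.morse.integrable_kernel_mul hk (h.ne_pole hw) (C := C) ?_ (fun z hz => ?_)
    fun z hz hzp => ?_
  · refine (((contDiffOn_phase t ħ h.isOpen h.morse.holomorphic).mono sdiff_subset).mul
      (hs.smooth () trivial)).congr fun z _ => ?_
    rw [indicator_smul_coeff, osc_comp_symm hψ]
  · rw [indicator_smul_coeff, h.indicator_coeff_eq_zero hf.zero hz, mul_zero]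
  · rw [indicator_smul_coeff, osc_comp_symm hψ, norm_mul, norm_phase, one_mul, ← zpow_neg_one]
    exact hC () trivial z hz hzp

/-- The Cauchy–Pompeiu formula: `∂̄⁻¹ ∂̄ u = u` for functions supported in a patch. -/
theorem IsPatch.dbarInv_dbar (h : IsPatch Φ z₀ V e L O K p) (g : ConformalMetric X)
    (hκ : IsCauchyKernel κ) {U : Set X} (hU : IsOpen U) (hκU : IsHolomorphicInSecond κ U)
    (hVU : V ⊆ U) (hL : IsClosed L) {u : X → ℂ} (hu : IsSingularFun z₀ L N u) (hN : 0 ≤ N)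
    {w : X} (hw : w ≠ z₀) : dbarInv g κ (dbar u) w = u w := by
  have hdu := hu.dbar hL
  have hO := h.isOpen
  set v := O.indicator (u ∘ e.symm) with hv
  have hvs : IsSymbol (univ : Set Unit) O p N fun _ => v :=
    (h.isSymbol_fun hu).congr hO fun _ _ z hz => (indicator_of_mem hz.1 _).symm
  have hv0 : ∀ z ∉ e '' L, v z = 0 := fun z hz => by
    by_cases hzO : z ∈ O
    · rw [hv, indicator_of_mem hzO, Function.comp_apply, hu.zero]
      exact fun hL => hz ⟨_, hL, e.right_inv (h.subset_target (h.subset hzO))⟩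
    · exact indicator_of_notMem hzO _
  have hS := h.morse.isCompact
  have hdv : dbarC v = O.indicator ((dbar u).coeff e) := by
    ext z
    by_cases hzO : z ∈ O
    · rw [indicator_of_mem hzO, dbar_coeff h.mem_atlas (h.subset_target (h.subset hzO))]
      refine dbarC_congr ?_
      filter_upwards [hO.mem_nhds hzO] with y hy using indicator_of_mem hy _
    · rw [indicator_of_notMem hzO, dbarC_eq_zero_of_notMem hS.isClosed hv0
        fun hz => hzO (h.morse.subset hz)]
  obtain ⟨C₁, hC₁0, hC₁⟩ := (hvs.bound 0).exists_norm_le hS h.morse.subset (M := 0) hN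
  obtain ⟨C₂, hC₂0, hC₂⟩ := ((hvs.dbarC hO).bound 0).exists_norm_le hS h.morse.subset (M := -1)
    (by lia)
  obtain ⟨C, hC0, hC⟩ := h.exists_norm_kernel_sub_le hκ (isCompact_singleton (x := w))
  have key : ∫ z, (κ w).coeff e z * dbarC v z =
      -(Real.pi * (residue e K w * v (pole e K p w))) := by
    refine integral_mul_dbarC (p := p) (C := max C₁ C₂) hO hS h.morse.subset
      (Or.inr (h.ne_pole hw)) ?_ hv0 (fun z hzp => ?_) (fun z hzp => ?_)
      (fun z hz hzq => h.differentiableAt_kernel hU hκU hVU hz hzq) (hC w rfl)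
    · refine contDiffOn_compl_of_eq_zero hO hS.isClosed isClosed_singleton h.morse.subset ?_ hv0
      exact (hvs.smooth () trivial).of_le (by exact_mod_cast le_top)
    · refine le_trans ?_ (le_max_left C₁ C₂)
      by_cases hz : z ∈ e '' L
      · simpa using hC₁ () trivial z hz hzp
      · rw [hv0 z hz, norm_zero]
        exact hC₁0
    · by_cases hz : z ∈ e '' L
      · rw [← zpow_neg_one]
        exact (hC₂ () trivial z hz hzp).trans (by gcongr; exact le_max_right C₁ C₂)
      · rw [dbarC_eq_zero_of_notMem hS.isClosed hv0 hz, norm_zero]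
        have := le_max_left C₁ C₂
        positivity
  have hval : residue e K w * v (pole e K p w) = u w := by
    unfold residue pole
    split_ifs with hc
    · rw [one_mul]
      by_cases hwO : e w ∈ O
      · rw [hv, indicator_of_mem hwO, Function.comp_apply, e.left_inv hc.1]
      · rw [hv, indicator_of_notMem hwO, hu.zero]
        exact fun hwL => hwO (h.morse.subset ⟨w, hwL, rfl⟩)
    · rw [zero_mul, hu.zero]
      exact fun hwL => hc ⟨h.subset_source hwL, h.subset (h.morse.subset ⟨w, hwL, rfl⟩)⟩
  rw [dbarInv, h.intWedge_eq g hdu.zero, ← hdv, key, hval]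
  have hpi : (Real.pi : ℂ) ≠ 0 := by exact_mod_cast Real.pi_ne_zero
  field_simp

end PatchForms

/-! ### Asymptotics in `L^p` -/

section Lp

set_option linter.unusedSectionVars false

variable {X : Type*} [TopologicalSpace X] [ChartedSpace ℂ X] [SecondCountableTopology X]
  [Nonempty X] [MeasurableSpace X] [BorelSpace X] {g : ConformalMetric X} {M : Set X} {q : ℝ≥0∞}
  {s : ℝ} {u v : ℝ → X → ℂ}

theorem IsLittleOLp.congr' (hu : IsLittleOLp g M q s u)
    (huv : ∀ h > 0, u h =ᵐ[g.area.restrict M] v h) : IsLittleOLp g M q s v := by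
  intro c hc
  filter_upwards [hu c hc, self_mem_nhdsWithin] with h hh hpos
  have e := huv h hpos
  exact ⟨hh.1.ae_eq e, by rw [← eLpNorm_congr_ae e]; exact hh.2⟩

theorem IsLittleOLp.sum (hq : 1 ≤ q) {ι : Type*} (t : Finset ι) {u : ι → ℝ → X → ℂ}
    (hu : ∀ i ∈ t, IsLittleOLp g M q s (u i)) :
    IsLittleOLp g M q s fun h w => ∑ i ∈ t, u i h w := by
  classical
  induction t using Finset.induction_on with
  | empty =>
    intro c hc
    refine Eventually.of_forall fun h => ?_
    simp
  | insert a t ha ih =>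
    intro c hc
    have h1 := hu a (Finset.mem_insert_self a t) (c / 2) (by positivity)
    have h2 := ih (fun i hi => hu i (Finset.mem_insert_of_mem hi)) (c / 2) (by positivity)
    filter_upwards [h1, h2, self_mem_nhdsWithin] with h hh1 hh2 hpos
    have hpos' : 0 < h := hpos
    have e : (fun w => ∑ i ∈ insert a t, u i h w) = u a h + fun w => ∑ i ∈ t, u i h w := by
      ext w
      simp [Finset.sum_insert ha]
    rw [e]
    refine ⟨hh1.1.add hh2.1, (eLpNorm_add_le hh1.1.1 hh2.1.1 hq).trans
      ((add_le_add hh1.2 hh2.2).trans (le_of_eq ?_))⟩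
    rw [← ENNReal.ofReal_add (by positivity) (by positivity)]
    congr 1
    ring

theorem isBigOLp_of_bound (hM : g.area M ≠ ⊤) (hMo : IsOpen M) {C : ℝ}
    (hm : ∀ h : ℝ, AEStronglyMeasurable (u h) (g.area.restrict M))
    (hC : ∀ h : ℝ, 0 < h → h ≤ 1 → ∀ w ∈ M, ‖u h w‖ ≤ C * h ^ s) : IsBigOLp g M q s u := by
  have : IsFiniteMeasure (g.area.restrict M) := ⟨by simpa using hM.lt_top⟩
  refine ⟨((g.area M) ^ q.toReal⁻¹).toReal * C, ?_⟩
  filter_upwards [Ioc_mem_nhdsGT (zero_lt_one (α := ℝ))] with h hh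
  have hb : ∀ᵐ w ∂g.area.restrict M, ‖u h w‖ ≤ C * h ^ s :=
    (ae_restrict_iff' hMo.measurableSet).2 (ae_of_all _ fun w hw => hC h hh.1 hh.2 w hw)
  refine ⟨MemLp.of_bound (hm h) _ hb, (eLpNorm_le_of_ae_bound hb).trans (le_of_eq ?_)⟩
  rw [Measure.restrict_apply_univ, mul_assoc, ENNReal.ofReal_mul ENNReal.toReal_nonneg,
    ENNReal.ofReal_toReal (ENNReal.rpow_ne_top_of_nonneg (by positivity) hM)]

/-- Dominated convergence in `L^q`: a uniform majorant and pointwise decay, at any rate faster than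
`h^s`, almost everywhere. -/
theorem isLittleOLp_of_dominated (hq : 1 ≤ q) (hq' : q ≠ ⊤) {b : X → ℝ}
    (hm : ∀ h : ℝ, Measurable (u h)) (hb : MemLp b q (g.area.restrict M))
    (hub : ∀ h : ℝ, 0 < h → h ≤ 1 → ∀ᵐ w ∂g.area.restrict M, ‖u h w‖ ≤ b w * h ^ s)
    (hlim : ∀ᵐ w ∂g.area.restrict M, ∃ C r : ℝ, s < r ∧ ∀ h : ℝ, 0 < h → h ≤ 1 →
      ‖u h w‖ ≤ C * h ^ r) : IsLittleOLp g M q s u := by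
  set μ := g.area.restrict M
  have hq0 : q ≠ 0 := (zero_lt_one.trans_le hq).ne'
  have hqr : 0 < q.toReal := ENNReal.toReal_pos hq0 hq'
  have hIoc := Ioc_mem_nhdsGT (zero_lt_one (α := ℝ))
  set v : ℝ → X → ℂ := fun h w => ((h ^ (-s) : ℝ) : ℂ) * u h w with hv
  have hvb : ∀ h : ℝ, 0 < h → h ≤ 1 → ∀ᵐ w ∂μ, ‖v h w‖ ≤ b w := fun h h0 h1 => by
    filter_upwards [hub h h0 h1] with w hw
    rw [hv, norm_mul, Complex.norm_real, Real.norm_of_nonneg (by positivity)]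
    calc h ^ (-s) * ‖u h w‖ ≤ h ^ (-s) * (b w * h ^ s) := by gcongr
      _ = b w := by
        rw [mul_left_comm, ← Real.rpow_add h0, neg_add_cancel, Real.rpow_zero, mul_one]
  have key : Tendsto (fun h => ∫⁻ w, ‖v h w‖ₑ ^ q.toReal ∂μ) (𝓝[>] 0) (𝓝 (∫⁻ _, 0 ∂μ)) := by
    refine tendsto_lintegral_filter_of_dominated_convergence (fun w => ‖b w‖ₑ ^ q.toReal) ?_ ?_ ?_ ?_
    · exact Eventually.of_forall fun h => ((hm h).const_mul _).enorm.pow_const _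
    · filter_upwards [hIoc] with h hh
      filter_upwards [hvb h hh.1 hh.2] with w hw
      refine ENNReal.rpow_le_rpow ?_ hqr.le
      rw [enorm_le_iff_norm_le]
      exact hw.trans (le_abs_self _)
    · exact ((eLpNorm_lt_top_iff_lintegral_rpow_enorm_lt_top hq0 hq').1 hb.2).ne
    · filter_upwards [hlim] with w ⟨C, r, hsr, hC⟩
      have h1 : Tendsto (fun h : ℝ => C * h ^ (r - s)) (𝓝[>] 0) (𝓝 0) := by
        have : Tendsto (fun h : ℝ => h ^ (r - s)) (𝓝 0) (𝓝 0) := by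
          have := (Real.continuousAt_rpow_const (0 : ℝ) (r - s) (Or.inr (by linarith))).tendsto
          rwa [Real.zero_rpow (by linarith)] at this
        simpa using (this.mono_left nhdsWithin_le_nhds).const_mul C
      have h2 : Tendsto (fun h => v h w) (𝓝[>] 0) (𝓝 0) := by
        refine squeeze_zero_norm' ?_ h1
        filter_upwards [hIoc] with h hh
        rw [hv, norm_mul, Complex.norm_real, Real.norm_of_nonneg (by have := hh.1; positivity)]
        calc h ^ (-s) * ‖u h w‖ ≤ h ^ (-s) * (C * h ^ r) := by
              have := hh.1
              gcongr
              exact hC h hh.1 hh.2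
          _ = C * h ^ (r - s) := by
              rw [mul_left_comm, ← Real.rpow_add hh.1, neg_add_eq_sub]
      have h3 := ((ENNReal.continuous_rpow_const (y := q.toReal)).tendsto _).comp h2.enorm
      simpa [Function.comp_def, hqr] using h3
  have key2 : Tendsto (fun h => eLpNorm (v h) q μ) (𝓝[>] 0) (𝓝 0) := by
    have := ((ENNReal.continuous_rpow_const (y := 1 / q.toReal)).tendsto _).comp key
    simp only [lintegral_zero, Function.comp_def] at this
    rw [ENNReal.zero_rpow_of_pos (by positivity)] at this
    refine this.congr fun h => ?_
    rw [eLpNorm_eq_lintegral_rpow_enorm_toReal hq0 hq']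
  intro c hc
  have hev := key2.eventually (gt_mem_nhds (ENNReal.ofReal_pos.2 hc))
  filter_upwards [hev, hIoc] with h hh hI
  have hI0 := hI.1
  have hvm : MemLp (v h) q μ :=
    MemLp.mono' hb ((hm h).const_mul _).aestronglyMeasurable (hvb h hI.1 hI.2)
  have huv : u h = ((h ^ s : ℝ) : ℂ) • v h := by
    ext w
    simp only [hv, Pi.smul_apply, smul_eq_mul]
    rw [← mul_assoc, ← Complex.ofReal_mul, ← Real.rpow_add hI.1, add_neg_cancel, Real.rpow_zero,
      Complex.ofReal_one, one_mul]
  rw [huv]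
  refine ⟨hvm.const_smul _, ?_⟩
  rw [eLpNorm_const_smul, mul_comm c, ENNReal.ofReal_mul (by positivity)]
  refine mul_le_mul' (le_of_eq ?_) hh.le
  rw [← ofReal_norm, Complex.norm_real, Real.norm_of_nonneg (by positivity)]

end Lp

/-! ### The transform of a form supported in a patch -/

section PatchTransform

set_option linter.unusedSectionVars false

variable {X : Type*} [TopologicalSpace X] [T2Space X] [SecondCountableTopology X] [Nonempty X]
  [ChartedSpace ℂ X] [IsManifold 𝓘(ℂ, ℂ) ω X] [MeasurableSpace X] [BorelSpace X]
  {Φ : X → ℂ} {z₀ : X} {V L : Set X} {e : OpenPartialHomeomorph X ℂ} {O K : Set ℂ} {p : ℂ}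
  {κ : X → Form10 X} {f : Form01 X} {N : ℤ} {ψ : X → ℝ} {g : ConformalMetric X}

theorem measurable_of_continuousOn_compl {G : ℂ → ℂ} {p : ℂ} (hG : ContinuousOn G {p}ᶜ) :
    Measurable G := by
  classical
  have h1 : ContinuousOn G ({p}ᶜ)ᶜ := by
    rw [compl_compl]
    exact continuousOn_singleton _ _
  have := hG.measurable_piecewise h1 (measurableSet_singleton p).compl
  simpa using this

/-- Measurability in the parameter of an integral whose integrand is continuous on a measurable
set and vanishes elsewhere. -/
theorem measurable_integral_indicator {A : Set (X × ℂ)} (hA : MeasurableSet A) {F : X × ℂ → ℂ}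
    (hF : ContinuousOn F A) {G : ℂ → ℂ} (hG : Measurable G) :
    Measurable fun w => ∫ z, A.indicator F (w, z) * G z := by
  classical
  have h1 : Measurable (A.indicator F) := by
    rw [← piecewise_eq_indicator]
    exact hF.measurable_piecewise continuousOn_const hA
  have h2 : Measurable (Function.uncurry fun (w : X) z => A.indicator F (w, z) * G z) :=
    h1.mul (hG.comp measurable_snd)
  exact h2.stronglyMeasurable.integral_prod_right.measurable

theorem IsPatch.measurable_phase_mul (h : IsPatch Φ z₀ V e L O K p) (hf : IsSingularForm z₀ L N f)
    (t ħ : ℝ) :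
    Measurable fun z => phase t ħ (Φ ∘ e.symm) z * O.indicator (f.coeff e) z := by
  refine measurable_of_continuousOn_compl (p := p) (ContDiffOn.continuousOn (𝕜 := ℝ) (n := ∞)
    (contDiffOn_compl_of_eq_zero h.isOpen h.morse.isCompact.isClosed isClosed_singleton
      h.morse.subset (((contDiffOn_phase t ħ h.isOpen h.morse.holomorphic).mono sdiff_subset).mul
        ((h.isSymbol_indicator hf).smooth () trivial)) fun z hz => ?_))
  rw [h.indicator_coeff_eq_zero hf.zero hz, mul_zero]

theorem IsPatch.measurable_dbarInvPsi (h : IsPatch Φ z₀ V e L O K p) (hκ : IsCauchyKernel κ)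
    (hψ : ∀ x, ψ x = (Φ x).im) (hf : IsSingularForm z₀ L N f) (ħ : ℝ) :
    Measurable (dbarInvPsi g κ ψ ħ f) := by
  set A : Set (X × ℂ) := {q | q.2 ∈ e.target ∧ e.symm q.2 ≠ q.1} with hA
  have hAo : IsOpen A := by
    have h1 : IsOpen {q : X × ℂ | q.2 ∈ e.target} := e.open_target.preimage continuous_snd
    have h2 : ContinuousOn (fun q : X × ℂ => (e.symm q.2, q.1)) {q | q.2 ∈ e.target} :=
      (e.continuousOn_symm.comp continuousOn_snd fun q hq => hq).prodMk continuousOn_fst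
    have := h2.isOpen_inter_preimage h1 (isClosed_diagonal (X := X)).isOpen_compl
    convert this using 1
    ext q
    simp [hA]
  have hm := (measurable_integral_indicator hAo.measurableSet (hκ.continuousOn h.mem_atlas)
    (h.measurable_phase_mul hf (-2) ħ)).const_mul (-(Real.pi : ℂ)⁻¹)
  convert hm using 1
  ext w
  rw [h.dbarInvPsi_eq g hψ hf.zero]
  congr 1
  refine integral_congr_ae ?_
  filter_upwards [ae_ne (e w)] with z hz
  by_cases hzS : z ∈ e '' L
  · have hzt := h.subset_target (h.subset (h.morse.subset hzS))
    have hzA : (w, z) ∈ A := ⟨hzt, fun h0 => hz (by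
      have h0' : e.symm z = w := h0
      rw [← h0', e.right_inv hzt])⟩
    rw [indicator_of_mem hzA]
    ring
  · rw [h.indicator_coeff_eq_zero hf.zero hzS]
    ring

theorem measurableSet_source_inter (e : OpenPartialHomeomorph X ℂ) (hK : IsCompact K) :
    MeasurableSet (e.source ∩ e ⁻¹' K) := by
  have : e.source ∩ e ⁻¹' K = e.source \ (e.source ∩ e ⁻¹' Kᶜ) := by
    ext x
    simp only [mem_inter_iff, mem_preimage, mem_compl_iff, Set.mem_sdiff]
    tauto
  rw [this]
  exact e.open_source.measurableSet.diff
    (e.isOpen_inter_preimage hK.isClosed.isOpen_compl).measurableSet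

theorem measurable_pole (e : OpenPartialHomeomorph X ℂ) (hK : IsCompact K) (p : ℂ) :
    Measurable (pole e K p) := by
  classical
  have := (e.continuousOn.mono inter_subset_left).measurable_piecewise
    (continuousOn_const (c := p + 1)) (measurableSet_source_inter e hK)
  convert this using 1
  ext w
  simp only [pole, piecewise, mem_inter_iff, mem_preimage]

/-- Negative powers of the distance of the pole to `p` are in `L^q` for small exponents. -/
theorem IsPatch.memLp_dist_pole (h : IsPatch Φ z₀ V e L O K p) (g : ConformalMetric X) {M : Set X}
    (hM : g.area M ≠ ⊤) {q : ℝ≥0∞} (hq : 1 ≤ q) (hq' : q ≠ ⊤) {s : ℝ} (hs : 0 < s)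
    (hsq : s * q.toReal < 2) :
    MemLp (fun w => ‖p - pole e K p w‖ ^ (-s)) q (g.area.restrict M) := by
  have hq0 : q ≠ 0 := (zero_lt_one.trans_le hq).ne'
  have hqr : 0 < q.toReal := ENNReal.toReal_pos hq0 hq'
  have hmp := measurable_pole e h.isCompact p
  have hmb : Measurable fun w => ‖p - pole e K p w‖ ^ (-s) :=
    (measurable_const.sub hmp).norm.pow_const _
  refine ⟨hmb.aestronglyMeasurable, (eLpNorm_lt_top_iff_lintegral_rpow_enorm_lt_top hq0 hq').2 ?_⟩
  set Q := e.source ∩ e ⁻¹' K with hQ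
  set F : X → ℝ≥0∞ := fun w => ‖‖p - pole e K p w‖ ^ (-s)‖ₑ ^ q.toReal with hF
  have hFe : ∀ w, F w = ENNReal.ofReal (‖p - pole e K p w‖ ^ (-(s * q.toReal))) := fun w => by
    rw [hF]
    simp only
    rw [Real.enorm_of_nonneg (by positivity), ENNReal.ofReal_rpow_of_nonneg (by positivity) hqr.le,
      ← Real.rpow_mul (norm_nonneg _), neg_mul]
  have hFQ : ∀ w, F w ≤ 1 + Q.indicator F w := fun w => by
    by_cases hw : w ∈ Q
    · rw [indicator_of_mem hw]
      exact le_add_self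
    · rw [hFe, pole, if_neg (show ¬(w ∈ e.source ∧ e w ∈ K) from hw)]
      simp
  obtain ⟨C, hC⟩ := h.isCompact.exists_bound_of_continuousOn
    ((g.continuousOn_coeff h.mem_atlas).mono h.subset_target)
  have hint : ∫⁻ w, Q.indicator F w ∂g.area < ⊤ := by
    have e1 : ∫⁻ w, Q.indicator F w ∂g.area = ∫⁻ w in e.source, Q.indicator F w ∂g.area := by
      rw [← lintegral_indicator e.open_source.measurableSet]
      congr 1
      ext w
      by_cases hw : w ∈ e.source
      · rw [indicator_of_mem hw]
      · rw [indicator_of_notMem hw, indicator_of_notMem fun h' => hw h'.1]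
    have hii := integrableOn_rpow (s := s * q.toReal) hsq (by positivity)
      h.isCompact.measure_lt_top.ne p
    have hii2 : ∫⁻ z in K, ENNReal.ofReal (‖z - p‖ ^ (-(s * q.toReal))) < ⊤ :=
      (hasFiniteIntegral_iff_ofReal (ae_of_all _ fun _ => by positivity)).1 hii.2
    rw [e1, g.setLIntegral_image h.mem_atlas]
    calc ∫⁻ z in e.target, ENNReal.ofReal (g.coeff e z) * Q.indicator F (e.symm z)
        ≤ ∫⁻ z in e.target, K.indicator
          (fun z => ENNReal.ofReal C * ENNReal.ofReal (‖z - p‖ ^ (-(s * q.toReal)))) z := by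
          refine setLIntegral_mono' e.open_target.measurableSet fun z hz => ?_
          by_cases hzK : z ∈ K
          · have hzQ : e.symm z ∈ Q := ⟨e.map_target hz, by rwa [mem_preimage, e.right_inv hz]⟩
            rw [indicator_of_mem hzK, indicator_of_mem hzQ, hFe, pole,
              if_pos (show e.symm z ∈ e.source ∧ e (e.symm z) ∈ K from hzQ), e.right_inv hz,
              norm_sub_rev]
            gcongr
            exact (le_abs_self _).trans (hC z hzK)
          · have hzQ : e.symm z ∉ Q := fun h' => hzK (by
              have := h'.2
              rwa [mem_preimage, e.right_inv hz] at this)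
            rw [indicator_of_notMem hzQ, mul_zero]
            exact zero_le
      _ ≤ ∫⁻ z, K.indicator
          (fun z => ENNReal.ofReal C * ENNReal.ofReal (‖z - p‖ ^ (-(s * q.toReal)))) z :=
          setLIntegral_le_lintegral _ _
      _ = ENNReal.ofReal C * ∫⁻ z in K, ENNReal.ofReal (‖z - p‖ ^ (-(s * q.toReal))) := by
          rw [lintegral_indicator h.isCompact.measurableSet, lintegral_const_mul']
          exact ENNReal.ofReal_ne_top
      _ < ⊤ := ENNReal.mul_lt_top ENNReal.ofReal_lt_top hii2
  calc ∫⁻ w in M, F w ∂g.area ≤ ∫⁻ w in M, (1 + Q.indicator F w) ∂g.area :=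
        lintegral_mono hFQ
    _ = g.area M + ∫⁻ w in M, Q.indicator F w ∂g.area := by
        rw [lintegral_add_left measurable_const]
        simp
    _ ≤ g.area M + ∫⁻ w, Q.indicator F w ∂g.area := by
        gcongr
        exact Measure.restrict_le_self
    _ < ⊤ := ENNReal.add_lt_top.2 ⟨hM.lt_top, hint⟩

theorem ae_ne_point (g : ConformalMetric X) (M : Set X) (z₀ : X) :
    ∀ᵐ w ∂g.area.restrict M, w ≠ z₀ :=
  ae_restrict_of_ae (compl_mem_ae_iff.2 (g.area_singleton z₀))

/-- The transform of a form of order `-1` has the majorant `|p - w|^(-s)` with `s = 1/q`, which is in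
`L^q`, and tends to `0` at every `w ≠ z₀`. -/
theorem IsPatch.isLittleOLp_neg_one (h : IsPatch Φ z₀ V e L O K p) (hκ : IsCauchyKernel κ)
    (hψ : ∀ x, ψ x = (Φ x).im) (hf : IsSingularForm z₀ L (-1) f) {M : Set X} (hMo : IsOpen M)
    (hM : g.area M ≠ ⊤) {B : ℝ} (hB : ∀ w ∈ M, IsKernel O (pole e K p w) B ((κ w).coeff e))
    {q : ℝ≥0∞} (hq : 1 ≤ q) (hq' : q ≠ ⊤) :
    IsLittleOLp g M q 0 fun ħ => dbarInvPsi g κ ψ ħ f := by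
  have hqr : 0 < q.toReal := ENNReal.toReal_pos (zero_lt_one.trans_le hq).ne' hq'
  have hq1 : 1 ≤ q.toReal := by
    rw [← ENNReal.toReal_one]
    exact ENNReal.toReal_mono hq' hq
  have hG := h.isSymbol_indicator hf
  have h0 : ∀ z ∉ e '' L, O.indicator (f.coeff e) z = 0 := fun z hz =>
    h.indicator_coeff_eq_zero hf.zero hz
  have hs : 0 < q.toReal⁻¹ := by positivity
  obtain ⟨C, hC0, hC⟩ := h.morse.exists_norm_integral_kernel_le_dist hG h0 hs
    (inv_le_one_of_one_le₀ hq1) (-2)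
  have hMm := hMo.measurableSet
  refine isLittleOLp_of_dominated hq hq' (fun ħ => h.measurable_dbarInvPsi hκ hψ hf ħ)
    ((h.memLp_dist_pole g hM hq hq' hs ?_).const_mul (C * B)) (fun ħ hħ hħ1 => ?_) ?_
  · rw [inv_mul_cancel₀ hqr.ne']
    norm_num
  · filter_upwards [ae_ne_point g M z₀, ae_restrict_mem hMm] with w hw hwM
    rw [h.dbarInvPsi_eq g hψ hf.zero, Real.rpow_zero, mul_one]
    exact (norm_neg_inv_pi_mul_le _).trans (hC (hB w hwM) (h.ne_pole hw) ħ hħ)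
  · filter_upwards [ae_ne_point g M z₀, ae_restrict_mem hMm] with w hw hwM
    obtain ⟨C', hC'⟩ := h.morse.exists_norm_integral_kernel_le_decay (t := -2) (by norm_num) hG h0
      (hB w hwM) (h.ne_pole hw)
    refine ⟨C', 1 / 8, by norm_num, fun ħ hħ hħ1 => ?_⟩
    rw [h.dbarInvPsi_eq g hψ hf.zero]
    exact (norm_neg_inv_pi_mul_le _).trans (hC' ħ hħ hħ1)

/-- The transform of a form of order `0` is `O(√h)` uniformly, and `O(h^(5/8))` at every `w ≠ z₀`. -/
theorem IsPatch.isLittleOLp_zero (h : IsPatch Φ z₀ V e L O K p) (hκ : IsCauchyKernel κ)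
    (hψ : ∀ x, ψ x = (Φ x).im) (hf : IsSingularForm z₀ L 0 f) {M : Set X} (hMo : IsOpen M)
    (hM : g.area M ≠ ⊤) {B : ℝ} (hB : ∀ w ∈ M, IsKernel O (pole e K p w) B ((κ w).coeff e)) :
    IsLittleOLp g M 2 (1 / 2) fun ħ => dbarInvPsi g κ ψ ħ f := by
  have hG := h.isSymbol_indicator hf
  have h0 : ∀ z ∉ e '' L, O.indicator (f.coeff e) z = 0 := fun z hz =>
    h.indicator_coeff_eq_zero hf.zero hz
  obtain ⟨C, hC⟩ := h.morse.exists_norm_integral_kernel_le_sqrt (t := -2) (by norm_num) hG h0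
  have hMm := hMo.measurableSet
  have : IsFiniteMeasure (g.area.restrict M) := ⟨by simpa using hM.lt_top⟩
  refine isLittleOLp_of_dominated (by norm_num) (by norm_num)
    (fun ħ => h.measurable_dbarInvPsi hκ hψ hf ħ) (memLp_const (C * B)) (fun ħ hħ hħ1 => ?_) ?_
  · filter_upwards [ae_restrict_mem hMm] with w hwM
    rw [h.dbarInvPsi_eq g hψ hf.zero, ← Real.sqrt_eq_rpow]
    exact (norm_neg_inv_pi_mul_le _).trans (hC (hB w hwM) ħ hħ)
  · filter_upwards [ae_ne_point g M z₀, ae_restrict_mem hMm] with w hw hwM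
    obtain ⟨C', hC'⟩ := h.morse.exists_norm_integral_kernel_le_rpow (t := -2) (by norm_num) hG h0
      (hB w hwM) (h.ne_pole hw)
    refine ⟨C', 5 / 8, by norm_num, fun ħ hħ hħ1 => ?_⟩
    rw [h.dbarInvPsi_eq g hψ hf.zero]
    exact (norm_neg_inv_pi_mul_le _).trans (hC' ħ hħ hħ1)

end PatchTransform

/-! ### Smooth amplitudes depending on a parameter -/

section Parameter

set_option linter.unusedSectionVars false

/-- The operator `∂̄` in the first of two complex variables. -/
def dbarFst (R : ℂ × ℂ → ℂ) (q : ℂ × ℂ) : ℂ := dbarC (fun z => R (z, q.2)) q.1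

theorem ContDiffOn.dbarFst {D : Set (ℂ × ℂ)} (hD : IsOpen D) {R : ℂ × ℂ → ℂ}
    (hR : ContDiffOn ℝ ∞ R D) : ContDiffOn ℝ ∞ (dbarFst R) D := by
  have h1 : ContDiffOn ℝ ∞ (fun q => dbarForm ((fderiv ℝ R q).comp
      (ContinuousLinearMap.inl ℝ ℂ ℂ))) D :=
    dbarForm.contDiff.comp_contDiffOn ((hR.fderiv_of_isOpen hD (by simp)).clm_comp contDiffOn_const)
  refine h1.congr fun q hq => ?_
  rw [RiemannSurface.dbarFst, dbarC_eq]
  congr 1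
  have h2 : HasFDerivAt R (fderiv ℝ R q) (q.1, q.2) :=
    ((hR.contDiffAt (hD.mem_nhds hq)).differentiableAt (by simp)).hasFDerivAt
  exact (h2.comp q.1 (hasFDerivAt_prodMk_left q.1 q.2)).fderiv

theorem contDiffOn_iterate_dbarFst {D : Set (ℂ × ℂ)} (hD : IsOpen D) {R : ℂ × ℂ → ℂ}
    (hR : ContDiffOn ℝ ∞ R D) (m : ℕ) : ContDiffOn ℝ ∞ (dbarFst^[m] R) D := by
  induction m generalizing R with
  | zero => exact hR
  | succ m ih => exact ih (ContDiffOn.dbarFst hD hR)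

theorem iterate_dbarFst (R : ℂ × ℂ → ℂ) (m : ℕ) (z y : ℂ) :
    dbarFst^[m] R (z, y) = dbarC^[m] (fun z => R (z, y)) z := by
  induction m generalizing R with
  | zero => rfl
  | succ m ih =>
    rw [Function.iterate_succ_apply, ih, Function.iterate_succ_apply]
    rfl

variable {X : Type*} [TopologicalSpace X] [ChartedSpace ℂ X] [IsManifold 𝓘(ℂ, ℂ) ω X]
  {e : OpenPartialHomeomorph X ℂ} {K : Set ℂ}
  {ρ : X × X → ℂ} {W : Set (X × X)}

theorem contDiffOn_param (he : e ∈ atlas ℂ X) {e' : OpenPartialHomeomorph X ℂ}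
    (he' : e' ∈ atlas ℂ X) (hρ : ContMDiffOn (𝓘(ℝ, ℂ).prod 𝓘(ℝ, ℂ)) 𝓘(ℝ, ℂ) ∞ ρ W) :
    ContDiffOn ℝ ∞ (fun q : ℂ × ℂ => ρ (e.symm q.1, e'.symm q.2))
      ((e.target ×ˢ e'.target) ∩ (fun q : ℂ × ℂ => (e.symm q.1, e'.symm q.2)) ⁻¹' W) := by
  have h1 : ContMDiffOn 𝓘(ℝ, ℂ × ℂ) 𝓘(ℝ, ℂ) ∞ (fun q : ℂ × ℂ => e.symm q.1)
      (e.target ×ˢ e'.target) :=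
    (contMDiffOn_symm_of_mem_maximalAtlas (IsManifold.subset_maximalAtlas he)).comp
      contDiff_fst.contMDiff.contMDiffOn fun q hq => hq.1
  have h2 : ContMDiffOn 𝓘(ℝ, ℂ × ℂ) 𝓘(ℝ, ℂ) ∞ (fun q : ℂ × ℂ => e'.symm q.2)
      (e.target ×ˢ e'.target) :=
    (contMDiffOn_symm_of_mem_maximalAtlas (IsManifold.subset_maximalAtlas he')).comp
      contDiff_snd.contMDiff.contMDiffOn fun q hq => hq.2
  exact (hρ.comp ((h1.prodMk h2).mono inter_subset_left) fun q hq => hq.2).contDiffOn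

theorem isOpen_param_domain (e e' : OpenPartialHomeomorph X ℂ) (hW : IsOpen W) :
    IsOpen ((e.target ×ˢ e'.target) ∩ (fun q : ℂ × ℂ => (e.symm q.1, e'.symm q.2)) ⁻¹' W) :=
  ((e.continuousOn_symm.comp continuousOn_fst fun _ hq => hq.1).prodMk
    (e'.continuousOn_symm.comp continuousOn_snd fun _ hq => hq.2)).isOpen_inter_preimage
      (e.open_target.prod e'.open_target) hW

/-- The derivatives in `z` of a smooth function `ρ(z, w)` are bounded uniformly for `w` in a compact
set. -/
theorem exists_iterate_dbarC_param_le (he : e ∈ atlas ℂ X) (hK : IsCompact K) (hKe : K ⊆ e.target)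
    (hW : IsOpen W) (hρ : ContMDiffOn (𝓘(ℝ, ℂ).prod 𝓘(ℝ, ℂ)) 𝓘(ℝ, ℂ) ∞ ρ W) {Y : Set X}
    (hY : IsCompact Y) (hYW : ∀ z ∈ K, ∀ w ∈ Y, (e.symm z, w) ∈ W) (m : ℕ) :
    ∃ C : ℝ, ∀ w ∈ Y, ∀ z ∈ K, ‖dbarC^[m] (fun z => ρ (e.symm z, w)) z‖ ≤ C := by
  refine hY.induction_on (p := fun Y => ∃ C : ℝ, ∀ w ∈ Y, ∀ z ∈ K,
    ‖dbarC^[m] (fun z => ρ (e.symm z, w)) z‖ ≤ C) ⟨0, by simp⟩ ?_ ?_ fun w hw => ?_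
  · rintro s t hst ⟨C, hC⟩
    exact ⟨C, fun w hw => hC w (hst hw)⟩
  · rintro s t ⟨C, hC⟩ ⟨C', hC'⟩
    refine ⟨max C C', fun w hw z hz => ?_⟩
    rcases hw with hw | hw
    · exact (hC w hw z hz).trans (le_max_left _ _)
    · exact (hC' w hw z hz).trans (le_max_right _ _)
  · set e' := chartAt ℂ w
    have hws := mem_chart_source ℂ w
    set D := (e.target ×ˢ e'.target) ∩ (fun q : ℂ × ℂ => (e.symm q.1, e'.symm q.2)) ⁻¹' W
    have hD : IsOpen D := isOpen_param_domain e e' hW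
    have hKD : K ×ˢ {e' w} ⊆ D := by
      rintro ⟨z, y⟩ ⟨hz, hy⟩
      have hy' : y = e' w := hy
      refine ⟨⟨hKe hz, ?_⟩, ?_⟩
      · rw [hy']
        exact e'.map_source hws
      · change (e.symm z, e'.symm y) ∈ W
        rw [hy', e'.left_inv hws]
        exact hYW z hz w hw
    obtain ⟨u, v, -, hv, hKu, hwv, huv⟩ := generalized_tube_lemma hK isCompact_singleton hD hKD
    obtain ⟨r, hr, hrv⟩ := Metric.nhds_basis_closedBall.mem_iff.1 (hv.mem_nhds (hwv rfl))
    obtain ⟨C, hC⟩ := (hK.prod (isCompact_closedBall (e' w) r)).exists_bound_of_continuousOn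
      ((contDiffOn_iterate_dbarFst hD (contDiffOn_param he (chart_mem_atlas ℂ w) hρ)
        m).continuousOn.mono ((prod_mono hKu hrv).trans huv))
    refine ⟨e'.source ∩ e' ⁻¹' Metric.ball (e' w) r, mem_nhdsWithin_of_mem_nhds
      ((e'.isOpen_inter_preimage Metric.isOpen_ball).mem_nhds ⟨hws, by simpa using hr⟩), C,
      fun w' hw' z hz => ?_⟩
    have := hC (z, e' w') ⟨hz, Metric.ball_subset_closedBall hw'.2⟩
    rw [iterate_dbarFst] at this
    simpa only [e'.left_inv hw'.1] using this

theorem contDiffOn_param_left (he : e ∈ atlas ℂ X)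
    (hρ : ContMDiffOn (𝓘(ℝ, ℂ).prod 𝓘(ℝ, ℂ)) 𝓘(ℝ, ℂ) ∞ ρ W) (w : X) :
    ContDiffOn ℝ ∞ (fun z => ρ (e.symm z, w)) (e.target ∩ {z | (e.symm z, w) ∈ W}) := by
  have h := contDiffOn_param he (chart_mem_atlas ℂ w) hρ
  have hl := (chartAt ℂ w).left_inv (mem_chart_source ℂ w)
  have h2 := h.comp (s := e.target ∩ {z | (e.symm z, w) ∈ W})
    (f := fun z => (z, chartAt ℂ w w)) (contDiff_prodMk_left (chartAt ℂ w w)).contDiffOn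
    fun z hz => ⟨⟨hz.1, mem_chart_target ℂ w⟩, by
      change (e.symm z, (chartAt ℂ w).symm (chartAt ℂ w w)) ∈ W
      rw [hl]
      exact hz.2⟩
  refine h2.congr fun z _ => ?_
  simp [hl]

end Parameter

/-! ### Oscillatory integrals over a patch -/

section PatchOscillatory

set_option linter.unusedSectionVars false

variable {X : Type*} [TopologicalSpace X] [T2Space X] [SecondCountableTopology X] [Nonempty X]
  [ChartedSpace ℂ X] [IsManifold 𝓘(ℂ, ℂ) ω X] [MeasurableSpace X] [BorelSpace X]
  {Φ : X → ℂ} {z₀ : X} {V L : Set X} {e : OpenPartialHomeomorph X ℂ} {O K : Set ℂ} {p : ℂ}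
  {f : Form01 X} {N : ℤ} {ψ : X → ℝ} {g : ConformalMetric X} {χ : Form10 X}
  {ρ : X × X → ℂ} {W : Set (X × X)} {Y : Set X}

/-- The decay exponents `r` of the oscillatory integrals with an amplitude of order `N` at the
critical point. -/
def IsDecayExponent (N : ℤ) (r : ℝ) : Prop :=
  ∃ n : ℕ, N = 2 * n - 1 ∧ r ≤ n ∨ N = 2 * n ∧ r < n + 1

theorem IsDecayExponent.neg_one_le {r : ℝ} (h : IsDecayExponent N r) : -1 ≤ N := by
  obtain ⟨n, ⟨hn, -⟩ | ⟨hn, -⟩⟩ := h <;> lia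

theorem IsMorsePhase.exists_norm_integral_le {O S : Set ℂ} {φ : ℂ → ℂ}
    (hφ : IsMorsePhase O S p φ) {t : ℝ} (ht : t ≠ 0) {ι : Type*} {T : Set ι} {u : ι → ℂ → ℂ}
    {r : ℝ} (hr : IsDecayExponent N r) (hu : IsSymbol T O p N u)
    (h0 : ∀ i ∈ T, ∀ z ∉ S, u i z = 0) (hT : T.Nonempty) :
    ∃ C : ℝ, ∀ h : ℝ, 0 < h → h ≤ 1 → ∀ i ∈ T, ‖∫ z, phase t h φ z * u i z‖ ≤ C * h ^ r := by
  obtain ⟨i₀, hi₀⟩ := hT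
  have key : ∀ {s C : ℝ}, r ≤ s → (∀ h : ℝ, 0 < h → h ≤ 1 → ∀ i ∈ T,
      ‖∫ z, phase t h φ z * u i z‖ ≤ C * h ^ s) → ∀ h : ℝ, 0 < h → h ≤ 1 → ∀ i ∈ T,
      ‖∫ z, phase t h φ z * u i z‖ ≤ C * h ^ r := by
    intro s C hrs hC h h0 h1 i hi
    have hC0 : 0 ≤ C := by
      have := (norm_nonneg _).trans (hC 1 one_pos le_rfl i₀ hi₀)
      simpa using this
    exact (hC h h0 h1 i hi).trans (mul_le_mul_of_nonneg_left
      (Real.rpow_le_rpow_of_exponent_ge h0 h1 hrs) hC0)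
  obtain ⟨n, ⟨hn, hrn⟩ | ⟨hn, hrn⟩⟩ := hr
  · obtain ⟨C, hC⟩ := hφ.exists_norm_integral_le_odd ht n (hn ▸ hu) h0
    exact ⟨C, key hrn fun h h0 h1 i hi => by rw [Real.rpow_natCast]; exact hC h h0 h1 i hi⟩
  · have hε : 0 < min (n + 1 - r) (1 / 2 : ℝ) := lt_min (by linarith) (by norm_num)
    obtain ⟨C, hC⟩ := hφ.exists_norm_integral_le_even ht n (hn ▸ hu) h0 hε
      ((min_le_right _ _).trans_lt (by norm_num))
    refine ⟨C, key ?_ hC⟩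
    have := min_le_left (n + 1 - r) (1 / 2 : ℝ)
    linarith

/-- The amplitude of `∫ e^{4iψ/h} ρ(z, w) f ∧ χ` in a patch. -/
def amplitude (χ : Form10 X) (ρ : X × X → ℂ) (f : Form01 X) (e : OpenPartialHomeomorph X ℂ)
    (O : Set ℂ) (w : X) (z : ℂ) : ℂ :=
  ρ (e.symm z, w) * (χ.coeff e z * O.indicator (f.coeff e) z)

/-- The amplitudes have the order of `f`, uniformly in the parameter `w`. -/
theorem IsPatch.isSymbol_amplitude (h : IsPatch Φ z₀ V e L O K p) (hf : IsSingularForm z₀ L N f)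
    (hχ : χ.SmoothOn univ) (hW : IsOpen W)
    (hρ : ContMDiffOn (𝓘(ℝ, ℂ).prod 𝓘(ℝ, ℂ)) 𝓘(ℝ, ℂ) ∞ ρ W) (hY : IsCompact Y)
    (hVW : V ×ˢ Y ⊆ W) : IsSymbol Y O p N (amplitude χ ρ f e O) := by
  have hO := h.isOpen
  have hKW : ∀ z ∈ K, ∀ w ∈ Y, (e.symm z, w) ∈ W := fun z hz w hw => hVW ⟨h.symm_mem z hz, hw⟩
  have h1 : IsSymbol (univ : Set Unit) O p 0 fun _ => χ.coeff e :=
    isSymbol_of_contDiffOn e.open_target h.isCompact h.subset_target h.subset le_rfl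
      (by simpa using hχ e h.mem_atlas)
  have h2 : IsSymbol Y O p N fun _ z => χ.coeff e z * O.indicator (f.coeff e) z := by
    have := h1.mul hO (h.isSymbol_indicator hf)
    rw [zero_add] at this
    exact this.mono (fun _ => ()) (fun _ _ => trivial) subset_rfl
  have h3 : IsSymbol Y O p 0 fun w z => ρ (e.symm z, w) := by
    refine ⟨fun w hw => (contDiffOn_param_left h.mem_atlas hρ w).mono fun z hz =>
      ⟨h.subset_target (h.subset hz.1), hKW z (h.subset hz.1) w hw⟩, ?_⟩
    obtain ⟨D, hD⟩ := h.isCompact.isBounded.exists_norm_le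
    refine symbolBound_of_iterate_bound (D := D + ‖p‖) (fun z hz => (norm_sub_le _ _).trans
      (add_le_add_left (hD z (h.subset hz)) _)) le_rfl fun m => ?_
    obtain ⟨C, hC⟩ := exists_iterate_dbarC_param_le h.mem_atlas h.isCompact h.subset_target hW hρ
      hY hKW m
    exact ⟨C, fun w hw z hz => hC w hw z (h.subset hz)⟩
  have := h3.mul hO h2
  rwa [zero_add] at this

theorem IsPatch.intWedge_osc_eq (h : IsPatch Φ z₀ V e L O K p) (hψ : ∀ x, ψ x = (Φ x).im)
    (hf : ∀ x ∉ L, f x = 0) (t ħ : ℝ) (w : X) :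
    intWedge g χ (fun z => (osc t ψ ħ z * ρ (z, w)) • f z) =
      -2 * Complex.I * ∫ z, phase t ħ (Φ ∘ e.symm) z * amplitude χ ρ f e O w z := by
  rw [h.intWedge_eq g fun x hx =>
    smul_form_eq_zero (θ := fun z => osc t ψ ħ z * ρ (z, w)) (hf x hx)]
  congr 2
  ext z
  rw [indicator_smul_coeff (θ := fun z => osc t ψ ħ z * ρ (z, w)), osc_comp_symm hψ, amplitude]
  ring

theorem IsPatch.amplitude_eq_zero (h : IsPatch Φ z₀ V e L O K p) (hf : ∀ x ∉ L, f x = 0) (w : X)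
    {z : ℂ} (hz : z ∉ e '' L) : amplitude χ ρ f e O w z = 0 := by
  rw [amplitude, h.indicator_coeff_eq_zero hf hz, mul_zero, mul_zero]

theorem IsPatch.integrable_starWedge_osc (h : IsPatch Φ z₀ V e L O K p)
    (hψ : ∀ x, ψ x = (Φ x).im) (hf : IsSingularForm z₀ L N f) (hN : -1 ≤ N)
    (hχ : χ.SmoothOn univ) (hW : IsOpen W)
    (hρ : ContMDiffOn (𝓘(ℝ, ℂ).prod 𝓘(ℝ, ℂ)) 𝓘(ℝ, ℂ) ∞ ρ W) (hY : IsCompact Y)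
    (hVW : V ×ˢ Y ⊆ W) (t ħ : ℝ) {w : X} (hw : w ∈ Y) :
    Integrable (starWedge g χ fun z => (osc t ψ ħ z * ρ (z, w)) • f z) g.area := by
  rw [h.integrable_iff g fun x hx =>
    smul_form_eq_zero (θ := fun z => osc t ψ ħ z * ρ (z, w)) (hf.zero x hx)]
  have hs := h.isSymbol_amplitude hf hχ hW hρ hY hVW
  obtain ⟨C, -, hC⟩ := (hs.bound 0).exists_norm_le h.morse.isCompact h.morse.subset (M := -1) hN
  refine (h.morse.integrable_phase_mul t ħ (hs.smooth w hw)
    (fun z hz => h.amplitude_eq_zero hf.zero w hz) (hC w hw)).congr (ae_of_all _ fun z => ?_)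
  simp only
  rw [indicator_smul_coeff (θ := fun z => osc t ψ ħ z * ρ (z, w)), osc_comp_symm hψ, amplitude]
  ring

theorem IsPatch.exists_norm_intWedge_osc_le (h : IsPatch Φ z₀ V e L O K p)
    (hψ : ∀ x, ψ x = (Φ x).im) (hf : IsSingularForm z₀ L N f)
    (hχ : χ.SmoothOn univ) (hW : IsOpen W)
    (hρ : ContMDiffOn (𝓘(ℝ, ℂ).prod 𝓘(ℝ, ℂ)) 𝓘(ℝ, ℂ) ∞ ρ W) (hY : IsCompact Y)
    (hYn : Y.Nonempty) (hVW : V ×ˢ Y ⊆ W) {t : ℝ} (ht : t ≠ 0) {r : ℝ}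
    (hr : IsDecayExponent N r) :
    ∃ C : ℝ, ∀ ħ : ℝ, 0 < ħ → ħ ≤ 1 → ∀ w ∈ Y,
      ‖intWedge g χ (fun z => (osc t ψ ħ z * ρ (z, w)) • f z)‖ ≤ C * ħ ^ r := by
  obtain ⟨C, hC⟩ := h.morse.exists_norm_integral_le ht hr
    (h.isSymbol_amplitude hf hχ hW hρ hY hVW)
    (fun w _ z hz => h.amplitude_eq_zero hf.zero w hz) hYn
  refine ⟨2 * C, fun ħ hħ hħ1 w hw => ?_⟩
  rw [h.intWedge_osc_eq hψ hf.zero, norm_mul, norm_mul, norm_neg, Complex.norm_I, mul_one,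
    mul_assoc, Complex.norm_two]
  exact mul_le_mul_of_nonneg_left (hC ħ hħ hħ1 w hw) zero_le_two

theorem IsPatch.aestronglyMeasurable_intWedge_osc (h : IsPatch Φ z₀ V e L O K p)
    (hψ : ∀ x, ψ x = (Φ x).im) (hf : IsSingularForm z₀ L N f)
    (hχ : χ.SmoothOn univ) (hρ : ContMDiffOn (𝓘(ℝ, ℂ).prod 𝓘(ℝ, ℂ)) 𝓘(ℝ, ℂ) ∞ ρ W)
    (hY : IsCompact Y) (hVW : V ×ˢ Y ⊆ W) (t ħ : ℝ) :
    AEStronglyMeasurable (fun w => intWedge g χ (fun z => (osc t ψ ħ z * ρ (z, w)) • f z))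
      (g.area.restrict Y) := by
  have hA : MeasurableSet (Y ×ˢ K) := hY.measurableSet.prod h.isCompact.measurableSet
  have hF : ContinuousOn (fun q : X × ℂ => ρ (e.symm q.2, q.1)) (Y ×ˢ K) :=
    hρ.continuousOn.comp ((e.continuousOn_symm.comp continuousOn_snd
      fun q hq => h.subset_target hq.2).prodMk continuousOn_fst)
      fun q hq => hVW ⟨h.symm_mem _ hq.2, hq.1⟩
  have h1 : IsSymbol (univ : Set Unit) O p 0 fun _ => χ.coeff e :=
    isSymbol_of_contDiffOn e.open_target h.isCompact h.subset_target h.subset le_rfl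
      (by simpa using hχ e h.mem_atlas)
  have hG : Measurable fun z => phase t ħ (Φ ∘ e.symm) z *
      (χ.coeff e z * O.indicator (f.coeff e) z) := by
    refine measurable_of_continuousOn_compl (p := p) (ContDiffOn.continuousOn (𝕜 := ℝ) (n := ∞)
      (contDiffOn_compl_of_eq_zero h.isOpen h.morse.isCompact.isClosed isClosed_singleton
        h.morse.subset (((contDiffOn_phase t ħ h.isOpen h.morse.holomorphic).mono sdiff_subset).mul
        ((h1.mul h.isOpen (h.isSymbol_indicator hf)).smooth () trivial)) fun z hz => ?_))
    rw [h.indicator_coeff_eq_zero hf.zero hz, mul_zero, mul_zero]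
  have hm := (measurable_integral_indicator hA hF hG).const_mul (-2 * Complex.I)
  refine hm.aestronglyMeasurable.congr ((ae_restrict_iff' hY.measurableSet).2
    (ae_of_all _ fun w hw => ?_))
  beta_reduce
  rw [h.intWedge_osc_eq hψ hf.zero]
  congr 2
  ext z
  by_cases hzS : z ∈ e '' L
  · have hq : (w, z) ∈ Y ×ˢ K := ⟨hw, h.subset (h.morse.subset hzS)⟩
    rw [indicator_of_mem hq, amplitude]
    ring
  · rw [h.amplitude_eq_zero hf.zero w hzS, h.indicator_coeff_eq_zero hf.zero hzS]
    ring

end PatchOscillatory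

/-! ### Globalization by a partition of unity -/

section Global

set_option linter.unusedSectionVars false

variable {X : Type*} [TopologicalSpace X] [T2Space X] [SecondCountableTopology X] [Nonempty X]
  [ChartedSpace ℂ X] [IsManifold 𝓘(ℂ, ℂ) ω X] [MeasurableSpace X] [BorelSpace X]

/-- The standing assumptions on the domain `M`, the phase `ψ = Im Φ` with its Morse point `z₀`, the
Cauchy kernel `κ`, and the compact set `K` in which the forms are supported. -/
structure IsPhaseSetting (M U K : Set X) (Φ : X → ℂ) (ψ : X → ℝ) (z₀ : X) (κ : X → Form10 X) :
    Prop where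
  isOpen : IsOpen M
  isCompact_closure : IsCompact (closure M)
  mdifferentiable : MDifferentiable 𝓘(ℂ, ℂ) 𝓘(ℂ, ℂ) Φ
  im_eq : ∀ x, ψ x = (Φ x).im
  mem : z₀ ∈ M
  isMorse : IsMorseCritical Φ z₀
  isCauchyKernel : IsCauchyKernel κ
  isOpen_holomorphic : IsOpen U
  isHolomorphicInSecond : IsHolomorphicInSecond κ U
  isCompact : IsCompact K
  subset : K ⊆ M
  subset_holomorphic : K ⊆ U
  eq_of_isCritical : ∀ x ∈ K, IsCritical Φ x → x = z₀

variable {M U K : Set X} {Φ : X → ℂ} {ψ : X → ℝ} {z₀ : X} {κ : X → Form10 X} {g : ConformalMetric X}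
  {f : Form01 X} {N : ℤ} {u : X → ℂ}

theorem IsPhaseSetting.area_ne_top (h : IsPhaseSetting M U K Φ ψ z₀ κ) (g : ConformalMetric X) :
    g.area M ≠ ⊤ :=
  ((measure_mono subset_closure).trans_lt h.isCompact_closure.measure_lt_top).ne

/-- The support of the forms is covered by patches that carry the members of a partition of unity. -/
theorem IsPhaseSetting.exists_patches (h : IsPhaseSetting M U K Φ ψ z₀ κ) :
    ∃ (t : Finset X) (θ : X → X → ℂ), (∀ x, IsSmoothFun (θ x)) ∧ (∀ y ∈ K, ∑ x ∈ t, θ x y = 1) ∧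
      ∀ x ∈ t, ∃ O K' p, IsPatch Φ z₀ (M ∩ U) (chartAt ℂ x) (K ∩ tsupport (θ x)) O K' p := by
  obtain ⟨t, θ, hθ, hts, htz, hsum⟩ := exists_partition h.isCompact z₀
  refine ⟨t, θ, hθ, hsum, fun x hx => ?_⟩
  refine exists_isPatch h.mdifferentiable h.isMorse (h.isOpen.inter h.isOpen_holomorphic)
    (chart_mem_atlas ℂ x) (h.isCompact.inter_right (isClosed_tsupport _))
    (inter_subset_right.trans (hts x hx))
    (inter_subset_left.trans (subset_inter h.subset h.subset_holomorphic))
    (fun y hy => h.eq_of_isCritical y hy.1) ?_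
  by_cases hxz : x = z₀
  · exact Or.inl (by rw [hxz])
  · exact Or.inr fun hz => htz x hx hxz hz.2

theorem starWedge_smul (g : ConformalMetric X) (α : Form10 X) (a : X → ℂ) (f : Form01 X) (x : X) :
    starWedge g α (fun x => a x • f x) x = a x * starWedge g α f x := by
  have : (a x • f x) (1 : ℂ) = a x * f x (1 : ℂ) := rfl
  rw [starWedge, starWedge, this]
  ring

/-- Splitting `∫ α ∧ (a f)` by a partition of unity. -/
theorem intWedge_eq_sum (g : ConformalMetric X) {t : Finset X} {θ : X → X → ℂ}
    (hsum : ∀ y ∈ K, ∑ x ∈ t, θ x y = 1) (hf : ∀ x ∉ K, f x = 0) (α : Form10 X) (a : X → ℂ)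
    (hint : ∀ x ∈ t, Integrable (starWedge g α fun y => a y • (θ x y • f y)) g.area) :
    Integrable (starWedge g α fun y => a y • f y) g.area ∧
      intWedge g α (fun y => a y • f y) =
        ∑ x ∈ t, intWedge g α fun y => a y • (θ x y • f y) := by
  have e : (starWedge g α fun y => a y • f y) =
      fun y => ∑ x ∈ t, starWedge g α (fun y => a y • (θ x y • f y)) y := by
    ext y
    have h1 : ∀ x, starWedge g α (fun y => a y • (θ x y • f y)) y =
        a y * (θ x y * starWedge g α f y) := fun x => by
      rw [starWedge_smul g α a fun y => θ x y • f y, starWedge_smul]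
    simp only [h1]
    rw [starWedge_smul, ← Finset.mul_sum, ← Finset.sum_mul]
    by_cases hy : y ∈ K
    · rw [hsum y hy, one_mul]
    · rw [starWedge_eq_zero g α (hf y hy), mul_zero, mul_zero, mul_zero]
  refine ⟨e ▸ integrable_finsetSum t hint, ?_⟩
  rw [intWedge, e, integral_finsetSum t hint]
  rfl

theorem IsPhaseSetting.exists_kernel_bound (h : IsPhaseSetting M U K Φ ψ z₀ κ)
    {e : OpenPartialHomeomorph X ℂ} {L : Set X} {O K' : Set ℂ} {p : ℂ}
    (hp : IsPatch Φ z₀ (M ∩ U) e L O K' p) :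
    ∃ B : ℝ, ∀ w ∈ closure M, IsKernel O (pole e K' p w) B ((κ w).coeff e) :=
  hp.exists_isKernel h.isCauchyKernel h.isOpen_holomorphic h.isHolomorphicInSecond
    inter_subset_right h.isCompact_closure

theorem IsPhaseSetting.integrable_piece (h : IsPhaseSetting M U K Φ ψ z₀ κ)
    (g : ConformalMetric X) (hf : IsSingularForm z₀ K N f) (hN : -1 ≤ N) (s ħ : ℝ) {w : X}
    (hw : w ∈ M) (hwz : w ≠ z₀) {x : X} {θ : X → ℂ} (hθ : IsSmoothFun θ)
    (hpx : ∃ O K' p, IsPatch Φ z₀ (M ∩ U) (chartAt ℂ x) (K ∩ tsupport θ) O K' p) :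
    Integrable (starWedge g (κ w) fun y => osc s ψ ħ y • (θ y • f y)) g.area := by
  obtain ⟨O, K', p, hp⟩ := hpx
  obtain ⟨B, hB⟩ := h.exists_kernel_bound hp
  exact hp.integrable_starWedge_kernel g h.im_eq (hf.smul hθ) hN s ħ hwz (hB w (subset_closure hw))

theorem IsPhaseSetting.integrable_starWedge_kernel (h : IsPhaseSetting M U K Φ ψ z₀ κ)
    (g : ConformalMetric X) (hf : IsSingularForm z₀ K N f) (hN : -1 ≤ N) (s ħ : ℝ) {w : X}
    (hw : w ∈ M) (hwz : w ≠ z₀) :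
    Integrable (starWedge g (κ w) fun y => osc s ψ ħ y • f y) g.area := by
  obtain ⟨t, θ, hθ, hsum, hpatch⟩ := h.exists_patches
  exact (intWedge_eq_sum g hsum hf.zero (κ w) (osc s ψ ħ) fun x hx =>
    h.integrable_piece g hf hN s ħ hw hwz (hθ x) (hpatch x hx)).1

theorem dbarInvPsi_eq_sum (g : ConformalMetric X) {t : Finset X} {θ : X → X → ℂ}
    (hsum : ∀ y ∈ K, ∑ x ∈ t, θ x y = 1) (hf : ∀ x ∉ K, f x = 0) (ħ : ℝ) (w : X)
    (hint : ∀ x ∈ t,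
      Integrable (starWedge g (κ w) fun y => osc (-2) ψ ħ y • (θ x y • f y)) g.area) :
    dbarInvPsi g κ ψ ħ f w = ∑ x ∈ t, dbarInvPsi g κ ψ ħ (fun y => θ x y • f y) w := by
  rw [dbarInvPsi, dbarInv, (intWedge_eq_sum g hsum hf (κ w) (osc (-2) ψ ħ) hint).2, Finset.mul_sum]
  rfl

/-- An `o`-estimate in `L^q` of the transform follows from the same estimate in every patch. -/
theorem IsPhaseSetting.isLittleOLp_of_pieces (h : IsPhaseSetting M U K Φ ψ z₀ κ)
    (hf : IsSingularForm z₀ K N f) (hN : -1 ≤ N) {q : ℝ≥0∞} (hq : 1 ≤ q) {s : ℝ}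
    (H : ∀ (e : OpenPartialHomeomorph X ℂ) (L : Set X) (O K' : Set ℂ) (p : ℂ) (f : Form01 X) (B : ℝ),
      IsPatch Φ z₀ (M ∩ U) e L O K' p → IsSingularForm z₀ L N f →
      (∀ w ∈ M, IsKernel O (pole e K' p w) B ((κ w).coeff e)) →
      IsLittleOLp g M q s fun ħ => dbarInvPsi g κ ψ ħ f) :
    IsLittleOLp g M q s fun ħ => dbarInvPsi g κ ψ ħ f := by
  obtain ⟨t, θ, hθ, hsum, hpatch⟩ := h.exists_patches
  have h1 : IsLittleOLp g M q s fun ħ w =>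
      ∑ x ∈ t, dbarInvPsi g κ ψ ħ (fun y => θ x y • f y) w := by
    refine IsLittleOLp.sum hq t fun x hx => ?_
    obtain ⟨O, K', p, hp⟩ := hpatch x hx
    obtain ⟨B, hB⟩ := h.exists_kernel_bound hp
    exact H _ _ O K' p _ B hp (hf.smul (hθ x)) fun w hw => hB w (subset_closure hw)
  refine h1.congr' fun ħ hħ => ?_
  filter_upwards [ae_ne_point g M z₀, ae_restrict_mem h.isOpen.measurableSet] with w hwz hw
  exact (dbarInvPsi_eq_sum g hsum hf.zero ħ w fun x hx =>
    h.integrable_piece g hf hN (-2) ħ hw hwz (hθ x) (hpatch x hx)).symm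

theorem IsPhaseSetting.isLittleOLp_neg_one (h : IsPhaseSetting M U K Φ ψ z₀ κ)
    (hf : IsSingularForm z₀ K (-1) f) {q : ℝ≥0∞} (hq : 1 ≤ q) (hq' : q ≠ ⊤) :
    IsLittleOLp g M q 0 fun ħ => dbarInvPsi g κ ψ ħ f :=
  h.isLittleOLp_of_pieces hf le_rfl hq fun _ _ _ _ _ _ _ hp hf hB =>
    hp.isLittleOLp_neg_one h.isCauchyKernel h.im_eq hf h.isOpen (h.area_ne_top g) hB hq hq'

theorem IsPhaseSetting.isLittleOLp_zero (h : IsPhaseSetting M U K Φ ψ z₀ κ)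
    (hf : IsSingularForm z₀ K 0 f) :
    IsLittleOLp g M 2 (1 / 2) fun ħ => dbarInvPsi g κ ψ ħ f :=
  h.isLittleOLp_of_pieces hf (by norm_num) (by norm_num) fun _ _ _ _ _ _ _ hp hf hB =>
    hp.isLittleOLp_zero h.isCauchyKernel h.im_eq hf h.isOpen (h.area_ne_top g) hB

theorem osc_zero_smul (ψ : X → ℝ) (ħ : ℝ) (f : Form01 X) : (fun x => osc 0 ψ ħ x • f x) = f := by
  ext x : 1
  have : osc 0 ψ ħ x = 1 := by simp [osc]
  rw [this]
  exact one_smul ℂ (show ℂ →L⋆[ℂ] ℂ from f x)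

/-- The Cauchy–Pompeiu formula on the surface. -/
theorem IsPhaseSetting.dbarInv_dbar (h : IsPhaseSetting M U K Φ ψ z₀ κ) (g : ConformalMetric X)
    (hu : IsSingularFun z₀ K N u) (hN : 0 ≤ N) {w : X} (hw : w ∈ M) (hwz : w ≠ z₀) :
    dbarInv g κ (dbar u) w = u w := by
  obtain ⟨t, θ, hθ, hsum, hpatch⟩ := h.exists_patches
  have hKc := h.isCompact.isClosed
  have hcl : ∀ x, IsClosed (K ∩ tsupport (θ x)) := fun x => hKc.inter (isClosed_tsupport _)
  have husum : u = fun y => ∑ x ∈ t, θ x y * u y := by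
    ext y
    rw [← Finset.sum_mul]
    by_cases hy : y ∈ K
    · rw [hsum y hy, one_mul]
    · rw [hu.zero y hy, mul_zero]
  have hd : ∀ y ≠ z₀, dbar u y (1 : ℂ) = ∑ x ∈ t, dbar (fun y => θ x y * u y) y (1 : ℂ) := by
    intro y hy
    have ht := mem_chart_target ℂ y
    have ha := chart_mem_atlas ℂ y
    have hv : ∀ v : X → ℂ, dbar v y (1 : ℂ) =
        dbarForm (fderiv ℝ (v ∘ (chartAt ℂ y).symm) (chartAt ℂ y y)) := fun v => by
      rw [← Form01.coeff_chartAt_self, dbar_coeff ha ht, dbarC_eq]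
    rw [hv, Finset.sum_congr rfl fun x _ => hv _, ← map_sum, ← fderiv_fun_sum]
    · congr 2
      ext z
      exact congrFun husum _
    · intro x _
      exact (((hu.smul (hθ x)).smooth _ ha).contDiffAt ((isOpen_target_inter_compl _ z₀).mem_nhds
        ⟨ht, by rwa [mem_preimage, (chartAt ℂ y).left_inv (mem_chart_source ℂ y)]⟩)).differentiableAt
        (by simp)
  have hint : ∀ x ∈ t, Integrable (starWedge g (κ w) (dbar fun y => θ x y * u y)) g.area := by
    intro x hx
    obtain ⟨O, K', p, hp⟩ := hpatch x hx
    obtain ⟨B, hB⟩ := h.exists_kernel_bound hp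
    have := hp.integrable_starWedge_kernel g h.im_eq ((hu.smul (hθ x)).dbar (hcl x)) (by lia) 0 1 hwz
      (hB w (subset_closure hw))
    rwa [osc_zero_smul] at this
  have hI : intWedge g (κ w) (dbar u) =
      ∑ x ∈ t, intWedge g (κ w) (dbar fun y => θ x y * u y) := by
    simp only [intWedge]
    rw [← integral_finsetSum t hint]
    refine integral_congr_ae ?_
    filter_upwards [compl_mem_ae_iff.2 (g.area_singleton z₀)] with y hy
    simp only [starWedge]
    rw [hd y hy, Finset.mul_sum, Finset.mul_sum, Finset.sum_div]
  rw [dbarInv, hI, Finset.mul_sum]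
  refine Eq.trans ?_ (congrFun husum w).symm
  refine Finset.sum_congr rfl fun x hx => ?_
  obtain ⟨O, K', p, hp⟩ := hpatch x hx
  exact hp.dbarInv_dbar g h.isCauchyKernel h.isOpen_holomorphic h.isHolomorphicInSecond
    inter_subset_right (hcl x) (hu.smul (hθ x)) hN hwz

/-- The oscillatory integrals `∫ e^{4iψ/h} ρ(z, w) f ∧ χ`: absolute convergence, measurability in
`w`, and a bound uniform in `w`. -/
theorem IsPhaseSetting.intWedge_osc (h : IsPhaseSetting M U K Φ ψ z₀ κ) (g : ConformalMetric X)
    (hf : IsSingularForm z₀ K N f) {χ : Form10 X} (hχ : χ.SmoothOn univ) {ρ : X × X → ℂ}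
    {W : Set (X × X)} (hW : IsOpen W) (hMW : closure M ×ˢ closure M ⊆ W)
    (hρ : ContMDiffOn (𝓘(ℝ, ℂ).prod 𝓘(ℝ, ℂ)) 𝓘(ℝ, ℂ) ∞ ρ W) (s : ℝ) {r : ℝ}
    (hr : IsDecayExponent N r) :
    (∀ ħ, ∀ w ∈ M, Integrable (starWedge g χ fun z => (osc s ψ ħ z * ρ (z, w)) • f z) g.area) ∧
    (∀ ħ, AEStronglyMeasurable (fun w => intWedge g χ fun z => (osc s ψ ħ z * ρ (z, w)) • f z)
      (g.area.restrict M)) ∧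
    (s ≠ 0 → ∃ C : ℝ, ∀ ħ : ℝ, 0 < ħ → ħ ≤ 1 → ∀ w ∈ M,
      ‖intWedge g χ fun z => (osc s ψ ħ z * ρ (z, w)) • f z‖ ≤ C * ħ ^ r) := by
  obtain ⟨t, θ, hθ, hsum, hpatch⟩ := h.exists_patches
  have hYn : (closure M).Nonempty := ⟨z₀, subset_closure h.mem⟩
  have hVW : (M ∩ U) ×ˢ closure M ⊆ W :=
    (Set.prod_mono_left (inter_subset_left.trans subset_closure)).trans hMW
  have hint : ∀ ħ, ∀ w ∈ M, ∀ x ∈ t, Integrable (starWedge g χ fun z =>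
      (osc s ψ ħ z * ρ (z, w)) • (θ x z • f z)) g.area := fun ħ w hw x hx => by
    obtain ⟨O, K', p, hp⟩ := hpatch x hx
    exact hp.integrable_starWedge_osc h.im_eq (hf.smul (hθ x)) hr.neg_one_le hχ hW hρ
      h.isCompact_closure hVW s ħ (subset_closure hw)
  have hsplit : ∀ ħ, ∀ w ∈ M, _ := fun ħ w hw => intWedge_eq_sum g hsum hf.zero χ
    (fun z => osc s ψ ħ z * ρ (z, w)) (hint ħ w hw)
  refine ⟨fun ħ w hw => (hsplit ħ w hw).1, fun ħ => ?_, fun hs => ?_⟩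
  · have hm : AEStronglyMeasurable (fun w => ∑ x ∈ t, intWedge g χ fun z =>
        (osc s ψ ħ z * ρ (z, w)) • (θ x z • f z)) (g.area.restrict M) := by
      refine Finset.aestronglyMeasurable_fun_sum t fun x hx => ?_
      obtain ⟨O, K', p, hp⟩ := hpatch x hx
      exact (hp.aestronglyMeasurable_intWedge_osc h.im_eq (hf.smul (hθ x)) hχ hρ
        h.isCompact_closure hVW s ħ).mono_measure (Measure.restrict_mono_set _ subset_closure)
    refine hm.congr ((ae_restrict_iff' h.isOpen.measurableSet).2 (ae_of_all _ fun w hw => ?_))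
    exact (hsplit ħ w hw).2.symm
  · have hC : ∀ x ∈ t, ∃ C : ℝ, ∀ ħ : ℝ, 0 < ħ → ħ ≤ 1 → ∀ w ∈ closure M,
        ‖intWedge g χ fun z => (osc s ψ ħ z * ρ (z, w)) • (θ x z • f z)‖ ≤ C * ħ ^ r := by
      intro x hx
      obtain ⟨O, K', p, hp⟩ := hpatch x hx
      exact hp.exists_norm_intWedge_osc_le h.im_eq (hf.smul (hθ x)) hχ hW hρ h.isCompact_closure
        hYn hVW hs hr
    choose! C hC using hC
    refine ⟨∑ x ∈ t, C x, fun ħ hħ hħ1 w hw => ?_⟩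
    rw [(hsplit ħ w hw).2, Finset.sum_mul]
    exact (norm_sum_le _ _).trans (Finset.sum_le_sum fun x hx =>
      hC x hx ħ hħ hħ1 w (subset_closure hw))

end Global

/-! ### Division by `∂̄ψ` and iterated integration by parts -/

section Iteration

set_option linter.unusedSectionVars false

variable {X : Type*} [TopologicalSpace X] [T2Space X] [SecondCountableTopology X] [Nonempty X]
  [ChartedSpace ℂ X] [IsManifold 𝓘(ℂ, ℂ) ω X] [MeasurableSpace X] [BorelSpace X]
  {M U K : Set X} {Φ : X → ℂ} {ψ : X → ℝ} {z₀ : X} {κ : X → Form10 X} {g : ConformalMetric X}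
  {f : Form01 X} {N : ℤ} {u : X → ℂ}

/-- The function `(i/2) f / ∂̄ψ`. -/
def divDbar (ψ : X → ℝ) (f : Form01 X) (x : X) : ℂ :=
  Complex.I / 2 * f.quot (dbar fun y => (ψ y : ℂ)) x

theorem divDbar_comp_symm (hΦ : MDifferentiable 𝓘(ℂ, ℂ) 𝓘(ℂ, ℂ) Φ) (hψ : ∀ x, ψ x = (Φ x).im)
    {e : OpenPartialHomeomorph X ℂ} (he : e ∈ atlas ℂ X) {z : ℂ} (hz : z ∈ e.target)
    (f : Form01 X) : divDbar ψ f (e.symm z) = f.coeff e z * conjDerivInv (Φ ∘ e.symm) z := by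
  have h1 : (fun y => (ψ y : ℂ)) ∘ e.symm = fun z => (((Φ ∘ e.symm) z).im : ℂ) := by
    ext z
    simp [hψ]
  have hd := (differentiableOn_comp_symm hΦ he).differentiableAt (e.open_target.mem_nhds hz)
  rw [divDbar, Form01.quot_comp he hz, dbar_coeff he hz, h1, dbarC_im hd, conjDerivInv,
    ← mul_div_assoc, mul_div_mul_left _ _ (by simp), div_eq_mul_inv]

theorem divDbar_eq_zero {x : X} (h : f x = 0) : divDbar ψ f x = 0 := by
  have : f x (1 : ℂ) = 0 := by rw [h]; rfl
  rw [divDbar, Form01.quot, this, zero_div, mul_zero]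

theorem divDbar_smooth (hΦ : MDifferentiable 𝓘(ℂ, ℂ) 𝓘(ℂ, ℂ) Φ) (hψ : ∀ x, ψ x = (Φ x).im)
    (hK : IsClosed K) (hcrit : ∀ x ∈ K, IsCritical Φ x → x = z₀) (hf : f.SmoothOn {z₀}ᶜ)
    (h0 : ∀ x ∉ K, f x = 0) : ∀ e ∈ atlas ℂ X,
      ContDiffOn ℝ ∞ (divDbar ψ f ∘ e.symm) (e.target ∩ e.symm ⁻¹' {z₀}ᶜ) := by
  intro e he z hz
  refine ContDiffAt.contDiffWithinAt ?_
  by_cases hzK : e.symm z ∈ K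
  · have hφ := differentiableOn_comp_symm hΦ he
    have hne : deriv (Φ ∘ e.symm) z ≠ 0 := fun h =>
      hz.2 (hcrit _ hzK ((isCritical_iff hΦ he hz.1).2 h))
    have ho : IsOpen (e.target ∩ deriv (Φ ∘ e.symm) ⁻¹' {0}ᶜ) :=
      (hφ.deriv e.open_target).continuousOn.isOpen_inter_preimage e.open_target
        isClosed_singleton.isOpen_compl
    have h1 : ContDiffAt ℝ ∞ (conjDerivInv (Φ ∘ e.symm)) z :=
      (contDiffOn_conjDerivInv e.open_target hφ inter_subset_left fun z hz => hz.2).contDiffAt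
        (ho.mem_nhds ⟨hz.1, hne⟩)
    have h2 : ContDiffAt ℝ ∞ (f.coeff e) z :=
      (hf e he).contDiffAt ((isOpen_target_inter_compl e z₀).mem_nhds hz)
    refine (h2.mul h1).congr_of_eventuallyEq ?_
    filter_upwards [e.open_target.mem_nhds hz.1] with y hy using divDbar_comp_symm hΦ hψ he hy f
  · refine (contDiffAt_const (c := (0 : ℂ))).congr_of_eventuallyEq ?_
    filter_upwards [(e.isOpen_inter_preimage_symm hK.isOpen_compl).mem_nhds ⟨hz.1, hzK⟩] with y hy
    exact divDbar_eq_zero (h0 _ hy.2)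

theorem hasOrderAt_conjDerivInv (hΦ : MDifferentiable 𝓘(ℂ, ℂ) 𝓘(ℂ, ℂ) Φ)
    (hz₀ : IsMorseCritical Φ z₀) :
    HasOrderAt (conjDerivInv (Φ ∘ (chartAt ℂ z₀).symm)) (chartAt ℂ z₀ z₀) (-1) := by
  obtain ⟨O, K', p, h⟩ := exists_isPatch (L := {z₀}) (V := univ) hΦ hz₀ isOpen_univ
    (chart_mem_atlas ℂ z₀) isCompact_singleton (by simp) (subset_univ _) (fun x hx _ => hx)
    (Or.inl rfl)
  have hO : chartAt ℂ z₀ z₀ ∈ O := h.morse.subset ⟨z₀, rfl, rfl⟩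
  have hp : chartAt ℂ z₀ z₀ = p :=
    (h.eq_center (h.subset hO)).2 ((chartAt ℂ z₀).left_inv (mem_chart_source ℂ z₀))
  obtain ⟨r, hr, hrO⟩ := Metric.isOpen_iff.1 h.isOpen _ hO
  exact ⟨r, hr, hp ▸ h.morse.symbol.mono id (fun _ _ => trivial) (hp ▸ hrO)⟩

/-- Division by `∂̄ψ`, which vanishes to first order at the Morse point, lowers the order by one. -/
theorem IsPhaseSetting.isSingularFun_divDbar (h : IsPhaseSetting M U K Φ ψ z₀ κ)
    (hf : IsSingularForm z₀ K N f) : IsSingularFun z₀ K (N - 1) (divDbar ψ f) := by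
  refine ⟨divDbar_smooth h.mdifferentiable h.im_eq h.isCompact.isClosed h.eq_of_isCritical
    hf.smooth hf.zero, fun x hx => divDbar_eq_zero (hf.zero x hx), ?_⟩
  exact (hf.order.mul (hasOrderAt_conjDerivInv h.mdifferentiable h.isMorse)).congr
    ((chartAt ℂ z₀).open_target.mem_nhds (mem_chart_target ℂ z₀)) fun z hz =>
      (divDbar_comp_symm h.mdifferentiable h.im_eq (chart_mem_atlas ℂ z₀) hz.1 f).symm

theorem isSmoothFun_osc (hΦ : MDifferentiable 𝓘(ℂ, ℂ) 𝓘(ℂ, ℂ) Φ) (hψ : ∀ x, ψ x = (Φ x).im)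
    (t ħ : ℝ) : IsSmoothFun (osc t ψ ħ) := fun e he =>
  (contDiffOn_phase t ħ e.open_target (differentiableOn_comp_symm hΦ he)).congr
    fun z _ => osc_comp_symm hψ t ħ e z

/-- Since `∂̄ e^{-2iψ/h} = -(2i/h) e^{-2iψ/h} ∂̄ψ`, the form `e^{-2iψ/h} f` is, up to a factor `h`
and a term with one more factor `h`, the `∂̄`-derivative of `e^{-2iψ/h} (i/2) f / ∂̄ψ`. -/
theorem IsPhaseSetting.dbar_osc_mul (h : IsPhaseSetting M U K Φ ψ z₀ κ)
    (hf : IsSingularForm z₀ K N f) (ħ : ℝ) {x : X} (hx : x ≠ z₀) :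
    dbar (fun y => osc (-2) ψ ħ y * divDbar ψ f y) x (1 : ℂ) =
      osc (-2) ψ ħ x * dbar (divDbar ψ f) x (1 : ℂ) +
        (ħ : ℂ)⁻¹ * (osc (-2) ψ ħ x * f x (1 : ℂ)) := by
  have hF := h.isSingularFun_divDbar hf
  have hK := h.isCompact.isClosed
  by_cases hxK : x ∈ K
  · have hz := mem_chart_target ℂ x
    have he := chart_mem_atlas ℂ x
    have hs : (chartAt ℂ x).symm (chartAt ℂ x x) = x := (chartAt ℂ x).left_inv (mem_chart_source ℂ x)
    have hd := (differentiableOn_comp_symm h.mdifferentiable he).differentiableAt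
      ((chartAt ℂ x).open_target.mem_nhds hz)
    have hne : deriv (Φ ∘ (chartAt ℂ x).symm) (chartAt ℂ x x) ≠ 0 := fun h0 => by
      refine hx (h.eq_of_isCritical x hxK ?_)
      rw [← hs]
      exact (isCritical_iff h.mdifferentiable he hz).2 h0
    have hne' : conj (deriv (Φ ∘ (chartAt ℂ x).symm) (chartAt ℂ x x)) ≠ 0 := by simpa using hne
    have hFd : DifferentiableAt ℝ (divDbar ψ f ∘ (chartAt ℂ x).symm) (chartAt ℂ x x) :=
      ((hF.smooth _ he).contDiffAt ((isOpen_target_inter_compl _ z₀).mem_nhds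
        ⟨hz, by rwa [mem_preimage, hs]⟩)).differentiableAt (by simp)
    have hEd : DifferentiableAt ℝ (phase (-2) ħ (Φ ∘ (chartAt ℂ x).symm)) (chartAt ℂ x x) :=
      ((contDiffOn_phase (-2) ħ (chartAt ℂ x).open_target
        (differentiableOn_comp_symm h.mdifferentiable he)).contDiffAt
          ((chartAt ℂ x).open_target.mem_nhds hz)).differentiableAt (by simp)
    have e1 : (fun y => osc (-2) ψ ħ y * divDbar ψ f y) ∘ (chartAt ℂ x).symm = fun z =>
        phase (-2) ħ (Φ ∘ (chartAt ℂ x).symm) z * (divDbar ψ f ∘ (chartAt ℂ x).symm) z := by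
      ext z
      simp [osc_comp_symm h.im_eq]
    have e2 : osc (-2) ψ ħ x = phase (-2) ħ (Φ ∘ (chartAt ℂ x).symm) (chartAt ℂ x x) := by
      rw [← osc_comp_symm h.im_eq, hs]
    rw [← Form01.coeff_chartAt_self, ← Form01.coeff_chartAt_self (dbar (divDbar ψ f)),
      ← Form01.coeff_chartAt_self f, dbar_coeff he hz, dbar_coeff he hz, e1, dbarC_mul hEd hFd,
      dbarC_phase _ _ hd, e2, Function.comp_apply,
      divDbar_comp_symm h.mdifferentiable h.im_eq he hz, conjDerivInv]
    push_cast
    field_simp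
    ring
  · have h1 : ∀ (β : Form01 X), β x = 0 → β x (1 : ℂ) = 0 := fun β hβ => by rw [hβ]; rfl
    rw [h1 _ (dbar_eq_zero hK (fun y hy => by rw [hF.zero y hy, mul_zero]) hxK),
      h1 _ (dbar_eq_zero hK hF.zero hxK), h1 _ (hf.zero x hxK)]
    ring

/-- One integration by parts: apply `∂̄⁻¹` to the formula for `∂̄ (e^{-2iψ/h} (i/2) f / ∂̄ψ)`. The
order of `f` is at least `1`, so that this function has order at least `0` and is recovered from its
`∂̄`-derivative. -/
theorem IsPhaseSetting.dbarInvPsi_step (h : IsPhaseSetting M U K Φ ψ z₀ κ)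
    (hf : IsSingularForm z₀ K N f) (hN : 1 ≤ N) {ħ : ℝ} (hħ : 0 < ħ) {w : X} (hw : w ∈ M)
    (hwz : w ≠ z₀) :
    dbarInvPsi g κ ψ ħ f w = (ħ : ℂ) * (osc (-2) ψ ħ w * divDbar ψ f w) -
      ħ * dbarInvPsi g κ ψ ħ (dbar (divDbar ψ f)) w := by
  have hF := h.isSingularFun_divDbar hf
  have hK := h.isCompact.isClosed
  have hoF : IsSingularFun z₀ K (N - 1) fun y => osc (-2) ψ ħ y * divDbar ψ f y :=
    (hF.smul (isSmoothFun_osc h.mdifferentiable h.im_eq (-2) ħ)).mono inter_subset_left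
  have i1 := h.integrable_starWedge_kernel g (hoF.dbar hK) (by lia) 0 ħ hw hwz
  rw [osc_zero_smul] at i1
  have i2 := h.integrable_starWedge_kernel g (hF.dbar hK) (by lia) (-2) ħ hw hwz
  have hR := h.dbarInv_dbar g hoF (by lia) hw hwz
  have hħ' : (ħ : ℂ) ≠ 0 := by exact_mod_cast hħ.ne'
  have hI : intWedge g (κ w) (fun x => osc (-2) ψ ħ x • f x) =
      ħ * intWedge g (κ w) (dbar fun y => osc (-2) ψ ħ y * divDbar ψ f y) -
        ħ * intWedge g (κ w) fun x => osc (-2) ψ ħ x • dbar (divDbar ψ f) x := by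
    rw [intWedge, intWedge, intWedge, ← integral_const_mul, ← integral_const_mul,
      ← integral_sub (i1.const_mul _) (i2.const_mul _)]
    refine integral_congr_ae ?_
    filter_upwards [compl_mem_ae_iff.2 (g.area_singleton z₀)] with y hy
    rw [starWedge_smul, starWedge_smul, starWedge, starWedge, starWedge, h.dbar_osc_mul hf ħ hy]
    field_simp
    ring
  rw [dbarInvPsi, dbarInv, hI, mul_sub, mul_left_comm, ← hR, dbarInv, dbarInvPsi, dbarInv]
  ring

/-- The forms `f, ∂̄F^1, ∂̄F^2, …`. -/
def formSeq (ψ : X → ℝ) (f : Form01 X) : ℕ → Form01 X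
  | 0 => f
  | j + 1 => dbar (expDbar ψ f (j + 1))

theorem expDbar_succ (ψ : X → ℝ) (f : Form01 X) (j : ℕ) :
    expDbar ψ f (j + 1) = divDbar ψ (formSeq ψ f j) := by
  cases j <;> rfl

/-- Each step costs two orders, one for the division by `∂̄ψ` and one for `∂̄`. -/
theorem IsPhaseSetting.isSingularForm_formSeq (h : IsPhaseSetting M U K Φ ψ z₀ κ)
    (hf : IsSingularForm z₀ K N f) (j : ℕ) : IsSingularForm z₀ K (N - 2 * j) (formSeq ψ f j) := by
  induction j with
  | zero => simpa [formSeq] using hf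
  | succ j ih =>
    have := (h.isSingularFun_divDbar ih).dbar h.isCompact.isClosed
    rw [← expDbar_succ] at this
    change IsSingularForm z₀ K _ (RiemannSurface.dbar (expDbar ψ f (j + 1)))
    convert this using 1
    push_cast
    ring

/-- The `n`-th step is applied to a form of order `N - 2 (n - 1)`, which has to be at least `1`. -/
theorem IsPhaseSetting.dbarInvPsi_expansion (h : IsPhaseSetting M U K Φ ψ z₀ κ)
    (hf : IsSingularForm z₀ K N f) {ħ : ℝ} (hħ : 0 < ħ) {w : X} (hw : w ∈ M)
    (hwz : w ≠ z₀) (n : ℕ) (hn : 2 * (n : ℤ) - 1 ≤ N) :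
    dbarInvPsi g κ ψ ħ f w =
      osc (-2) ψ ħ w * ∑ j ∈ Finset.Icc 1 n, (-1) ^ (j - 1) * (ħ : ℂ) ^ j * expDbar ψ f j w +
        (-1) ^ n * (ħ : ℂ) ^ n * dbarInvPsi g κ ψ ħ (formSeq ψ f n) w := by
  induction n with
  | zero => simp [formSeq]
  | succ n ih =>
    push_cast at hn
    rw [ih (by lia), Finset.sum_Icc_succ_top (by lia),
      h.dbarInvPsi_step (h.isSingularForm_formSeq hf n) (by lia) hħ hw hwz, ← expDbar_succ,
      Nat.add_sub_cancel, formSeq]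
    ring

end Iteration

/-! ### Forms of a given degree -/

section Degree

set_option linter.unusedSectionVars false

variable {X : Type*} [TopologicalSpace X] [T2Space X] [SecondCountableTopology X] [Nonempty X]
  [ChartedSpace ℂ X] [IsManifold 𝓘(ℂ, ℂ) ω X] [MeasurableSpace X] [BorelSpace X]
  {M U K : Set X} {Φ : X → ℂ} {ψ : X → ℝ} {z₀ : X} {κ : X → Form10 X} {g : ConformalMetric X}
  {f : Form01 X} {N : ℤ}

theorem eq_zero_of_notMem_supp {x : X} (hx : x ∉ f.supp) : f x = 0 := by
  by_contra h
  exact hx (subset_closure h)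

/-- The leading terms of a form of degree `N` and its remainder are both symbols of order `N`; the
expansion itself is not used any further. -/
theorem Form01.HasDegree.isSingularForm (hd : f.HasDegree z₀ N) (hf : f.SmoothOn {z₀}ᶜ) :
    IsSingularForm z₀ f.supp N f := by
  refine ⟨hf, fun x hx => eq_zero_of_notMem_supp hx, ?_⟩
  refine HasDegreeAt.hasOrderAt (chartAt ℂ z₀).open_target (mem_chart_target ℂ z₀) ?_ hd
  refine (hf _ (chart_mem_atlas ℂ z₀)).mono fun z hz => ⟨hz.1, fun h => hz.2 ?_⟩
  have hr := (chartAt ℂ z₀).right_inv hz.1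
  rw [mem_singleton_iff.1 h] at hr
  exact hr.symm

/-- The functions `F^j` are smooth off `z₀`; no bound on the degree of `f` is needed. -/
theorem contMDiffOn_expDbar (hΦ : MDifferentiable 𝓘(ℂ, ℂ) 𝓘(ℂ, ℂ) Φ)
    (hψ : ∀ x, ψ x = (Φ x).im) (hcrit : ∀ x ∈ f.supp, IsCritical Φ x → x = z₀)
    (hf : f.SmoothOn {z₀}ᶜ) (j : ℕ) :
    ContMDiffOn 𝓘(ℝ, ℂ) 𝓘(ℝ, ℂ) ∞ (expDbar ψ f j) {z₀}ᶜ := by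
  have hK : IsClosed f.supp := isClosed_closure
  have key : ∀ j, (formSeq ψ f j).SmoothOn {z₀}ᶜ ∧ ∀ x ∉ f.supp, formSeq ψ f j x = 0 := by
    intro j
    induction j with
    | zero => exact ⟨hf, fun x hx => eq_zero_of_notMem_supp hx⟩
    | succ j ih =>
      have h1 : formSeq ψ f (j + 1) = dbar (divDbar ψ (formSeq ψ f j)) := by
        rw [← expDbar_succ, formSeq]
      rw [h1]
      exact ⟨dbar_smoothOn (divDbar_smooth hΦ hψ hK hcrit ih.1 ih.2), fun x hx =>
        dbar_eq_zero hK (fun y hy => divDbar_eq_zero (ih.2 y hy)) hx⟩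
  cases j with
  | zero => exact contMDiffOn_const (c := (0 : ℂ))
  | succ j =>
    rw [expDbar_succ]
    exact contMDiffOn_of_contDiffOn_charts (divDbar_smooth hΦ hψ hK hcrit (key j).1 (key j).2)

theorem isDecayExponent_of_odd (hN : -1 ≤ N) (h : Odd N) {r : ℝ}
    (hr : r ≤ (⌊(N : ℝ) / 2⌋ : ℝ) + 1) : IsDecayExponent N r := by
  obtain ⟨k, rfl⟩ := h
  have h1 : ⌊((2 * k + 1 : ℤ) : ℝ) / 2⌋ = k := by
    rw [Int.floor_eq_iff]
    push_cast
    constructor <;> linarith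
  rw [h1] at hr
  obtain ⟨n, hn⟩ := Int.eq_ofNat_of_zero_le (show 0 ≤ k + 1 by lia)
  refine ⟨n, Or.inl ⟨by lia, hr.trans (le_of_eq ?_)⟩⟩
  exact_mod_cast hn

theorem isDecayExponent_of_even (hN : -1 ≤ N) (h : Even N) {r : ℝ} (hr : r < (N : ℝ) / 2 + 1) :
    IsDecayExponent N r := by
  obtain ⟨k, rfl⟩ := h
  obtain ⟨n, rfl⟩ := Int.eq_ofNat_of_zero_le (show 0 ≤ k by lia)
  refine ⟨n, Or.inr ⟨by lia, hr.trans_eq ?_⟩⟩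
  push_cast
  ring

theorem exists_isDecayExponent (hN : -1 ≤ N) : ∃ r, IsDecayExponent N r := by
  rcases Int.even_or_odd N with h | h
  · exact ⟨_, isDecayExponent_of_even hN h (sub_one_lt _)⟩
  · exact ⟨_, isDecayExponent_of_odd hN h le_rfl⟩

theorem IsPhaseSetting.intWedge_osc_one (h : IsPhaseSetting M U K Φ ψ z₀ κ)
    (g : ConformalMetric X) (hf : IsSingularForm z₀ K N f) {χ : Form10 X} (hχ : χ.SmoothOn univ)
    (s : ℝ) {r : ℝ} (hr : IsDecayExponent N r) :
    Integrable (starWedge g χ f) g.area ∧ (s ≠ 0 →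
      (fun ħ : ℝ => intWedge g χ (fun x => osc s ψ ħ x • f x)) =O[𝓝[>] 0] fun ħ => ħ ^ r) := by
  have H := fun s => h.intWedge_osc g hf hχ (ρ := fun _ => 1) isOpen_univ (subset_univ _)
    contMDiffOn_const s hr
  simp only [mul_one] at H
  refine ⟨?_, fun hs => ?_⟩
  · have := (H 0).1 1 z₀ h.mem
    rwa [osc_zero_smul] at this
  · obtain ⟨C, hC⟩ := (H s).2.2 hs
    refine IsBigO.of_bound C ?_
    filter_upwards [Ioc_mem_nhdsGT (zero_lt_one (α := ℝ))] with ħ hħ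
    rw [Real.norm_of_nonneg (Real.rpow_nonneg hħ.1.le r)]
    exact hC ħ hħ.1 hħ.2 z₀ h.mem

/-- The sign comes from the order of the factors in `f ∧ χ`. -/
theorem IsPhaseSetting.hasHDegree (h : IsPhaseSetting M U K Φ ψ z₀ κ)
    (hf : IsSingularForm z₀ K N f) (hN : -1 ≤ N) {I : Set ℝ} (hI : ∀ r ∈ I, IsDecayExponent N r) :
    f.HasHDegree g M ψ I := by
  intro χ hχ _ _
  obtain ⟨r, hr⟩ := exists_isDecayExponent hN
  exact ⟨(h.intWedge_osc_one g hf hχ 4 hr).1, fun r hr =>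
    ((h.intWedge_osc_one g hf hχ 4 (hI r hr)).2 (by norm_num)).neg_left⟩

theorem IsPhaseSetting.isBigOLp_intWedge (h : IsPhaseSetting M U K Φ ψ z₀ κ)
    (hf : IsSingularForm z₀ K N f) {χ : Form10 X} (hχ : χ.SmoothOn univ) {ρ : X × X → ℂ}
    {W : Set (X × X)} (hW : IsOpen W) (hMW : closure M ×ˢ closure M ⊆ W)
    (hρ : ContMDiffOn (𝓘(ℝ, ℂ).prod 𝓘(ℝ, ℂ)) 𝓘(ℝ, ℂ) ∞ ρ W) {s : ℝ} (hs : s ≠ 0) {r : ℝ}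
    (hr : IsDecayExponent N r) (q : ℝ≥0∞) :
    IsBigOLp g M q r fun ħ w => -intWedge g χ fun z => (osc s ψ ħ z * ρ (z, w)) • f z := by
  obtain ⟨-, hm, hb⟩ := h.intWedge_osc g hf hχ hW hMW hρ s hr
  obtain ⟨C, hC⟩ := hb hs
  refine isBigOLp_of_bound (h.area_ne_top g) h.isOpen (C := C) (fun ħ => (hm ħ).neg)
    fun ħ h0 h1 w hw => ?_
  rw [norm_neg]
  exact hC ħ h0 h1 w hw

end Degree

/-! ### Complex conjugation, which exchanges `∂` and `∂̄` -/

theorem HasDegreeAt.conj {c : ℂ → ℂ} {a : ℂ} {N : ℤ} (h : HasDegreeAt c a N) :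
    HasDegreeAt (fun z => conj (c z)) a N := by
  obtain ⟨S, C, h⟩ := h
  refine ⟨S.image (N - ·), fun k => conj (C (N - k)), fun m => ?_⟩
  have e : (fun z => conj (c z) - ∑ k ∈ S.image (N - ·),
      conj (C (N - k)) * (z - a) ^ k * (conj (z - a)) ^ (N - k)) = Complex.conjLIE ∘
        fun z => c z - ∑ k ∈ S, C k * (z - a) ^ k * (conj (z - a)) ^ (N - k) := by
    ext z
    rw [Finset.sum_image fun _ _ _ _ h => by simpa using h, Function.comp_apply,
      Complex.conjLIE_apply]
    simp only [sub_sub_cancel, map_sub, map_sum, map_mul, map_zpow₀, Complex.conj_conj]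
    congr 1
    refine Finset.sum_congr rfl fun k _ => ?_
    ring
  rw [e]
  refine IsBigO.of_norm_left ?_
  simp only [LinearIsometryEquiv.norm_iteratedFDeriv_comp_left]
  exact (h m).norm_left

section Conj

set_option linter.unusedSectionVars false

variable {X : Type*} [TopologicalSpace X] [T2Space X] [SecondCountableTopology X] [Nonempty X]
  [ChartedSpace ℂ X] [IsManifold 𝓘(ℂ, ℂ) ω X] [MeasurableSpace X] [BorelSpace X]
  {M U K : Set X} {Φ : X → ℂ} {ψ : X → ℝ} {z₀ : X} {κ : X → Form10 X} {g : ConformalMetric X}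
  {N : ℤ}

/-- Complex conjugation `T*_{0,1} → T*_{1,0}`. -/
def Form01.conj (α : Form01 X) : Form10 X := fun x =>
  (starL ℂ : ℂ ≃L⋆[ℂ] ℂ).toContinuousLinearMap.comp (α x)

theorem Form10.conj_apply_one (α : Form10 X) (x : X) :
    α.conj x (1 : ℂ) = (starRingEnd ℂ) (α x (1 : ℂ)) := rfl

theorem Form01.conj_apply_one (α : Form01 X) (x : X) :
    α.conj x (1 : ℂ) = (starRingEnd ℂ) (α x (1 : ℂ)) := rfl

theorem Form01.ext_one {α β : Form01 X} (h : ∀ x, α x (1 : ℂ) = β x (1 : ℂ)) : α = β :=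
  funext fun x => conjLinear_ext (h x)

theorem Form10.SmoothOn.conj {α : Form10 X} {S : Set X} (h : α.SmoothOn S) :
    α.conj.SmoothOn S := fun e he => Complex.conjCLE.contDiff.comp_contDiffOn (h e he)

theorem Form01.SmoothOn.conj {α : Form01 X} {S : Set X} (h : α.SmoothOn S) :
    α.conj.SmoothOn S := fun e he => Complex.conjCLE.contDiff.comp_contDiffOn (h e he)

theorem Form10.supp_conj (α : Form10 X) : α.conj.supp = α.supp := by
  have h2 : ∀ α : ℂ →L[ℂ] ℂ,
      (starL ℂ : ℂ ≃L⋆[ℂ] ℂ).toContinuousLinearMap.comp α = 0 ↔ α = 0 := fun α => by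
    refine ⟨fun h => ContinuousLinearMap.ext fun c => ?_, fun h => by simp [h]⟩
    have := DFunLike.congr_fun h c
    simpa using this
  exact congrArg closure (Set.ext fun x => not_congr (h2 (α x)))

theorem Form10.HasDegree.conj {α : Form10 X} (h : α.HasDegree z₀ N) : α.conj.HasDegree z₀ N :=
  HasDegreeAt.conj h

theorem Form10.conj_smul (a : X → ℂ) (α : Form10 X) :
    Form10.conj (fun x => a x • α x) = fun x => (starRingEnd ℂ) (a x) • α.conj x :=
  Form01.ext_one fun x => map_mul (starRingEnd ℂ) (a x) (α x (1 : ℂ))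

/-- Conjugation exchanges the two factors of `α ∧ β`, hence the sign. -/
theorem starWedge_conj (g : ConformalMetric X) (α : Form10 X) (β : Form01 X) (x : X) :
    starWedge g α β x = -conj (starWedge g β.conj α.conj x) := by
  simp only [starWedge, Form10.conj_apply_one, Form01.conj_apply_one, map_div₀, map_mul, map_neg,
    Complex.conj_ofReal, Complex.conj_conj, Complex.conj_I, map_ofNat]
  ring

theorem intWedge_conj (g : ConformalMetric X) (α : Form10 X) (β : Form01 X) :
    intWedge g α β = -conj (intWedge g β.conj α.conj) := by
  rw [intWedge, intWedge, ← integral_conj, ← integral_neg]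
  exact integral_congr_ae (ae_of_all _ fun x => starWedge_conj g α β x)

theorem osc_neg_phase (t : ℝ) (ψ : X → ℝ) (ħ : ℝ) (x : X) :
    osc t (fun y => -ψ y) ħ x = conj (osc t ψ ħ x) := by
  rw [osc, osc, ← Complex.exp_conj]
  congr 1
  simp only [map_mul, Complex.conj_I, Complex.conj_ofReal]
  push_cast
  ring

theorem realDeriv_eq_fderiv (u : X → ℂ) (x : X) (v : ℂ) :
    realDeriv u x v = fderiv ℝ (u ∘ (chartAt ℂ x).symm) (chartAt ℂ x x) v := by
  rw [fderiv_comp_symm (chart_mem_atlas ℂ x) (mem_chart_target ℂ x), coordVec_chartAt, one_mul,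
    (chartAt ℂ x).left_inv (mem_chart_source ℂ x)]

theorem realDeriv_conj (u : X → ℂ) (x : X) (v : ℂ) :
    realDeriv (fun y => conj (u y)) x v = conj (realDeriv u x v) := by
  have : (fun y => conj (u y)) ∘ (chartAt ℂ x).symm =
    Complex.conjCLE ∘ (u ∘ (chartAt ℂ x).symm) := rfl
  rw [realDeriv_eq_fderiv, realDeriv_eq_fderiv, this, ContinuousLinearEquiv.comp_fderiv]
  rfl

theorem realDeriv_neg (u : X → ℂ) (x : X) (v : ℂ) :
    realDeriv (fun y => -u y) x v = -realDeriv u x v := by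
  have : (fun y => -u y) ∘ (chartAt ℂ x).symm = -(u ∘ (chartAt ℂ x).symm) := rfl
  rw [realDeriv_eq_fderiv, realDeriv_eq_fderiv, this, fderiv_neg]
  rfl

theorem dbar_apply_one (u : X → ℂ) (x : X) :
    dbar u x (1 : ℂ) = (realDeriv u x 1 + Complex.I * realDeriv u x Complex.I) / 2 := by
  change _ / 2 * (starRingEnd ℂ) 1 = _
  rw [map_one, mul_one]

theorem del_apply_one (u : X → ℂ) (x : X) :
    del u x (1 : ℂ) = (realDeriv u x 1 - Complex.I * realDeriv u x Complex.I) / 2 := by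
  change (realDeriv u x 1 - Complex.I * realDeriv u x Complex.I) / 2 * 1 = _
  rw [mul_one]

theorem conj_del (u : X → ℂ) : (del u).conj = dbar fun y => conj (u y) :=
  Form01.ext_one fun x => by
    rw [Form10.conj_apply_one, del_apply_one, dbar_apply_one, realDeriv_conj, realDeriv_conj]
    simp only [map_div₀, map_sub, map_mul, Complex.conj_I, map_ofNat]
    ring

theorem dbar_neg_apply_one (u : X → ℂ) (x : X) :
    dbar (fun y => -u y) x (1 : ℂ) = -dbar u x (1 : ℂ) := by
  rw [dbar_apply_one, dbar_apply_one, realDeriv_neg, realDeriv_neg]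
  ring

/-- `∂̄(-ψ)` is the negative of the conjugate of `∂ψ`, and `i/2` is the negative of its conjugate: the
two signs cancel. -/
theorem quot_conj (α : Form10 X) (ψ : X → ℝ) (x : X) :
    Complex.I / 2 * α.conj.quot (dbar fun y => ((-ψ y : ℝ) : ℂ)) x =
      conj (Complex.I / 2 * α.quot (del fun y => (ψ y : ℂ)) x) := by
  have h1 : dbar (fun y => ((-ψ y : ℝ) : ℂ)) x (1 : ℂ) =
      -conj (del (fun y => (ψ y : ℂ)) x (1 : ℂ)) := by
    rw [← Form10.conj_apply_one, conj_del, ← dbar_neg_apply_one]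
    simp
  rw [Form01.quot, Form10.quot, h1, Form10.conj_apply_one]
  simp only [map_mul, map_div₀, Complex.conj_I, map_ofNat, div_neg]
  ring

theorem expDbar_conj (ψ : X → ℝ) (α : Form10 X) (j : ℕ) :
    expDbar (fun y => -ψ y) α.conj j = fun x => conj (expDel ψ α j x) := by
  induction j with
  | zero =>
    ext x
    simp [expDbar, expDel]
  | succ j ih =>
    cases j with
    | zero =>
      ext x
      exact quot_conj α ψ x
    | succ j =>
      ext x
      rw [expDbar, ih, ← conj_del]
      exact quot_conj _ ψ x

/-- The definition of `∂⁻¹` by conjugation turns the phase `e^{-2iψ/h}` into `e^{-2i(-ψ)/h}`. -/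
theorem delInvPsi_eq (g : ConformalMetric X) (κ : X → Form10 X) (ψ : X → ℝ) (ħ : ℝ) (α : Form10 X)
    (w : X) : delInvPsi g κ ψ ħ α w = conj (dbarInvPsi g κ (fun y => -ψ y) ħ α.conj w) := by
  simp only [delInvPsi, delInv, dbarInvPsi, Form10.conj_smul, osc_neg_phase]

theorem MemLp.conj {μ : Measure X} {q : ℝ≥0∞} {u : X → ℂ} (h : MemLp u q μ) :
    MemLp (fun x => conj (u x)) q μ :=
  h.of_le (Complex.continuous_conj.comp_aestronglyMeasurable h.aestronglyMeasurable)
    (ae_of_all _ fun x => by simp)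

theorem eLpNorm_conj {μ : Measure X} {q : ℝ≥0∞} (u : X → ℂ) :
    eLpNorm (fun x => conj (u x)) q μ = eLpNorm u q μ :=
  eLpNorm_congr_norm_ae (ae_of_all _ fun x => by simp)

theorem IsLittleOLp.conj {q : ℝ≥0∞} {s : ℝ} {u : ℝ → X → ℂ} (h : IsLittleOLp g M q s u) :
    IsLittleOLp g M q s fun ħ w => conj (u ħ w) := fun c hc =>
  (h c hc).mono fun _ hh => ⟨MemLp.conj hh.1, by rw [eLpNorm_conj]; exact hh.2⟩

theorem IsBigOLp.conj {q : ℝ≥0∞} {s : ℝ} {u : ℝ → X → ℂ} (h : IsBigOLp g M q s u) :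
    IsBigOLp g M q s fun ħ w => conj (u ħ w) := by
  obtain ⟨C, h⟩ := h
  exact ⟨C, h.mono fun _ hh => ⟨MemLp.conj hh.1, by rw [eLpNorm_conj]; exact hh.2⟩⟩

theorem isCritical_neg {x : X} : IsCritical (fun y => -Φ y) x ↔ IsCritical Φ x := by
  have : mfderiv 𝓘(ℂ, ℂ) 𝓘(ℂ, ℂ) (fun y => -Φ y) x = -mfderiv 𝓘(ℂ, ℂ) 𝓘(ℂ, ℂ) Φ x :=
    mfderiv_neg
  rw [IsCritical, IsCritical, this]
  exact neg_eq_zero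

theorem IsMorseCritical.neg (h : IsMorseCritical Φ z₀) : IsMorseCritical (fun y => -Φ y) z₀ := by
  refine ⟨isCritical_neg.2 h.1, ?_⟩
  have : (fun y => -Φ y) ∘ (chartAt ℂ z₀).symm = -(Φ ∘ (chartAt ℂ z₀).symm) := rfl
  have h2 : deriv (-(Φ ∘ (chartAt ℂ z₀).symm)) = -deriv (Φ ∘ (chartAt ℂ z₀).symm) := deriv.neg'
  rw [this, h2, deriv.neg]
  exact neg_ne_zero.2 h.2

/-- `-Im Φ = Im (-Φ)`, and `-Φ` has the same critical points as `Φ`. -/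
theorem IsPhaseSetting.neg (h : IsPhaseSetting M U K Φ ψ z₀ κ) :
    IsPhaseSetting M U K (fun y => -Φ y) (fun y => -ψ y) z₀ κ where
  __ := h
  mdifferentiable := fun x => (h.mdifferentiable x).neg
  im_eq := fun x => by simp [h.im_eq]
  isMorse := h.isMorse.neg
  eq_of_isCritical := fun x hx hc => h.eq_of_isCritical x hx (isCritical_neg.1 hc)

variable {f : Form10 X}

theorem contMDiffOn_expDel (hΦ : MDifferentiable 𝓘(ℂ, ℂ) 𝓘(ℂ, ℂ) Φ)
    (hψ : ∀ x, ψ x = (Φ x).im) (hcrit : ∀ x ∈ f.supp, IsCritical Φ x → x = z₀)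
    (hf : f.SmoothOn {z₀}ᶜ) (j : ℕ) :
    ContMDiffOn 𝓘(ℝ, ℂ) 𝓘(ℝ, ℂ) ∞ (expDel ψ f j) {z₀}ᶜ := by
  have h1 := contMDiffOn_expDbar (Φ := fun y => -Φ y) (ψ := fun y => -ψ y) (f := f.conj)
    (z₀ := z₀) (fun x => (hΦ x).neg) (fun x => by simp [hψ])
    (fun x hx hc => hcrit x (f.supp_conj ▸ hx) (isCritical_neg.1 hc)) hf.conj j
  rw [expDbar_conj] at h1
  have h2 := Complex.conjCLE.contDiff (n := ∞).contMDiff.comp_contMDiffOn h1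
  refine h2.congr fun x _ => ?_
  simp

theorem IsPhaseSetting.hasHDegree_conj (h : IsPhaseSetting M U K Φ ψ z₀ κ)
    (hf : IsSingularForm z₀ K N f.conj) (hN : -1 ≤ N) {I : Set ℝ}
    (hI : ∀ r ∈ I, IsDecayExponent N r) : f.HasHDegree g M ψ I := by
  intro χ hχ _ _
  obtain ⟨r, hr⟩ := exists_isDecayExponent hN
  have key : ∀ r, IsDecayExponent N r → _ := fun r hr =>
    h.neg.intWedge_osc_one g hf hχ.conj 4 hr
  refine ⟨?_, fun r hr => ?_⟩
  · have h1 := (Complex.conjCLE : ℂ →L[ℝ] ℂ).integrable_comp (key r hr).1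
    exact h1.neg.congr (ae_of_all _ fun x => (starWedge_conj g f χ x).symm)
  · refine IsBigO.of_norm_left ((((key r (hI r hr)).2 (by norm_num)).norm_left).congr_left fun ħ => ?_)
    rw [intWedge_conj g _ χ, norm_neg, RCLike.norm_conj, Form10.conj_smul]
    simp only [osc_neg_phase]

theorem IsPhaseSetting.isBigOLp_intWedge_conj (h : IsPhaseSetting M U K Φ ψ z₀ κ)
    (hf : IsSingularForm z₀ K N f.conj) {χ : Form01 X} (hχ : χ.SmoothOn univ) {ρ : X × X → ℂ}
    {W : Set (X × X)} (hW : IsOpen W) (hMW : closure M ×ˢ closure M ⊆ W)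
    (hρ : ContMDiffOn (𝓘(ℝ, ℂ).prod 𝓘(ℝ, ℂ)) 𝓘(ℝ, ℂ) ∞ ρ W) {s : ℝ} (hs : s ≠ 0) {r : ℝ}
    (hr : IsDecayExponent N r) (q : ℝ≥0∞) :
    IsBigOLp g M q r fun ħ w => intWedge g (fun z => (osc s ψ ħ z * ρ (z, w)) • f z) χ := by
  have hρ' : ContMDiffOn (𝓘(ℝ, ℂ).prod 𝓘(ℝ, ℂ)) 𝓘(ℝ, ℂ) ∞ (fun q => conj (ρ q)) W :=
    Complex.conjCLE.contDiff (n := ∞).contMDiff.comp_contMDiffOn hρ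
  have h1 := (h.neg.isBigOLp_intWedge (g := g) hf hχ.conj hW hMW hρ' hs hr q).conj
  refine (congrArg (IsBigOLp g M q r) ?_).mp h1
  ext ħ w
  rw [intWedge_conj g _ χ, Form10.conj_smul, map_neg]
  simp only [osc_neg_phase, map_mul]

theorem IsPhaseSetting.delInvPsi_expansion (h : IsPhaseSetting M U K Φ ψ z₀ κ)
    (hf : IsSingularForm z₀ K N f.conj) {ħ : ℝ} (hħ : 0 < ħ) {w : X} (hw : w ∈ M)
    (hwz : w ≠ z₀) (n : ℕ) (hn : 2 * (n : ℤ) + 1 ≤ N) :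
    delInvPsi g κ ψ ħ f w =
      osc (-2) ψ ħ w *
          ∑ j ∈ Finset.Icc 1 (n + 1), (-1) ^ (j - 1) * (ħ : ℂ) ^ j * expDel ψ f j w +
        (-1) ^ (n + 1) * (ħ : ℂ) ^ (n + 1) *
          delInvPsi g κ ψ ħ (del (expDel ψ f (n + 1))) w := by
  rw [delInvPsi_eq, delInvPsi_eq, h.neg.dbarInvPsi_expansion hf hħ hw hwz (n + 1)
    (by push_cast; lia), formSeq, expDbar_conj, ← conj_del]
  simp only [expDbar_conj, osc_neg_phase, map_add, map_mul, map_sum, map_pow, map_neg, map_one,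
    Complex.conj_ofReal, Complex.conj_conj]

theorem IsPhaseSetting.isSingularForm_conj_del_expDel (h : IsPhaseSetting M U K Φ ψ z₀ κ)
    (hf : IsSingularForm z₀ K N f.conj) (n : ℕ) :
    IsSingularForm z₀ K (N - 2 * (n + 1)) (del (expDel ψ f (n + 1))).conj := by
  have := h.neg.isSingularForm_formSeq hf (n + 1)
  rw [formSeq, expDbar_conj, ← conj_del] at this
  exact_mod_cast this

theorem IsLittleOLp.delInvPsi {q : ℝ≥0∞} {s : ℝ}
    (h : IsLittleOLp g M q s fun ħ => dbarInvPsi g κ (fun y => -ψ y) ħ f.conj) :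
    IsLittleOLp g M q s fun ħ => delInvPsi g κ ψ ħ f := by
  refine (congrArg (IsLittleOLp g M q s) ?_).mp h.conj
  ext ħ w
  exact (delInvPsi_eq g κ ψ ħ f w).symm

end Conj

end RiemannSurface

end

theorem lemma3p4
    {X : Type*} [TopologicalSpace X] [T2Space X] [SecondCountableTopology X] [Nonempty X]
    [ChartedSpace ℂ X] [IsManifold 𝓘(ℂ, ℂ) ω X] [MeasurableSpace X] [BorelSpace X]
    (g : RiemannSurface.ConformalMetric X)
    (M : Set X) (hMo : IsOpen M) (hMc : IsCompact (closure M))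
    (Φ : X → ℂ) (hΦ : MDifferentiable 𝓘(ℂ, ℂ) 𝓘(ℂ, ℂ) Φ)
    (ψ : X → ℝ) (hψ : ∀ x, ψ x = (Φ x).im)
    (z₀ : X) (hz₀M : z₀ ∈ M) (hz₀ : RiemannSurface.IsMorseCritical Φ z₀)
    (κ : X → RiemannSurface.Form10 X) (hκ : RiemannSurface.IsCauchyKernel κ)
    (U : Set X) (hU : IsOpen U) (hz₀U : z₀ ∈ U)
    (hκU : RiemannSurface.IsHolomorphicInSecond κ U) :
    -- the result for (0,1)-forms and `∂̄_ψ⁻¹`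
    (∀ f : RiemannSurface.Form01 X, f.SmoothOn {z₀}ᶜ → f.supp ⊆ M → f.supp ⊆ U →
      (∀ x ∈ f.supp, RiemannSurface.IsCritical Φ x → x = z₀) →
      (∀ j, ContMDiffOn 𝓘(ℝ, ℂ) 𝓘(ℝ, ℂ) ∞ (RiemannSurface.expDbar ψ f j) {z₀}ᶜ) ∧
      -- a)
      (∀ K : ℤ, -1 ≤ K → f.HasDegree z₀ K →
        (Odd K → f.HasHDegree g M ψ (Iic ((⌊(K : ℝ) / 2⌋ : ℝ) + 1))) ∧
        (Even K → f.HasHDegree g M ψ (Iio ((K : ℝ) / 2 + 1))) ∧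
        ∀ χ : RiemannSurface.Form10 X, χ.SmoothOn univ → IsCompact χ.supp → χ.supp ⊆ M →
        ∀ (ρ : X × X → ℂ) (W : Set (X × X)), IsOpen W → closure M ×ˢ closure M ⊆ W →
        ContMDiffOn (𝓘(ℝ, ℂ).prod 𝓘(ℝ, ℂ)) 𝓘(ℝ, ℂ) ∞ ρ W →
        ∀ p : ℝ≥0∞, 1 ≤ p → p ≠ ⊤ →
          (Odd K → RiemannSurface.IsBigOLp g M p ((⌊(K : ℝ) / 2⌋ : ℝ) + 1) fun h w =>
            -RiemannSurface.intWedge g χ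
              (fun z => (RiemannSurface.osc 4 ψ h z * ρ (z, w)) • f z)) ∧
          (Even K → ∀ ε : ℝ, 0 < ε →
            RiemannSurface.IsBigOLp g M p ((K : ℝ) / 2 + 1 - ε) fun h w =>
              -RiemannSurface.intWedge g χ
                (fun z => (RiemannSurface.osc 4 ψ h z * ρ (z, w)) • f z))) ∧
      -- b)
      (∀ K : ℕ, f.HasDegree z₀ (2 * (K : ℤ) + 1) →
        (∀ h : ℝ, 0 < h → ∀ w ∈ M, w ≠ z₀ →
          RiemannSurface.dbarInvPsi g κ ψ h f w =
            RiemannSurface.osc (-2) ψ h w * ∑ j ∈ Finset.Icc 1 (K + 1),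
                (-1) ^ (j - 1) * (h : ℂ) ^ j * RiemannSurface.expDbar ψ f j w
              + (-1) ^ (K + 1) * (h : ℂ) ^ (K + 1) * RiemannSurface.dbarInvPsi g κ ψ h
                  (RiemannSurface.dbar (RiemannSurface.expDbar ψ f (K + 1))) w) ∧
        ∀ p : ℝ≥0∞, 1 ≤ p → p ≠ ⊤ →
          RiemannSurface.IsLittleOLp g M p 0 fun h => RiemannSurface.dbarInvPsi g κ ψ h
            (RiemannSurface.dbar (RiemannSurface.expDbar ψ f (K + 1)))) ∧
      -- c)
      (∀ K : ℕ, 1 ≤ K → f.HasDegree z₀ (2 * (K : ℤ)) →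
        (∀ h : ℝ, 0 < h → ∀ w ∈ M, w ≠ z₀ →
          RiemannSurface.dbarInvPsi g κ ψ h f w =
            RiemannSurface.osc (-2) ψ h w * ∑ j ∈ Finset.Icc 1 K,
                (-1) ^ (j - 1) * (h : ℂ) ^ j * RiemannSurface.expDbar ψ f j w
              + (-1) ^ K * (h : ℂ) ^ K * RiemannSurface.dbarInvPsi g κ ψ h
                  (RiemannSurface.dbar (RiemannSurface.expDbar ψ f K)) w) ∧
        RiemannSurface.IsLittleOLp g M 2 (1 / 2) fun h => RiemannSurface.dbarInvPsi g κ ψ h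
          (RiemannSurface.dbar (RiemannSurface.expDbar ψ f K)))) ∧
    -- the result for (1,0)-forms and `∂_ψ⁻¹`
    (∀ f : RiemannSurface.Form10 X, f.SmoothOn {z₀}ᶜ → f.supp ⊆ M → f.supp ⊆ U →
      (∀ x ∈ f.supp, RiemannSurface.IsCritical Φ x → x = z₀) →
      (∀ j, ContMDiffOn 𝓘(ℝ, ℂ) 𝓘(ℝ, ℂ) ∞ (RiemannSurface.expDel ψ f j) {z₀}ᶜ) ∧
      -- a)
      (∀ K : ℤ, -1 ≤ K → f.HasDegree z₀ K →
        (Odd K → f.HasHDegree g M ψ (Iic ((⌊(K : ℝ) / 2⌋ : ℝ) + 1))) ∧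
        (Even K → f.HasHDegree g M ψ (Iio ((K : ℝ) / 2 + 1))) ∧
        ∀ χ : RiemannSurface.Form01 X, χ.SmoothOn univ → IsCompact χ.supp → χ.supp ⊆ M →
        ∀ (ρ : X × X → ℂ) (W : Set (X × X)), IsOpen W → closure M ×ˢ closure M ⊆ W →
        ContMDiffOn (𝓘(ℝ, ℂ).prod 𝓘(ℝ, ℂ)) 𝓘(ℝ, ℂ) ∞ ρ W →
        ∀ p : ℝ≥0∞, 1 ≤ p → p ≠ ⊤ →
          (Odd K → RiemannSurface.IsBigOLp g M p ((⌊(K : ℝ) / 2⌋ : ℝ) + 1) fun h w =>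
            RiemannSurface.intWedge g
              (fun z => (RiemannSurface.osc 4 ψ h z * ρ (z, w)) • f z) χ) ∧
          (Even K → ∀ ε : ℝ, 0 < ε →
            RiemannSurface.IsBigOLp g M p ((K : ℝ) / 2 + 1 - ε) fun h w =>
              RiemannSurface.intWedge g
                (fun z => (RiemannSurface.osc 4 ψ h z * ρ (z, w)) • f z) χ)) ∧
      -- b)
      (∀ K : ℕ, f.HasDegree z₀ (2 * (K : ℤ) + 1) →
        (∀ h : ℝ, 0 < h → ∀ w ∈ M, w ≠ z₀ →
          RiemannSurface.delInvPsi g κ ψ h f w =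
            RiemannSurface.osc (-2) ψ h w * ∑ j ∈ Finset.Icc 1 (K + 1),
                (-1) ^ (j - 1) * (h : ℂ) ^ j * RiemannSurface.expDel ψ f j w
              + (-1) ^ (K + 1) * (h : ℂ) ^ (K + 1) * RiemannSurface.delInvPsi g κ ψ h
                  (RiemannSurface.del (RiemannSurface.expDel ψ f (K + 1))) w) ∧
        ∀ p : ℝ≥0∞, 1 ≤ p → p ≠ ⊤ →
          RiemannSurface.IsLittleOLp g M p 0 fun h => RiemannSurface.delInvPsi g κ ψ h
            (RiemannSurface.del (RiemannSurface.expDel ψ f (K + 1)))) ∧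
      -- c)
      (∀ K : ℕ, 1 ≤ K → f.HasDegree z₀ (2 * (K : ℤ)) →
        (∀ h : ℝ, 0 < h → ∀ w ∈ M, w ≠ z₀ →
          RiemannSurface.delInvPsi g κ ψ h f w =
            RiemannSurface.osc (-2) ψ h w * ∑ j ∈ Finset.Icc 1 K,
                (-1) ^ (j - 1) * (h : ℂ) ^ j * RiemannSurface.expDel ψ f j w
              + (-1) ^ K * (h : ℂ) ^ K * RiemannSurface.delInvPsi g κ ψ h
                  (RiemannSurface.del (RiemannSurface.expDel ψ f K)) w) ∧
        RiemannSurface.IsLittleOLp g M 2 (1 / 2) fun h => RiemannSurface.delInvPsi g κ ψ h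
          (RiemannSurface.del (RiemannSurface.expDel ψ f K)))) := by
  have hK : ∀ S : Set X, IsClosed S → S ⊆ M → IsCompact S := fun S hS hSM =>
    hMc.of_isClosed_subset hS (hSM.trans subset_closure)
  refine ⟨fun f hf hfM hfU hcrit => ?_, fun f hf hfM hfU hcrit => ?_⟩
  · have h : RiemannSurface.IsPhaseSetting M U f.supp Φ ψ z₀ κ :=
      ⟨hMo, hMc, hΦ, hψ, hz₀M, hz₀, hκ, hU, hκU, hK _ isClosed_closure hfM, hfM, hfU, hcrit⟩
    refine ⟨RiemannSurface.contMDiffOn_expDbar hΦ hψ hcrit hf, fun K hK hd => ?_, fun K hd => ?_,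
      fun K hK1 hd => ?_⟩
    · have hs := hd.isSingularForm hf
      refine ⟨fun ho => h.hasHDegree hs hK fun r hr => RiemannSurface.isDecayExponent_of_odd hK ho hr,
        fun he => h.hasHDegree hs hK fun r hr => RiemannSurface.isDecayExponent_of_even hK he hr,
        fun χ hχ _ _ ρ W hW hMW hρ p _ _ => ⟨fun ho => ?_, fun he ε hε => ?_⟩⟩
      · exact h.isBigOLp_intWedge hs hχ hW hMW hρ four_ne_zero
          (RiemannSurface.isDecayExponent_of_odd hK ho le_rfl) p
      · exact h.isBigOLp_intWedge hs hχ hW hMW hρ four_ne_zero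
          (RiemannSurface.isDecayExponent_of_even hK he (sub_lt_self _ hε)) p
    · have hs := hd.isSingularForm hf
      refine ⟨fun ħ hħ w hw hwz => h.dbarInvPsi_expansion hs hħ hw hwz (K + 1) (by push_cast; lia),
        fun p hp hp' => h.isLittleOLp_neg_one ?_ hp hp'⟩
      have h1 := h.isSingularForm_formSeq hs (K + 1)
      rwa [show 2 * (K : ℤ) + 1 - 2 * ((K + 1 : ℕ) : ℤ) = -1 by push_cast; ring] at h1
    · have hs := hd.isSingularForm hf
      obtain ⟨n, rfl⟩ := Nat.exists_eq_add_of_le' hK1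
      refine ⟨fun ħ hħ w hw hwz => h.dbarInvPsi_expansion hs hħ hw hwz (n + 1) (by lia),
        h.isLittleOLp_zero ?_⟩
      have h1 := h.isSingularForm_formSeq hs (n + 1)
      rwa [sub_self] at h1
  · have h : RiemannSurface.IsPhaseSetting M U f.supp Φ ψ z₀ κ :=
      ⟨hMo, hMc, hΦ, hψ, hz₀M, hz₀, hκ, hU, hκU, hK _ isClosed_closure hfM, hfM, hfU, hcrit⟩
    have hsing : ∀ N, f.HasDegree z₀ N → RiemannSurface.IsSingularForm z₀ f.supp N f.conj := fun N hd =>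
      f.supp_conj ▸ hd.conj.isSingularForm hf.conj
    refine ⟨RiemannSurface.contMDiffOn_expDel hΦ hψ hcrit hf, fun K hK hd => ?_, fun K hd => ?_,
      fun K hK1 hd => ?_⟩
    · have hs := hsing K hd
      refine ⟨fun ho => h.hasHDegree_conj hs hK fun r hr => RiemannSurface.isDecayExponent_of_odd hK ho hr,
        fun he => h.hasHDegree_conj hs hK fun r hr => RiemannSurface.isDecayExponent_of_even hK he hr,
        fun χ hχ _ _ ρ W hW hMW hρ p _ _ => ⟨fun ho => ?_, fun he ε hε => ?_⟩⟩
      · exact h.isBigOLp_intWedge_conj hs hχ hW hMW hρ four_ne_zero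
          (RiemannSurface.isDecayExponent_of_odd hK ho le_rfl) p
      · exact h.isBigOLp_intWedge_conj hs hχ hW hMW hρ four_ne_zero
          (RiemannSurface.isDecayExponent_of_even hK he (sub_lt_self _ hε)) p
    · have hs := hsing _ hd
      refine ⟨fun ħ hħ w hw hwz => h.delInvPsi_expansion hs hħ hw hwz K le_rfl,
        fun p hp hp' => (h.neg.isLittleOLp_neg_one ?_ hp hp').delInvPsi⟩
      have h1 := h.isSingularForm_conj_del_expDel hs K
      rwa [show 2 * (K : ℤ) + 1 - 2 * (K + 1) = -1 by ring] at h1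
    · have hs := hsing _ hd
      obtain ⟨n, rfl⟩ := Nat.exists_eq_add_of_le' hK1
      refine ⟨fun ħ hħ w hw hwz => h.delInvPsi_expansion hs hħ hw hwz n (by push_cast; lia),
        (h.neg.isLittleOLp_zero ?_).delInvPsi⟩
      have h1 := h.isSingularForm_conj_del_expDel hs n
      rwa [show 2 * ((n + 1 : ℕ) : ℤ) - 2 * (n + 1) = 0 by push_cast; ring] at h1
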